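/- **Conventions.** A Feynman graph consists of finitely many half-lines, a partition of the half-lines into vertices, each of valence at least $3$ (all valences $\ge 3$ are allowed), and a partition of the half-lines into lines: internal lines (two half-lines, possibly at the same vertex) and external lines (one half-line). There is a single type of line. A graph is *one-particle irreducible* (1PI) if it is connected, is not a tree, and does not become disconnected when a single internal line is cut. We consider 1PI graphs with at least one external line, up to isomorphism (external lines are not labelled). The loop number is $L=I-V+1$, where $I$ and $V$ are the numbers of internal lines and of vertices. The *core Hopf algebra* $H$ is the free commutative $\mathbb C$-algebra generated by these graphs, with algebra homomorphisms $\epsilon:H\to\mathbb C$, $\Delta:H\to H\otimes H$, $S:H\to H$ given on generators by $\epsilon(\Gamma)=0$, $$\Delta(\Gamma)=\Gamma\otimes 1+1\otimes\Gamma+\sum_{\emptyset\subsetneq\gamma\subsetneq\Gamma}\gamma\otimes\Gamma/\gamma,\qquad S(\Gamma)=-\Gamma-\sum_{\emptyset\subsetneq\gamma\subsetneq\Gamma}S(\gamma)\,\Gamma/\gamma .$$ Here $\gamma$ runs over the disjoint unions of 1PI subgraphs of $\Gamma$ (each such $\gamma$ is given by its set of internal lines, a nonempty proper subset of the internal lines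 of $\Gamma$, and is read as the product of its components). In $\Gamma/\gamma$ every component of $\gamma$ with at least three external lines is contracted to a vertex, and every component with two external lines is replaced by a line. For $n\ge2$ the 1PI Green's function is the formal power series $$X^{n}=1\pm\sum_{\Gamma}g^{L(\Gamma)}\frac{\Gamma}{\mathrm{Sym}(\Gamma)}\in H[[g]],$$ with sign $-$ for $n=2$ and $+$ for $n>2$. The sum is over the isomorphism classes of 1PI graphs with $n$ external lines labelled $1,\dots,n$ (in $H$ the labels are forgotten), and $\mathrm{Sym}(\Gamma)$ is the number of automorphisms (permutations of half-lines respecting vertices and lines) which fix all external lines. For $m\ge 3$ put $$Q^{(m)}=\left[\frac{X^{m}}{(X^{2})^{m/2}}\right]^{1/(m-2)}\in H[[g]],$$ where fractional powers of series with constant term $1$ are defined by the binomial series, and let $Q^{(m)}_l\in H$ be the coefficient of $g^l$ in $Q^{(m)}$. **Proposition.** $H$, with $\Delta$, $\epsilon$ and $S$ as above, is a Hopf algebra. The ideal $I=\langle Q^{(m)}_l-Q^{(n)}_l : m,n\ge 3,\ l\ge 0\rangle$ of $H$ is a Hopf ideal, i.e. $$\Delta(I)\subset I\otimes H+H\otimes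 I,\qquad \epsilon(I)=0,\qquad S(I)\subset I .$$ Hence $H/I$, with the induced coproduct, counit and antipode, is a Hopf algebra. In $(H/I)[[g]]$ all the $Q^{(m)}$, $m\ge3$, have the same image $Q$, and for all $n\ge 4$ $$\frac{X^{n}}{X^{n-1}}=\frac{X^{n-1}}{X^{n-2}} .$$ -/

import Mathlib

open scoped TensorProduct

noncomputable section

namespace CoreHopf

/-! ### Feynman graphs -/

/-- The equivalence relation `r` restricted to the set `T`; every point outside `T` is equivalent
to itself only. -/
def onSet {α : Type} (r : Setoid α) (T : Set α) : Setoid α where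
  r x y := x = y ∨ (x ∈ T ∧ y ∈ T ∧ r x y)
  iseqv :=
    { refl := fun _ => Or.inl rfl
      symm := by
        rintro x y (h | ⟨hx, hy, h⟩)
        · exact Or.inl h.symm
        · exact Or.inr ⟨hy, hx, r.symm h⟩
      trans := by
        rintro x y z (rfl | ⟨hx, hy, h⟩) (rfl | ⟨_, hz, h'⟩)
        · exact Or.inl rfl
        · exact Or.inr ⟨by assumption, hz, h'⟩
        · exact Or.inr ⟨hx, hy, h⟩
        · exact Or.inr ⟨hx, hz, r.trans h h'⟩ }

/-- A graph with set of half-lines `α`. The classes of `vert` are the vertices (a vertex is the set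
of half-lines attached to it); the classes of `edge` are the lines. A one-element class of
`edge` is an external line, a two-element class is an internal line. (That no class of `edge` has
more than two elements is part of `IsOnePI` below.) -/
@[ext]
structure Graph (α : Type) where
  vert : Setoid α
  edge : Setoid α

namespace Graph

/-- The external lines. -/
def legs {α : Type} (G : Graph α) : Set α := {x | ∀ y, G.edge x y → y = x}

/-- The half-lines that belong to internal lines. -/
def inner {α : Type} (G : Graph α) : Set α := G.legsᶜ

/-- `E`, the number of external lines. -/
def numLegs {α : Type} (G : Graph α) : ℕ := G.legs.ncard

/-- `I`, the number of internal lines. -/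
def numEdges {α : Type} (G : Graph α) : ℕ := G.inner.ncard / 2

/-- `V`, the number of vertices. -/
def numVerts {α : Type} (G : Graph α) : ℕ := Nat.card (Quotient G.vert)

/-- `L = I - V + 1`, the number of loops; for a connected graph `V ≤ I + 1`, so nothing is lost by
subtracting natural numbers. -/
def loops {α : Type} (G : Graph α) : ℕ := G.numEdges + 1 - G.numVerts

/-- Two half-lines are related if they lie in the same connected component of the graph. -/
def conn {α : Type} (G : Graph α) : Setoid α := G.vert ⊔ G.edge

/-- The graph in which all internal lines outside `S` are cut into pairs of external lines. -/
def keep {α : Type} (G : Graph α) (S : Set α) : Graph α := ⟨G.vert, onSet G.edge S⟩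

/-- The graph on a subset of the half-lines (used for connected components). -/
def restrict {α : Type} (G : Graph α) (p : Set α) : Graph p :=
  ⟨Setoid.comap Subtype.val G.vert, Setoid.comap Subtype.val G.edge⟩

/-- One-particle irreducible Feynman graphs with at least one external line: every line has at
most two ends, every vertex has valence at least three, the graph is connected, is not a tree, and
remains connected when any one internal line is cut. -/
structure IsOnePI {α : Type} (G : Graph α) : Prop where
  edge_le : ∀ x, {y | G.edge x y}.ncard ≤ 2
  three_le_valence : ∀ x, 3 ≤ {y | G.vert x y}.ncard
  connected : ∀ x y, G.conn x y
  not_tree : 1 ≤ G.loops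
  bridgeless : ∀ x ∈ G.inner, ∀ y z, (G.keep {w | ¬ G.edge x w}).conn y z
  one_le_legs : 1 ≤ G.numLegs

/-- An isomorphism of graphs: a bijection between the half-lines that respects vertices and
lines. -/
structure Iso {α β : Type} (G : Graph α) (G' : Graph β) where
  toEquiv : α ≃ β
  vert_iff : ∀ x y, G'.vert (toEquiv x) (toEquiv y) ↔ G.vert x y
  edge_iff : ∀ x y, G'.edge (toEquiv x) (toEquiv y) ↔ G.edge x y

namespace Iso

def refl {α : Type} (G : Graph α) : Iso G G := ⟨Equiv.refl α, fun _ _ => Iff.rfl, fun _ _ => Iff.rfl⟩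

def symm {α β : Type} {G : Graph α} {G' : Graph β} (e : Iso G G') : Iso G' G :=
  ⟨e.toEquiv.symm, fun x y => by simp [← e.vert_iff], fun x y => by simp [← e.edge_iff]⟩

def trans {α β γ : Type} {G : Graph α} {G' : Graph β} {G'' : Graph γ}
    (e : Iso G G') (f : Iso G' G'') : Iso G G'' :=
  ⟨e.toEquiv.trans f.toEquiv, fun x y => by simp [f.vert_iff, e.vert_iff],
    fun x y => by simp [f.edge_iff, e.edge_iff]⟩

theorem conn_of {α β : Type} {G : Graph α} {G' : Graph β} (e : Iso G G') {x y : α}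
    (h : G.conn x y) : G'.conn (e.toEquiv x) (e.toEquiv y) := by
  have : G.conn ≤ Setoid.comap e.toEquiv G'.conn := by
    refine sup_le ?_ ?_
    · intro a b hab
      exact (le_sup_left : G'.vert ≤ G'.conn) ((e.vert_iff a b).2 hab)
    · intro a b hab
      exact (le_sup_right : G'.edge ≤ G'.conn) ((e.edge_iff a b).2 hab)
  exact this h

theorem mem_legs {α β : Type} {G : Graph α} {G' : Graph β} (e : Iso G G') (x : α) :
    e.toEquiv x ∈ G'.legs ↔ x ∈ G.legs := by
  constructor
  · intro h y hy
    exact e.toEquiv.injective (h _ ((e.edge_iff x y).2 hy))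
  · intro h y hy
    obtain ⟨y, rfl⟩ := e.toEquiv.surjective y
    rw [h y ((e.edge_iff x y).1 hy)]

theorem ncard_eq {α β : Type} (e : α ≃ β) (s : Set α) (t : Set β)
    (h : ∀ x, e x ∈ t ↔ x ∈ s) : t.ncard = s.ncard := by
  have : t = e '' s := by
    ext y
    obtain ⟨x, rfl⟩ := e.surjective y
    simp [h]
  rw [this, Set.ncard_image_of_injective _ e.injective]

theorem numLegs_eq {α β : Type} {G : Graph α} {G' : Graph β} (e : Iso G G') :
    G'.numLegs = G.numLegs := ncard_eq e.toEquiv _ _ e.mem_legs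

theorem loops_eq {α β : Type} {G : Graph α} {G' : Graph β} (e : Iso G G') :
    G'.loops = G.loops := by
  have h1 : G'.inner.ncard = G.inner.ncard :=
    ncard_eq e.toEquiv _ _ fun x => not_congr (e.mem_legs x)
  have h2 : G'.numVerts = G.numVerts :=
    Nat.card_congr (Quotient.congr e.toEquiv fun x y => (e.vert_iff x y).symm).symm
  simp only [loops, numEdges, h1, h2]

/-- Being one-particle irreducible is invariant under isomorphism. -/
theorem isOnePI {α β : Type} {G : Graph α} {G' : Graph β} (e : Iso G G') (h : G.IsOnePI) :
    G'.IsOnePI where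
  edge_le x := by
    obtain ⟨x, rfl⟩ := e.toEquiv.surjective x
    exact (ncard_eq e.toEquiv {y | G.edge x y} {y | G'.edge (e.toEquiv x) y}
      (e.edge_iff x)).trans_le (h.edge_le x)
  three_le_valence x := by
    obtain ⟨x, rfl⟩ := e.toEquiv.surjective x
    exact (h.three_le_valence x).trans_eq (ncard_eq e.toEquiv {y | G.vert x y}
      {y | G'.vert (e.toEquiv x) y} (e.vert_iff x)).symm
  connected x y := by
    obtain ⟨x, rfl⟩ := e.toEquiv.surjective x
    obtain ⟨y, rfl⟩ := e.toEquiv.surjective y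
    exact e.conn_of (h.connected x y)
  not_tree := by rw [e.loops_eq]; exact h.not_tree
  bridgeless x hx y z := by
    obtain ⟨x, rfl⟩ := e.toEquiv.surjective x
    obtain ⟨y, rfl⟩ := e.toEquiv.surjective y
    obtain ⟨z, rfl⟩ := e.toEquiv.surjective z
    have hx' : x ∈ G.inner := fun hh => hx ((e.mem_legs x).2 hh)
    let e' : Iso (G.keep {w | ¬ G.edge x w}) (G'.keep {w | ¬ G'.edge (e.toEquiv x) w}) :=
      ⟨e.toEquiv, e.vert_iff, fun a b => by
        change (_ ∨ _) ↔ (_ ∨ _)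
        simp [e.edge_iff]⟩
    exact e'.conn_of (h.bridgeless x hx' y z)
  one_le_legs := by rw [e.numLegs_eq]; exact h.one_le_legs

end Iso

/-- The graph obtained by renaming the half-lines. -/
def transport {α β : Type} (e : α ≃ β) (G : Graph α) : Graph β :=
  ⟨Setoid.comap e.symm G.vert, Setoid.comap e.symm G.edge⟩

def isoTransport {α β : Type} (e : α ≃ β) (G : Graph α) : Iso G (G.transport e) :=
  ⟨e, fun x y => by
      change G.vert (e.symm (e x)) (e.symm (e y)) ↔ _
      simp,
    fun x y => by
      change G.edge (e.symm (e x)) (e.symm (e y)) ↔ _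
      simp⟩

/-- `Sym(Γ)`: the number of automorphisms of the graph that fix every external line. -/
def symFactor {α : Type} (G : Graph α) : ℕ :=
  Nat.card {e : Iso G G // ∀ x ∈ G.legs, e.toEquiv x = x}

/-! ### Subgraphs and contraction -/

/-- The connected component `q` of a graph, as a graph. -/
def component {α : Type} (G : Graph α) (q : Quotient G.conn) :
    Graph {x | Quotient.mk G.conn x = q} := G.restrict _

/-- A set `S` of half-lines describes a proper nonempty disjoint union of 1PI subgraphs: it is a
union of internal lines, it is neither empty nor the set of all internal lines, and each connected
component of `(vertices, S)` which contains a line of `S` is 1PI. -/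
structure IsProperSub {α : Type} (G : Graph α) (S : Set α) : Prop where
  subset_inner : S ⊆ G.inner
  closed : ∀ x ∈ S, ∀ y, G.edge x y → y ∈ S
  nonempty : S.Nonempty
  ne_inner : S ≠ G.inner
  component_isOnePI : ∀ x ∈ S,
    ((G.keep S).component (Quotient.mk (G.keep S).conn x)).IsOnePI

/-- The number of external lines of the component of `(vertices, S)` which contains `x`. -/
def residue {α : Type} (G : Graph α) (S : Set α) (x : α) : ℕ :=
  {y | (G.keep S).conn x y ∧ y ∉ S}.ncard

/-- The external half-lines of the components of `(vertices, S)` with two external lines. -/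
def twoPoint {α : Type} (G : Graph α) (S : Set α) : Set α := {x | x ∉ S ∧ G.residue S x = 2}

/-- The contraction `Γ/γ`, for the subgraph `γ` with internal lines `S`. Each component of `γ` with
at least three external lines becomes a vertex; each component with two external lines is replaced
by a line, so that the two lines attached to it are joined to one. -/
def contract {α : Type} (G : Graph α) (S : Set α) :
    Graph {x | x ∉ S ∧ x ∉ G.twoPoint S} where
  vert := Setoid.comap Subtype.val (G.keep S).conn
  edge := Setoid.comap Subtype.val
    (onSet G.edge Sᶜ ⊔ onSet (G.keep S).conn (G.twoPoint S))

end Graph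

/-! ### The core Hopf algebra -/

/-- A 1PI graph whose half-lines are numbered (so that there is a set of all of them). -/
structure OnePIGraph where
  size : ℕ
  graph : Graph (Fin size)
  isOnePI : graph.IsOnePI

instance OnePIGraph.isoSetoid : Setoid OnePIGraph where
  r G G' := Nonempty (Graph.Iso G.graph G'.graph)
  iseqv :=
    { refl := fun G => ⟨Graph.Iso.refl G.graph⟩
      symm := fun ⟨e⟩ => ⟨e.symm⟩
      trans := fun ⟨e⟩ ⟨f⟩ => ⟨e.trans f⟩ }

/-- Isomorphism classes of 1PI graphs. External lines carry no labels. -/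
abbrev GraphClass : Type := Quotient OnePIGraph.isoSetoid

/-- A graph representing the class. -/
def GraphClass.rep (c : GraphClass) : OnePIGraph := Quotient.out c

/-- The isomorphism class of a 1PI graph. -/
def classOf {α : Type} [Finite α] (G : Graph α) (h : G.IsOnePI) : GraphClass :=
  Quotient.mk _ ⟨Nat.card α, G.transport (Finite.equivFin α),
    (G.isoTransport (Finite.equivFin α)).isOnePI h⟩

/-- The free commutative algebra over `ℂ` generated by the 1PI graphs. -/
abbrev H : Type := MvPolynomial GraphClass ℂ

open Classical in
/-- The value on `G` of a function of 1PI graphs. A graph which is not 1PI (below, this is only the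
trivial graph: one vertex and no internal line) gets the value `1`. -/
def evalGraph {A : Type} [CommRing A] (f : GraphClass → A) {α : Type} [Finite α]
    (G : Graph α) : A :=
  if h : G.IsOnePI then f (classOf G h) else 1

open Classical in
/-- The value on the subgraph `γ = ∏ γᵢ` with internal lines `S` of a function of 1PI graphs,
extended multiplicatively to disjoint unions. -/
def evalSub {A : Type} [CommRing A] (f : GraphClass → A) {α : Type} [Fintype α]
    (G : Graph α) (S : Set α) : A :=
  ∏ q : Quotient (G.keep S).conn, evalGraph f ((G.keep S).component q)

open Classical in
/-- The proper nonempty disjoint unions of 1PI subgraphs. -/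
def properSubs {α : Type} [Fintype α] (G : Graph α) : Finset (Set α) :=
  Finset.univ.filter fun S => G.IsProperSub S

/-- The coproduct `Δ(Γ) = Γ ⊗ 1 + 1 ⊗ Γ + ∑ γ ⊗ Γ/γ`. -/
def coproduct : H →ₐ[ℂ] H ⊗[ℂ] H :=
  MvPolynomial.aeval fun c =>
    MvPolynomial.X c ⊗ₜ[ℂ] 1 + 1 ⊗ₜ[ℂ] MvPolynomial.X c +
      ∑ S ∈ properSubs c.rep.graph,
        evalSub MvPolynomial.X c.rep.graph S ⊗ₜ[ℂ]
          evalGraph MvPolynomial.X (c.rep.graph.contract S)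

/-- The counit: `ε(Γ) = 0` for every nonempty graph. -/
def counit : H →ₐ[ℂ] ℂ := MvPolynomial.aeval fun _ => 0

/-- The recursion `S(Γ) = -Γ - ∑ S(γ) Γ/γ`, for graphs with at most `n` loops. The components of a
proper subgraph have fewer loops than the graph. -/
def antipodeAux : ℕ → GraphClass → H
  | 0, _ => 0
  | n + 1, c => -MvPolynomial.X c -
      ∑ S ∈ properSubs c.rep.graph,
        evalSub (antipodeAux n) c.rep.graph S *
          evalGraph MvPolynomial.X (c.rep.graph.contract S)

/-- The antipode. -/
def antipode : H →ₐ[ℂ] H :=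
  MvPolynomial.aeval fun c => antipodeAux c.rep.graph.loops c

/-- The laws of a Hopf algebra, for algebra homomorphisms `Δ`, `ε` and a linear map `S`. -/
structure HopfLaws {A : Type} [CommRing A] [Algebra ℂ A]
    (Δ : A →ₐ[ℂ] A ⊗[ℂ] A) (ε : A →ₐ[ℂ] ℂ) (S : A →ₗ[ℂ] A) : Prop where
  coassoc : (Algebra.TensorProduct.assoc ℂ ℂ ℂ A A A).toAlgHom.comp
      ((Algebra.TensorProduct.map Δ (.id ℂ A)).comp Δ) =
    (Algebra.TensorProduct.map (.id ℂ A) Δ).comp Δ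
  counit_left : (Algebra.TensorProduct.map ε (.id ℂ A)).comp Δ =
    (Algebra.TensorProduct.lid ℂ A).symm
  counit_right : (Algebra.TensorProduct.map (.id ℂ A) ε).comp Δ =
    (Algebra.TensorProduct.rid ℂ ℂ A).symm
  antipode_left : LinearMap.mul' ℂ A ∘ₗ S.rTensor A ∘ₗ Δ.toLinearMap =
    Algebra.linearMap ℂ A ∘ₗ ε.toLinearMap
  antipode_right : LinearMap.mul' ℂ A ∘ₗ S.lTensor A ∘ₗ Δ.toLinearMap =
    Algebra.linearMap ℂ A ∘ₗ ε.toLinearMap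

/-- The Hopf algebra with the structure maps `Δ`, `ε`, `S`. -/
abbrev HopfLaws.hopfAlgebra {A : Type} [CommRing A] [Algebra ℂ A]
    {Δ : A →ₐ[ℂ] A ⊗[ℂ] A} {ε : A →ₐ[ℂ] ℂ} {S : A →ₗ[ℂ] A} (h : HopfLaws Δ ε S) :
    HopfAlgebra ℂ A :=
  letI : Bialgebra ℂ A := Bialgebra.ofAlgHom Δ ε h.coassoc h.counit_left h.counit_right
  { antipode := S
    mul_antipode_rTensor_comul := h.antipode_left
    mul_antipode_lTensor_comul := h.antipode_right }

/-! ### Green's functions and couplings -/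

/-- A 1PI graph with `n` external lines, labelled by `Fin n`, and `l` loops. -/
structure LabelledGraph (n l : ℕ) extends OnePIGraph where
  label : Fin n ≃ graph.legs
  loops_eq : graph.loops = l

/-- Two labelled graphs are identified if there is an isomorphism which respects the labels of the
external lines. -/
instance LabelledGraph.isoSetoid (n l : ℕ) : Setoid (LabelledGraph n l) where
  r G G' := ∃ e : Graph.Iso G.graph G'.graph, ∀ i, e.toEquiv (G.label i) = G'.label i
  iseqv :=
    { refl := fun G => ⟨Graph.Iso.refl G.graph, fun _ => rfl⟩
      symm := fun ⟨e, h⟩ => ⟨e.symm, fun i => by simp [Graph.Iso.symm, ← h]⟩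
      trans := fun ⟨e, h⟩ ⟨f, h'⟩ => ⟨e.trans f, fun i => by simp [Graph.Iso.trans, h, h']⟩ }

/-- Isomorphism classes of 1PI graphs with `n` distinguishable external lines and `l` loops. -/
abbrev LabelledClass (n l : ℕ) : Type := Quotient (LabelledGraph.isoSetoid n l)

/-- A 1PI graph with `n` external lines and `l` loops has at most `6 l + 3 n` half-lines. -/
theorem LabelledGraph.size_le {n l : ℕ} (G : LabelledGraph n l) : G.size ≤ 6 * l + 3 * n := by
  classical
  have hV : 3 * G.graph.numVerts ≤ G.size := by
    have h1 : G.graph.numVerts = Fintype.card (Quotient G.graph.vert) := Nat.card_eq_fintype_card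
    have h2 := Finset.mul_card_image_le_card_of_maps_to (s := (Finset.univ : Finset (Fin G.size)))
      (t := (Finset.univ : Finset (Quotient G.graph.vert)))
      (f := Quotient.mk G.graph.vert) (fun _ _ => Finset.mem_univ _) 3 (fun q _ => by
        obtain ⟨x, rfl⟩ := Quotient.exists_rep q
        refine (G.isOnePI.three_le_valence x).trans_eq ?_
        rw [Set.ncard_eq_toFinset_card']
        congr 1
        ext y
        simp only [Set.mem_toFinset, Set.mem_ofPred_eq, Finset.mem_filter, Finset.mem_univ,
          true_and]
        exact ⟨fun h => Quotient.sound (G.graph.vert.symm h),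
          fun h => G.graph.vert.symm (Quotient.exact h)⟩)
    rw [h1]
    simpa [Nat.mul_comm] using h2
  have hE : G.graph.legs.ncard = n := by
    rw [← Nat.card_coe_set_eq, ← Nat.card_congr G.label, Nat.card_fin]
  have hI : G.graph.legs.ncard + G.graph.inner.ncard = G.size := by
    simpa [Graph.inner] using Set.ncard_add_ncard_compl G.graph.legs
  have hl := G.loops_eq
  have h1 := G.isOnePI.not_tree
  simp only [Graph.loops, Graph.numEdges] at hl h1
  omega

instance (n l : ℕ) : Finite (LabelledClass n l) := by
  let code : LabelledGraph n l → (k : Fin (6 * l + 3 * n + 1)) ×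
      (Set (Fin k × Fin k) × Set (Fin k × Fin k) × (Fin n → Fin k)) := fun G =>
    ⟨⟨G.size, Nat.lt_succ_of_le G.size_le⟩, {p | G.graph.vert p.1 p.2},
      {p | G.graph.edge p.1 p.2}, fun i => (G.label i : Fin G.size)⟩
  have hcode : Function.Injective code := by
    rintro ⟨⟨a, g, hg⟩, lab, hl⟩ ⟨⟨b, g', hg'⟩, lab', hl'⟩ h
    simp only [code, Sigma.mk.injEq, Fin.mk.injEq] at h
    obtain ⟨rfl, h⟩ := h
    simp only [heq_eq_eq, Prod.mk.injEq] at h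
    obtain ⟨h1, h2, h3⟩ := h
    have : g = g' := by
      ext x y
      · exact Set.ext_iff.1 h1 (x, y)
      · exact Set.ext_iff.1 h2 (x, y)
    subst this
    have : lab = lab' := by
      ext i
      exact congrArg Fin.val (congrFun h3 i)
    subst this
    rfl
  have : Finite (LabelledGraph n l) := Finite.of_injective code hcode
  exact Quotient.finite _

/-- The `l`-loop part `∑ Γ / Sym(Γ)` of the 1PI Green's function with `n` external lines. -/
def greenCoeff (n l : ℕ) : H :=
  letI := Fintype.ofFinite (LabelledClass n l)
  ∑ c : LabelledClass n l,
    (1 / (c.out.graph.symFactor : ℂ)) • MvPolynomial.X (Quotient.mk _ c.out.toOnePIGraph)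

/-- The 1PI Green's function `Xⁿ = 1 ± ∑ g^{|Γ|} Γ / Sym(Γ)`, a power series in the coupling
constant `g` with coefficients in `H`; the sign is `-` for `n = 2` and `+` for `n > 2`. -/
def green (n : ℕ) : PowerSeries H :=
  if n = 2 then 1 - PowerSeries.mk (greenCoeff n) else 1 + PowerSeries.mk (greenCoeff n)

theorem constantCoeff_green (n : ℕ) : PowerSeries.constantCoeff (green n) = 1 := by
  have h : greenCoeff n 0 = 0 := by
    unfold greenCoeff
    refine Finset.sum_eq_zero fun c _ => ?_
    have h1 := c.out.isOnePI.not_tree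
    have h2 := c.out.loops_eq
    omega
  have h' : PowerSeries.constantCoeff (PowerSeries.mk (greenCoeff n)) = 0 := by
    rw [← PowerSeries.coeff_zero_eq_constantCoeff_apply, PowerSeries.coeff_mk, h]
  unfold green
  split_ifs <;> simp [h']

/-- The power `f ^ a = ∑ₖ (a choose k) (f - 1) ^ k` of a power series with constant
coefficient `1`. -/
def fracPow (f : PowerSeries H) (a : ℚ) : PowerSeries H :=
  (PowerSeries.binomialSeries H a).subst (f - 1)

/-- The coupling `Q⁽ᵐ⁾ = [Xᵐ / (X²)^{m/2}]^{1/(m-2)}`, for `m > 2`. -/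
def coupling (m : ℕ) : PowerSeries H :=
  fracPow (green m * fracPow (green 2) (-((m : ℚ) / 2))) (1 / ((m : ℚ) - 2))

/-- The ideal generated by the differences `Q⁽ᵐ⁾_l - Q⁽ⁿ⁾_l`, for `m, n ≥ 3` and `l ≥ 0`. -/
def couplingIdeal : Ideal H :=
  Ideal.span {x | ∃ m n l : ℕ, 3 ≤ m ∧ 3 ≤ n ∧
    x = PowerSeries.coeff l (coupling m) - PowerSeries.coeff l (coupling n)}

/-- The quotient map `H → H/I`. -/
def proj : H →ₐ[ℂ] H ⧸ couplingIdeal := Ideal.Quotient.mkₐ ℂ couplingIdeal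

/-- The Green's function `Xⁿ` in the quotient `H/I`. -/
def greenQuot (n : ℕ) : PowerSeries (H ⧸ couplingIdeal) :=
  PowerSeries.map proj.toRingHom (green n)

/-- The inverse of a power series with constant coefficient `1`. -/
def inv {A : Type} [CommRing A] (f : PowerSeries A) : PowerSeries A :=
  PowerSeries.invOfUnit f 1

end CoreHopf

end

open scoped TensorProduct

noncomputable section

namespace CoreHopf

/-! ### Equivalence relations -/

section Setoids

variable {α β : Type}

/-! A character of `H` is a function of 1PI graphs, extended multiplicatively. A homomorphism on `H
⊗ H`, composed with the coproduct, is the convolution product `conv` of its restrictions to the two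
factors (`map_coproduct_X`). This product is a sum over all bridgeless subgraphs, the empty and the
full one included (`conv_eq`). The proof therefore works with characters with values in an arbitrary
commutative ring.

Hopf algebra: coassociativity is associativity of `conv` (`conv_assoc`). Choosing a subgraph `D` and
a subgraph `S` of `D` is the same as choosing `S` and then the subgraph `D/S` of `G/S`. To make this
literal, the contraction of the coproduct is split into a plain contraction `quo`, which may create
vertices of valence two, and their removal `smooth`. The removal does not change the sum over
subgraphs (`convSum_smooth`), since a bridgeless subgraph contains both lines at a bivalent vertex
or neither. The loop number is additive (`loops_eq_sum`), so the recursion for the antipode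
terminates. It gives a left convolution inverse of the identity, and associativity shows that this
is also a right inverse.

Green's functions: a sum over isomorphism classes with weights 1/Sym is a sum over all graphs on
numbered half-lines with weights 1/N! (`sum_labelledClass`). A graph with a subgraph is a contracted
graph together with a connected graph for each of its vertices. By the exponential formula the
Green's function of `conv a b` is then a sum over contracted graphs with values in `b`, where an
m-valent vertex carries a factor y_m (`greenSum_conv`). Here y_m = a(X^m) for m ≥ 3 and y_2 = 1 -
a(X^2), because the graph without lines is a vertex only for m ≥ 3. The bivalent vertices on an
internal line sum up to a geometric series 1/(1 - y_2) = 1/a(X^2).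

Suppose that `a` takes the same value Q on all couplings, and let Y be the square root of a(X^2).
Then a(X^m) = Q^(m-2) Y^m. In a graph with n external lines, I internal lines and L loops the
vertices contribute Q^(2L+n-2) Y^(n+2I) and the lines Y^(-2I), so that Y^n Q^(n-2) (Q^2)^L remains.
With the weight g^L this is a substitution g ↦ g Q^2. For k = f * h, where f has the common coupling
Q, it follows that k(X^n) = f(X^n) · h(X^n)(g Q^2) and k(Q^(m)) = Q · h(Q^(m))(g Q^2)
(`map_green_conv`, `map_coupling_conv`).

Hopf ideal: if f and h do not distinguish the couplings, neither does f * h, which gives the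
statement on the coproduct. For the antipode, take f the projection to `H/I`, h its composition with
the antipode and k the counit. Then 1 = Q · h(Q^(m))(g Q^2) for all m, and the substitution is
injective, so h(Q^(m)) does not depend on m. In the quotient X^n = Q^(n-2) Y^n is a geometric
progression, which is the last claim. -/

theorem sup_closed {r s : Setoid α} {C : Set α} (hr : ∀ x y, r x y → x ∈ C → y ∈ C)
    (hs : ∀ x y, s x y → x ∈ C → y ∈ C) {x y : α} (h : (r ⊔ s) x y) (hx : x ∈ C) : y ∈ C := by
  -- Lying on the same side of `C` is an equivalence relation which contains both `r` and `s`, hence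
  -- their join.
  let t : Setoid α := ⟨fun x y => x ∈ C ↔ y ∈ C, fun _ => Iff.rfl, fun h => h.symm,
    fun h h' => h.trans h'⟩
  have : r ⊔ s ≤ t := sup_le
    (fun a b hab => ⟨hr a b hab, hr b a (r.symm hab)⟩)
    (fun a b hab => ⟨hs a b hab, hs b a (s.symm hab)⟩)
  exact (this h).1 hx

theorem sup_left {r s : Setoid α} {x y : α} (h : r x y) : (r ⊔ s) x y :=
  (le_sup_left : r ≤ r ⊔ s) h

theorem sup_right {r s : Setoid α} {x y : α} (h : s x y) : (r ⊔ s) x y :=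
  (le_sup_right : s ≤ r ⊔ s) h

theorem onSet_iff {r : Setoid α} {T : Set α} {x y : α} :
    onSet r T x y ↔ x = y ∨ (x ∈ T ∧ y ∈ T ∧ r x y) := Iff.rfl

theorem onSet_le (r : Setoid α) (T : Set α) : onSet r T ≤ r := by
  rintro x y (rfl | ⟨_, _, h⟩)
  · exact r.refl _
  · exact h

theorem onSet_mono (r : Setoid α) {T T' : Set α} (h : T ⊆ T') : onSet r T ≤ onSet r T' := by
  rintro x y (rfl | ⟨h1, h2, h3⟩)
  · exact Or.inl rfl
  · exact Or.inr ⟨h h1, h h2, h3⟩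

theorem onSet_onSet (r : Setoid α) (T T' : Set α) :
    onSet (onSet r T) T' = onSet r (T ∩ T') := by
  ext x y
  simp only [onSet_iff, Set.mem_inter_iff]
  tauto

theorem onSet_sup_compl (r : Setoid α) (T : Set α) (hT : ∀ x ∈ T, ∀ y, r x y → y ∈ T) :
    onSet r T ⊔ onSet r Tᶜ = r := by
  refine le_antisymm (sup_le (onSet_le _ _) (onSet_le _ _)) fun x y h => ?_
  by_cases hx : x ∈ T
  · exact sup_left (Or.inr ⟨hx, hT x hx y h, h⟩)
  · exact sup_right (Or.inr ⟨hx, fun hy => hx (hT y hy x (r.symm h)), h⟩)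

theorem comap_onSet (i : β → α) (hi : Function.Injective i) (r : Setoid α) (T : Set α) :
    Setoid.comap i (onSet r T) = onSet (Setoid.comap i r) (i ⁻¹' T) := by
  ext x y
  simp only [Setoid.comap_rel, onSet_iff, Set.mem_preimage, hi.eq_iff]

/-- Pulling back does not commute with joins in general. Here every nontrivial step of `t` has both
ends in the range of `i`, so a chain between points of the range can be broken up at points of the
range. This computes connectedness after contraction and after removal of vertices. -/
theorem comap_sup (i : β → α) (s t : Setoid α)
    (ht : ∀ x y, t x y → x = y ∨ (x ∈ Set.range i ∧ y ∈ Set.range i)) :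
    Setoid.comap i (s ⊔ t) = Setoid.comap i s ⊔ Setoid.comap i t := by
  refine le_antisymm (fun x y h => ?_)
    (sup_le (fun x y h => sup_left h) (fun x y h => sup_right h))
  -- The invariant set consists of the points reached by a chain inside `β` followed by one step of
  -- `s` in `α`.
  have := sup_closed (r := s) (s := t)
    (C := {z | ∃ u, (Setoid.comap i s ⊔ Setoid.comap i t) x u ∧ s (i u) z}) ?_ ?_ h
    ⟨x, Setoid.refl' _ _, Setoid.refl' _ _⟩
  · obtain ⟨u, hu, huy⟩ := this
    exact Setoid.trans' _ hu (sup_left huy)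
  · rintro a b hab ⟨u, hu, hua⟩
    exact ⟨u, hu, s.trans hua hab⟩
  · rintro a b hab ⟨u, hu, hua⟩
    rcases ht a b hab with rfl | ⟨⟨a, rfl⟩, ⟨b, rfl⟩⟩
    · exact ⟨u, hu, hua⟩
    · exact ⟨b, Setoid.trans' _ hu (Setoid.trans' _ (sup_left (y := a) hua) (sup_right hab)),
        s.refl _⟩

end Setoids

/-! ### Elementary properties of graphs and isomorphisms -/

namespace Graph

variable {α β : Type}

theorem conn_vert {G : Graph α} {x y : α} (h : G.vert x y) : G.conn x y := sup_left h

theorem conn_edge {G : Graph α} {x y : α} (h : G.edge x y) : G.conn x y := sup_right h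

theorem mem_inner {G : Graph α} {x : α} : x ∈ G.inner ↔ ∃ y, G.edge x y ∧ y ≠ x := by
  simp [inner, legs]

theorem not_mem_inner {G : Graph α} {x : α} : x ∉ G.inner ↔ x ∈ G.legs := by
  simp [inner]

theorem keep_edge_iff {G : Graph α} {S : Set α} {x y : α} :
    (G.keep S).edge x y ↔ x = y ∨ (x ∈ S ∧ y ∈ S ∧ G.edge x y) := Iff.rfl

theorem keep_conn_mono (G : Graph α) {S T : Set α} (h : S ⊆ T) :
    (G.keep S).conn ≤ (G.keep T).conn := sup_le_sup le_rfl (onSet_mono _ h)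

theorem keep_conn_le (G : Graph α) (S : Set α) : (G.keep S).conn ≤ G.conn :=
  sup_le_sup le_rfl (onSet_le _ _)

theorem keep_keep (G : Graph α) (S T : Set α) : (G.keep S).keep T = G.keep (S ∩ T) := by
  simp only [keep, onSet_onSet]

namespace Iso

theorem sup_iff {r s : Setoid α} {r' s' : Setoid β} (e : α ≃ β)
    (hr : ∀ x y, r' (e x) (e y) ↔ r x y) (hs : ∀ x y, s' (e x) (e y) ↔ s x y) (x y : α) :
    (r' ⊔ s') (e x) (e y) ↔ (r ⊔ s) x y := by
  -- Any two equivalence relations form a graph, whose connectedness relation is their join.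
  let f : Iso (⟨r, s⟩ : Graph α) (⟨r', s'⟩ : Graph β) := ⟨e, hr, hs⟩
  constructor
  · intro h
    have h1 : (⟨r, s⟩ : Graph α).conn (e.symm (e x)) (e.symm (e y)) := f.symm.conn_of h
    rwa [e.symm_apply_apply, e.symm_apply_apply] at h1
  · exact fun h => f.conn_of h

theorem conn_iff {G : Graph α} {G' : Graph β} (e : Iso G G') (x y : α) :
    G'.conn (e.toEquiv x) (e.toEquiv y) ↔ G.conn x y :=
  sup_iff e.toEquiv e.vert_iff e.edge_iff x y

theorem onSet_iff' {r : Setoid α} {r' : Setoid β} (e : α ≃ β)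
    (hr : ∀ x y, r' (e x) (e y) ↔ r x y) {S : Set α} {S' : Set β} (hS : ∀ x, e x ∈ S' ↔ x ∈ S)
    (x y : α) : onSet r' S' (e x) (e y) ↔ onSet r S x y := by
  simp [onSet_iff, hS, hr]

/-- An isomorphism induces one of the graphs with fewer lines kept. -/
def keep {G : Graph α} {G' : Graph β} (e : Iso G G') {S : Set α} {S' : Set β}
    (hS : ∀ x, e.toEquiv x ∈ S' ↔ x ∈ S) : Iso (G.keep S) (G'.keep S') :=
  ⟨e.toEquiv, e.vert_iff, onSet_iff' e.toEquiv e.edge_iff hS⟩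

/-- An isomorphism restricts to corresponding sets of half-lines. -/
def restrict {G : Graph α} {G' : Graph β} (e : Iso G G') {S : Set α} {S' : Set β}
    (hS : ∀ x, e.toEquiv x ∈ S' ↔ x ∈ S) : Iso (G.restrict S) (G'.restrict S') :=
  ⟨e.toEquiv.subtypeEquiv fun x => (hS x).symm, fun x y => e.vert_iff x y,
    fun x y => e.edge_iff x y⟩

/-- Two graphs whose half-lines are embedded into one set with the same range are isomorphic if
the relations agree. -/
def ofInj {X Y : Type} {A : Graph X} {B : Graph Y} (i : X → α) (j : Y → α)
    (hi : Function.Injective i) (hj : Function.Injective j) (hr : Set.range i = Set.range j)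
    (hv : ∀ x x' y y', i x = j y → i x' = j y' → (B.vert y y' ↔ A.vert x x'))
    (he : ∀ x x' y y', i x = j y → i x' = j y' → (B.edge y y' ↔ A.edge x x')) : Iso A B :=
  let e : X ≃ Y := (Equiv.ofInjective i hi).trans
    ((Equiv.setCongr hr).trans (Equiv.ofInjective j hj).symm)
  have h : ∀ x, i x = j (e x) := fun x => by
    have : (Equiv.ofInjective j hj) (e x) = (Equiv.setCongr hr) (Equiv.ofInjective i hi x) := by
      simp [e]
    exact (congrArg Subtype.val this).symm
  ⟨e, fun x y => hv _ _ _ _ (h x) (h y), fun x y => he _ _ _ _ (h x) (h y)⟩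

/-- A graph is isomorphic to its restriction to the set of all half-lines. -/
def restrictAll (G : Graph α) {p : Set α} (hp : ∀ x, x ∈ p) : Iso (G.restrict p) G :=
  ⟨Equiv.subtypeUnivEquiv hp, fun _ _ => Iff.rfl, fun _ _ => Iff.rfl⟩

/-- A restriction of a restriction. -/
def restrictRestrict (G : Graph α) (p : Set α) (q : Set p) {r : Set α}
    (hr : r = Subtype.val '' q) : Iso ((G.restrict p).restrict q) (G.restrict r) :=
  ofInj (fun x : q => (x : α)) (fun x : r => (x : α))
    (Subtype.val_injective.comp Subtype.val_injective) Subtype.val_injective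
    (by
      ext x
      simp [hr])
    (by
      intro x x' y y' h h'
      change G.vert y y' ↔ G.vert x x'
      rw [h, h'])
    (by
      intro x x' y y' h h'
      change G.edge y y' ↔ G.edge x x'
      rw [h, h'])

end Iso

/-! ### Restriction to unions of components -/

theorem restrict_conn (G : Graph α) (p : Set α) (hp : ∀ x ∈ p, ∀ y, G.conn x y → y ∈ p) :
    (G.restrict p).conn = Setoid.comap Subtype.val G.conn := by
  refine le_antisymm (sup_le (fun x y h => conn_vert h) (fun x y h => conn_edge h)) ?_
  intro x y h
  have := sup_closed (r := G.vert) (s := G.edge)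
    (C := {z | ∃ hz : z ∈ p, (G.restrict p).conn x ⟨z, hz⟩}) ?_ ?_ (x := x) (y := y) h
    ⟨x.2, Setoid.refl' _ _⟩
  · exact this.2
  · rintro a b hab ⟨ha, h1⟩
    exact ⟨hp a ha b (conn_vert hab), Setoid.trans' _ h1 (conn_vert hab)⟩
  · rintro a b hab ⟨ha, h1⟩
    exact ⟨hp a ha b (conn_edge hab), Setoid.trans' _ h1 (conn_edge hab)⟩

theorem component_closed (G : Graph α) (q : Quotient G.conn) :
    ∀ x ∈ {x | Quotient.mk G.conn x = q}, ∀ y, G.conn x y → y ∈ {x | Quotient.mk G.conn x = q} :=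
  fun _ hx _ h => (Quotient.sound (G.conn.symm h)).trans hx

theorem component_connected (G : Graph α) (q : Quotient G.conn) (x y) :
    (G.component q).conn x y := by
  rw [component, restrict_conn _ _ (G.component_closed q)]
  have h : Quotient.mk G.conn x.1 = Quotient.mk G.conn y.1 := x.2.trans y.2.symm
  have h' : G.conn x.1 y.1 := Quotient.exact h
  exact h'

theorem restrict_legs (G : Graph α) (p : Set α) (hp : ∀ x ∈ p, ∀ y, G.edge x y → y ∈ p)
    (x : p) : x ∈ (G.restrict p).legs ↔ (x : α) ∈ G.legs := by
  constructor
  · intro h y hy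
    exact congrArg Subtype.val (h ⟨y, hp x x.2 y hy⟩ hy)
  · intro h y hy
    exact Subtype.ext (h y hy)

/-- Without internal lines `I = 0` and `V ≥ 1`, so the loop number would be zero. -/
theorem IsOnePI.inner_nonempty [Finite α] {G : Graph α} (h : G.IsOnePI) : G.inner.Nonempty := by
  by_contra hne
  rw [Set.not_nonempty_iff_eq_empty] at hne
  have h1 := h.not_tree
  have h2 : G.numEdges = 0 := by simp [numEdges, hne]
  have h3 : G.legs.Nonempty := Set.nonempty_of_ncard_ne_zero
    (Nat.one_le_iff_ne_zero.1 h.one_le_legs)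
  have : Nonempty (Quotient G.vert) := ⟨Quotient.mk _ h3.some⟩
  have h4 : 0 < G.numVerts := Nat.card_pos
  simp only [loops, h2] at h1
  omega

end Graph

/-! ### Values of multiplicative functions of graphs -/

section Values

variable {A : Type} [CommRing A] {α β : Type} [Finite α] [Finite β]

theorem classOf_eq {G : Graph α} {G' : Graph β} (e : Graph.Iso G G') (h : G.IsOnePI)
    (h' : G'.IsOnePI) : classOf G h = classOf G' h' :=
  Quotient.sound ⟨((G.isoTransport _).symm.trans e).trans (G'.isoTransport _)⟩

theorem classOf_rep (c : GraphClass) : classOf c.rep.graph c.rep.isOnePI = c := by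
  refine Eq.trans ?_ (Quotient.out_eq c)
  exact Quotient.sound ⟨(c.rep.graph.isoTransport _).symm⟩

/-- The chosen representative of the class of a graph is isomorphic to it. -/
def repIso (G : Graph α) (h : G.IsOnePI) : Graph.Iso G (classOf G h).rep.graph := by
  have : Nonempty (Graph.Iso (classOf G h).rep.graph (G.transport (Finite.equivFin α))) :=
    Quotient.exact (Quotient.out_eq (classOf G h))
  exact (G.isoTransport _).trans this.some.symm

theorem evalGraph_of_isOnePI (f : GraphClass → A) {G : Graph α} (h : G.IsOnePI) :
    evalGraph f G = f (classOf G h) := dif_pos h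

theorem evalGraph_of_not (f : GraphClass → A) {G : Graph α} (h : ¬ G.IsOnePI) :
    evalGraph f G = 1 := dif_neg h

theorem evalGraph_iso (f : GraphClass → A) {G : Graph α} {G' : Graph β} (e : Graph.Iso G G') :
    evalGraph f G = evalGraph f G' := by
  by_cases h : G.IsOnePI
  · rw [evalGraph_of_isOnePI f h, evalGraph_of_isOnePI f (e.isOnePI h), classOf_eq e]
  · rw [evalGraph_of_not f h, evalGraph_of_not f fun h' => h (e.symm.isOnePI h')]

/-- The value of a multiplicative function on a disjoint union of graphs. -/
def prodVal (f : GraphClass → A) (G : Graph α) : A :=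
  ∏ᶠ q : Quotient G.conn, evalGraph f (G.component q)

theorem evalSub_eq {α : Type} [Fintype α] (f : GraphClass → A) (G : Graph α) (S : Set α) :
    evalSub f G S = prodVal f (G.keep S) := by
  classical
  rw [prodVal, finprod_eq_prod_of_fintype, evalSub]

/-- An isomorphism induces a bijection between the components. -/
def Graph.Iso.connEquiv {α β : Type} {G : Graph α} {G' : Graph β} (e : Graph.Iso G G') :
    Quotient G.conn ≃ Quotient G'.conn :=
  Quotient.congr e.toEquiv fun x y => (e.conn_iff x y).symm

theorem prodVal_iso (f : GraphClass → A) {G : Graph α} {G' : Graph β} (e : Graph.Iso G G') :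
    prodVal f G = prodVal f G' := by
  refine finprod_eq_of_bijective e.connEquiv e.connEquiv.bijective fun q => ?_
  refine evalGraph_iso f (e.restrict fun x => ?_)
  change Quotient.mk G'.conn (e.toEquiv x) = _ ↔ Quotient.mk G.conn x = _
  rw [← e.connEquiv.apply_eq_iff_eq]
  rfl

theorem prodVal_of_connected (f : GraphClass → A) {G : Graph α} (h : ∀ x y, G.conn x y) :
    prodVal f G = evalGraph f G := by
  rcases isEmpty_or_nonempty α with hα | ⟨⟨x⟩⟩
  · have : IsEmpty (Quotient G.conn) := ⟨fun q => hα.elim q.out⟩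
    rw [prodVal, finprod_of_isEmpty, evalGraph_of_not]
    intro h'
    have := h'.one_le_legs
    simp [Graph.numLegs, Set.eq_empty_of_isEmpty] at this
  · have : Unique (Quotient G.conn) := ⟨⟨Quotient.mk _ x⟩, fun q => by
      induction q using Quotient.inductionOn
      exact Quotient.sound (h _ _)⟩
    rw [prodVal, finprod_unique]
    exact evalGraph_iso f (Graph.Iso.restrictAll G fun x => Subsingleton.elim _ _)

/-- Components without internal lines are not 1PI and have the value `1` by convention, so isolated
vertices do not contribute. -/
theorem prodVal_eq_one (f : GraphClass → A) {G : Graph α} (h : ∀ x, x ∈ G.legs) :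
    prodVal f G = 1 := by
  refine finprod_eq_one_of_forall_eq_one fun q => evalGraph_of_not f fun h' => ?_
  obtain ⟨x, hx⟩ := h'.inner_nonempty
  refine hx ((Graph.restrict_legs _ _ (fun y hy z hz => ?_) x).2 (h x))
  exact G.component_closed q y hy z (Graph.conn_edge hz)

theorem prodVal_partition (f : GraphClass → A) {G : Graph α} {ι : Type} [Finite ι] (p : α → ι)
    (hp : ∀ x y, G.conn x y → p x = p y) :
    prodVal f G = ∏ᶠ i, prodVal f (G.restrict {x | p x = i}) := by
  classical
  have := Fintype.ofFinite ι
  have := Fintype.ofFinite (Quotient G.conn)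
  let g : Quotient G.conn → ι := Quotient.lift p hp
  have hcl : ∀ i, ∀ x ∈ {x | p x = i}, ∀ y, G.conn x y → y ∈ {x | p x = i} :=
    fun i x hx y h => (hp x y h).symm.trans hx
  rw [prodVal, finprod_eq_prod_of_fintype, finprod_eq_prod_of_fintype,
    ← Fintype.prod_fiberwise g]
  refine Finset.prod_congr rfl fun i _ => ?_
  rw [← finprod_eq_prod_of_fintype]
  symm
  have hc := G.restrict_conn _ (hcl i)
  let F : Quotient (G.restrict {x | p x = i}).conn → {q // g q = i} :=
    Quotient.lift (fun x => ⟨Quotient.mk _ x.1, x.2⟩) fun x y h => by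
      refine Subtype.ext (Quotient.sound ?_)
      change (G.restrict {x | p x = i}).conn x y at h
      rw [hc] at h
      exact h
  refine finprod_eq_of_bijective F ⟨?_, ?_⟩ ?_
  · intro q q'
    induction q, q' using Quotient.inductionOn₂ with | _ x y => ?_
    intro h
    refine Quotient.sound ?_
    change (G.restrict {x | p x = i}).conn x y
    rw [hc]
    have h' : Quotient.mk G.conn x.1 = Quotient.mk G.conn y.1 := congrArg Subtype.val h
    have h2 : G.conn x.1 y.1 := Quotient.exact h'
    exact h2
  · rintro ⟨q, hq⟩
    induction q using Quotient.inductionOn with | _ x => ?_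
    exact ⟨Quotient.mk _ ⟨x, hq⟩, rfl⟩
  · intro q
    induction q using Quotient.inductionOn with | _ x => ?_
    refine evalGraph_iso f (Graph.Iso.restrictRestrict _ _ _ ?_)
    ext y
    simp only [Set.mem_ofPred_eq, Set.mem_image, Subtype.exists, exists_and_right, exists_eq_right,
      F]
    constructor
    · intro h
      have h' : G.conn y x := Quotient.exact h
      have hy : p y = i := (hp _ _ h').trans x.2
      refine ⟨hy, Quotient.sound ?_⟩
      change (G.restrict {x | p x = i}).conn _ _
      rw [hc]
      exact h'
    · rintro ⟨hy, h⟩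
      have h' : (G.restrict {x | p x = i}).conn _ _ := Quotient.exact h
      rw [hc] at h'
      exact Quotient.sound h'

end Values

namespace Graph

variable {α β : Type}

/-! ### Bridgeless graphs -/

/-- Every line has at most two ends. -/
def EdgeUnique (G : Graph α) : Prop :=
  ∀ x y z, G.edge x y → G.edge x z → y ≠ x → z ≠ x → y = z

/-- No set of vertices is joined to its complement by exactly one line. -/
def Bridgeless (G : Graph α) : Prop :=
  ∀ C : Set α, (∀ x ∈ C, ∀ y, G.vert x y → y ∈ C) → ∀ x ∈ C, ∀ y ∉ C, G.edge x y →
    ∃ x' ∈ C, ∃ y' ∉ C, G.edge x' y' ∧ x' ≠ x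

/-- A disjoint union of bridgeless connected graphs with external lines, where vertices may have
any valence. -/
structure Nice (G : Graph α) : Prop where
  edge_unique : G.EdgeUnique
  bridgeless : G.Bridgeless
  leg : ∀ x, ∃ y ∈ G.legs, G.conn x y

theorem edge_le_iff [Finite α] {G : Graph α} :
    (∀ x, {y | G.edge x y}.ncard ≤ 2) ↔ G.EdgeUnique := by
  constructor
  · intro h x y z hy hz hyx hzx
    by_contra hyz
    have := (Set.two_lt_ncard_iff (s := {y | G.edge x y})).2
      ⟨x, y, z, G.edge.refl x, hy, hz, hyx.symm, hzx.symm, hyz⟩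
    exact absurd (h x) (by omega)
  · intro h x
    by_contra hlt
    obtain ⟨a, b, c, ha, hb, hc, hab, hac, hbc⟩ := (Set.two_lt_ncard_iff).1 (not_le.1 hlt)
    simp only [Set.mem_ofPred_eq] at ha hb hc
    by_cases hax : a = x
    · subst hax
      exact hbc (h a b c hb hc hab.symm hac.symm)
    · by_cases hbx : b = x
      · subst hbx
        exact hac (h b a c ha hc hax hbc.symm)
      · exact hab (h x a b ha hb hax hbx)

theorem EdgeUnique.eq_or {G : Graph α} (hG : G.EdgeUnique) {x y z : α} (h : G.edge x y)
    (hxy : y ≠ x) (hz : G.edge x z) : z = x ∨ z = y := by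
  by_cases hzx : z = x
  · exact Or.inl hzx
  · exact Or.inr (hG x y z h hz hxy hzx).symm

theorem EdgeUnique.keep {G : Graph α} (hG : G.EdgeUnique) (S : Set α) : (G.keep S).EdgeUnique :=
  fun x y z hy hz => hG x y z (onSet_le _ _ hy) (onSet_le _ _ hz)

/-- If cutting the line `{x, y}` separates its ends, then the component of `x` in the cut graph is a
set which only this line leaves. Conversely, a set left by this line alone is closed in the cut
graph and separates `x` from `y`. -/
theorem bridgeless_iff {G : Graph α} (hG : G.EdgeUnique) :
    G.Bridgeless ↔ ∀ x y, G.edge x y → (G.keep {w | ¬ G.edge x w}).conn x y := by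
  constructor
  · intro h x y hxy
    by_contra hc
    have hne : y ≠ x := by
      rintro rfl
      exact hc (Setoid.refl' _ _)
    obtain ⟨x', hx', y', hy', he, hne'⟩ := h {z | (G.keep {w | ¬ G.edge x w}).conn x z}
      (fun a ha b hab => (G.keep {w | ¬ G.edge x w}).conn.trans ha (conn_vert hab)) x
      ((G.keep {w | ¬ G.edge x w}).conn.refl x) y hc hxy
    refine hy' (Setoid.trans' _ hx' (conn_edge (Or.inr ⟨?_, ?_, he⟩)))
    · intro hxx'
      rcases hG.eq_or hxy hne hxx' with rfl | rfl
      · exact hne' rfl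
      · exact hc hx'
    · intro hxy'
      rcases hG.eq_or hxy hne (G.edge.trans hxy' (G.edge.symm he)) with rfl | rfl
      · exact hne' rfl
      · exact hc hx'
  · intro h C hC x hx y hy hxy
    by_contra hno
    push Not at hno
    refine hy (sup_closed (C := C) (fun a b hab ha => hC a ha b hab) ?_ (h x y hxy) hx)
    have key : ∀ a b, (G.keep {w | ¬ G.edge x w}).edge a b → a ∈ C → b ∉ C → False := by
      rintro a b (rfl | ⟨ha, _, hab⟩) haC hbC
      · exact hbC haC
      · have := hno a haC b hbC hab
        subst this
        exact ha (G.edge.refl a)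
    exact fun a b hab ha => by_contra fun hb => key a b hab ha hb

theorem Iso.edgeUnique {G : Graph α} {G' : Graph β} (e : Iso G G') (h : G.EdgeUnique) :
    G'.EdgeUnique := by
  intro x y z
  obtain ⟨x, rfl⟩ := e.toEquiv.surjective x
  obtain ⟨y, rfl⟩ := e.toEquiv.surjective y
  obtain ⟨z, rfl⟩ := e.toEquiv.surjective z
  simpa [e.edge_iff] using h x y z

theorem Iso.bridgeless {G : Graph α} {G' : Graph β} (e : Iso G G') (h : G.Bridgeless) :
    G'.Bridgeless := by
  intro C hC x hx y hy hxy
  obtain ⟨x, rfl⟩ := e.toEquiv.surjective x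
  obtain ⟨y, rfl⟩ := e.toEquiv.surjective y
  obtain ⟨x', hx', y', hy', he, hne⟩ := h (e.toEquiv ⁻¹' C)
    (fun a ha b hab => hC _ ha _ ((e.vert_iff a b).2 hab)) x hx y hy ((e.edge_iff x y).1 hxy)
  exact ⟨_, hx', _, hy', (e.edge_iff _ _).2 he, fun hh => hne (e.toEquiv.injective hh)⟩

theorem Iso.nice {G : Graph α} {G' : Graph β} (e : Iso G G') (h : G.Nice) : G'.Nice where
  edge_unique := e.edgeUnique h.edge_unique
  bridgeless := e.bridgeless h.bridgeless
  leg x := by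
    obtain ⟨x, rfl⟩ := e.toEquiv.surjective x
    obtain ⟨y, hy, hxy⟩ := h.leg x
    exact ⟨_, (e.mem_legs y).2 hy, (e.conn_iff x y).2 hxy⟩

theorem Nice.restrict {G : Graph α} (h : G.Nice) (p : Set α)
    (hp : ∀ x ∈ p, ∀ y, G.conn x y → y ∈ p) : (G.restrict p).Nice where
  edge_unique x y z hy hz hyx hzx := Subtype.ext (h.edge_unique x y z hy hz
    (fun hh => hyx (Subtype.ext hh)) fun hh => hzx (Subtype.ext hh))
  bridgeless C hC x hx y hy hxy := by
    have hval : ∀ z : p, (z : α) ∈ Subtype.val '' C ↔ z ∈ C := fun z => by simp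
    obtain ⟨x', ⟨x', hx', rfl⟩, y', hy', he, hne⟩ := h.bridgeless (Subtype.val '' C)
      (by
        rintro _ ⟨a, ha, rfl⟩ b hab
        exact ⟨⟨b, hp a a.2 b (conn_vert hab)⟩, hC a ha _ hab, rfl⟩)
      x ((hval x).2 hx) y (fun hh => hy ((hval y).1 hh)) hxy
    exact ⟨x', hx', ⟨y', hp _ x'.2 _ (conn_edge he)⟩, fun hh => hy' ⟨_, hh, rfl⟩, he,
      fun hh => hne (congrArg Subtype.val hh)⟩
  leg x := by
    obtain ⟨y, hy, hxy⟩ := h.leg x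
    refine ⟨⟨y, hp x x.2 y hxy⟩,
      (restrict_legs G p (fun a ha b hab => hp a ha b (conn_edge hab)) _).2 hy, ?_⟩
    rw [restrict_conn G p hp]
    exact hxy

theorem Nice.component {G : Graph α} (h : G.Nice) (q : Quotient G.conn) :
    (G.component q).Nice := h.restrict _ (G.component_closed q)

/-! ### Counting vertices, lines and components -/

/-- By the hypothesis, classes of `r` other than that of `y` are never merged with each other, so
the class of `y` is the only one that can be lost. -/
theorem card_quotient_le_add_one [Finite α] {r s : Setoid α} (hrs : r ≤ s) (y : α)
    (h : ∀ u v, s u v → r u v ∨ r u y ∨ r v y) :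
    Nat.card (Quotient r) ≤ Nat.card (Quotient s) + 1 := by
  classical
  let F : Quotient r → Option (Quotient s) := fun q =>
    if q = Quotient.mk r y then none else some (Quotient.map id (fun _ _ hab => hrs hab) q)
  have hF : Function.Injective F := by
    intro a b
    induction a, b using Quotient.inductionOn₂ with | _ a b => ?_
    simp only [F]
    split_ifs with h1 h2 h2
    · intro _
      rw [h1, h2]
    · simp
    · simp
    · intro hab
      have hab' : Quotient.mk s a = Quotient.mk s b := Option.some.inj hab
      rcases h a b (Quotient.exact hab') with h3 | h3 | h3
      · exact Quotient.sound h3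
      · exact absurd (Quotient.sound h3) h1
      · exact absurd (Quotient.sound h3) h2
  have := Nat.card_le_card_of_injective F hF
  rwa [Finite.card_option] at this

theorem card_quotient_conn_of_connected [Nonempty α] {G : Graph α} (h : ∀ x y, G.conn x y) :
    Nat.card (Quotient G.conn) = 1 := by
  rw [Nat.card_eq_one_iff_exists]
  refine ⟨Quotient.mk _ (Classical.arbitrary α), fun q => ?_⟩
  induction q using Quotient.inductionOn
  exact Quotient.sound (h _ _)

/-- The half-lines of internal lines after cutting the internal line `{x, y}`. -/
theorem inner_cut {G : Graph α} (hG : G.EdgeUnique) {x y : α} (hxy : G.edge x y) (hne : y ≠ x) :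
    (G.keep {w | ¬ G.edge x w}).inner = G.inner \ {x, y} := by
  ext z
  simp only [mem_inner, Set.mem_sdiff, Set.mem_insert_iff, Set.mem_singleton_iff, keep_edge_iff,
    Set.mem_ofPred_eq]
  constructor
  · rintro ⟨w, rfl | ⟨hz, hw, hzw⟩, hwz⟩
    · exact absurd rfl hwz
    · refine ⟨⟨w, hzw, hwz⟩, ?_⟩
      rintro (rfl | rfl)
      · exact hz (G.edge.refl _)
      · exact hz hxy
  · rintro ⟨⟨w, hzw, hwz⟩, hz⟩
    have hz' : ¬ G.edge x z := fun h => hz (hG.eq_or hxy hne h)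
    exact ⟨w, Or.inr ⟨hz', fun h => hz' (G.edge.trans h (G.edge.symm hzw)), hzw⟩, hwz⟩

theorem ncard_inner_cut [Finite α] {G : Graph α} (hG : G.EdgeUnique) {x y : α}
    (hxy : G.edge x y) (hne : y ≠ x) :
    (G.keep {w | ¬ G.edge x w}).inner.ncard + 2 = G.inner.ncard := by
  have hsub : {x, y} ⊆ G.inner := by
    rintro z (rfl | rfl)
    · exact mem_inner.2 ⟨y, hxy, hne⟩
    · exact mem_inner.2 ⟨x, G.edge.symm hxy, hne.symm⟩
  rw [inner_cut hG hxy hne, ← Set.ncard_sdiff_add_ncard_of_subset hsub, Set.ncard_pair hne.symm]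

/-- A path which uses the line `{x, y}` runs from its start to one of the two ends without this
line, and likewise from its last passage to its end. -/
theorem conn_cut {G : Graph α} (hG : G.EdgeUnique) {x y : α} (hxy : G.edge x y) (hne : y ≠ x)
    {u v : α} (h : G.conn u v) :
    (G.keep {w | ¬ G.edge x w}).conn u v ∨
      (((G.keep {w | ¬ G.edge x w}).conn u x ∨ (G.keep {w | ¬ G.edge x w}).conn u y) ∧
        ((G.keep {w | ¬ G.edge x w}).conn v x ∨ (G.keep {w | ¬ G.edge x w}).conn v y)) := by
  set K := G.keep {w | ¬ G.edge x w}
  have tr : ∀ {a b}, K.conn a b → (K.conn a x ∨ K.conn a y) → (K.conn b x ∨ K.conn b y) :=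
    fun hab => Or.imp (Setoid.trans' _ (Setoid.symm' _ hab)) (Setoid.trans' _ (Setoid.symm' _ hab))
  refine sup_closed (C := {v | K.conn u v ∨ ((K.conn u x ∨ K.conn u y) ∧
    (K.conn v x ∨ K.conn v y))}) ?_ ?_ h (Or.inl (Setoid.refl' _ _))
  · rintro a b hab (ha | ⟨hu, ha⟩)
    · exact Or.inl (Setoid.trans' _ ha (conn_vert hab))
    · exact Or.inr ⟨hu, tr (conn_vert hab) ha⟩
  · rintro a b hab ha
    by_cases hxa : G.edge x a
    · have hxb := G.edge.trans hxa hab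
      have hb : K.conn b x ∨ K.conn b y := by
        rcases hG.eq_or hxy hne hxb with rfl | rfl
        · exact Or.inl (Setoid.refl' _ _)
        · exact Or.inr (Setoid.refl' _ _)
      rcases ha with ha | ⟨hu, ha⟩
      · refine Or.inr ⟨?_, hb⟩
        rcases hG.eq_or hxy hne hxa with rfl | rfl
        · exact Or.inl ha
        · exact Or.inr ha
      · exact Or.inr ⟨hu, hb⟩
    · have hK : K.conn a b :=
        conn_edge (Or.inr ⟨hxa, fun h => hxa (G.edge.trans h (G.edge.symm hab)), hab⟩)
      rcases ha with ha | ⟨hu, ha⟩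
      · exact Or.inl (Setoid.trans' _ ha hK)
      · exact Or.inr ⟨hu, tr hK ha⟩

/-- The number of lines is a natural number, and there are at most as many vertices as components
and internal lines together. -/
theorem exists_numEdges [Finite α] {G : Graph α} (hG : G.EdgeUnique) :
    ∃ k, G.inner.ncard = 2 * k ∧ G.numVerts ≤ Nat.card (Quotient G.conn) + k := by
  induction hn : G.inner.ncard using Nat.strong_induction_on generalizing G with
  | _ n ih =>
    by_cases hne : G.inner.Nonempty
    · obtain ⟨x, hx⟩ := hne
      obtain ⟨y, hxy, hyx⟩ := mem_inner.1 hx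
      have h1 := ncard_inner_cut hG hxy hyx
      obtain ⟨k, hk, hv⟩ := ih _ (by omega) (hG.keep {w | ¬ G.edge x w}) rfl
      refine ⟨k + 1, by omega, ?_⟩
      -- Cutting one line keeps the vertices and increases the number of components by at most one.
      have h2 := card_quotient_le_add_one (keep_conn_le G {w | ¬ G.edge x w}) y fun u v huv => by
        rcases conn_cut hG hxy hyx huv with h | ⟨h | h, h' | h'⟩
        · exact Or.inl h
        · exact Or.inl (Setoid.trans' _ h (Setoid.symm' _ h'))
        · exact Or.inr (Or.inr h')
        · exact Or.inr (Or.inl h)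
        · exact Or.inr (Or.inl h)
      have h3 : (G.keep {w | ¬ G.edge x w}).numVerts = G.numVerts := rfl
      omega
    · rw [Set.not_nonempty_iff_eq_empty] at hne
      refine ⟨0, by rw [← hn, hne]; simp, ?_⟩
      have : G.conn = G.vert := by
        refine le_antisymm (sup_le le_rfl fun x y hxy => ?_) le_sup_left
        have hx : x ∉ G.inner := by simp [hne]
        rw [not_mem_inner.1 hx y hxy]
      rw [this]
      rfl

theorem numLegs_add_ncard_inner [Finite α] (G : Graph α) :
    G.numLegs + G.inner.ncard = Nat.card α := Set.ncard_add_ncard_compl G.legs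

/-- One-particle irreducible graphs are the nice connected graphs with an internal line where all
vertices have valence at least three. -/
theorem isOnePI_iff [Finite α] {G : Graph α} :
    G.IsOnePI ↔ G.Nice ∧ (∀ x y, G.conn x y) ∧ G.inner.Nonempty ∧
      ∀ x, 3 ≤ {y | G.vert x y}.ncard := by
  constructor
  · intro h
    have hu := edge_le_iff.1 h.edge_le
    refine ⟨⟨hu, (bridgeless_iff hu).2 fun x y hxy => ?_, fun x => ?_⟩, h.connected,
      h.inner_nonempty, h.three_le_valence⟩
    · by_cases hne : y = x
      · subst hne
        exact Setoid.refl' _ _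
      · exact h.bridgeless x (mem_inner.2 ⟨y, hxy, hne⟩) x y
    · have h3 : G.legs.Nonempty := Set.nonempty_of_ncard_ne_zero
        (Nat.one_le_iff_ne_zero.1 h.one_le_legs)
      exact ⟨_, h3.some_mem, h.connected _ _⟩
  · rintro ⟨hn, hc, ⟨x, hx⟩, hv⟩
    obtain ⟨y, hxy, hyx⟩ := mem_inner.1 hx
    -- In a connected graph it is enough that the two ends of the cut line remain connected.
    have hbr : ∀ x y, G.edge x y → y ≠ x → ∀ u v, (G.keep {w | ¬ G.edge x w}).conn u v := by
      intro x y hxy hyx u v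
      have h1 := (bridgeless_iff hn.edge_unique).1 hn.bridgeless x y hxy
      rcases conn_cut hn.edge_unique hxy hyx (hc u v) with h | ⟨h | h, h' | h'⟩
      · exact h
      · exact Setoid.trans' _ h (Setoid.symm' _ h')
      · exact Setoid.trans' _ (Setoid.trans' _ h h1) (Setoid.symm' _ h')
      · exact Setoid.trans' _ (Setoid.trans' _ h (Setoid.symm' _ h1)) (Setoid.symm' _ h')
      · exact Setoid.trans' _ h (Setoid.symm' _ h')
    have hne : Nonempty α := ⟨x⟩
    refine ⟨edge_le_iff.2 hn.edge_unique, hv, hc, ?_, fun x hx u v => ?_, ?_⟩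
    · obtain ⟨k, hk, hV⟩ := exists_numEdges (hn.edge_unique.keep {w | ¬ G.edge x w})
      rw [card_quotient_conn_of_connected (hbr x y hxy hyx)] at hV
      have h1 := ncard_inner_cut hn.edge_unique hxy hyx
      have h3 : (G.keep {w | ¬ G.edge x w}).numVerts = G.numVerts := rfl
      simp only [loops, numEdges]
      omega
    · obtain ⟨y, hxy, hyx⟩ := mem_inner.1 hx
      exact hbr x y hxy hyx u v
    · obtain ⟨l, hl, _⟩ := hn.leg x
      exact Nat.one_le_iff_ne_zero.2 (Set.ncard_ne_zero_of_mem hl)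

theorem IsOnePI.nice [Finite α] {G : Graph α} (h : G.IsOnePI) : G.Nice := (isOnePI_iff.1 h).1

/-- The number of loops of a connected graph in terms of its half-lines, vertices and external
lines. -/
theorem two_mul_loops [Finite α] [Nonempty α] {G : Graph α} (hu : G.EdgeUnique)
    (hc : ∀ x y, G.conn x y) :
    2 * G.loops + G.numLegs + 2 * G.numVerts = Nat.card α + 2 := by
  obtain ⟨k, hk, hV⟩ := exists_numEdges hu
  rw [card_quotient_conn_of_connected hc] at hV
  have := numLegs_add_ncard_inner G
  simp only [loops, numEdges]
  omega

end Graph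

namespace Graph

variable {α β : Type}

/-! ### Subgraphs and plain contraction -/

/-- The graph in which each component of the graph with internal lines `S` is contracted to a
vertex, which may have any valence. -/
def quo (G : Graph α) (S : Set α) : Graph {x | x ∉ S} :=
  (⟨(G.keep S).conn, G.edge⟩ : Graph α).restrict {x | x ∉ S}

/-- The set `S` of half-lines describes a disjoint union of bridgeless subgraphs. -/
structure IsSub (G : Graph α) (S : Set α) : Prop where
  subset_inner : S ⊆ G.inner
  closed : ∀ x ∈ S, ∀ y, G.edge x y → y ∈ S
  bridgeless : (G.keep S).Bridgeless

theorem not_mem_of_closed {G : Graph α} {S : Set α} (hS : ∀ x ∈ S, ∀ y, G.edge x y → y ∈ S)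
    {x y : α} (h : G.edge x y) (hx : x ∉ S) : y ∉ S :=
  fun hy => hx (hS y hy x (G.edge.symm h))

/-- Connectedness is generated by the connectedness of the subgraph and the lines outside `S`. The
latter have both ends outside `S`, so that `comap_sup` applies. -/
theorem quo_conn (G : Graph α) {S : Set α} (hS : ∀ x ∈ S, ∀ y, G.edge x y → y ∈ S) :
    (G.quo S).conn = Setoid.comap Subtype.val G.conn := by
  have h1 : G.conn = (G.keep S).conn ⊔ onSet G.edge Sᶜ := by
    change G.vert ⊔ G.edge = G.vert ⊔ onSet G.edge S ⊔ onSet G.edge Sᶜ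
    rw [sup_assoc, onSet_sup_compl _ _ hS]
  rw [h1, comap_sup]
  · change Setoid.comap Subtype.val (G.keep S).conn ⊔ Setoid.comap Subtype.val G.edge = _
    congr 1
    rw [comap_onSet _ Subtype.val_injective]
    ext x y
    exact ⟨fun h => Or.inr ⟨x.2, y.2, h⟩, fun h => onSet_le _ _ h⟩
  · rintro x y (rfl | ⟨hx, hy, _⟩)
    · exact Or.inl rfl
    · exact Or.inr ⟨⟨⟨x, hx⟩, rfl⟩, ⟨⟨y, hy⟩, rfl⟩⟩

theorem quo_keep (G : Graph α) {S D : Set α} (h : S ⊆ D) :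
    (G.quo S).keep (Subtype.val ⁻¹' D) = (G.keep D).quo S := by
  have h1 : (G.keep D).keep S = G.keep S := by rw [keep_keep, Set.inter_eq_right.2 h]
  ext x y
  · change (G.keep S).conn x y ↔ ((G.keep D).keep S).conn x y
    rw [h1]
  · change onSet (Setoid.comap Subtype.val G.edge) (Subtype.val ⁻¹' D) x y ↔
      Setoid.comap Subtype.val (onSet G.edge D) x y
    rw [comap_onSet _ Subtype.val_injective]

theorem quo_legs (G : Graph α) {S : Set α} (hS : ∀ x ∈ S, ∀ y, G.edge x y → y ∈ S)
    (x : {x | x ∉ S}) : x ∈ (G.quo S).legs ↔ (x : α) ∈ G.legs :=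
  restrict_legs ⟨(G.keep S).conn, G.edge⟩ {x | x ∉ S}
    (fun _ hx _ h => not_mem_of_closed hS h hx) x

theorem quo_inner (G : Graph α) {S : Set α} (hS : ∀ x ∈ S, ∀ y, G.edge x y → y ∈ S)
    (x : {x | x ∉ S}) : x ∈ (G.quo S).inner ↔ (x : α) ∈ G.inner :=
  not_congr (G.quo_legs hS x)

theorem closed_keep {G : Graph α} {S D : Set α} (hS : ∀ x ∈ S, ∀ y, G.edge x y → y ∈ S) :
    ∀ x ∈ S, ∀ y, (G.keep D).edge x y → y ∈ S := fun x hx y h => hS x hx y (onSet_le _ _ h)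

theorem EdgeUnique.quo {G : Graph α} (h : G.EdgeUnique) (S : Set α) : (G.quo S).EdgeUnique :=
  fun x y z hy hz hyx hzx => Subtype.ext (h x y z hy hz
    (fun hh => hyx (Subtype.ext hh)) fun hh => hzx (Subtype.ext hh))

/-- Cutting a line outside `S` commutes with contracting `S`. Thus the bridges of `G/S` are the
bridges of `G` outside `S`. -/
theorem quo_cut_conn (G : Graph α) {S : Set α} (hS : ∀ x ∈ S, ∀ y, G.edge x y → y ∈ S)
    (x y z : {x | x ∉ S}) :
    ((G.quo S).keep {w | ¬ (G.quo S).edge x w}).conn y z ↔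
      (G.keep {w | ¬ G.edge x w}).conn y z := by
  have hsub : S ⊆ {w | ¬ G.edge x w} := fun w hw h => x.2 (hS w hw _ (G.edge.symm h))
  change ((G.quo S).keep (Subtype.val ⁻¹' {w | ¬ G.edge x w})).conn y z ↔ _
  rw [G.quo_keep hsub, quo_conn _ (closed_keep hS)]
  rfl

theorem Bridgeless.quo {G : Graph α} (hu : G.EdgeUnique) (h : G.Bridgeless) {S : Set α}
    (hS : ∀ x ∈ S, ∀ y, G.edge x y → y ∈ S) : (G.quo S).Bridgeless :=
  (bridgeless_iff (hu.quo S)).2 fun x y hxy =>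
    (G.quo_cut_conn hS x x y).2 ((bridgeless_iff hu).1 h x y hxy)

/-- A line in `S` is no bridge already inside the subgraph, and a line outside `S` is no bridge
because it is none in the contracted graph. -/
theorem bridgeless_of_quo {G : Graph α} (hu : G.EdgeUnique) {S : Set α}
    (hS : ∀ x ∈ S, ∀ y, G.edge x y → y ∈ S) (h1 : (G.keep S).Bridgeless)
    (h2 : (G.quo S).Bridgeless) : G.Bridgeless := by
  refine (bridgeless_iff hu).2 fun x y hxy => ?_
  by_cases hx : x ∈ S
  · have hy := hS x hx y hxy
    have := (bridgeless_iff (hu.keep S)).1 h1 x y (Or.inr ⟨hx, hy, hxy⟩)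
    rw [keep_keep] at this
    have hsub : S ∩ {w | ¬ (G.keep S).edge x w} ⊆ {w | ¬ G.edge x w} :=
      fun w hw h => hw.2 (Or.inr ⟨hx, hw.1, h⟩)
    exact keep_conn_mono G hsub this
  · have hy := not_mem_of_closed hS hxy hx
    exact (G.quo_cut_conn hS ⟨x, hx⟩ ⟨x, hx⟩ ⟨y, hy⟩).1
      ((bridgeless_iff (hu.quo S)).1 h2 ⟨x, hx⟩ ⟨y, hy⟩ hxy)

theorem keep_legs {G : Graph α} {S : Set α} (hS : S ⊆ G.inner)
    (hc : ∀ x ∈ S, ∀ y, G.edge x y → y ∈ S) (x : α) : x ∈ (G.keep S).legs ↔ x ∉ S := by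
  constructor
  · intro h hx
    obtain ⟨y, hxy, hne⟩ := mem_inner.1 (hS hx)
    exact hne (h y (Or.inr ⟨hx, hc x hx y hxy, hxy⟩))
  · rintro h y (rfl | ⟨hx, _⟩)
    · rfl
    · exact absurd hx h

/-- Every component of a subgraph has an external line. -/
theorem Nice.exists_not_mem {G : Graph α} (h : G.Nice) {S : Set α} (hS : S ⊆ G.inner)
    (hc : ∀ x ∈ S, ∀ y, G.edge x y → y ∈ S) (x : α) : ∃ y ∉ S, (G.keep S).conn x y := by
  by_contra hno
  push Not at hno
  have hno' : ∀ y, (G.keep S).conn x y → y ∈ S := fun y hy => by_contra fun h' => hno y h' hy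
  obtain ⟨y, hy, hxy⟩ := h.leg x
  have hy' : (G.keep S).conn x y := by
    -- A component of the subgraph with all half-lines in `S` would be a component of `G`. It would
    -- contain an external line `y` of `G`, but `S` consists of internal lines.
    refine sup_closed (C := {z | (G.keep S).conn x z}) ?_ ?_ hxy ((G.keep S).conn.refl x)
    · exact fun a b hab ha => (G.keep S).conn.trans ha (conn_vert hab)
    · intro a b hab ha
      have haS := hno' a ha
      exact (G.keep S).conn.trans ha (conn_edge (Or.inr ⟨haS, hc a haS b hab, hab⟩))
  exact not_mem_inner.2 hy (hS (hno' y hy'))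

theorem Nice.keep {G : Graph α} (h : G.Nice) {S : Set α} (hS : G.IsSub S) : (G.keep S).Nice where
  edge_unique := h.edge_unique.keep S
  bridgeless := hS.bridgeless
  leg x := by
    obtain ⟨y, hy, hxy⟩ := h.exists_not_mem hS.subset_inner hS.closed x
    exact ⟨y, (keep_legs hS.subset_inner hS.closed y).2 hy, hxy⟩

theorem Nice.quo {G : Graph α} (h : G.Nice) {S : Set α} (hS : S ⊆ G.inner)
    (hc : ∀ x ∈ S, ∀ y, G.edge x y → y ∈ S) : (G.quo S).Nice where
  edge_unique := h.edge_unique.quo S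
  bridgeless := h.bridgeless.quo h.edge_unique hc
  leg x := by
    obtain ⟨y, hy, hxy⟩ := h.leg x
    refine ⟨⟨y, fun hyS => not_mem_inner.2 hy (hS hyS)⟩, (quo_legs G hc _).2 hy, ?_⟩
    rw [quo_conn G hc]
    exact hxy

/-! ### Subgraphs of subgraphs and of contracted graphs -/

theorem IsSub.subset_of_keep {G : Graph α} {S D : Set α} (h : (G.keep D).IsSub S) : S ⊆ D := by
  intro x hx
  obtain ⟨y, hxy | ⟨hx, _⟩, hne⟩ := mem_inner.1 (h.subset_inner hx)
  · exact absurd hxy.symm hne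
  · exact hx

theorem IsSub.of_keep {G : Graph α} {S D : Set α} (hD : G.IsSub D) (hS : (G.keep D).IsSub S) :
    G.IsSub S where
  subset_inner := hS.subset_of_keep.trans hD.subset_inner
  closed x hx y hxy := hS.closed x hx y (Or.inr
    ⟨hS.subset_of_keep hx, hD.closed x (hS.subset_of_keep hx) y hxy, hxy⟩)
  bridgeless := by
    have := hS.bridgeless
    rwa [keep_keep, Set.inter_eq_right.2 hS.subset_of_keep] at this

/-- This lemma and the three around it show that, for `S ⊆ D`, the pairs `(D, S)` and `(S, D/S)`
consist of subgraphs simultaneously. The content is that bridgelessness passes to contractions and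
can be recovered from `S` and the contraction. -/
theorem IsSub.quo {G : Graph α} (hu : G.EdgeUnique) {S D : Set α} (hD : G.IsSub D)
    (hS : (G.keep D).IsSub S) : (G.quo S).IsSub (Subtype.val ⁻¹' D) where
  subset_inner x hx := (quo_inner G (hD.of_keep hS).closed x).2 (hD.subset_inner hx)
  closed x hx y hxy := hD.closed x hx y hxy
  bridgeless := by
    rw [quo_keep G hS.subset_of_keep]
    exact hD.bridgeless.quo (hu.keep D) hS.closed

theorem IsSub.keep_of_subset {G : Graph α} {S D : Set α} (hS : G.IsSub S) (h : S ⊆ D) :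
    (G.keep D).IsSub S where
  subset_inner x hx := by
    obtain ⟨y, hxy, hne⟩ := mem_inner.1 (hS.subset_inner hx)
    exact mem_inner.2 ⟨y, Or.inr ⟨h hx, h (hS.closed x hx y hxy), hxy⟩, hne⟩
  closed := closed_keep hS.closed
  bridgeless := by
    rw [keep_keep, Set.inter_eq_right.2 h]
    exact hS.bridgeless

theorem IsSub.of_quo {G : Graph α} (hu : G.EdgeUnique) {S D : Set α} (hS : G.IsSub S)
    (h : S ⊆ D) (hD : (G.quo S).IsSub (Subtype.val ⁻¹' D)) : G.IsSub D where
  subset_inner x hx := by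
    by_cases hxS : x ∈ S
    · exact hS.subset_inner hxS
    · exact (quo_inner G hS.closed ⟨x, hxS⟩).1 (hD.subset_inner hx)
  closed x hx y hxy := by
    by_cases hxS : x ∈ S
    · exact h (hS.closed x hxS y hxy)
    · exact hD.closed ⟨x, hxS⟩ hx ⟨y, not_mem_of_closed hS.closed hxy hxS⟩ hxy
  bridgeless := by
    refine bridgeless_of_quo (hu.keep D) (closed_keep hS.closed) ?_ ?_
    · rw [keep_keep, Set.inter_eq_right.2 h]
      exact hS.bridgeless
    · rw [← quo_keep G h]
      exact hD.bridgeless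

/-- Contracting in two steps. -/
def quoQuoIso (G : Graph α) {S D : Set α} (hS : ∀ x ∈ S, ∀ y, G.edge x y → y ∈ S) (h : S ⊆ D) :
    Iso ((G.quo S).quo (Subtype.val ⁻¹' D)) (G.quo D) := by
  have h1 : (⟨((G.quo S).keep (Subtype.val ⁻¹' D)).conn, (G.quo S).edge⟩ : Graph {x | x ∉ S}) =
      (⟨(G.keep D).conn, G.edge⟩ : Graph α).restrict {x | x ∉ S} := by
    rw [quo_keep G h, quo_conn _ (closed_keep hS)]
    rfl
  have h2 : (G.quo S).quo (Subtype.val ⁻¹' D) =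
      ((⟨(G.keep D).conn, G.edge⟩ : Graph α).restrict {x | x ∉ S}).restrict
        {x | x ∉ Subtype.val ⁻¹' D} := by
    rw [← h1]
    rfl
  rw [h2]
  refine Iso.restrictRestrict _ _ _ ?_
  ext x
  constructor
  · exact fun hx => ⟨⟨x, fun hxS => hx (h hxS)⟩, hx, rfl⟩
  · rintro ⟨y, hy, rfl⟩
    exact hy

theorem sigma_subtype_ext {X Y : Type} {P : X → Prop} {R : X → Y → Prop}
    {p q : Σ x : {x // P x}, {y // R x y}} (h1 : p.1.1 = q.1.1) (h2 : p.2.1 = q.2.1) : p = q := by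
  obtain ⟨⟨x, hx⟩, ⟨y, hy⟩⟩ := p
  obtain ⟨⟨x', hx'⟩, ⟨y', hy'⟩⟩ := q
  obtain rfl : x = x' := h1
  obtain rfl : y = y' := h2
  rfl

/-- Pairs of a subgraph and a subgraph of it correspond to pairs of a subgraph and a subgraph of
the contracted graph. -/
def subSubEquiv (G : Graph α) (hu : G.EdgeUnique) :
    (Σ D : {D // G.IsSub D}, {S // (G.keep D).IsSub S}) ≃
      (Σ S : {S // G.IsSub S}, {T // (G.quo S).IsSub T}) where
  toFun p := ⟨⟨p.2, p.1.2.of_keep p.2.2⟩, ⟨Subtype.val ⁻¹' p.1.1, p.1.2.quo hu p.2.2⟩⟩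
  invFun p :=
    have h : Subtype.val ⁻¹' (p.1.1 ∪ Subtype.val '' p.2.1) = p.2.1 := by
      ext x
      simp only [Set.mem_preimage, Set.mem_union, Subtype.val_injective.mem_set_image]
      exact ⟨fun h => h.resolve_left x.2, Or.inr⟩
    ⟨⟨p.1.1 ∪ Subtype.val '' p.2.1, p.1.2.of_quo hu Set.subset_union_left
      (by rw [h]; exact p.2.2)⟩, ⟨p.1.1, p.1.2.keep_of_subset Set.subset_union_left⟩⟩
  left_inv := by
    rintro ⟨⟨D, hD⟩, ⟨S, hS⟩⟩
    have : S ∪ Subtype.val '' (Subtype.val ⁻¹' D : Set {x | x ∉ S}) = D := by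
      ext x
      simp only [Set.mem_union, Set.mem_image, Set.mem_preimage, Subtype.exists]
      constructor
      · rintro (h | ⟨y, _, hy, rfl⟩)
        · exact hS.subset_of_keep h
        · exact hy
      · intro h
        by_cases hx : x ∈ S
        · exact Or.inl hx
        · exact Or.inr ⟨x, hx, h, rfl⟩
    exact sigma_subtype_ext (R := fun D S => (G.keep D).IsSub S) this rfl
  right_inv := by
    rintro ⟨⟨S, hS⟩, ⟨T, hT⟩⟩
    refine Sigma.ext rfl (heq_of_eq (Subtype.ext ?_))
    ext x
    simp only [Set.mem_preimage, Set.mem_union, Subtype.val_injective.mem_set_image]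
    exact ⟨fun h => h.resolve_left x.2, Or.inr⟩

/-! ### The subgraphs in the coproduct -/

theorem ncard_vert_restrict (G : Graph α) (p : Set α) (hp : ∀ x ∈ p, ∀ y, G.vert x y → y ∈ p)
    (x : p) : {y | (G.restrict p).vert x y}.ncard = {y | G.vert x y}.ncard := by
  have : {y | G.vert x y} = Subtype.val '' {y | (G.restrict p).vert x y} := by
    ext y
    simp only [Set.mem_ofPred_eq, Set.mem_image, Subtype.exists, exists_and_right, exists_eq_right]
    exact ⟨fun h => ⟨hp x x.2 y h, h⟩, fun ⟨_, h⟩ => h⟩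
  rw [this, Set.ncard_image_of_injective _ Subtype.val_injective]

/-- Both ends of a line of `S` lie in one component, so a cut set of the subgraph can be examined in
that component. -/
theorem isSub_of_isOnePI {G : Graph α} {S : Set α} [Finite α] (hS : S ⊆ G.inner)
    (hc : ∀ x ∈ S, ∀ y, G.edge x y → y ∈ S)
    (h : ∀ x ∈ S, ((G.keep S).component (Quotient.mk (G.keep S).conn x)).IsOnePI) :
    G.IsSub S := by
  refine ⟨hS, hc, fun C hC x hx y hy hxy => ?_⟩
  rcases hxy with rfl | hxy
  · exact absurd hx hy
  · have hcl := (G.keep S).component_closed (Quotient.mk _ x)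
    obtain ⟨x', hx', y', hy', he, hne⟩ := (h x hxy.1).nice.bridgeless (Subtype.val ⁻¹' C)
      (fun a ha b hab => hC a ha b hab) ⟨x, rfl⟩ hx
      ⟨y, hcl x rfl y (conn_edge (Or.inr hxy))⟩ hy (Or.inr hxy)
    exact ⟨x', hx', y', hy', he, fun hh => hne (Subtype.ext hh)⟩

/-- The components of a bridgeless subgraph are automatically 1PI. They inherit the valences from
`G`, because cut lines stay as external half-lines, and `Nice.keep` provides an external line. -/
theorem isProperSub_iff [Finite α] {G : Graph α} (hG : G.IsOnePI) {S : Set α} :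
    G.IsProperSub S ↔ G.IsSub S ∧ S.Nonempty ∧ S ≠ G.inner := by
  constructor
  · intro h
    exact ⟨isSub_of_isOnePI h.subset_inner h.closed h.component_isOnePI, h.nonempty, h.ne_inner⟩
  · rintro ⟨h, hne, hni⟩
    refine ⟨h.subset_inner, h.closed, hne, hni, fun x hx => ?_⟩
    refine isOnePI_iff.2 ⟨(hG.nice.keep h).component _, component_connected _ _, ?_, fun y => ?_⟩
    · refine ⟨⟨x, rfl⟩, fun hl => ?_⟩
      have := (restrict_legs _ _ (fun a ha b hab =>
        (G.keep S).component_closed (Quotient.mk _ x) a ha b (conn_edge hab)) _).1 hl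
      exact (keep_legs h.subset_inner h.closed x).1 this hx
    · refine (hG.three_le_valence y).trans_eq (ncard_vert_restrict (G.keep S) _ (fun a ha b hab =>
        (G.keep S).component_closed (Quotient.mk _ x) a ha b (conn_vert hab)) y).symm

end Graph

namespace Graph

variable {α β : Type}

/-! ### Removing bivalent vertices -/

/-- The half-lines at vertices of valence two. -/
def biv (G : Graph α) : Set α := {x | {y | G.vert x y}.ncard = 2}

/-- The set `B` of half-lines at certain vertices is removed, and the lines which meet at these
vertices are joined. -/
def remove (G : Graph α) (B : Set α) : Graph {x | x ∉ B} :=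
  (⟨G.vert, G.edge ⊔ onSet G.vert B⟩ : Graph α).restrict {x | x ∉ B}

/-- All vertices of valence two are removed. -/
def smooth (G : Graph α) : Graph {x | x ∉ G.biv} := G.remove G.biv

/-- The set of half-lines is a union of vertices. -/
def VertClosed (G : Graph α) (B : Set α) : Prop := ∀ x ∈ B, ∀ y, G.vert x y → y ∈ B

theorem VertClosed.not_mem {G : Graph α} {B : Set α} (hB : G.VertClosed B) {x y : α}
    (h : G.vert x y) (hx : x ∉ B) : y ∉ B := fun hy => hx (hB y hy x (G.vert.symm h))

theorem biv_closed (G : Graph α) : G.VertClosed G.biv := by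
  intro x hx y hxy
  have : {z | G.vert y z} = {z | G.vert x z} := by
    ext z
    exact ⟨fun h => G.vert.trans hxy h, fun h => G.vert.trans (G.vert.symm hxy) h⟩
  change {z | G.vert y z}.ncard = 2
  rw [this]
  exact hx

theorem remove_conn (G : Graph α) {B : Set α} (hB : G.VertClosed B) :
    (G.remove B).conn = Setoid.comap Subtype.val G.conn := by
  have h1 : G.conn = (G.edge ⊔ onSet G.vert B) ⊔ onSet G.vert Bᶜ := by
    rw [sup_assoc, onSet_sup_compl _ _ hB, sup_comm]
    rfl
  rw [h1, comap_sup]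
  · change Setoid.comap Subtype.val G.vert ⊔ _ = _
    rw [sup_comm]
    congr 1
    rw [comap_onSet _ Subtype.val_injective]
    ext x y
    exact ⟨fun h => Or.inr ⟨x.2, y.2, h⟩, fun h => onSet_le _ _ h⟩
  · rintro x y (rfl | ⟨hx, hy, _⟩)
    · exact Or.inl rfl
    · exact Or.inr ⟨⟨⟨x, hx⟩, rfl⟩, ⟨⟨y, hy⟩, rfl⟩⟩

theorem remove_biv (G : Graph α) {B : Set α} (hB : G.VertClosed B) :
    (G.remove B).biv = Subtype.val ⁻¹' G.biv := by
  ext x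
  change {y | (G.remove B).vert x y}.ncard = 2 ↔ {y | G.vert x y}.ncard = 2
  rw [← ncard_vert_restrict G {x | x ∉ B} (fun x hx y h => hB.not_mem h hx) x]
  rfl

/-- Removing vertices in two steps. -/
def removeRemoveIso (G : Graph α) {B D : Set α} (hB : G.VertClosed B) (hBD : B ⊆ D) :
    Iso ((G.remove B).remove (Subtype.val ⁻¹' D)) (G.remove D) := by
  have h1 : G.edge ⊔ onSet G.vert D = (G.edge ⊔ onSet G.vert B) ⊔ onSet G.vert (D \ B) := by
    rw [sup_assoc]
    congr 1
    refine le_antisymm ?_ (sup_le (onSet_mono _ hBD) (onSet_mono _ Set.sdiff_subset))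
    rintro x y (rfl | ⟨hx, hy, h⟩)
    · exact Setoid.refl' _ _
    · by_cases hxB : x ∈ B
      · exact sup_left (Or.inr ⟨hxB, hB x hxB y h, h⟩)
      · exact sup_right (Or.inr ⟨⟨hx, hxB⟩, ⟨hy, hB.not_mem h hxB⟩, h⟩)
  have h2 : (⟨(G.remove B).vert, (G.remove B).edge ⊔
      onSet (G.remove B).vert (Subtype.val ⁻¹' D)⟩ : Graph {x | x ∉ B}) =
      (⟨G.vert, G.edge ⊔ onSet G.vert D⟩ : Graph α).restrict {x | x ∉ B} := by
    refine Graph.ext rfl ?_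
    change Setoid.comap Subtype.val (G.edge ⊔ onSet G.vert B) ⊔ _ = Setoid.comap Subtype.val _
    rw [h1, comap_sup (t := onSet G.vert (D \ B)), comap_onSet _ Subtype.val_injective]
    · congr 2
      ext x
      exact ⟨fun h => ⟨h, x.2⟩, fun h => h.1⟩
    · rintro x y (rfl | ⟨hx, hy, _⟩)
      · exact Or.inl rfl
      · exact Or.inr ⟨⟨⟨x, hx.2⟩, rfl⟩, ⟨⟨y, hy.2⟩, rfl⟩⟩
  have h3 : (G.remove B).remove (Subtype.val ⁻¹' D) =
      ((⟨G.vert, G.edge ⊔ onSet G.vert D⟩ : Graph α).restrict {x | x ∉ B}).restrict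
        {x | x ∉ Subtype.val ⁻¹' D} := by
    rw [← h2]
    rfl
  rw [h3]
  refine Iso.restrictRestrict _ _ _ ?_
  ext x
  constructor
  · exact fun hx => ⟨⟨x, fun hxS => hx (hBD hxS)⟩, hx, rfl⟩
  · rintro ⟨y, hy, rfl⟩
    exact hy

/-- Removing some vertices of valence two does not change the graph without them. -/
def smoothRemoveIso (G : Graph α) {B : Set α} (hB : G.VertClosed B) (hbiv : B ⊆ G.biv) :
    Iso (G.remove B).smooth G.smooth := by
  unfold smooth
  rw [remove_biv G hB]
  exact removeRemoveIso G hB hbiv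

theorem Iso.mem_biv {G : Graph α} {G' : Graph β} (e : Iso G G') (x : α) :
    e.toEquiv x ∈ G'.biv ↔ x ∈ G.biv := by
  change _ = 2 ↔ _ = 2
  rw [ncard_eq e.toEquiv {y | G.vert x y} {y | G'.vert (e.toEquiv x) y} (e.vert_iff x)]

/-- Isomorphic graphs remain so if corresponding vertices are removed. -/
def Iso.remove {G : Graph α} {G' : Graph β} (e : Iso G G') {B : Set α} {B' : Set β}
    (hB : ∀ x, e.toEquiv x ∈ B' ↔ x ∈ B) : Iso (G.remove B) (G'.remove B') :=
  Iso.restrict (G := ⟨G.vert, G.edge ⊔ onSet G.vert B⟩)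
    (G' := ⟨G'.vert, G'.edge ⊔ onSet G'.vert B'⟩)
    ⟨e.toEquiv, e.vert_iff, sup_iff e.toEquiv e.edge_iff (onSet_iff' e.toEquiv e.vert_iff hB)⟩
    (fun x => not_congr (hB x))

def Iso.smooth {G : Graph α} {G' : Graph β} (e : Iso G G') : Iso G.smooth G'.smooth :=
  e.remove e.mem_biv

/-- Isomorphic graphs remain so if corresponding subgraphs are contracted. -/
def Iso.quo {G : Graph α} {G' : Graph β} (e : Iso G G') {S : Set α} {S' : Set β}
    (hS : ∀ x, e.toEquiv x ∈ S' ↔ x ∈ S) : Iso (G.quo S) (G'.quo S') :=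
  Iso.restrict (G := ⟨(G.keep S).conn, G.edge⟩) (G' := ⟨(G'.keep S').conn, G'.edge⟩)
    ⟨e.toEquiv, (e.keep hS).conn_iff, e.edge_iff⟩ (fun x => not_congr (hS x))

theorem Iso.isSub {G : Graph α} {G' : Graph β} (e : Iso G G') {S : Set α} {S' : Set β}
    (hS : ∀ x, e.toEquiv x ∈ S' ↔ x ∈ S) (h : G.IsSub S) : G'.IsSub S' where
  subset_inner x hx := by
    obtain ⟨x, rfl⟩ := e.toEquiv.surjective x
    exact fun hl => h.subset_inner ((hS x).1 hx) ((e.mem_legs x).1 hl)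
  closed x hx y hxy := by
    obtain ⟨x, rfl⟩ := e.toEquiv.surjective x
    obtain ⟨y, rfl⟩ := e.toEquiv.surjective y
    exact (hS y).2 (h.closed x ((hS x).1 hx) y ((e.edge_iff x y).1 hxy))
  bridgeless := (e.keep hS).bridgeless h.bridgeless

/-- Without vertices of valence two, nothing is removed. -/
def smoothIso (G : Graph α) (h : G.biv = ∅) : Iso G.smooth G := by
  have h1 : (⟨G.vert, G.edge ⊔ onSet G.vert G.biv⟩ : Graph α) = G := by
    refine Graph.ext rfl (sup_eq_left.2 ?_)
    rintro x y (rfl | ⟨hx, _⟩)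
    · exact Setoid.refl' _ _
    · rw [h] at hx
      exact hx.elim
  have h2 : G.smooth = (⟨G.vert, G.edge ⊔ onSet G.vert G.biv⟩ : Graph α).restrict
      {x | x ∉ G.biv} := rfl
  rw [h2]
  refine Iso.trans (Iso.restrictAll _ fun x => by simp [h]) ?_
  rw [h1]
  exact Iso.refl G

theorem quo_biv (G : Graph α) (S : Set α) :
    (G.quo S).biv = Subtype.val ⁻¹' {x | G.residue S x = 2} := by
  ext x
  change {y | (G.keep S).conn x (y : {x | x ∉ S})}.ncard = 2 ↔
    {y | (G.keep S).conn x y ∧ y ∉ S}.ncard = 2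
  have : {y | (G.keep S).conn x y ∧ y ∉ S} =
      Subtype.val '' {y : {x | x ∉ S} | (G.keep S).conn x y} := by
    ext y
    constructor
    · exact fun h => ⟨⟨y, h.2⟩, h.1, rfl⟩
    · rintro ⟨y, hy, rfl⟩
      exact ⟨hy, y.2⟩
  rw [this, Set.ncard_image_of_injective _ Subtype.val_injective]

/-- The contraction in the coproduct is the plain contraction without vertices of valence two. -/
def contractIso (G : Graph α) (S : Set α) : Iso (G.quo S).smooth (G.contract S) := by
  have h1 : (⟨(G.quo S).vert, (G.quo S).edge ⊔ onSet (G.quo S).vert (G.quo S).biv⟩ :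
      Graph {x | x ∉ S}) = (⟨(G.keep S).conn, onSet G.edge Sᶜ ⊔
        onSet (G.keep S).conn (G.twoPoint S)⟩ : Graph α).restrict {x | x ∉ S} := by
    refine Graph.ext rfl ?_
    change _ = Setoid.comap Subtype.val (onSet G.edge Sᶜ ⊔ _)
    rw [comap_sup (t := onSet (G.keep S).conn (G.twoPoint S)), comap_onSet _ Subtype.val_injective,
      comap_onSet _ Subtype.val_injective, quo_biv]
    · refine congrArg₂ (· ⊔ ·) ?_ ?_
      · ext x y
        exact ⟨fun h => Or.inr ⟨x.2, y.2, h⟩, fun h => onSet_le _ _ h⟩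
      · refine congrArg₂ onSet rfl ?_
        ext x
        exact ⟨fun h => ⟨x.2, h⟩, fun h => h.2⟩
    · rintro x y (rfl | ⟨hx, hy, _⟩)
      · exact Or.inl rfl
      · exact Or.inr ⟨⟨⟨x, hx.1⟩, rfl⟩, ⟨⟨y, hy.1⟩, rfl⟩⟩
  have h3 : (G.quo S).smooth = ((⟨(G.keep S).conn, onSet G.edge Sᶜ ⊔
        onSet (G.keep S).conn (G.twoPoint S)⟩ : Graph α).restrict {x | x ∉ S}).restrict
        {x | x ∉ (G.quo S).biv} := by
    rw [← h1]
    rfl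
  rw [h3]
  refine Iso.restrictRestrict (⟨(G.keep S).conn, onSet G.edge Sᶜ ⊔
        onSet (G.keep S).conn (G.twoPoint S)⟩ : Graph α) _ _ ?_
  rw [quo_biv]
  ext x
  constructor
  · exact fun hx => ⟨⟨x, hx.1⟩, fun h => hx.2 ⟨hx.1, h⟩, rfl⟩
  · rintro ⟨y, hy, rfl⟩
    exact ⟨y.2, fun h => hy h.2⟩

/-! ### Removing vertices and passing to subgraphs -/

/-- The set `S` contains with a half-line all others at the same vertex in `B`. -/
def Saturated (G : Graph α) (B S : Set α) : Prop := ∀ x ∈ B, ∀ y, G.vert x y → x ∈ S → y ∈ S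

/-- By saturation, lines which are joined at a removed vertex are both kept or both cut, so it does
not matter whether they are joined before or after cutting. -/
theorem remove_keep (G : Graph α) {B S : Set α}
    (hS : ∀ x ∈ S, ∀ y, G.edge x y → y ∈ S) (hBS : G.Saturated B S) :
    (G.remove B).keep (Subtype.val ⁻¹' S) = (G.keep S).remove B := by
  refine Graph.ext rfl ?_
  ext z z'
  change (z = z' ∨ (z : α) ∈ S ∧ (z' : α) ∈ S ∧ (G.edge ⊔ onSet G.vert B) z z') ↔
    (onSet G.edge S ⊔ onSet G.vert B) z z'
  constructor
  · rintro (rfl | ⟨hz, -, h⟩)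
    · exact Setoid.refl' _ _
    · refine (sup_closed (C := {w : α | w ∈ S ∧ (onSet G.edge S ⊔ onSet G.vert B) z w}) ?_ ?_ h
        ⟨hz, Setoid.refl' _ _⟩).2
      · rintro a b hab ⟨haS, ha⟩
        have hbS := hS a haS b hab
        exact ⟨hbS, Setoid.trans' _ ha (sup_left (Or.inr ⟨haS, hbS, hab⟩))⟩
      · rintro a b hab ⟨haS, ha⟩
        refine ⟨?_, Setoid.trans' _ ha (sup_right hab)⟩
        rcases hab with rfl | ⟨haB, _, hab⟩
        · exact haS
        · exact hBS a haB b hab haS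
  · intro h
    have := sup_closed (C := {w : α | w = z ∨ (w ∈ S ∧ (z : α) ∈ S ∧
      (G.edge ⊔ onSet G.vert B) z w)}) ?_ ?_ h (Or.inl rfl)
    · rcases this with h1 | ⟨h1, h2, h3⟩
      · exact Or.inl (Subtype.ext h1.symm)
      · exact Or.inr ⟨h2, h1, h3⟩
    · rintro a b hab ha
      rcases hab with rfl | ⟨haS, hbS, hab⟩
      · exact ha
      · rcases ha with rfl | ⟨_, hz, ha⟩
        · exact Or.inr ⟨hbS, haS, sup_left hab⟩
        · exact Or.inr ⟨hbS, hz, Setoid.trans' _ ha (sup_left hab)⟩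
    · rintro a b hab ha
      rcases hab with rfl | ⟨haB, hbB, hab⟩
      · exact ha
      · rcases ha with rfl | ⟨haS, hz, ha⟩
        · exact absurd haB z.2
        · exact Or.inr ⟨hBS a haB b hab haS, hz, Setoid.trans' _ ha
            (sup_right (Or.inr ⟨haB, hbB, hab⟩))⟩

/-- A saturated vertex outside a subgraph is a component of its own. -/
theorem keep_conn_of_saturated {G : Graph α} {B S : Set α} (hBS : G.Saturated B S) {x : α}
    (hB : G.VertClosed B)
    (hx : x ∈ B) (hxS : x ∉ S) (y : α) : (G.keep S).conn x y ↔ G.vert x y := by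
  refine ⟨fun h => ?_, fun h => conn_vert (G := G.keep S) h⟩
  refine sup_closed (C := {y | G.vert x y}) ?_ ?_ h (G.vert.refl x)
  · exact fun a b hab ha => G.vert.trans ha hab
  · rintro a b (rfl | ⟨ha, _⟩) hxa
    · exact hxa
    · have hxa' : G.vert x a := hxa
      exact absurd (hBS a (hB x hx a hxa') x (G.vert.symm hxa') ha) hxS

end Graph

/-! ### Contraction commutes with the removal of bivalent vertices -/

namespace Graph

variable {α β : Type}

theorem onSet_saturated_compl {G : Graph α} {B S : Set α}
    (hBS : G.Saturated B S) :
    onSet G.vert B = onSet G.vert (B ∩ S) ⊔ onSet G.vert (B \ S) := by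
  refine le_antisymm ?_ (sup_le (onSet_mono _ Set.inter_subset_left)
    (onSet_mono _ Set.sdiff_subset))
  rintro x y (rfl | ⟨hx, hy, h⟩)
  · exact Setoid.refl' _ _
  · by_cases hxS : x ∈ S
    · exact sup_left (Or.inr ⟨⟨hx, hxS⟩, ⟨hy, hBS x hx y h hxS⟩, h⟩)
    · exact sup_right (Or.inr ⟨⟨hx, hxS⟩,
        ⟨hy, fun hyS => hxS (hBS y hy x (G.vert.symm h) hyS)⟩, h⟩)

/-- Contracting a subgraph after and before some vertices of valence two are removed. -/
def removeQuoIso (G : Graph α) {B S : Set α} (hB : G.VertClosed B)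
    (hS : ∀ x ∈ S, ∀ y, G.edge x y → y ∈ S) (hBS : G.Saturated B S) :
    Iso ((G.remove B).quo (Subtype.val ⁻¹' S)) ((G.quo S).remove (Subtype.val ⁻¹' B)) := by
  -- Both sides are restrictions of this graph on all half-lines, with the vertices contracted and
  -- the lines joined.
  set M : Graph α := ⟨(G.keep S).conn, G.edge ⊔ onSet G.vert B⟩ with hM
  have h1 : (⟨((G.remove B).keep (Subtype.val ⁻¹' S)).conn, (G.remove B).edge⟩ :
      Graph {x | x ∉ B}) = M.restrict {x | x ∉ B} := by
    rw [remove_keep G hS hBS, remove_conn]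
    · rfl
    · exact hB
  have h2 : (⟨(G.quo S).vert, (G.quo S).edge ⊔ onSet (G.quo S).vert (Subtype.val ⁻¹' B)⟩ :
      Graph {x | x ∉ S}) = M.restrict {x | x ∉ S} := by
    refine Graph.ext rfl ?_
    -- The joined lines split into a part inside `S`, which is trivial on the complement of `S`, and
    -- a part outside.
    have h3 : G.edge ⊔ onSet G.vert B = (onSet G.edge S ⊔ onSet G.vert (B ∩ S)) ⊔
        (onSet G.edge Sᶜ ⊔ onSet G.vert (B \ S)) := by
      rw [onSet_saturated_compl hBS, sup_sup_sup_comm, onSet_sup_compl _ _ hS]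
    have h4 : ∀ x y : {x | x ∉ S}, (onSet G.edge S ⊔ onSet G.vert (B ∩ S)) x y → x = y := by
      intro x y h
      have := sup_closed (C := {w : α | w = x}) ?_ ?_ h rfl
      · exact Subtype.ext this.symm
      · rintro a b (rfl | ⟨ha, _⟩) rfl
        · rfl
        · exact absurd ha x.2
      · rintro a b (rfl | ⟨ha, _⟩) rfl
        · rfl
        · exact absurd ha.2 x.2
    change _ = Setoid.comap Subtype.val (G.edge ⊔ onSet G.vert B)
    rw [h3, comap_sup]
    · have h5 : Setoid.comap (Subtype.val : {x | x ∉ S} → α)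
          (onSet G.edge S ⊔ onSet G.vert (B ∩ S)) = ⊥ := by
        ext x y
        exact ⟨fun h => h4 x y h, fun h => by rw [show x = y from h]⟩
      rw [h5, bot_sup_eq, comap_sup]
      · refine congrArg₂ (· ⊔ ·) ?_ ?_
        · ext x y
          exact ⟨fun h => Or.inr ⟨x.2, y.2, h⟩, fun h => onSet_le G.edge Sᶜ h⟩
        · ext x y
          change (x = y ∨ (x : α) ∈ B ∧ (y : α) ∈ B ∧ (G.keep S).conn x y) ↔
            ((x : α) = y ∨ (x : α) ∈ B \ S ∧ (y : α) ∈ B \ S ∧ G.vert x y)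
          constructor
          · rintro (rfl | ⟨hx, hy, h⟩)
            · exact Or.inl rfl
            · exact Or.inr ⟨⟨hx, x.2⟩, ⟨hy, y.2⟩, (keep_conn_of_saturated hBS hB hx x.2 y).1 h⟩
          · rintro (h | ⟨hx, hy, h⟩)
            · exact Or.inl (Subtype.ext h)
            · exact Or.inr ⟨hx.1, hy.1, (keep_conn_of_saturated hBS hB hx.1 x.2 y).2 h⟩
      · rintro x y (rfl | ⟨hx, hy, _⟩)
        · exact Or.inl rfl
        · exact Or.inr ⟨⟨⟨x, hx.2⟩, rfl⟩, ⟨⟨y, hy.2⟩, rfl⟩⟩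
    · intro x y h
      by_cases hx : x ∈ S
      · have := sup_closed (C := {w : α | w = x}) ?_ ?_ h rfl
        · exact Or.inl this.symm
        · rintro a b (rfl | ⟨ha, _⟩) rfl
          · rfl
          · exact absurd hx ha
        · rintro a b (rfl | ⟨ha, _⟩) rfl
          · rfl
          · exact absurd hx ha.2
      · have := sup_closed (C := {w : α | w ∉ S}) ?_ ?_ h hx
        · exact Or.inr ⟨⟨⟨x, hx⟩, rfl⟩, ⟨⟨y, this⟩, rfl⟩⟩
        · rintro a b (rfl | ⟨_, hb, _⟩) ha
          · exact ha
          · exact hb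
        · rintro a b (rfl | ⟨_, hb, _⟩) ha
          · exact ha
          · exact hb.2
  have h6 : (G.remove B).quo (Subtype.val ⁻¹' S) =
      (M.restrict {x | x ∉ B}).restrict {x | x ∉ Subtype.val ⁻¹' S} := by
    rw [← h1]
    rfl
  have h7 : (G.quo S).remove (Subtype.val ⁻¹' B) =
      (M.restrict {x | x ∉ S}).restrict {x | x ∉ Subtype.val ⁻¹' B} := by
    rw [← h2]
    rfl
  rw [h6, h7]
  refine (Iso.restrictRestrict M _ _ (r := {x | x ∉ B ∧ x ∉ S}) ?_).trans
    (Iso.restrictRestrict M _ _ (r := {x | x ∉ B ∧ x ∉ S}) ?_).symm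
  · ext x
    exact ⟨fun hx => ⟨⟨x, hx.1⟩, hx.2, rfl⟩, by rintro ⟨y, hy, rfl⟩; exact ⟨y.2, hy⟩⟩
  · ext x
    exact ⟨fun hx => ⟨⟨x, hx.2⟩, hx.1, rfl⟩, by rintro ⟨y, hy, rfl⟩; exact ⟨hy, y.2⟩⟩

theorem quo_vertClosed {G : Graph α} {B S : Set α} (hB : G.VertClosed B)
    (hBS : G.Saturated B S) : (G.quo S).VertClosed (Subtype.val ⁻¹' B) :=
  fun x hx y h => hB x hx y ((keep_conn_of_saturated hBS hB hx x.2 y).1 h)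

theorem quo_biv_of_saturated {G : Graph α} {B S : Set α} (hB : G.VertClosed B)
    (hBS : G.Saturated B S) (hbiv : B ⊆ G.biv) : Subtype.val ⁻¹' B ⊆ (G.quo S).biv := by
  rw [quo_biv]
  intro x hx
  refine Eq.trans (congrArg Set.ncard ?_) (hbiv hx)
  ext y
  have h1 := keep_conn_of_saturated hBS hB hx x.2 y
  refine ⟨fun h => h1.1 h.1, fun h => ⟨h1.2 h, fun hy => ?_⟩⟩
  exact x.2 (hBS y (hB x hx y h) x (G.vert.symm h) hy)

end Graph

/-! ### Values of graphs with vertices of valence two -/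

section Values

variable {A : Type} [CommRing A] {α β : Type} [Finite α] [Finite β]

/-- The value of a multiplicative function on a graph which may have vertices of valence two, each
of which is read as part of a line. -/
def value (f : GraphClass → A) (G : Graph α) : A := prodVal f G.smooth

theorem value_iso (f : GraphClass → A) {G : Graph α} {G' : Graph β} (e : Graph.Iso G G') :
    value f G = value f G' := prodVal_iso f e.smooth

theorem value_of_biv_eq_empty (f : GraphClass → A) {G : Graph α} (h : G.biv = ∅) :
    value f G = prodVal f G := prodVal_iso f (G.smoothIso h)

theorem value_remove (f : GraphClass → A) {G : Graph α} {B : Set α} (hB : G.VertClosed B)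
    (hbiv : B ⊆ G.biv) : value f (G.remove B) = value f G :=
  prodVal_iso f (G.smoothRemoveIso hB hbiv)

omit [Finite α] in
theorem smooth_connected {G : Graph α} (h : ∀ x y, G.conn x y) (x y) : G.smooth.conn x y := by
  rw [Graph.smooth, G.remove_conn G.biv_closed]
  exact h _ _

theorem value_of_connected (f : GraphClass → A) {G : Graph α} (h : ∀ x y, G.conn x y) :
    value f G = evalGraph f G.smooth := prodVal_of_connected f (smooth_connected h)

theorem evalGraph_contract (f : GraphClass → A) {G : Graph α} (h : ∀ x y, G.conn x y)
    {S : Set α} (hS : ∀ x ∈ S, ∀ y, G.edge x y → y ∈ S) :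
    evalGraph f (G.contract S) = value f (G.quo S) := by
  rw [value_of_connected, evalGraph_iso f (G.contractIso S)]
  intro x y
  rw [G.quo_conn hS]
  exact h _ _

theorem value_eq_one (f : GraphClass → A) {G : Graph α} (h : ∀ x, x ∈ G.legs) :
    value f G = 1 := by
  refine prodVal_eq_one f fun x y hxy => ?_
  have := sup_closed (C := {w : α | w = x}) ?_ ?_ hxy rfl
  · exact Subtype.ext this
  · rintro a b hab rfl
    exact h _ _ hab
  · rintro a b (rfl | ⟨ha, _⟩) rfl
    · rfl
    · exact absurd ha x.2

/-- The sum over all disjoint unions of bridgeless subgraphs which defines the convolution product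
of two multiplicative functions. -/
def convSum (a b : GraphClass → A) (G : Graph α) : A :=
  ∑ᶠ S : {S : Set α // G.IsSub S}, value a (G.keep S) * value b (G.quo S)

theorem convSum_iso (a b : GraphClass → A) {G : Graph α} {G' : Graph β} (e : Graph.Iso G G') :
    convSum a b G = convSum a b G' := by
  let F : {S : Set α // G.IsSub S} ≃ {S : Set β // G'.IsSub S} :=
    (Equiv.Set.congr e.toEquiv).subtypeEquiv fun S =>
      ⟨fun h => e.isSub (by simp) h, fun h => e.symm.isSub (by simp [Graph.Iso.symm]) h⟩
  refine finsum_eq_of_bijective F F.bijective fun S => ?_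
  have hS : ∀ x, e.toEquiv x ∈ (F S : Set β) ↔ x ∈ (S : Set α) := by
    intro x
    simp [F, Equiv.subtypeEquiv_apply]
  rw [value_iso a (e.keep hS), value_iso b (e.quo hS)]

theorem value_keep_remove (a : GraphClass → A) {G : Graph α} {B S : Set α}
    (hB : G.VertClosed B) (hbiv : B ⊆ G.biv)
    (hS : ∀ x ∈ S, ∀ y, G.edge x y → y ∈ S) (hBS : G.Saturated B S) :
    value a ((G.remove B).keep (Subtype.val ⁻¹' S)) = value a (G.keep S) := by
  rw [G.remove_keep hS hBS]
  exact value_remove (G := G.keep S) a hB hbiv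

theorem value_quo_remove (b : GraphClass → A) {G : Graph α} {B S : Set α}
    (hB : G.VertClosed B) (hbiv : B ⊆ G.biv)
    (hS : ∀ x ∈ S, ∀ y, G.edge x y → y ∈ S) (hBS : G.Saturated B S) :
    value b ((G.remove B).quo (Subtype.val ⁻¹' S)) = value b (G.quo S) := by
  rw [value_iso b (G.removeQuoIso hB hS hBS)]
  exact value_remove b (Graph.quo_vertClosed hB hBS) (Graph.quo_biv_of_saturated hB hBS hbiv)

/-- The two factors of each summand agree by `value_keep_remove` and `value_quo_remove`. It remains
to match the index sets, which is what the last three hypotheses say. -/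
theorem convSum_remove_of_bijective (a b : GraphClass → A) {G : Graph α} {B : Set α}
    (hB : G.VertClosed B) (hbiv : B ⊆ G.biv)
    (hBS : ∀ S, G.IsSub S → G.Saturated B S)
    (h1 : ∀ S, G.IsSub S → (G.remove B).IsSub (Subtype.val ⁻¹' S))
    (h2 : ∀ S S', G.IsSub S → G.IsSub S' →
      (Subtype.val ⁻¹' S : Set {x | x ∉ B}) = Subtype.val ⁻¹' S' → S = S')
    (h3 : ∀ T, (G.remove B).IsSub T → ∃ S, G.IsSub S ∧ Subtype.val ⁻¹' S = T) :
    convSum a b (G.remove B) = convSum a b G := by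
  symm
  refine finsum_eq_of_bijective
    (fun S : {S : Set α // G.IsSub S} => (⟨Subtype.val ⁻¹' S.1, h1 S.1 S.2⟩ :
      {T // (G.remove B).IsSub T})) ⟨?_, ?_⟩ fun S => ?_
  · intro S S' h
    exact Subtype.ext (h2 _ _ S.2 S'.2 (congrArg Subtype.val h))
  · rintro ⟨T, hT⟩
    obtain ⟨S, hS, rfl⟩ := h3 T hT
    exact ⟨⟨S, hS⟩, rfl⟩
  · rw [value_keep_remove a hB hbiv S.2.closed (hBS _ S.2),
      value_quo_remove b hB hbiv S.2.closed (hBS _ S.2)]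

end Values

namespace Graph

variable {α β : Type}

/-! ### Removing vertices which carry only external lines -/

theorem remove_edge_iff_of_legs {G : Graph α} {B : Set α} (hl : B ⊆ G.legs) (z z' : {x | x ∉ B}) :
    (G.remove B).edge z z' ↔ G.edge z z' := by
  refine ⟨fun h => ?_, fun h => sup_left h⟩
  refine sup_closed (C := {w : α | G.edge z w}) ?_ ?_ h (G.edge.refl (z : α))
  · exact fun a b hab ha => G.edge.trans ha hab
  · rintro a b (rfl | ⟨haB, _⟩) ha
    · exact ha
    · exact absurd ((hl haB _ (G.edge.symm ha)) ▸ haB) z.2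

theorem EdgeUnique.of_edge_iff {G : Graph α} {p : Set α} {K : Graph p} (hG : G.EdgeUnique)
    (h : ∀ z z', K.edge z z' ↔ G.edge z z') : K.EdgeUnique :=
  fun x y z hy hz hyx hzx => Subtype.ext (hG x y z ((h _ _).1 hy) ((h _ _).1 hz)
    (fun hh => hyx (Subtype.ext hh)) fun hh => hzx (Subtype.ext hh))

/-- Vertices that carry only external half-lines meet no line with two ends, so they play no role
for cut sets. -/
theorem bridgeless_remove_of_legs {G : Graph α} {B : Set α} (hB : G.VertClosed B)
    (hl : B ⊆ G.legs) : (G.remove B).Bridgeless ↔ G.Bridgeless := by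
  have hne : ∀ u v, G.edge u v → u ≠ v → u ∉ B ∧ v ∉ B := fun u v huv hne =>
    ⟨fun h => hne (hl h v huv).symm, fun h => hne (hl h u (G.edge.symm huv))⟩
  constructor
  · intro h C hC u hu v hv huv
    obtain ⟨huB, hvB⟩ := hne u v huv (fun hh => hv (hh ▸ hu))
    obtain ⟨u', hu', v', hv', he, hne'⟩ := h (Subtype.val ⁻¹' C) (fun a ha b hab => hC a ha b hab)
      ⟨u, huB⟩ hu ⟨v, hvB⟩ hv ((remove_edge_iff_of_legs hl _ _).2 huv)
    exact ⟨u', hu', v', hv', (remove_edge_iff_of_legs hl _ _).1 he,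
      fun hh => hne' (Subtype.ext hh)⟩
  · intro h C hC u hu v hv huv
    obtain ⟨_, ⟨u', hu', rfl⟩, v', hv', he, hne'⟩ := h (Subtype.val '' C)
      (by
        rintro _ ⟨a, ha, rfl⟩ b hab
        exact ⟨⟨b, hB.not_mem hab a.2⟩, hC a ha _ hab, rfl⟩)
      u ⟨u, hu, rfl⟩ v (by rintro ⟨w, hw, hwv⟩; exact hv (Subtype.ext hwv ▸ hw))
      ((remove_edge_iff_of_legs hl _ _).1 huv)
    have hv'B := (hne _ _ he (fun hh => hv' ⟨u', hu', hh⟩)).2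
    exact ⟨u', hu', ⟨v', hv'B⟩, fun hh => hv' ⟨_, hh, rfl⟩,
      (remove_edge_iff_of_legs hl _ _).2 he, fun hh => hne' (congrArg Subtype.val hh)⟩

theorem Nice.remove_of_legs {G : Graph α} (hG : G.Nice) {B : Set α} (hB : G.VertClosed B)
    (hl : B ⊆ G.legs) : (G.remove B).Nice where
  edge_unique := hG.edge_unique.of_edge_iff (remove_edge_iff_of_legs hl)
  bridgeless := (bridgeless_remove_of_legs hB hl).2 hG.bridgeless
  leg z := by
    obtain ⟨y, hy, hzy⟩ := hG.leg z
    have hyB : y ∉ B := by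
      refine sup_closed (C := Bᶜ) ?_ ?_ hzy z.2
      · exact fun a b hab ha => hB.not_mem hab ha
      · exact fun a b hab ha hb => ha ((hl hb a (G.edge.symm hab)).symm ▸ hb)
    refine ⟨⟨y, hyB⟩, fun w hw => Subtype.ext (hy w ((remove_edge_iff_of_legs hl _ _).1 hw)), ?_⟩
    rw [G.remove_conn hB]
    exact hzy

/-! ### Removing one vertex of valence two from a line -/

/-- The half-lines `x` and `x'` form a vertex, and the lines at this vertex are `{x, y}` and
`{x', y'}`. -/
structure BivStep (G : Graph α) (x x' y y' : α) : Prop where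
  edge_unique : G.EdgeUnique
  ne : x ≠ x'
  vert_iff : ∀ z, G.vert x z ↔ z = x ∨ z = x'
  edge : G.edge x y
  edge' : G.edge x' y'
  y_ne : y ≠ x ∧ y ≠ x'
  y'_ne : y' ≠ x ∧ y' ≠ x'

namespace BivStep

variable {G : Graph α} {x x' y y' : α}

theorem symm (h : G.BivStep x x' y y') : G.BivStep x' x y' y where
  edge_unique := h.edge_unique
  ne := h.ne.symm
  vert_iff z := by
    have hxx' : G.vert x x' := (h.vert_iff x').2 (Or.inr rfl)
    rw [or_comm, ← h.vert_iff]
    exact ⟨fun hz => G.vert.trans hxx' hz, fun hz => G.vert.trans (G.vert.symm hxx') hz⟩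
  edge := h.edge'
  edge' := h.edge
  y_ne := h.y'_ne.symm
  y'_ne := h.y_ne.symm

theorem vert (h : G.BivStep x x' y y') : G.vert x x' := (h.vert_iff x').2 (Or.inr rfl)

theorem edge_x (h : G.BivStep x x' y y') {z : α} (hz : G.edge x z) : z = x ∨ z = y :=
  h.edge_unique.eq_or h.edge h.y_ne.1 hz

theorem edge_y (h : G.BivStep x x' y y') {z : α} (hz : G.edge y z) : z = y ∨ z = x :=
  h.edge_unique.eq_or (G.edge.symm h.edge) h.y_ne.1.symm hz

theorem y_ne_y' (h : G.BivStep x x' y y') : y ≠ y' := by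
  rintro rfl
  exact h.ne (h.edge_unique y x x' (G.edge.symm h.edge) (G.edge.symm h.edge') h.y_ne.1.symm
    h.y_ne.2.symm)

theorem vertClosed (h : G.BivStep x x' y y') : G.VertClosed {x, x'} := by
  rintro z (rfl | rfl) w hw
  · exact (h.vert_iff w).1 hw
  · exact ((h.symm.vert_iff w).1 hw).symm

theorem subset_biv (h : G.BivStep x x' y y') : {x, x'} ⊆ G.biv := by
  have hx : ∀ {x x' y y'}, G.BivStep x x' y y' → x ∈ G.biv := fun {x x' y y'} h => by
    have : {z | G.vert x z} = {x, x'} := Set.ext h.vert_iff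
    change {z | G.vert x z}.ncard = 2
    rw [this, Set.ncard_pair h.ne]
  rintro z (rfl | rfl)
  · exact hx h
  · exact hx h.symm

theorem y_notMem (h : G.BivStep x x' y y') : y ∉ ({x, x'} : Set α) := by
  rintro (hh | hh)
  · exact h.y_ne.1 hh
  · exact h.y_ne.2 hh

theorem y'_notMem (h : G.BivStep x x' y y') : y' ∉ ({x, x'} : Set α) := by
  rintro (hh | hh)
  · exact h.y'_ne.1 hh
  · exact h.y'_ne.2 hh

theorem remove_edge_iff (h : G.BivStep x x' y y') (z z' : {z | z ∉ ({x, x'} : Set α)}) :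
    (G.remove {x, x'}).edge z z' ↔
      G.edge z z' ∨ ((z : α) = y ∧ (z' : α) = y') ∨ ((z : α) = y' ∧ (z' : α) = y) := by
  have key : ∀ {x x' y y'}, G.BivStep x x' y y' →
      (G.edge ⊔ onSet G.vert {x, x'}) y y' := fun {x x' y y'} h =>
    Setoid.trans' _ (sup_left (G.edge.symm h.edge)) (Setoid.trans' _
      (sup_right (Or.inr ⟨Or.inl rfl, Or.inr rfl, h.vert⟩)) (sup_left h.edge'))
  -- The joined line is the chain `y - x - x' - y'`; of its half-lines only `y` and `y'` survive.
  have key2 : ∀ {x x' y y'}, G.BivStep x x' y y' → ∀ w, (G.edge ⊔ onSet G.vert {x, x'}) y w →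
      w = y ∨ w = x ∨ w = x' ∨ w = y' := fun {x x' y y'} h w hw => by
    refine sup_closed (C := {w | w = y ∨ w = x ∨ w = x' ∨ w = y'}) ?_ ?_ hw (Or.inl rfl)
    · rintro a b hab (rfl | rfl | rfl | rfl)
      · exact (h.edge_y hab).imp_right Or.inl
      · rcases h.edge_x hab with hh | hh
        · exact Or.inr (Or.inl hh)
        · exact Or.inl hh
      · exact Or.inr (Or.inr (h.symm.edge_x hab))
      · rcases h.symm.edge_y hab with hh | hh
        · exact Or.inr (Or.inr (Or.inr hh))
        · exact Or.inr (Or.inr (Or.inl hh))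
    · rintro a b (rfl | ⟨_, hb, _⟩) ha
      · exact ha
      · rcases hb with hb | hb
        · exact Or.inr (Or.inl hb)
        · exact Or.inr (Or.inr (Or.inl hb))
  have hset : ({x', x} : Set α) = {x, x'} := Set.pair_comm _ _
  constructor
  · intro hz
    by_cases hzy : (z : α) = y
    · rcases key2 h z' (hzy ▸ hz) with hh | hh | hh | hh
      · exact Or.inl (by rw [hzy, hh])
      · exact absurd (Or.inl hh) z'.2
      · exact absurd (Or.inr hh) z'.2
      · exact Or.inr (Or.inl ⟨hzy, hh⟩)
    · by_cases hzy' : (z : α) = y'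
      · have hz' : (G.edge ⊔ onSet G.vert {x', x}) y' z' := by
          rw [hset]
          exact hzy' ▸ hz
        rcases key2 h.symm z' hz' with hh | hh | hh | hh
        · exact Or.inl (by rw [hzy', hh])
        · exact absurd (Or.inr hh) z'.2
        · exact absurd (Or.inl hh) z'.2
        · exact Or.inr (Or.inr ⟨hzy', hh⟩)
      · left
        refine sup_closed (C := {w : α | G.edge z w}) ?_ ?_ hz (G.edge.refl (z : α))
        · exact fun a b hab ha => G.edge.trans ha hab
        · rintro a b (rfl | ⟨haB, _⟩) ha
          · exact ha
          · exfalso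
            rcases haB with rfl | rfl
            · rcases h.edge_x (G.edge.symm ha) with hh | hh
              · exact z.2 (Or.inl hh)
              · exact hzy hh
            · rcases h.symm.edge_x (G.edge.symm ha) with hh | hh
              · exact z.2 (Or.inr hh)
              · exact hzy' hh
  · rintro (hz | ⟨hz, hz'⟩ | ⟨hz, hz'⟩)
    · exact sup_left hz
    · change (G.edge ⊔ onSet G.vert {x, x'}) z z'
      rw [hz, hz']
      exact key h
    · change (G.edge ⊔ onSet G.vert {x, x'}) z z'
      rw [hz, hz']
      exact Setoid.symm' _ (key h)

theorem remove_edgeUnique (h : G.BivStep x x' y y') : (G.remove {x, x'}).EdgeUnique := by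
  intro a b c hb hc hba hca
  rw [h.remove_edge_iff] at hb hc
  have hba' : (b : α) ≠ a := fun hh => hba (Subtype.ext hh)
  have hca' : (c : α) ≠ a := fun hh => hca (Subtype.ext hh)
  have hy : ∀ w : {z | z ∉ ({x, x'} : Set α)}, (w : α) ≠ y → ¬ G.edge y w := fun w hw hh => by
    rcases h.edge_y hh with h1 | h1
    · exact hw h1
    · exact w.2 (Or.inl h1)
  have hy' : ∀ w : {z | z ∉ ({x, x'} : Set α)}, (w : α) ≠ y' → ¬ G.edge y' w := fun w hw hh => by
    rcases h.symm.edge_y hh with h1 | h1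
    · exact hw h1
    · exact w.2 (Or.inr h1)
  rcases hb with hb | ⟨ha, hb⟩ | ⟨ha, hb⟩ <;> rcases hc with hc | ⟨ha', hc⟩ | ⟨ha', hc⟩
  · exact Subtype.ext (h.edge_unique a b c hb hc hba' hca')
  · rw [ha'] at hb hba'
    exact absurd hb (hy b hba')
  · rw [ha'] at hb hba'
    exact absurd hb (hy' b hba')
  · rw [ha] at hc hca'
    exact absurd hc (hy c hca')
  · exact Subtype.ext (hb.trans hc.symm)
  · exact absurd (ha.symm.trans ha') h.y_ne_y'
  · rw [ha] at hc hca'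
    exact absurd hc (hy' c hca')
  · exact absurd (ha'.symm.trans ha) h.y_ne_y'
  · exact Subtype.ext (hb.trans hc.symm)

theorem bridgeless_remove (h : G.BivStep x x' y y') (hG : G.Bridgeless) :
    (G.remove {x, x'}).Bridgeless := by
  classical
  intro C hC u hu v hv huv
  rw [h.remove_edge_iff] at huv
  set P : Prop := (⟨y, h.y_notMem⟩ : {z | z ∉ ({x, x'} : Set α)}) ∈ C ∧
    (⟨y', h.y'_notMem⟩ : {z | z ∉ ({x, x'} : Set α)}) ∈ C with hP
  -- The vertex `{x, x'}` is put on the side of `C` only if `y` and `y'` both lie in `C`. Then the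
  -- joined line crosses `C` exactly when one of the two lines at the vertex crosses `D`, and never
  -- do both leave `D` starting from the vertex.
  let D : Set α := {z |
    (∃ hz : z ∉ ({x, x'} : Set α), (⟨z, hz⟩ : {z | z ∉ ({x, x'} : Set α)}) ∈ C) ∨
    (z ∈ ({x, x'} : Set α) ∧ P)}
  have hD : ∀ z : {z | z ∉ ({x, x'} : Set α)}, (z : α) ∈ D ↔ z ∈ C := fun z =>
    ⟨fun hz => by
      rcases hz with ⟨_, hz⟩ | ⟨hz, _⟩
      · exact hz
      · exact absurd hz z.2, fun hz => Or.inl ⟨z.2, hz⟩⟩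
  have hDx : x ∈ D ↔ P := ⟨fun hz => by
      rcases hz with ⟨hz, _⟩ | ⟨_, hz⟩
      · exact absurd (Or.inl rfl) hz
      · exact hz, fun hz => Or.inr ⟨Or.inl rfl, hz⟩⟩
  have hDx' : x' ∈ D ↔ P := ⟨fun hz => by
      rcases hz with ⟨hz, _⟩ | ⟨_, hz⟩
      · exact absurd (Or.inr rfl) hz
      · exact hz, fun hz => Or.inr ⟨Or.inr rfl, hz⟩⟩
  have hDc : ∀ a ∈ D, ∀ b, G.vert a b → b ∈ D := by
    rintro a (⟨ha, haC⟩ | ⟨ha, hp⟩) b hab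
    · exact Or.inl ⟨h.vertClosed.not_mem hab ha, hC _ haC _ hab⟩
    · exact Or.inr ⟨h.vertClosed a ha b hab, hp⟩
  obtain ⟨w, hw, huw⟩ : ∃ w ∉ D, G.edge u w := by
    rcases huv with huv | ⟨h1, h2⟩ | ⟨h1, h2⟩
    · exact ⟨v, fun hh => hv ((hD v).1 hh), huv⟩
    · refine ⟨x, fun hh => hv ?_, h1 ▸ G.edge.symm h.edge⟩
      have := (hDx.1 hh).2
      rwa [show v = ⟨y', h.y'_notMem⟩ from Subtype.ext h2]
    · refine ⟨x', fun hh => hv ?_, h1 ▸ G.edge.symm h.edge'⟩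
      have := (hDx'.1 hh).1
      rwa [show v = ⟨y, h.y_notMem⟩ from Subtype.ext h2]
  obtain ⟨u', hu', v', hv', he, hne⟩ := hG D hDc u ((hD u).2 hu) w hw huw
  have hu'B : u' ∉ ({x, x'} : Set α) := by
    rintro (rfl | rfl)
    · rcases h.edge_x he with rfl | rfl
      · exact hv' hu'
      · exact hv' ((hD ⟨_, h.y_notMem⟩).2 (hDx.1 hu').1)
    · rcases h.symm.edge_x he with rfl | rfl
      · exact hv' hu'
      · exact hv' ((hD ⟨_, h.y'_notMem⟩).2 (hDx'.1 hu').2)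
  have hu'C := (hD ⟨u', hu'B⟩).1 hu'
  have hne' : (⟨u', hu'B⟩ : {z | z ∉ ({x, x'} : Set α)}) ≠ u :=
    fun hh => hne (congrArg Subtype.val hh)
  by_cases hv'B : v' ∈ ({x, x'} : Set α)
  · rcases hv'B with rfl | rfl
    · have hu'y : u' = y := (h.edge_x (G.edge.symm he)).resolve_left fun hh => hu'B (Or.inl hh)
      subst hu'y
      exact ⟨_, hu'C, ⟨y', h.y'_notMem⟩, fun hh => hv' (hDx.2 ⟨hu'C, hh⟩),
        (h.remove_edge_iff _ _).2 (Or.inr (Or.inl ⟨rfl, rfl⟩)), hne'⟩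
    · have hu'y : u' = y' := (h.symm.edge_x (G.edge.symm he)).resolve_left
        fun hh => hu'B (Or.inr hh)
      subst hu'y
      exact ⟨_, hu'C, ⟨y, h.y_notMem⟩, fun hh => hv' (hDx'.2 ⟨hh, hu'C⟩),
        (h.remove_edge_iff _ _).2 (Or.inr (Or.inr ⟨rfl, rfl⟩)), hne'⟩
  · exact ⟨_, hu'C, ⟨v', hv'B⟩, fun hh => hv' ((hD _).2 hh),
      (h.remove_edge_iff _ _).2 (Or.inl he), hne'⟩

theorem bridgeless_of_remove (h : G.BivStep x x' y y') (hR : (G.remove {x, x'}).Bridgeless) :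
    G.Bridgeless := by
  intro C hC u hu v hv huv
  by_contra hno
  have hno' : ∀ a b, a ∈ C → b ∉ C → G.edge a b → a = u := fun a b ha hb hab => by
    by_contra hne
    exact hno ⟨a, ha, b, hb, hab, hne⟩
  have hxx' : x ∈ C ↔ x' ∈ C := ⟨fun hx => hC x hx x' h.vert, fun hx => hC x' hx x h.symm.vert⟩
  have hRC := hR (Subtype.val ⁻¹' C) (fun a ha b hab => hC a ha b hab)
  -- If `C` separates `y` from `y'`, one of the two lines at the vertex leaves `C`. By assumption it
  -- is the only line that does.
  have hyC : y ∈ C → y' ∉ C → u ∈ ({x, x'} : Set α) ∨ u = y := fun h1 h2 => by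
    by_cases hx : x ∈ C
    · exact Or.inl (Or.inr (hno' x' y' (hxx'.1 hx) h2 h.edge').symm)
    · exact Or.inr (hno' y x h1 hx (G.edge.symm h.edge)).symm
  have hyC' : y' ∈ C → y ∉ C → u ∈ ({x, x'} : Set α) ∨ u = y' := fun h1 h2 => by
    by_cases hx : x ∈ C
    · exact Or.inl (Or.inl (hno' x y hx h2 h.edge).symm)
    · exact Or.inr (hno' y' x' h1 (fun hh => hx (hxx'.2 hh)) (G.edge.symm h.edge')).symm
  -- The bridge of `G` yields a line `{w, w'}` which leaves `C` after the removal. By bridgelessness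
  -- there is another such line, and it comes from a second line of `G` leaving `C`.
  have main : ∀ w : {z | z ∉ ({x, x'} : Set α)}, (w : α) ∈ C → ∀ w' : {z | z ∉ ({x, x'} : Set α)},
      (w' : α) ∉ C → (G.remove {x, x'}).edge w w' → (u ∉ ({x, x'} : Set α) → u = w) →
      (u ∈ ({x, x'} : Set α) → ((w : α) = y ∨ (w : α) = y')) → False := by
    intro w hw w' hw' hww' h1 h2
    obtain ⟨a, ha, b, hb, hab, hne⟩ := hRC w hw w' hw' hww'
    have hne' : (a : α) ≠ w := fun hh => hne (Subtype.ext hh)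
    rw [h.remove_edge_iff] at hab
    by_cases huB : u ∈ ({x, x'} : Set α)
    · rcases hab with hab | ⟨hay, hby⟩ | ⟨hay, hby⟩
      · exact a.2 (hno' a b ha hb hab ▸ huB)
      · rcases h2 huB with hwy | hwy
        · exact hne' (hay.trans hwy.symm)
        · exact hb (show (b : α) ∈ C by rw [hby, ← hwy]; exact hw)
      · rcases h2 huB with hwy | hwy
        · exact hb (show (b : α) ∈ C by rw [hby, ← hwy]; exact hw)
        · exact hne' (hay.trans hwy.symm)
    · have huw := h1 huB
      rcases hab with hab | ⟨hay, hby⟩ | ⟨hay, hby⟩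
      · exact hne' ((hno' a b ha hb hab).trans huw)
      · rcases hyC (hay ▸ ha) (hby ▸ hb) with hh | hh
        · exact huB hh
        · exact hne' (hay.trans (hh.symm.trans huw))
      · rcases hyC' (hay ▸ ha) (hby ▸ hb) with hh | hh
        · exact huB hh
        · exact hne' (hay.trans (hh.symm.trans huw))
  have hy_edge : (G.remove {x, x'}).edge ⟨y, h.y_notMem⟩ ⟨y', h.y'_notMem⟩ :=
    (h.remove_edge_iff _ _).2 (Or.inr (Or.inl ⟨rfl, rfl⟩))
  have huv' : u ≠ v := fun hh => hv (hh ▸ hu)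
  by_cases huB : u ∈ ({x, x'} : Set α)
  · rcases huB with rfl | rfl
    · have hvy : v = y := (h.edge_x huv).resolve_left huv'.symm
      subst hvy
      have hy' : y' ∈ C := by
        by_contra hh
        exact h.ne (hno' x' y' (hxx'.1 hu) hh h.edge').symm
      exact main ⟨y', h.y'_notMem⟩ hy' ⟨v, h.y_notMem⟩ hv (Setoid.symm' _ hy_edge)
        (fun hh => absurd (Or.inl rfl) hh) fun _ => Or.inr rfl
    · have hvy : v = y' := (h.symm.edge_x huv).resolve_left huv'.symm
      subst hvy
      have hy : y ∈ C := by
        by_contra hh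
        exact h.ne (hno' x y (hxx'.2 hu) hh h.edge)
      exact main ⟨y, h.y_notMem⟩ hy ⟨v, h.y'_notMem⟩ hv hy_edge
        (fun hh => absurd (Or.inr rfl) hh) fun _ => Or.inl rfl
  · by_cases hvB : v ∈ ({x, x'} : Set α)
    · rcases hvB with rfl | rfl
      · have huy : u = y := (h.edge_x (G.edge.symm huv)).resolve_left huv'
        subst huy
        have hy' : y' ∉ C := fun hh => h.y_ne_y'
          (hno' y' x' hh (fun hx => hv (hxx'.2 hx)) (G.edge.symm h.edge')).symm
        exact main ⟨u, h.y_notMem⟩ hu ⟨y', h.y'_notMem⟩ hy' hy_edge (fun _ => rfl)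
          fun _ => Or.inl rfl
      · have huy : u = y' := (h.symm.edge_x (G.edge.symm huv)).resolve_left huv'
        subst huy
        have hy : y ∉ C := fun hh => h.y_ne_y'
          (hno' y x hh (fun hx => hv (hxx'.1 hx)) (G.edge.symm h.edge))
        exact main ⟨u, h.y'_notMem⟩ hu ⟨y, h.y_notMem⟩ hy (Setoid.symm' _ hy_edge) (fun _ => rfl)
          fun _ => Or.inr rfl
    · exact main ⟨u, huB⟩ hu ⟨v, hvB⟩ hv ((h.remove_edge_iff _ _).2 (Or.inl huv)) (fun _ => rfl)
        fun hh => absurd hh huB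

theorem remove_legs (h : G.BivStep x x' y y') (z : {z | z ∉ ({x, x'} : Set α)}) :
    z ∈ (G.remove {x, x'}).legs ↔ (z : α) ∈ G.legs := by
  constructor
  · intro hz w hw
    by_cases hwB : w ∈ ({x, x'} : Set α)
    · exfalso
      rcases hwB with rfl | rfl
      · have hzy : (z : α) = y :=
          (h.edge_x (G.edge.symm hw)).resolve_left fun hh => z.2 (Or.inl hh)
        have := hz ⟨y', h.y'_notMem⟩ ((h.remove_edge_iff _ _).2 (Or.inr (Or.inl ⟨hzy, rfl⟩)))
        exact h.y_ne_y' (hzy.symm.trans (congrArg Subtype.val this).symm)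
      · have hzy : (z : α) = y' :=
          (h.symm.edge_x (G.edge.symm hw)).resolve_left fun hh => z.2 (Or.inr hh)
        have := hz ⟨y, h.y_notMem⟩ ((h.remove_edge_iff _ _).2 (Or.inr (Or.inr ⟨hzy, rfl⟩)))
        exact h.y_ne_y' ((congrArg Subtype.val this).trans hzy)
    · exact congrArg Subtype.val (hz ⟨w, hwB⟩ ((h.remove_edge_iff _ _).2 (Or.inl hw)))
  · intro hz w hw
    rcases (h.remove_edge_iff _ _).1 hw with hw | ⟨hzy, _⟩ | ⟨hzy, _⟩
    · exact Subtype.ext (hz w hw)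
    · exact absurd (Or.inl (hz x (hzy ▸ G.edge.symm h.edge)).symm) z.2
    · exact absurd (Or.inr (hz x' (hzy ▸ G.edge.symm h.edge')).symm) z.2

theorem nice_remove (h : G.BivStep x x' y y') (hG : G.Nice) : (G.remove {x, x'}).Nice where
  edge_unique := h.remove_edgeUnique
  bridgeless := h.bridgeless_remove hG.bridgeless
  leg z := by
    obtain ⟨l, hl, hzl⟩ := hG.leg z
    have hlB : l ∉ ({x, x'} : Set α) := by
      rintro (rfl | rfl)
      · exact h.y_ne.1 (hl y h.edge)
      · exact h.y'_ne.2 (hl y' h.edge')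
    refine ⟨⟨l, hlB⟩, (h.remove_legs _).2 hl, ?_⟩
    rw [G.remove_conn h.vertClosed]
    exact hzl

theorem nice_of_remove (h : G.BivStep x x' y y') (hR : (G.remove {x, x'}).Nice) : G.Nice where
  edge_unique := h.edge_unique
  bridgeless := h.bridgeless_of_remove hR.bridgeless
  leg z := by
    obtain ⟨w, hw, hzw⟩ : ∃ w ∉ ({x, x'} : Set α), G.conn z w := by
      by_cases hz : z ∈ ({x, x'} : Set α)
      · rcases hz with rfl | rfl
        · exact ⟨y, h.y_notMem, conn_edge h.edge⟩
        · exact ⟨y', h.y'_notMem, conn_edge h.edge'⟩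
      · exact ⟨z, hz, G.conn.refl z⟩
    obtain ⟨l, hl, hwl⟩ := hR.leg ⟨w, hw⟩
    rw [G.remove_conn h.vertClosed] at hwl
    exact ⟨l, (h.remove_legs l).1 hl, G.conn.trans hzw hwl⟩

/-- A bridgeless subgraph which contains one of the half-lines of the vertex contains both. -/
theorem mem_of_mem (h : G.BivStep x x' y y') {S : Set α} (hS : G.IsSub S) (hx : x ∈ S) :
    x' ∈ S := by
  obtain ⟨u, hu, v, hv, he, hne⟩ := hS.bridgeless {x, x'} h.vertClosed x (Or.inl rfl) y h.y_notMem
    (Or.inr ⟨hx, hS.closed x hx y h.edge, h.edge⟩)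
  obtain rfl : u = x' := hu.resolve_left hne
  rcases he with rfl | he
  · exact absurd hu hv
  · exact he.1

theorem saturated (h : G.BivStep x x' y y') {S : Set α} (hS : G.IsSub S) :
    G.Saturated {x, x'} S := by
  rintro z (rfl | rfl) w hw hz
  · rcases (h.vert_iff w).1 hw with rfl | rfl
    · exact hz
    · exact h.mem_of_mem hS hz
  · rcases (h.symm.vert_iff w).1 hw with rfl | rfl
    · exact hz
    · exact h.symm.mem_of_mem hS hz

theorem keep (h : G.BivStep x x' y y') {S : Set α} (hS : ∀ x ∈ S, ∀ y, G.edge x y → y ∈ S)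
    (hx : x ∈ S) (hx' : x' ∈ S) : (G.keep S).BivStep x x' y y' where
  edge_unique := h.edge_unique.keep S
  ne := h.ne
  vert_iff := h.vert_iff
  edge := Or.inr ⟨hx, hS x hx y h.edge, h.edge⟩
  edge' := Or.inr ⟨hx', hS x' hx' y' h.edge', h.edge'⟩
  y_ne := h.y_ne
  y'_ne := h.y'_ne

/-- Either both lines at the vertex are kept, and the vertex is a bivalent vertex on a line of the
subgraph, or both are cut, and it carries only external half-lines. -/
theorem bridgeless_keep_iff (h : G.BivStep x x' y y') {S : Set α}
    (hS : ∀ x ∈ S, ∀ y, G.edge x y → y ∈ S) (hxx' : x ∈ S ↔ x' ∈ S) :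
    ((G.remove {x, x'}).keep (Subtype.val ⁻¹' S)).Bridgeless ↔ (G.keep S).Bridgeless := by
  have hsat : G.Saturated {x, x'} S := by
    rintro z (rfl | rfl) w hw hz
    · rcases (h.vert_iff w).1 hw with rfl | rfl
      · exact hz
      · exact hxx'.1 hz
    · rcases (h.symm.vert_iff w).1 hw with rfl | rfl
      · exact hz
      · exact hxx'.2 hz
  rw [G.remove_keep hS hsat]
  by_cases hx : x ∈ S
  · have := h.keep hS hx (hxx'.1 hx)
    exact ⟨this.bridgeless_of_remove, this.bridgeless_remove⟩
  · refine bridgeless_remove_of_legs h.vertClosed ?_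
    rintro z (rfl | rfl) w (rfl | ⟨hz, _⟩)
    · rfl
    · exact absurd hz hx
    · rfl
    · exact absurd (hxx'.2 hz) hx

end BivStep

end Graph

/-! ### Bivalent vertices in bridgeless graphs, and restriction to components -/

namespace Graph

variable {α β : Type}

/-- If the line of `x` ended at `x'`, the vertex would be a component without external line. So this
line leaves the vertex, and since it is no bridge, the other line leaves it too. -/
theorem Nice.exists_bivStep {G : Graph α} (hG : G.Nice) {x x' y : α} (hne : x ≠ x')
    (hv : ∀ z, G.vert x z ↔ z = x ∨ z = x') (hxy : G.edge x y) (hyx : y ≠ x) :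
    ∃ y', G.BivStep x x' y y' := by
  have hc : ∀ a ∈ ({x, x'} : Set α), ∀ b, G.vert a b → b ∈ ({x, x'} : Set α) := by
    rintro a (rfl | rfl) b hab
    · exact (hv b).1 hab
    · exact (hv b).1 (G.vert.trans ((hv a).2 (Or.inr rfl)) hab)
  have hyx' : y ≠ x' := by
    rintro rfl
    obtain ⟨l, hl, hxl⟩ := hG.leg x
    have := sup_closed (C := {x, y}) (fun a b hab ha => hc a ha b hab) ?_ hxl (Or.inl rfl)
    · rcases this with rfl | rfl
      · exact hyx (hl y hxy)
      · exact hyx (hl x (G.edge.symm hxy)).symm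
    · rintro a b hab (rfl | rfl)
      · exact hG.edge_unique.eq_or hxy hyx hab
      · exact (hG.edge_unique.eq_or (G.edge.symm hxy) hyx.symm hab).symm
  obtain ⟨u, hu, v, hv', he, hne'⟩ := hG.bridgeless {x, x'} hc x (Or.inl rfl) y
    (by rintro (h | h); exacts [hyx h, hyx' h]) hxy
  obtain rfl : u = x' := hu.resolve_left hne'
  exact ⟨v, hG.edge_unique, hne, hv, hxy, he, ⟨hyx, hyx'⟩,
    ⟨fun h => hv' (Or.inl h), fun h => hv' (Or.inr h)⟩⟩

/-- A vertex of valence two carries two external lines or lies on a line. -/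
theorem Nice.biv_cases {G : Graph α} (hG : G.Nice) {x : α} (hx : x ∈ G.biv) :
    ∃ x', G.VertClosed {x, x'} ∧ {x, x'} ⊆ G.biv ∧
      (({x, x'} : Set α) ⊆ G.legs ∨ ∃ y y', G.BivStep x x' y y') := by
  have hcard : {z | G.vert x z}.ncard = 2 := hx
  obtain ⟨a, b, hab, hset⟩ := Set.ncard_eq_two.1 hcard
  obtain ⟨x', hne, hv⟩ : ∃ x', x ≠ x' ∧ ∀ z, G.vert x z ↔ z = x ∨ z = x' := by
    have hmem : ∀ z, G.vert x z ↔ z = a ∨ z = b := fun z => Set.ext_iff.1 hset z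
    rcases (hmem x).1 (G.vert.refl x) with rfl | rfl
    · exact ⟨b, hab, hmem⟩
    · exact ⟨a, hab.symm, fun z => (hmem z).trans or_comm⟩
  have hc : G.VertClosed {x, x'} := by
    rintro a (rfl | rfl) b hab
    · exact (hv b).1 hab
    · exact (hv b).1 (G.vert.trans ((hv a).2 (Or.inr rfl)) hab)
  have hv' : ∀ z, G.vert x' z ↔ z = x' ∨ z = x := fun z => by
    rw [or_comm, ← hv]
    have := (hv x').2 (Or.inr rfl)
    exact ⟨fun h => G.vert.trans this h, fun h => G.vert.trans (G.vert.symm this) h⟩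
  refine ⟨x', hc, ?_, ?_⟩
  · rintro z (rfl | rfl)
    · exact hx
    · exact G.biv_closed x hx z ((hv z).2 (Or.inr rfl))
  · by_cases hxl : x ∈ G.inner
    · obtain ⟨y, hxy, hyx⟩ := mem_inner.1 hxl
      exact Or.inr ⟨y, hG.exists_bivStep hne hv hxy hyx⟩
    · left
      rintro z (rfl | rfl)
      · exact not_mem_inner.1 hxl
      · by_contra hz
        obtain ⟨y, hzy, hyz⟩ := mem_inner.1 hz
        obtain ⟨y', h⟩ := hG.exists_bivStep hne.symm hv' hzy hyz
        exact hxl (mem_inner.2 ⟨y', h.edge', h.y'_ne.2⟩)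

/-- Valence one has to be excluded: the only half-line would belong to a bridge, or it would be
external and form a component without internal lines. -/
theorem Nice.three_le_valence {G : Graph α} [Finite α] (hG : G.Nice) (hc : ∀ x y, G.conn x y)
    (hi : G.inner.Nonempty) {x : α} (hx : x ∉ G.biv) : 3 ≤ {y | G.vert x y}.ncard := by
  by_contra hlt
  have h0 : {y | G.vert x y}.ncard ≠ 0 := Set.ncard_ne_zero_of_mem (a := x) (G.vert.refl x)
  have h2 : {y | G.vert x y}.ncard ≠ 2 := hx
  have h1 : {y | G.vert x y}.ncard = 1 := by omega
  obtain ⟨a, ha⟩ := Set.ncard_eq_one.1 h1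
  have hmem : ∀ z, G.vert x z ↔ z = a := fun z => Set.ext_iff.1 ha z
  obtain rfl : x = a := (hmem x).1 (G.vert.refl x)
  by_cases hxl : x ∈ G.inner
  · obtain ⟨y, hxy, hyx⟩ := mem_inner.1 hxl
    obtain ⟨u, hu, _, _, _, hne⟩ := hG.bridgeless {x} (by rintro a rfl b hab; exact (hmem b).1 hab)
      x rfl y hyx hxy
    exact hne hu
  · obtain ⟨z, hz⟩ := hi
    have := sup_closed (C := {x}) (by rintro a b hab rfl; exact (hmem b).1 hab)
      (by rintro a b hab rfl; exact not_mem_inner.1 hxl b hab) (hc x z) rfl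
    exact hxl (this ▸ hz)

theorem Bridgeless.restrict {G : Graph α} (h : G.Bridgeless) (p : Set α)
    (hp : ∀ x ∈ p, ∀ y, G.conn x y → y ∈ p) : (G.restrict p).Bridgeless := by
  intro C hC x hx y hy hxy
  have hval : ∀ z : p, (z : α) ∈ Subtype.val '' C ↔ z ∈ C := fun z => by simp
  obtain ⟨x', ⟨x', hx', rfl⟩, y', hy', he, hne⟩ := h (Subtype.val '' C)
    (by
      rintro _ ⟨a, ha, rfl⟩ b hab
      exact ⟨⟨b, hp a a.2 b (conn_vert hab)⟩, hC a ha _ hab, rfl⟩)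
    x ((hval x).2 hx) y (fun hh => hy ((hval y).1 hh)) hxy
  exact ⟨x', hx', ⟨y', hp _ x'.2 _ (conn_edge he)⟩, fun hh => hy' ⟨_, hh, rfl⟩, he,
    fun hh => hne (congrArg Subtype.val hh)⟩

theorem restrict_keep (G : Graph α) (p S : Set α) :
    (G.restrict p).keep (Subtype.val ⁻¹' S) = (G.keep S).restrict p := by
  refine Graph.ext rfl ?_
  exact (comap_onSet _ Subtype.val_injective G.edge S).symm

/-- Restriction to a union of components and removal of the vertices of valence two. -/
def smoothRestrictIso (G : Graph α) (p : Set α) (hp : ∀ x ∈ p, ∀ y, G.conn x y → y ∈ p) :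
    Iso (G.smooth.restrict (Subtype.val ⁻¹' p)) (G.restrict p).smooth := by
  set M : Graph α := ⟨G.vert, G.edge ⊔ onSet G.vert G.biv⟩
  have hb : (G.restrict p).biv = Subtype.val ⁻¹' G.biv := by
    ext x
    change _ = 2 ↔ _ = 2
    rw [ncard_vert_restrict G p (fun x hx y h => hp x hx y (conn_vert h)) x]
  have h1 : (⟨(G.restrict p).vert, (G.restrict p).edge ⊔ onSet (G.restrict p).vert
      (G.restrict p).biv⟩ : Graph p) = M.restrict p := by
    refine Graph.ext rfl ?_
    have := restrict_conn (⟨G.edge, onSet G.vert G.biv⟩ : Graph α) p fun x hx y h => by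
      refine sup_closed (C := p) ?_ ?_ h hx
      · exact fun a b hab ha => hp a ha b (conn_edge hab)
      · exact fun a b hab ha => hp a ha b (conn_vert (onSet_le _ _ hab))
    rw [hb]
    refine Eq.trans ?_ this
    change Setoid.comap Subtype.val G.edge ⊔ _ = _ ⊔ Setoid.comap Subtype.val (onSet G.vert G.biv)
    rw [comap_onSet _ Subtype.val_injective]
    rfl
  have h2 : (G.restrict p).smooth = (M.restrict p).restrict {x | x ∉ (G.restrict p).biv} := by
    rw [← h1]
    rfl
  rw [h2]
  refine (Iso.restrictRestrict M {x | x ∉ G.biv} _ (r := {x | x ∈ p ∧ x ∉ G.biv}) ?_).trans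
    (Iso.restrictRestrict M _ _ (r := {x | x ∈ p ∧ x ∉ G.biv}) ?_).symm
  · ext x
    exact ⟨fun hx => ⟨⟨x, hx.2⟩, hx.1, rfl⟩, by rintro ⟨y, hy, rfl⟩; exact ⟨hy, y.2⟩⟩
  · rw [hb]
    ext x
    exact ⟨fun hx => ⟨⟨x, hx.1⟩, hx.2, rfl⟩, by rintro ⟨y, hy, rfl⟩; exact ⟨y.2, hy⟩⟩

/-- Contraction of a subgraph and restriction to a union of components. -/
def quoRestrictIso (G : Graph α) (p S : Set α) (hp : ∀ x ∈ p, ∀ y, G.conn x y → y ∈ p) :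
    Iso ((G.quo S).restrict (Subtype.val ⁻¹' p)) ((G.restrict p).quo (Subtype.val ⁻¹' S)) := by
  set M : Graph α := ⟨(G.keep S).conn, G.edge⟩
  have h1 : (⟨((G.restrict p).keep (Subtype.val ⁻¹' S)).conn, (G.restrict p).edge⟩ : Graph p) =
      M.restrict p := by
    rw [restrict_keep, restrict_conn _ _ fun x hx y h => hp x hx y (keep_conn_le G S h)]
    rfl
  have h2 : (G.restrict p).quo (Subtype.val ⁻¹' S) =
      (M.restrict p).restrict {x | x ∉ Subtype.val ⁻¹' S} := by
    rw [← h1]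
    rfl
  rw [h2]
  refine (Iso.restrictRestrict M {x | x ∉ S} _ (r := {x | x ∈ p ∧ x ∉ S}) ?_).trans
    (Iso.restrictRestrict M _ _ (r := {x | x ∈ p ∧ x ∉ S}) ?_).symm
  · ext x
    exact ⟨fun hx => ⟨⟨x, hx.2⟩, hx.1, rfl⟩, by rintro ⟨y, hy, rfl⟩; exact ⟨hy, y.2⟩⟩
  · ext x
    exact ⟨fun hx => ⟨⟨x, hx.1⟩, hx.2, rfl⟩, by rintro ⟨y, hy, rfl⟩; exact ⟨y.2, hy⟩⟩

theorem IsSub.restrict {G : Graph α} {S : Set α} (h : G.IsSub S) (p : Set α)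
    (hp : ∀ x ∈ p, ∀ y, G.conn x y → y ∈ p) : (G.restrict p).IsSub (Subtype.val ⁻¹' S) where
  subset_inner x hx hl := h.subset_inner hx
    ((restrict_legs G p (fun a ha b hab => hp a ha b (conn_edge hab)) x).1 hl)
  closed x hx y hxy := h.closed x hx y hxy
  bridgeless := by
    rw [restrict_keep]
    exact h.bridgeless.restrict p fun x hx y hxy => hp x hx y (keep_conn_le G S hxy)

theorem isSub_of_components {G : Graph α} {S : Set α}
    (h : ∀ q, (G.component q).IsSub (Subtype.val ⁻¹' S)) : G.IsSub S where
  subset_inner x hx hl := (h (Quotient.mk _ x)).subset_inner (a := ⟨x, rfl⟩) hx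
    ((restrict_legs G _ (fun a ha b hab => G.component_closed _ a ha b (conn_edge hab))
      ⟨x, rfl⟩).2 hl)
  closed x hx y hxy := (h (Quotient.mk _ x)).closed ⟨x, rfl⟩ hx
    ⟨y, G.component_closed _ x rfl y (conn_edge hxy)⟩ hxy
  bridgeless C hC x hx y hy hxy := by
    have hb := (h (Quotient.mk _ x)).bridgeless
    rw [component, restrict_keep] at hb
    obtain ⟨x', hx', y', hy', he, hne⟩ := hb (Subtype.val ⁻¹' C) (fun a ha b hab => hC a ha b hab)
      ⟨x, rfl⟩ hx ⟨y, G.component_closed _ x rfl y (conn_edge (onSet_le _ _ hxy))⟩ hy hxy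
    exact ⟨x', hx', y', hy', he, fun hh => hne (Subtype.ext hh)⟩

end Graph

/-! ### The convolution product on all graphs, and its associativity -/

section Values

variable {A : Type} [CommRing A] {α β : Type} [Finite α] [Finite β]

theorem convSum_remove_of_legs (a b : GraphClass → A) {G : Graph α} {B : Set α}
    (hB : G.VertClosed B) (hbiv : B ⊆ G.biv) (hl : B ⊆ G.legs) :
    convSum a b (G.remove B) = convSum a b G := by
  have hdisj : ∀ S, G.IsSub S → ∀ x ∈ B, x ∉ S := fun S hS x hx hxS =>
    hS.subset_inner hxS (hl hx)
  have hsat : ∀ S, (∀ x ∈ B, x ∉ S) → G.Saturated B S := fun S hS x hx _ _ hxS =>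
    absurd hxS (hS x hx)
  have hbr : ∀ S, (∀ x ∈ S, ∀ y, G.edge x y → y ∈ S) → (∀ x ∈ B, x ∉ S) →
      (((G.remove B).keep (Subtype.val ⁻¹' S)).Bridgeless ↔ (G.keep S).Bridgeless) := by
    intro S hS hd
    rw [G.remove_keep hS (hsat S hd)]
    exact Graph.bridgeless_remove_of_legs (G := G.keep S) hB fun x hx y hxy =>
      hl hx y (onSet_le _ _ hxy)
  refine convSum_remove_of_bijective a b hB hbiv (fun S hS => hsat S (hdisj S hS)) ?_ ?_ ?_
  · intro S hS
    refine ⟨fun x hx => ?_, fun x hx y hxy => ?_, (hbr S hS.closed (hdisj S hS)).2 hS.bridgeless⟩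
    · obtain ⟨y, hxy, hne⟩ := Graph.mem_inner.1 (hS.subset_inner hx)
      exact Graph.mem_inner.2 ⟨⟨y, fun hy => hdisj S hS y hy (hS.closed x hx y hxy)⟩,
        (Graph.remove_edge_iff_of_legs hl _ _).2 hxy, fun hh => hne (congrArg Subtype.val hh)⟩
    · exact hS.closed x hx y ((Graph.remove_edge_iff_of_legs hl _ _).1 hxy)
  · intro S S' hS hS' h
    ext x
    by_cases hx : x ∈ B
    · exact iff_of_false (hdisj S hS x hx) (hdisj S' hS' x hx)
    · exact Set.ext_iff.1 h ⟨x, hx⟩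
  · intro T hT
    have hpre : (Subtype.val ⁻¹' (Subtype.val '' T) : Set {x | x ∉ B}) = T :=
      Set.preimage_image_eq _ Subtype.val_injective
    have hcl : ∀ x ∈ Subtype.val '' T, ∀ y, G.edge x y → y ∈ Subtype.val '' T := by
      rintro _ ⟨x, hx, rfl⟩ y hxy
      have hy : y ∉ B := fun hy => x.2 (hl hy x (G.edge.symm hxy) ▸ hy)
      exact ⟨⟨y, hy⟩, hT.closed x hx _ ((Graph.remove_edge_iff_of_legs hl _ _).2 hxy), rfl⟩
    have hd : ∀ x ∈ B, x ∉ Subtype.val '' T := by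
      rintro _ hx ⟨x, _, rfl⟩
      exact x.2 hx
    refine ⟨Subtype.val '' T, ⟨?_, hcl, ?_⟩, hpre⟩
    · rintro _ ⟨x, hx, rfl⟩
      obtain ⟨y, hxy, hne⟩ := Graph.mem_inner.1 (hT.subset_inner hx)
      exact Graph.mem_inner.2 ⟨y, (Graph.remove_edge_iff_of_legs hl _ _).1 hxy,
        fun hh => hne (Subtype.ext hh)⟩
    · rw [← hbr _ hcl hd, hpre]
      exact hT.bridgeless

/-- A bridgeless subgraph containing one line at a bivalent vertex contains the other one, so the
two lines behave like the single line which replaces them. -/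
theorem convSum_remove_of_bivStep (a b : GraphClass → A) {G : Graph α} {x x' y y' : α}
    (h : G.BivStep x x' y y') : convSum a b (G.remove {x, x'}) = convSum a b G := by
  have hxy : ∀ S, G.IsSub S → (x ∈ S ↔ y ∈ S) := fun S hS =>
    ⟨fun hx => hS.closed x hx y h.edge, fun hy => hS.closed y hy x (G.edge.symm h.edge)⟩
  have hxy' : ∀ S, G.IsSub S → (x' ∈ S ↔ y' ∈ S) := fun S hS =>
    ⟨fun hx => hS.closed x' hx y' h.edge', fun hy => hS.closed y' hy x' (G.edge.symm h.edge')⟩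
  have hxx' : ∀ S, G.IsSub S → (x ∈ S ↔ x' ∈ S) := fun S hS =>
    ⟨h.mem_of_mem hS, h.symm.mem_of_mem hS⟩
  refine convSum_remove_of_bijective a b h.vertClosed h.subset_biv (fun S hS => h.saturated hS)
    ?_ ?_ ?_
  · intro S hS
    refine ⟨fun z hz hl => ?_, fun z hz w hzw => ?_,
      (h.bridgeless_keep_iff hS.closed (hxx' S hS)).2 hS.bridgeless⟩
    · exact hS.subset_inner hz ((h.remove_legs z).1 hl)
    · have hz' : (z : α) ∈ S := hz
      change (w : α) ∈ S
      rcases (h.remove_edge_iff z w).1 hzw with hzw | ⟨h1, h2⟩ | ⟨h1, h2⟩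
      · exact hS.closed z hz w hzw
      · rw [h2, ← hxy' S hS, ← hxx' S hS, hxy S hS, ← h1]
        exact hz'
      · rw [h2, ← hxy S hS, hxx' S hS, hxy' S hS, ← h1]
        exact hz'
  · intro S S' hS hS' hSS'
    have hy : ∀ z ∉ ({x, x'} : Set α), z ∈ S ↔ z ∈ S' := fun z hz => Set.ext_iff.1 hSS' ⟨z, hz⟩
    ext z
    by_cases hz : z ∈ ({x, x'} : Set α)
    · rcases hz with rfl | rfl
      · rw [hxy S hS, hxy S' hS', hy y h.y_notMem]
      · rw [hxy' S hS, hxy' S' hS', hy y' h.y'_notMem]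
    · exact hy z hz
  · intro T hT
    have hyT : (⟨y, h.y_notMem⟩ : {z | z ∉ ({x, x'} : Set α)}) ∈ T ↔
        (⟨y', h.y'_notMem⟩ : {z | z ∉ ({x, x'} : Set α)}) ∈ T :=
      ⟨fun hh => hT.closed _ hh _ ((h.remove_edge_iff _ _).2 (Or.inr (Or.inl ⟨rfl, rfl⟩))),
        fun hh => hT.closed _ hh _ ((h.remove_edge_iff _ _).2 (Or.inr (Or.inr ⟨rfl, rfl⟩)))⟩
    -- The inverse map adds the half-lines of the removed vertex if the joined line belongs to `T`.
    let S : Set α := Subtype.val '' T ∪ {z | z ∈ ({x, x'} : Set α) ∧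
      (⟨y, h.y_notMem⟩ : {z | z ∉ ({x, x'} : Set α)}) ∈ T}
    have hmem : ∀ z : {z | z ∉ ({x, x'} : Set α)}, (z : α) ∈ S ↔ z ∈ T := fun z => by
      constructor
      · rintro (⟨w, hw, hwz⟩ | ⟨hz, _⟩)
        · rwa [← Subtype.ext hwz]
        · exact absurd hz z.2
      · exact fun hz => Or.inl ⟨z, hz, rfl⟩
    have hmemB : ∀ z ∈ ({x, x'} : Set α), z ∈ S ↔
        (⟨y, h.y_notMem⟩ : {z | z ∉ ({x, x'} : Set α)}) ∈ T := fun z hz => by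
      constructor
      · rintro (⟨w, hw, hwz⟩ | ⟨_, hz⟩)
        · exact absurd (hwz ▸ hz) w.2
        · exact hz
      · exact fun hy => Or.inr ⟨hz, hy⟩
    have hpre : (Subtype.val ⁻¹' S : Set {z | z ∉ ({x, x'} : Set α)}) = T := Set.ext hmem
    have hcl : ∀ z ∈ S, ∀ w, G.edge z w → w ∈ S := by
      intro z hz w hzw
      by_cases hzB : z ∈ ({x, x'} : Set α)
      · have hyT' := (hmemB z hzB).1 hz
        rcases hzB with rfl | rfl
        · rcases h.edge_x hzw with rfl | rfl
          · exact hz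
          · exact (hmem ⟨w, h.y_notMem⟩).2 hyT'
        · rcases h.symm.edge_x hzw with rfl | rfl
          · exact hz
          · exact (hmem ⟨w, h.y'_notMem⟩).2 (hyT.1 hyT')
      · have hzT := (hmem ⟨z, hzB⟩).1 hz
        by_cases hwB : w ∈ ({x, x'} : Set α)
        · refine (hmemB w hwB).2 ?_
          rcases hwB with rfl | rfl
          · obtain rfl := (h.edge_x (G.edge.symm hzw)).resolve_left fun hh => hzB (Or.inl hh)
            exact hzT
          · obtain rfl := (h.symm.edge_x (G.edge.symm hzw)).resolve_left fun hh => hzB (Or.inr hh)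
            exact hyT.2 hzT
        · exact (hmem ⟨w, hwB⟩).2 (hT.closed _ hzT _ ((h.remove_edge_iff _ _).2 (Or.inl hzw)))
    refine ⟨S, ⟨fun z hz hl => ?_, hcl, ?_⟩, hpre⟩
    · by_cases hzB : z ∈ ({x, x'} : Set α)
      · rcases hzB with rfl | rfl
        · exact h.y_ne.1 (hl y h.edge)
        · exact h.y'_ne.2 (hl y' h.edge')
      · exact hT.subset_inner ((hmem ⟨z, hzB⟩).1 hz) ((h.remove_legs _).2 hl)
    · rw [← h.bridgeless_keep_iff hcl, hpre]
      · exact hT.bridgeless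
      · rw [hmemB x (Or.inl rfl), hmemB x' (Or.inr rfl)]

theorem ncard_remove_biv_lt {G : Graph α} {B : Set α} (hB : G.VertClosed B) {x : α} (hx : x ∈ B)
    (hbiv : B ⊆ G.biv) : (G.remove B).biv.ncard < G.biv.ncard := by
  rw [G.remove_biv hB, ← Set.ncard_image_of_injective _ Subtype.val_injective]
  refine Set.ncard_lt_ncard ⟨?_, fun h => ?_⟩
  · rintro _ ⟨z, hz, rfl⟩
    exact hz
  · obtain ⟨z, _, rfl⟩ := h (hbiv hx)
    exact z.2 hx

/-- Removing all vertices of valence two. -/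
theorem nice_smooth_and_convSum (a b : GraphClass → A) {G : Graph α} (hG : G.Nice) :
    G.smooth.Nice ∧ convSum a b G.smooth = convSum a b G := by
  induction hn : G.biv.ncard using Nat.strong_induction_on generalizing α with
  | _ n ih =>
    by_cases hne : G.biv.Nonempty
    · obtain ⟨x, hx⟩ := hne
      obtain ⟨x', hB, hbiv, hcase⟩ := hG.biv_cases hx
      have hlt := ncard_remove_biv_lt hB (Or.inl rfl) hbiv
      have key : (G.remove {x, x'}).Nice ∧ convSum a b (G.remove {x, x'}) = convSum a b G := by
        rcases hcase with hl | ⟨y, y', h⟩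
        · exact ⟨hG.remove_of_legs hB hl, convSum_remove_of_legs a b hB hbiv hl⟩
        · exact ⟨h.nice_remove hG, convSum_remove_of_bivStep a b h⟩
      obtain ⟨h1, h2⟩ := ih _ (hn ▸ hlt) key.1 rfl
      have e := G.smoothRemoveIso hB hbiv
      exact ⟨e.nice h1, by rw [← convSum_iso a b e, h2, key.2]⟩
    · rw [Set.not_nonempty_iff_eq_empty] at hne
      exact ⟨(G.smoothIso hne).symm.nice hG, convSum_iso a b (G.smoothIso hne)⟩

theorem Graph.Nice.smooth {G : Graph α} (hG : G.Nice) : G.smooth.Nice :=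
  -- The functions are arbitrary, since only the first half of the statement is used.
  (nice_smooth_and_convSum (A := ℂ) 0 0 hG).1

theorem convSum_smooth (a b : GraphClass → A) {G : Graph α} (hG : G.Nice) :
    convSum a b G.smooth = convSum a b G := (nice_smooth_and_convSum a b hG).2

omit [Finite α] in
theorem Graph.smooth_biv (G : Graph α) : G.smooth.biv = ∅ := by
  rw [Graph.smooth, G.remove_biv G.biv_closed]
  ext x
  exact ⟨fun h => x.2 h, fun h => h.elim⟩

theorem value_partition (f : GraphClass → A) {G : Graph α} {ι : Type} [Finite ι] (p : α → ι)
    (hp : ∀ x y, G.conn x y → p x = p y) :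
    value f G = ∏ᶠ i, value f (G.restrict {x | p x = i}) := by
  rw [value, prodVal_partition f (fun x : {x | x ∉ G.biv} => p x) fun x y h => hp x y (by
    rw [Graph.smooth, G.remove_conn G.biv_closed] at h
    exact h)]
  refine finprod_congr fun i => ?_
  exact prodVal_iso f (G.smoothRestrictIso {x | p x = i}
    fun x hx y h => (hp x y h).symm.trans hx)

theorem convSum_eq_one (a b : GraphClass → A) {G : Graph α} (h : ∀ x, x ∈ G.legs) :
    convSum a b G = 1 := by
  have : Unique {S : Set α // G.IsSub S} :=
    { default := ⟨∅, fun x hx => hx.elim, fun x hx => hx.elim, fun C _ x hx y hy hxy => by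
        rcases hxy with rfl | ⟨hx, _⟩
        · exact absurd hx hy
        · exact hx.elim⟩
      uniq := fun S => Subtype.ext (Set.eq_empty_of_forall_notMem fun x hx =>
        S.2.subset_inner hx (h x)) }
  rw [convSum, finsum_unique, value_eq_one, value_eq_one, one_mul]
  · exact fun x y hxy => Subtype.ext (h x y hxy)
  · exact fun x y hxy => h x y (onSet_le _ _ hxy)

/-- The convolution product of two multiplicative functions, given by their values on connected
graphs. -/
def conv (a b : GraphClass → A) (c : GraphClass) : A := convSum a b c.rep.graph

theorem conv_classOf (a b : GraphClass → A) {G : Graph α} (h : G.IsOnePI) :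
    conv a b (classOf G h) = convSum a b G := (convSum_iso a b (repIso G h)).symm

/-- If such a graph is not 1PI, it has no internal line. Then the only subgraph is the empty one and
both sides are `1`. -/
theorem evalGraph_conv (a b : GraphClass → A) {G : Graph α} (hG : G.Nice)
    (hc : ∀ x y, G.conn x y) (hb : G.biv = ∅) : evalGraph (conv a b) G = convSum a b G := by
  by_cases h : G.IsOnePI
  · rw [evalGraph_of_isOnePI _ h, conv_classOf]
  · rw [evalGraph_of_not _ h, convSum_eq_one]
    intro x
    by_contra hx
    exact h (Graph.isOnePI_iff.2 ⟨hG, hc, ⟨x, hx⟩, fun y =>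
      hG.three_le_valence hc ⟨x, hx⟩ (by simp [hb])⟩)

/-- A subgraph is a family of subgraphs of the components, and both factors are multiplicative. The
claim is the distributive law. -/
theorem convSum_components (a b : GraphClass → A) (G : Graph α) :
    convSum a b G = ∏ᶠ q, convSum a b (G.component q) := by
  classical
  have := Fintype.ofFinite (Quotient G.conn)
  have : ∀ q, Fintype {S // (G.component q).IsSub S} := fun q => Fintype.ofFinite _
  have hcl := G.component_closed
  simp only [finprod_eq_prod_of_fintype, convSum, finsum_eq_sum_of_fintype, Finset.prod_univ_sum,
    Fintype.piFinset_univ]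
  rw [← finsum_eq_sum_of_fintype]
  refine finsum_eq_of_bijective
    (fun S q => ⟨Subtype.val ⁻¹' S.1, S.2.restrict _ (hcl q)⟩) ⟨fun S S' h => ?_, fun T => ?_⟩
    fun S => ?_
  · refine Subtype.ext (Set.ext fun x => ?_)
    have := congrArg Subtype.val (congrFun h (Quotient.mk _ x))
    exact Set.ext_iff.1 this ⟨x, rfl⟩
  · have hmem : ∀ q, (Subtype.val ⁻¹' {x : α | (⟨x, rfl⟩ : {y | Quotient.mk G.conn y =
        Quotient.mk _ x}) ∈ (T (Quotient.mk _ x)).1} : Set {y | Quotient.mk G.conn y = q}) =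
        (T q).1 := by
      intro q
      ext ⟨x, hx⟩
      obtain rfl : Quotient.mk G.conn x = q := hx
      rfl
    refine ⟨⟨{x : α | (⟨x, rfl⟩ : {y | Quotient.mk G.conn y =
        Quotient.mk _ x}) ∈ (T (Quotient.mk _ x)).1}, Graph.isSub_of_components fun q => ?_⟩,
        funext fun q => Subtype.ext (hmem q)⟩
    rw [hmem]
    exact (T q).2
  · rw [Finset.prod_mul_distrib, value_partition a (G := G.keep S.1) (Quotient.mk G.conn)
      fun x y h => Quotient.sound (G.keep_conn_le _ h), finprod_eq_prod_of_fintype,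
      value_partition b (G := G.quo S.1) (fun x => Quotient.mk G.conn (x : α)) fun x y h => by
        rw [G.quo_conn S.2.closed] at h
        exact Quotient.sound h, finprod_eq_prod_of_fintype]
    congr 1
    · refine Finset.prod_congr rfl fun q _ => ?_
      exact congrArg (value a) (G.restrict_keep _ S.1).symm
    · refine Finset.prod_congr rfl fun q _ => ?_
      exact value_iso b (G.quoRestrictIso _ S.1 (hcl q))

/-- The convolution product on all graphs, with several components and with vertices of valence
two. -/
theorem value_conv (a b : GraphClass → A) {G : Graph α} (hG : G.Nice) :
    value (conv a b) G = convSum a b G := by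
  rw [← convSum_smooth a b hG, convSum_components, value, prodVal]
  refine finprod_congr fun q => evalGraph_conv a b (hG.smooth.component q)
    (Graph.component_connected _ q) ?_
  ext x
  have : (x : {x | x ∉ G.biv}) ∉ G.smooth.biv := by simp [G.smooth_biv]
  refine iff_of_false (fun h => this (Eq.trans ?_ h)) fun h => h
  exact (Graph.ncard_vert_restrict G.smooth _ (fun x hx y h =>
    G.smooth.component_closed q x hx y (Graph.conn_vert h)) x).symm

/-- The convolution product is associative. -/
theorem conv_assoc (a b c : GraphClass → A) : conv (conv a b) c = conv a (conv b c) := by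
  classical
  funext Γ
  set G := Γ.rep.graph
  have hG : G.Nice := Γ.rep.isOnePI.nice
  have f1 : Fintype {D // G.IsSub D} := Fintype.ofFinite _
  have f2 : ∀ D : {D // G.IsSub D}, Fintype {S // (G.keep D).IsSub S} :=
    fun _ => Fintype.ofFinite _
  have f3 : ∀ S : {S // G.IsSub S}, Fintype {T // (G.quo S).IsSub T} :=
    fun _ => Fintype.ofFinite _
  have h1 : conv (conv a b) c Γ = ∑ p : (Σ D : {D // G.IsSub D}, {S // (G.keep D).IsSub S}),
      value a ((G.keep p.1).keep p.2) * value b ((G.keep p.1).quo p.2) * value c (G.quo p.1) := by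
    rw [Fintype.sum_sigma, conv, convSum, finsum_eq_sum_of_fintype]
    refine Finset.sum_congr rfl fun D _ => ?_
    -- Here the convolution product is evaluated on a graph with several components.
    rw [value_conv a b (hG.keep D.2), convSum, finsum_eq_sum_of_fintype, Finset.sum_mul]
  have h2 : conv a (conv b c) Γ = ∑ p : (Σ S : {S // G.IsSub S}, {T // (G.quo S).IsSub T}),
      value a (G.keep p.1) * (value b ((G.quo p.1).keep p.2) * value c ((G.quo p.1).quo p.2)) := by
    rw [Fintype.sum_sigma, conv, convSum, finsum_eq_sum_of_fintype]
    refine Finset.sum_congr rfl fun S _ => ?_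
    -- Here it is evaluated on a contracted graph, in which components of `S` with two external
    -- lines have become bivalent vertices.
    rw [value_conv b c (hG.quo S.2.subset_inner S.2.closed), convSum, finsum_eq_sum_of_fintype,
      Finset.mul_sum]
  rw [h1, h2]
  refine Fintype.sum_equiv (G.subSubEquiv hG.edge_unique) _ _ ?_
  rintro ⟨⟨D, hD⟩, ⟨S, hS⟩⟩
  have hSD : S ⊆ D := hS.subset_of_keep
  change value a ((G.keep D).keep S) * value b ((G.keep D).quo S) * value c (G.quo D) =
    value a (G.keep S) * (value b ((G.quo S).keep (Subtype.val ⁻¹' D)) *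
      value c ((G.quo S).quo (Subtype.val ⁻¹' D)))
  rw [G.keep_keep, Set.inter_eq_right.2 hSD, G.quo_keep hSD,
    value_iso c (G.quoQuoIso (hD.of_keep hS).closed hSD), mul_assoc]

end Values

namespace Graph

variable {α β : Type}

/-! ### Loop numbers of subgraphs and contracted graphs -/

theorem numVerts_remove [Finite α] {G : Graph α} {x : α} {B : Set α}
    (hB : ∀ z, z ∈ B ↔ G.vert x z) : G.numVerts = (G.remove B).numVerts + 1 := by
  let F : Option (Quotient (G.remove B).vert) → Quotient G.vert := fun q =>
    q.elim (Quotient.mk _ x) (Quotient.map Subtype.val fun _ _ h => h)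
  have hF : Function.Bijective F := by
    constructor
    · rintro (_ | a) (_ | b) h
      · rfl
      · induction b using Quotient.inductionOn with | _ b => ?_
        exact absurd ((hB b).2 (Quotient.exact h)) b.2
      · induction a using Quotient.inductionOn with | _ a => ?_
        exact absurd ((hB a).2 (G.vert.symm (Quotient.exact h))) a.2
      · induction a, b using Quotient.inductionOn₂ with | _ a b => ?_
        have h' : G.vert a b := Quotient.exact h
        exact congrArg some (Quotient.sound h')
    · intro q
      induction q using Quotient.inductionOn with | _ z => ?_
      by_cases hz : z ∈ B
      · exact ⟨none, Quotient.sound ((hB z).1 hz)⟩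
      · exact ⟨some (Quotient.mk _ ⟨z, hz⟩), rfl⟩
  rw [numVerts, ← Nat.card_eq_of_bijective F hF, Finite.card_option]
  rfl

theorem BivStep.numVerts_remove [Finite α] {G : Graph α} {x x' y y' : α}
    (h : G.BivStep x x' y y') : G.numVerts = (G.remove {x, x'}).numVerts + 1 :=
  Graph.numVerts_remove (x := x) fun z => (h.vert_iff z).symm

theorem BivStep.card_remove [Finite α] {G : Graph α} {x x' y y' : α}
    (h : G.BivStep x x' y y') : Nat.card α = Nat.card {z | z ∉ ({x, x'} : Set α)} + 2 := by
  have := Set.ncard_add_ncard_compl ({x, x'} : Set α)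
  rw [Set.ncard_pair h.ne] at this
  rw [← this, add_comm]
  rfl

theorem BivStep.numLegs_remove {G : Graph α} {x x' y y' : α}
    (h : G.BivStep x x' y y') : (G.remove {x, x'}).numLegs = G.numLegs := by
  have : G.legs = Subtype.val '' (G.remove {x, x'}).legs := by
    ext z
    constructor
    · intro hz
      have hzB : z ∉ ({x, x'} : Set α) := by
        rintro (rfl | rfl)
        · exact h.y_ne.1 (hz y h.edge)
        · exact h.y'_ne.2 (hz y' h.edge')
      exact ⟨⟨z, hzB⟩, (h.remove_legs _).2 hz, rfl⟩
    · rintro ⟨z, hz, rfl⟩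
      exact (h.remove_legs z).1 hz
  rw [numLegs, numLegs, this, Set.ncard_image_of_injective _ Subtype.val_injective]

theorem Iso.inner_nonempty {G : Graph α} {G' : Graph β} (e : Iso G G') (h : G.inner.Nonempty) :
    G'.inner.Nonempty := by
  obtain ⟨x, hx⟩ := h
  exact ⟨e.toEquiv x, fun hl => hx ((e.mem_legs x).1 hl)⟩

theorem remove_connected {G : Graph α} (h : ∀ x y, G.conn x y) {B : Set α} (hB : G.VertClosed B)
    (x y) : (G.remove B).conn x y := by
  rw [G.remove_conn hB]
  exact h _ _

/-- In a connected graph with an internal line, every vertex of valence two lies on a line. -/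
theorem Nice.exists_bivStep_of_connected {G : Graph α} (hG : G.Nice) (hc : ∀ x y, G.conn x y)
    (hi : G.inner.Nonempty) {x : α} (hx : x ∈ G.biv) : ∃ x' y y', G.BivStep x x' y y' := by
  obtain ⟨x', hB, -, hl | h⟩ := hG.biv_cases hx
  · obtain ⟨z, hz⟩ := hi
    have := sup_closed (C := {x, x'}) (fun a b hab ha => hB a ha b hab)
      (fun a b hab ha => hl ha b hab ▸ ha) (hc x z) (Or.inl rfl)
    exact absurd (hl this) hz
  · exact ⟨x', h⟩

/-- Each removal decreases the number of vertices by one and the number of half-lines by two and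
preserves the external lines. By `two_mul_loops` the loop number stays the same. -/
theorem smooth_data [Finite α] {G : Graph α} (hG : G.Nice) (hc : ∀ x y, G.conn x y)
    (hi : G.inner.Nonempty) :
    G.smooth.inner.Nonempty ∧ G.smooth.numLegs = G.numLegs ∧ G.smooth.loops = G.loops := by
  induction hn : G.biv.ncard using Nat.strong_induction_on generalizing α with
  | _ n ih =>
    by_cases hne : G.biv.Nonempty
    · obtain ⟨x, hx⟩ := hne
      obtain ⟨x', y, y', h⟩ := hG.exists_bivStep_of_connected hc hi hx
      have hi' : (G.remove {x, x'}).inner.Nonempty := ⟨⟨y, h.y_notMem⟩, mem_inner.2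
        ⟨⟨y', h.y'_notMem⟩, (h.remove_edge_iff _ _).2 (Or.inr (Or.inl ⟨rfl, rfl⟩)),
          fun hh => h.y_ne_y' (congrArg Subtype.val hh).symm⟩⟩
      have hc' := remove_connected hc h.vertClosed
      obtain ⟨h1, h2, h3⟩ := ih _ (hn ▸ ncard_remove_biv_lt h.vertClosed (Or.inl rfl) h.subset_biv)
        (h.nice_remove hG) hc' hi' rfl
      have e := G.smoothRemoveIso h.vertClosed h.subset_biv
      have : Nonempty α := ⟨x⟩
      have : Nonempty {z | z ∉ ({x, x'} : Set α)} := ⟨⟨y, h.y_notMem⟩⟩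
      have h4 := two_mul_loops hG.edge_unique hc
      have h5 := two_mul_loops h.remove_edgeUnique hc'
      have h6 := h.numVerts_remove
      have h7 := h.card_remove
      have h8 := h.numLegs_remove
      refine ⟨e.inner_nonempty h1, ?_, ?_⟩
      · rw [e.numLegs_eq, h2, h8]
      · rw [e.loops_eq, h3]
        omega
    · rw [Set.not_nonempty_iff_eq_empty] at hne
      have e := (G.smoothIso hne).symm
      exact ⟨e.inner_nonempty hi, e.numLegs_eq, e.loops_eq⟩

theorem smooth_isOnePI [Finite α] {G : Graph α} (hG : G.Nice) (hc : ∀ x y, G.conn x y)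
    (hi : G.inner.Nonempty) : G.smooth.IsOnePI :=
  isOnePI_iff.2 ⟨hG.smooth, smooth_connected hc, (smooth_data hG hc hi).1, fun x =>
    hG.smooth.three_le_valence (smooth_connected hc) (smooth_data hG hc hi).1
      (by rw [G.smooth_biv]; exact fun h => h)⟩

theorem loops_of_inner_eq_empty [Finite α] [Nonempty α] {G : Graph α} (h : G.inner = ∅) :
    G.loops = 0 := by
  have h1 : G.numEdges = 0 := by simp [numEdges, h]
  have : Nonempty (Quotient G.vert) := ⟨Quotient.mk _ (Classical.arbitrary α)⟩
  have h2 : 0 < G.numVerts := Nat.card_pos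
  simp only [loops, h1]
  omega

theorem one_le_loops [Finite α] {G : Graph α} (hG : G.Nice) (hc : ∀ x y, G.conn x y)
    (hi : G.inner.Nonempty) : 1 ≤ G.loops := by
  rw [← (smooth_data hG hc hi).2.2]
  exact (smooth_isOnePI hG hc hi).not_tree

theorem card_eq_sum_fiber {ι : Type} [Fintype ι] [Finite α] (p : α → ι) :
    Nat.card α = ∑ i, Nat.card {x | p x = i} := by
  rw [← Nat.card_congr (Equiv.sigmaFiberEquiv p), Nat.card_sigma]
  rfl

theorem ncard_eq_sum_fiber {ι : Type} [Fintype ι] [Finite α] (p : α → ι) (S : Set α) :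
    S.ncard = ∑ i, (Subtype.val ⁻¹' S : Set {x | p x = i}).ncard := by
  have h := card_eq_sum_fiber (fun x : S => p x)
  rw [Nat.card_coe_set_eq] at h
  rw [h]
  refine Finset.sum_congr rfl fun i _ => ?_
  rw [← Nat.card_coe_set_eq]
  refine Nat.card_congr ⟨fun x => ⟨⟨x.1.1, x.2⟩, x.1.2⟩, fun x => ⟨⟨x.1.1, x.2⟩, x.1.2⟩,
    fun _ => rfl, fun _ => rfl⟩

theorem numVerts_eq_sum [Finite α] (G : Graph α) [Fintype (Quotient G.conn)] :
    G.numVerts = ∑ q, (G.component q).numVerts := by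
  have hle : G.vert ≤ G.conn := le_sup_left
  rw [numVerts, ← Nat.card_congr (Setoid.sigmaQuotientEquivOfLe hle), Nat.card_sigma]
  rfl

theorem numVerts_quo [Finite α] {G : Graph α} (hG : G.Nice) {S : Set α} (hS : G.IsSub S) :
    (G.quo S).numVerts = Nat.card (Quotient (G.keep S).conn) := by
  refine Nat.card_eq_of_bijective
    (Quotient.map (sa := (G.quo S).vert) (sb := (G.keep S).conn) Subtype.val
      fun _ _ h => h) ⟨?_, ?_⟩
  · intro a b
    induction a, b using Quotient.inductionOn₂ with | _ a b => ?_
    intro h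
    have h' : (G.keep S).conn a b := Quotient.exact h
    exact Quotient.sound h'
  · intro q
    induction q using Quotient.inductionOn with | _ x => ?_
    obtain ⟨y, hy, hxy⟩ := hG.exists_not_mem hS.subset_inner hS.closed x
    exact ⟨Quotient.mk _ ⟨y, hy⟩, Quotient.sound ((G.keep S).conn.symm hxy)⟩

/-- The loop number is additive. -/
theorem loops_eq_sum [Finite α] {G : Graph α} (hG : G.Nice) (hc : ∀ x y, G.conn x y) {S : Set α}
    (hS : G.IsSub S) [Nonempty α] [Fintype (Quotient (G.keep S).conn)] :
    G.loops = ∑ q, ((G.keep S).component q).loops + (G.quo S).loops := by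
  obtain ⟨l, hl, -⟩ := hG.leg (Classical.arbitrary α)
  have hlS : l ∉ S := fun h => hS.subset_inner h hl
  have : Nonempty {x | x ∉ S} := ⟨⟨l, hlS⟩⟩
  have h1 := two_mul_loops hG.edge_unique hc
  have h2 := two_mul_loops (hG.edge_unique.quo S) (fun x y => by
    rw [G.quo_conn hS.closed]
    exact hc _ _)
  have h3 : ∀ q, 2 * ((G.keep S).component q).loops + ((G.keep S).component q).numLegs +
      2 * ((G.keep S).component q).numVerts =
      Nat.card {x | Quotient.mk (G.keep S).conn x = q} + 2 := fun q => by
    have : Nonempty {x | Quotient.mk (G.keep S).conn x = q} := by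
      induction q using Quotient.inductionOn with | _ x => exact ⟨⟨x, rfl⟩⟩
    exact two_mul_loops ((hG.keep hS).component q).edge_unique (component_connected _ q)
  -- The Euler relations of the components are added. The half-lines and vertices add up to those of
  -- `G`, the external half-lines of the components are the half-lines of `G/S`, and the components
  -- are the vertices of `G/S`.
  have h4 := Finset.sum_congr (rfl : Finset.univ = Finset.univ) fun q _ => h3 q
  simp only [Finset.sum_add_distrib, ← Finset.mul_sum, Finset.sum_const, smul_eq_mul] at h4
  rw [← card_eq_sum_fiber, ← numVerts_eq_sum, Finset.card_univ, ← Nat.card_eq_fintype_card] at h4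
  have h5 : ∑ q, ((G.keep S).component q).numLegs = Nat.card {x | x ∉ S} := by
    have : Nat.card {x | x ∉ S} = ({x | x ∉ S} : Set α).ncard := Nat.card_coe_set_eq _
    rw [this, ncard_eq_sum_fiber (Quotient.mk (G.keep S).conn)]
    refine Finset.sum_congr rfl fun q _ => ?_
    refine congrArg Set.ncard ?_
    ext x
    refine (restrict_legs _ _ (fun a ha b hab =>
      (G.keep S).component_closed q a ha b (conn_edge hab)) x).trans ?_
    exact keep_legs hS.subset_inner hS.closed _
  have h6 : (G.quo S).numLegs = G.numLegs := by
    have : G.legs = Subtype.val '' (G.quo S).legs := by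
      ext z
      constructor
      · intro hz
        exact ⟨⟨z, fun h => hS.subset_inner h hz⟩, (G.quo_legs hS.closed _).2 hz, rfl⟩
      · rintro ⟨z, hz, rfl⟩
        exact (G.quo_legs hS.closed z).1 hz
    rw [numLegs, numLegs, this, Set.ncard_image_of_injective _ Subtype.val_injective]
  have h7 := numVerts_quo hG hS
  have h8 : (G.keep S).numVerts = G.numVerts := rfl
  omega

theorem quo_connected {G : Graph α} (hc : ∀ x y, G.conn x y) {S : Set α}
    (hS : ∀ x ∈ S, ∀ y, G.edge x y → y ∈ S) (x y) : (G.quo S).conn x y := by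
  rw [G.quo_conn hS]
  exact hc _ _

theorem quo_inner_nonempty {G : Graph α} {S : Set α} (hS : G.IsSub S) (hne : S ≠ G.inner) :
    (G.quo S).inner.Nonempty := by
  obtain ⟨x, hx, hxS⟩ : ∃ x ∈ G.inner, x ∉ S := by
    by_contra h
    push Not at h
    exact hne (Set.Subset.antisymm hS.subset_inner h)
  exact ⟨⟨x, hxS⟩, (G.quo_inner hS.closed _).2 hx⟩

/-- A line outside `S` survives in the contracted graph, which therefore has at least one loop. Now
use additivity. -/
theorem loops_component_lt [Finite α] {G : Graph α} (hG : G.Nice) (hc : ∀ x y, G.conn x y)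
    {S : Set α} (hS : G.IsSub S) (hne : S ≠ G.inner) (q : Quotient (G.keep S).conn) :
    ((G.keep S).component q).loops < G.loops := by
  have := Fintype.ofFinite (Quotient (G.keep S).conn)
  have : Nonempty α := ⟨q.out⟩
  rw [loops_eq_sum hG hc hS]
  have h1 := one_le_loops (hG.quo hS.subset_inner hS.closed) (quo_connected hc hS.closed)
    (quo_inner_nonempty hS hne)
  have h2 := Finset.single_le_sum (f := fun q => ((G.keep S).component q).loops)
    (fun _ _ => Nat.zero_le _) (Finset.mem_univ q)
  omega

theorem contract_isOnePI [Finite α] {G : Graph α} (hG : G.Nice) (hc : ∀ x y, G.conn x y)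
    {S : Set α} (hS : G.IsSub S) (hne : S ≠ G.inner) : (G.contract S).IsOnePI :=
  (G.contractIso S).isOnePI (smooth_isOnePI (hG.quo hS.subset_inner hS.closed)
    (quo_connected hc hS.closed) (quo_inner_nonempty hS hne))

end Graph

/-! ### The convolution product and the Hopf algebra -/

namespace Graph

variable {α : Type} {G : Graph α}

theorem IsOnePI.biv_eq_empty (h : G.IsOnePI) : G.biv = ∅ :=
  Set.eq_empty_of_forall_notMem fun x hx => by
    have h1 := h.three_le_valence x
    have h2 : {y | G.vert x y}.ncard = 2 := hx
    omega

theorem keep_inner_eq (G : Graph α) : G.keep G.inner = G := by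
  refine Graph.ext rfl (Setoid.ext fun x y => ⟨fun h => onSet_le _ _ h, fun h => ?_⟩)
  by_cases hxy : x = y
  · exact Or.inl hxy
  · exact Or.inr ⟨mem_inner.2 ⟨y, h, fun e => hxy e.symm⟩,
      mem_inner.2 ⟨x, G.edge.symm h, hxy⟩, h⟩

theorem isSub_empty (G : Graph α) : G.IsSub ∅ :=
  ⟨fun x hx => hx.elim, fun x hx => hx.elim, fun C _ x hx y hy hxy => by
    rcases hxy with rfl | ⟨hx, _⟩
    · exact absurd hx hy
    · exact hx.elim⟩

theorem Nice.isSub_inner (h : G.Nice) : G.IsSub G.inner :=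
  ⟨fun _ hx => hx, fun x hx y hxy => by
    obtain ⟨z, hz, hzx⟩ := mem_inner.1 hx
    by_cases hy : y = x
    · rwa [hy]
    · exact mem_inner.2 ⟨x, G.edge.symm hxy, fun e => hy e.symm⟩,
    by rw [keep_inner_eq]; exact h.bridgeless⟩

/-- Contracting nothing changes nothing. -/
def quoEmptyIso (G : Graph α) : Iso (G.quo ∅) G where
  toEquiv := Equiv.subtypeUnivEquiv fun x => Set.notMem_empty x
  vert_iff x y := by
    refine ⟨fun h => conn_vert h, fun h => ?_⟩
    refine sup_closed (C := {z | G.vert x z}) (fun a b hab ha => G.vert.trans ha hab) ?_ h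
      (G.vert.refl _)
    rintro a b (rfl | ⟨ha, _⟩) h'
    · exact h'
    · exact ha.elim
  edge_iff _ _ := Iff.rfl

end Graph

section Laws

variable {A B : Type} [CommRing A] [CommRing B]

theorem evalGraph_congr {α : Type} [Finite α] {f g : GraphClass → A} {G : Graph α}
    (h : ∀ hG : G.IsOnePI, f (classOf G hG) = g (classOf G hG)) :
    evalGraph f G = evalGraph g G := by
  by_cases hG : G.IsOnePI
  · rw [evalGraph_of_isOnePI f hG, evalGraph_of_isOnePI g hG, h hG]
  · rw [evalGraph_of_not f hG, evalGraph_of_not g hG]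

theorem map_evalGraph {α : Type} [Finite α] (φ : A →+* B) (f : GraphClass → A) (G : Graph α) :
    φ (evalGraph f G) = evalGraph (fun c => φ (f c)) G := by
  by_cases hG : G.IsOnePI
  · rw [evalGraph_of_isOnePI _ hG, evalGraph_of_isOnePI _ hG]
  · rw [evalGraph_of_not _ hG, evalGraph_of_not _ hG, map_one]

theorem map_evalSub {α : Type} [Fintype α] (φ : A →+* B) (f : GraphClass → A) (G : Graph α)
    (S : Set α) : φ (evalSub f G S) = evalSub (fun c => φ (f c)) G S := by
  rw [evalSub, map_prod]
  exact Finset.prod_congr rfl fun q _ => map_evalGraph φ f _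

theorem loops_classOf {α : Type} [Finite α] {G : Graph α} (h : G.IsOnePI) :
    (classOf G h).rep.graph.loops = G.loops := (repIso G h).loops_eq

theorem mem_properSubs {α : Type} [Fintype α] {G : Graph α} {S : Set α} :
    S ∈ properSubs G ↔ G.IsProperSub S := by simp [properSubs]

/-- The empty subgraph contributes `b c`, the full one `a c`, and the proper ones the sum in the
coproduct. -/
theorem conv_eq (a b : GraphClass → A) (c : GraphClass) :
    conv a b c = a c + b c + ∑ S ∈ properSubs c.rep.graph,
      evalSub a c.rep.graph S * evalGraph b (c.rep.graph.contract S) := by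
  classical
  set G := c.rep.graph with hGdef
  have hG : G.IsOnePI := c.rep.isOnePI
  have hN := hG.nice
  have hc := hG.connected
  have hi := hG.inner_nonempty
  have hval : ∀ (f : GraphClass → A) S, value f (G.keep S) = prodVal f (G.keep S) := fun f S =>
    value_of_biv_eq_empty f hG.biv_eq_empty
  have hev : ∀ f : GraphClass → A, evalGraph f G = f c := fun f => by
    rw [evalGraph_of_isOnePI f hG]
    exact congrArg f (classOf_rep c)
  have hset : (Finset.univ.filter fun S => G.IsSub S) =
      insert ∅ (insert G.inner (properSubs G)) := by
    ext S
    simp only [Finset.mem_filter, Finset.mem_univ, true_and, Finset.mem_insert, mem_properSubs,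
      Graph.isProperSub_iff hG]
    constructor
    · intro h
      rcases S.eq_empty_or_nonempty with h1 | h1
      · exact Or.inl h1
      · by_cases h2 : S = G.inner
        · exact Or.inr (Or.inl h2)
        · exact Or.inr (Or.inr ⟨h, h1, h2⟩)
    · rintro (rfl | rfl | h)
      · exact G.isSub_empty
      · exact hN.isSub_inner
      · exact h.1
  have h1 : conv a b c = ∑ S ∈ Finset.univ.filter (fun S => G.IsSub S),
      value a (G.keep S) * value b (G.quo S) := by
    have : Fintype {S // G.IsSub S} := Fintype.ofFinite _
    rw [conv, convSum, finsum_eq_sum_of_fintype]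
    exact (Finset.sum_subtype _ (by simp) fun S => value a (G.keep S) * value b (G.quo S)).symm
  rw [h1, hset, Finset.sum_insert, Finset.sum_insert, add_comm (a c), add_assoc]
  · congr 1
    · rw [value_eq_one a, value_iso b G.quoEmptyIso, value_of_biv_eq_empty b hG.biv_eq_empty,
        prodVal_of_connected b hc, hev, one_mul]
      rintro x y (h | ⟨h, _⟩)
      · exact h.symm
      · exact h.elim
    · congr 1
      · rw [G.keep_inner_eq, value_of_biv_eq_empty a hG.biv_eq_empty, prodVal_of_connected a hc,
          hev,
          value_eq_one, mul_one]
        exact fun x y h => Subtype.ext (Graph.not_mem_inner.1 x.2 y h)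
      · refine Finset.sum_congr rfl fun S hS => ?_
        rw [mem_properSubs, Graph.isProperSub_iff hG] at hS
        rw [hval, evalSub_eq, evalGraph_contract b hc hS.1.closed]
  · simp [mem_properSubs, Graph.isProperSub_iff hG]
  · simp only [Finset.mem_insert, mem_properSubs, Graph.isProperSub_iff hG]
    rintro (h | h)
    · exact hi.ne_empty h.symm
    · exact h.2.1.ne_empty rfl

theorem evalSub_eq_zero {a : GraphClass → A} {c : GraphClass} {S : Set (Fin c.rep.size)}
    (hS : S ∈ properSubs c.rep.graph)
    (ha : ∀ c', c'.rep.graph.loops < c.rep.graph.loops → a c' = 0) :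
    evalSub a c.rep.graph S = 0 := by
  rw [mem_properSubs] at hS
  obtain ⟨x, hx⟩ := hS.nonempty
  have h := hS.component_isOnePI x hx
  classical
  refine Finset.prod_eq_zero (i := Quotient.mk _ x) (Finset.mem_univ _) ?_
  rw [evalGraph_of_isOnePI a h]
  refine ha _ ?_
  rw [loops_classOf]
  exact Graph.loops_component_lt c.rep.isOnePI.nice c.rep.isOnePI.connected
    ((Graph.isProperSub_iff c.rep.isOnePI).1 hS).1 hS.ne_inner _

/-- The function `0` on connected graphs is the counit: its multiplicative extension is `1` on the
graph without lines. Hence it is a unit for the convolution product. -/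
theorem conv_zero_left (b : GraphClass → A) : conv 0 b = b := by
  funext c
  rw [conv_eq, Finset.sum_eq_zero, add_zero, Pi.zero_apply, zero_add]
  intro S hS
  rw [evalSub_eq_zero (a := 0) hS fun _ _ => rfl, zero_mul]

theorem conv_zero_right (a : GraphClass → A) : conv a 0 = a := by
  funext c
  rw [conv_eq, Finset.sum_eq_zero, add_zero, Pi.zero_apply, add_zero]
  intro S hS
  rw [mem_properSubs] at hS
  rw [evalGraph_of_isOnePI, Pi.zero_apply, mul_zero]
  exact Graph.contract_isOnePI c.rep.isOnePI.nice c.rep.isOnePI.connected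
    ((Graph.isProperSub_iff c.rep.isOnePI).1 hS).1 hS.ne_inner

/-- An algebra homomorphism on `H ⊗ H`, composed with the coproduct, is a convolution product. -/
theorem map_coproduct_X [Algebra ℂ A] (φ : H ⊗[ℂ] H →ₐ[ℂ] A) (c : GraphClass) :
    φ (coproduct (MvPolynomial.X c)) =
      conv (fun c => φ (MvPolynomial.X c ⊗ₜ 1)) (fun c => φ (1 ⊗ₜ MvPolynomial.X c)) c := by
  rw [coproduct, MvPolynomial.aeval_X, conv_eq, map_add, map_add, map_sum]
  congr 1
  refine Finset.sum_congr rfl fun S _ => ?_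
  have h1 := map_evalSub ((φ.comp Algebra.TensorProduct.includeLeft : H →ₐ[ℂ] A) : H →+* A)
    MvPolynomial.X c.rep.graph S
  have h2 := map_evalGraph ((φ.comp Algebra.TensorProduct.includeRight : H →ₐ[ℂ] A) : H →+* A)
    MvPolynomial.X (c.rep.graph.contract S)
  simp only [RingHom.coe_coe, AlgHom.comp_apply, Algebra.TensorProduct.includeLeft_apply,
    Algebra.TensorProduct.includeRight_apply] at h1 h2
  rw [← h1, ← h2, ← map_mul, Algebra.TensorProduct.tmul_mul_tmul, mul_one, one_mul]

/-- The recursion depth is irrelevant as soon as it reaches the loop number, because components of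
proper subgraphs have fewer loops. -/
theorem antipodeAux_congr (n : ℕ) : ∀ (m : ℕ) (c : GraphClass), c.rep.graph.loops ≤ n →
    c.rep.graph.loops ≤ m → antipodeAux n c = antipodeAux m c := by
  induction n with
  | zero =>
    intro m c h
    have := c.rep.isOnePI.not_tree
    omega
  | succ n ih =>
    intro m c hn hm
    have h0 := c.rep.isOnePI.not_tree
    obtain ⟨m, rfl⟩ : ∃ k, m = k + 1 := ⟨m - 1, by omega⟩
    rw [antipodeAux, antipodeAux]
    congr 1
    refine Finset.sum_congr rfl fun S hS => ?_
    congr 1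
    refine Finset.prod_congr rfl fun q _ => evalGraph_congr fun hq => ?_
    rw [mem_properSubs] at hS
    have := Graph.loops_component_lt c.rep.isOnePI.nice c.rep.isOnePI.connected
      ((Graph.isProperSub_iff c.rep.isOnePI).1 hS).1 hS.ne_inner q
    refine ih m _ ?_ ?_ <;> rw [loops_classOf] <;> omega

theorem antipode_X (c : GraphClass) : antipode (MvPolynomial.X c) = -MvPolynomial.X c -
    ∑ S ∈ properSubs c.rep.graph, evalSub (fun c => antipode (MvPolynomial.X c)) c.rep.graph S *
      evalGraph MvPolynomial.X (c.rep.graph.contract S) := by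
  have h0 : ∀ c, antipode (MvPolynomial.X c) = antipodeAux c.rep.graph.loops c := fun c =>
    MvPolynomial.aeval_X _ _
  rw [h0, antipodeAux_congr _ (c.rep.graph.loops + 1) c le_rfl (Nat.le_succ _), antipodeAux]
  congr 1
  refine Finset.sum_congr rfl fun S hS => ?_
  congr 1
  refine Finset.prod_congr rfl fun q _ => evalGraph_congr fun hq => ?_
  rw [mem_properSubs] at hS
  have := Graph.loops_component_lt c.rep.isOnePI.nice c.rep.isOnePI.connected
    ((Graph.isProperSub_iff c.rep.isOnePI).1 hS).1 hS.ne_inner q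
  rw [h0]
  refine antipodeAux_congr _ _ _ ?_ ?_ <;> rw [loops_classOf]
  omega

theorem conv_antipode_X : conv (fun c => antipode (MvPolynomial.X c)) MvPolynomial.X = 0 := by
  funext c
  rw [conv_eq, antipode_X, Pi.zero_apply]
  ring

/-- With `D = X * S` and `S * X = 0`, the unit, associativity gives `D * X = X`. In this equation
the value of `D` on a graph is determined by its values on graphs with fewer loops, so `D = 0` by
induction. -/
theorem conv_X_antipode : conv MvPolynomial.X (fun c => antipode (MvPolynomial.X c)) = 0 := by
  set D := conv MvPolynomial.X (fun c => antipode (MvPolynomial.X c)) with hD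
  have h : conv D MvPolynomial.X = MvPolynomial.X := by
    rw [hD, conv_assoc, conv_antipode_X, conv_zero_right]
  suffices ∀ n c, c.rep.graph.loops = n → D c = 0 from funext fun c => this _ c rfl
  intro n
  induction n using Nat.strong_induction_on with
  | _ n ih =>
    intro c hc
    have h1 := congrFun h c
    rw [conv_eq, Finset.sum_eq_zero, add_zero] at h1
    · simpa using h1
    · intro S hS
      rw [evalSub_eq_zero hS fun c' hc' => ih _ (hc ▸ hc') c' rfl, zero_mul]

theorem mul'_comp_rTensor [Algebra ℂ A] (S : A →ₐ[ℂ] A) :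
    LinearMap.mul' ℂ A ∘ₗ S.toLinearMap.rTensor A =
    (Algebra.TensorProduct.productMap S (.id ℂ A)).toLinearMap :=
  TensorProduct.ext' fun x y => by simp

theorem mul'_comp_lTensor [Algebra ℂ A] (S : A →ₐ[ℂ] A) :
    LinearMap.mul' ℂ A ∘ₗ S.toLinearMap.lTensor A =
    (Algebra.TensorProduct.productMap (.id ℂ A) S).toLinearMap :=
  TensorProduct.ext' fun x y => by simp

theorem counit_X (c : GraphClass) : counit (MvPolynomial.X c) = 0 := MvPolynomial.aeval_X _ _

theorem hopfLaws : HopfLaws coproduct counit antipode.toLinearMap where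
  coassoc := by
    -- The three embeddings of `H` into the triple tensor product are characters. The two sides of
    -- coassociativity are their convolution products with the two bracketings.
    let ι₁ : GraphClass → H ⊗[ℂ] (H ⊗[ℂ] H) := fun c => MvPolynomial.X c ⊗ₜ (1 ⊗ₜ 1)
    let ι₂ : GraphClass → H ⊗[ℂ] (H ⊗[ℂ] H) := fun c => 1 ⊗ₜ (MvPolynomial.X c ⊗ₜ 1)
    let ι₃ : GraphClass → H ⊗[ℂ] (H ⊗[ℂ] H) := fun c => 1 ⊗ₜ (1 ⊗ₜ MvPolynomial.X c)
    refine MvPolynomial.algHom_ext fun c => ?_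
    have hl := map_coproduct_X (A := H ⊗[ℂ] (H ⊗[ℂ] H))
        ((Algebra.TensorProduct.assoc ℂ ℂ ℂ H H H).toAlgHom.comp
      (Algebra.TensorProduct.map coproduct (.id ℂ H))) c
    have hr := map_coproduct_X (A := H ⊗[ℂ] (H ⊗[ℂ] H))
      (Algebra.TensorProduct.map (.id ℂ H) coproduct) c
    have hl' : ∀ c, (Algebra.TensorProduct.assoc ℂ ℂ ℂ H H H) (coproduct (MvPolynomial.X c) ⊗ₜ 1) =
        conv ι₁ ι₂ c := fun c =>
      map_coproduct_X (A := H ⊗[ℂ] (H ⊗[ℂ] H))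
        ((Algebra.TensorProduct.assoc ℂ ℂ ℂ H H H).toAlgHom.comp
        Algebra.TensorProduct.includeLeft) c
    have hr' : ∀ c, (1 : H) ⊗ₜ[ℂ] coproduct (MvPolynomial.X c) = conv ι₂ ι₃ c := fun c =>
      map_coproduct_X (A := H ⊗[ℂ] (H ⊗[ℂ] H))
        (Algebra.TensorProduct.includeRight : H ⊗[ℂ] H →ₐ[ℂ] H ⊗[ℂ] (H ⊗[ℂ] H)) c
    refine hl.trans (Eq.trans ?_ hr.symm)
    simp only [AlgHom.comp_apply, Algebra.TensorProduct.map_tmul, AlgHom.id_apply, map_one,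
      AlgEquiv.toAlgHom_apply]
    simp only [hl', hr', Algebra.TensorProduct.one_def, Algebra.TensorProduct.assoc_tmul]
    exact congrFun (conv_assoc ι₁ ι₂ ι₃) c
  counit_left := by
    refine MvPolynomial.algHom_ext fun c => ?_
    refine (map_coproduct_X (Algebra.TensorProduct.map counit (.id ℂ H)) c).trans ?_
    simp only [Algebra.TensorProduct.map_tmul, counit_X, TensorProduct.zero_tmul]
    refine (congrFun (conv_zero_left _) c).trans ?_
    simp
  counit_right := by
    refine MvPolynomial.algHom_ext fun c => ?_
    refine (map_coproduct_X (Algebra.TensorProduct.map (.id ℂ H) counit) c).trans ?_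
    simp only [Algebra.TensorProduct.map_tmul, counit_X, TensorProduct.tmul_zero]
    refine (congrFun (conv_zero_right _) c).trans ?_
    simp
  antipode_left := by
    rw [← LinearMap.comp_assoc, mul'_comp_rTensor]
    have : (Algebra.TensorProduct.productMap antipode (.id ℂ H)).comp coproduct =
        (Algebra.ofId ℂ H).comp counit := by
      refine MvPolynomial.algHom_ext fun c => ?_
      refine (map_coproduct_X (Algebra.TensorProduct.productMap antipode (.id ℂ H)) c).trans ?_
      simp only [Algebra.TensorProduct.productMap_apply_tmul, map_one, mul_one, one_mul,
        AlgHom.id_apply, AlgHom.comp_apply, counit_X, map_zero]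
      exact congrFun conv_antipode_X c
    exact LinearMap.ext fun x => congrArg (fun f : H →ₐ[ℂ] H => f x) this
  antipode_right := by
    rw [← LinearMap.comp_assoc, mul'_comp_lTensor]
    have : (Algebra.TensorProduct.productMap (.id ℂ H) antipode).comp coproduct =
        (Algebra.ofId ℂ H).comp counit := by
      refine MvPolynomial.algHom_ext fun c => ?_
      refine (map_coproduct_X (Algebra.TensorProduct.productMap (.id ℂ H) antipode) c).trans ?_
      simp only [Algebra.TensorProduct.productMap_apply_tmul, map_one, mul_one, one_mul,
        AlgHom.id_apply, AlgHom.comp_apply, counit_X, map_zero]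
      exact congrFun conv_X_antipode c
    exact LinearMap.ext fun x => congrArg (fun f : H →ₐ[ℂ] H => f x) this

end Laws

/-! ### Sums over graphs with marked external lines -/

section Sums

instance (β : Type) [Finite β] : Finite (Graph β) := by
  refine Finite.of_injective
    (fun G : Graph β => (({p | G.vert p.1 p.2}, {p | G.edge p.1 p.2}) : Set (β × β) × Set (β × β)))
    fun G G' h => ?_
  rw [Prod.mk.injEq] at h
  exact Graph.ext (Setoid.ext fun x y => Set.ext_iff.1 h.1 (x, y))
    (Setoid.ext fun x y => Set.ext_iff.1 h.2 (x, y))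

instance (β : Type) [Finite β] : Fintype (Graph β) := Fintype.ofFinite _

instance {α β : Type} [Finite α] [Finite β] (G : Graph α) (G' : Graph β) :
    Finite (Graph.Iso G G') :=
  Finite.of_injective Graph.Iso.toEquiv fun e e' h => by
    cases e; cases e'; cases h; rfl

/-- Connected graphs without bridges with the set `E` of external lines. -/
structure Graph.Marked {β : Type} (E : Set β) (G : Graph β) : Prop where
  nice : G.Nice
  connected : ∀ x y, G.conn x y
  legs_eq : G.legs = E

theorem Graph.Marked.iso {β β' : Type} {E : Set β} {E' : Set β'} {G : Graph β} {G' : Graph β'}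
    (h : G.Marked E) (e : Graph.Iso G G') (he : ∀ x, e.toEquiv x ∈ E' ↔ x ∈ E) : G'.Marked E' where
  nice := e.nice h.nice
  connected x y := by
    obtain ⟨x, rfl⟩ := e.toEquiv.surjective x
    obtain ⟨y, rfl⟩ := e.toEquiv.surjective y
    exact e.conn_of (h.connected x y)
  legs_eq := by
    ext x
    obtain ⟨x, rfl⟩ := e.toEquiv.surjective x
    rw [e.mem_legs, he, h.legs_eq]

theorem Graph.IsOnePI.marked {β : Type} [Finite β] {G : Graph β} (h : G.IsOnePI) :
    G.Marked G.legs := ⟨h.nice, h.connected, rfl⟩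

variable {R : Type} [CommRing R]

/-- A function of graphs with values in `R`. -/
abbrev GraphFun (R : Type) : Type 1 := ∀ β : Type, [Finite β] → Graph β → R

/-- Invariance under isomorphism. -/
def Invariant (Φ : GraphFun R) : Prop :=
  ∀ {β β' : Type} [Finite β] [Finite β'] {G : Graph β} {G' : Graph β'},
    Graph.Iso G G' → Φ β G = Φ β' G'

open Classical in
/-- The sum of `Φ` over the connected bridgeless graphs on `β` with the set `E` of external
lines. -/
def gsum (Φ : GraphFun R) {β : Type} [Finite β] (E : Set β) : R :=
  ∑ G : Graph β with G.Marked E, Φ β G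

theorem gsum_equiv {Φ : GraphFun R} (hΦ : Invariant Φ) {β β' : Type} [Finite β] [Finite β']
    {E : Set β} {E' : Set β'} (e : β ≃ β') (he : ∀ x, e x ∈ E' ↔ x ∈ E) :
    gsum Φ E = gsum Φ E' := by
  classical
  refine Finset.sum_bij' (fun G _ => G.transport e) (fun G _ => G.transport e.symm) ?_ ?_ ?_ ?_ ?_
  · intro G hG
    rw [Finset.mem_filter] at hG ⊢
    exact ⟨Finset.mem_univ _, hG.2.iso (G.isoTransport e) he⟩
  · intro G hG
    rw [Finset.mem_filter] at hG ⊢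
    exact ⟨Finset.mem_univ _, hG.2.iso (G.isoTransport e.symm) fun x => by
      rw [← he]
      exact iff_of_eq (congrArg (· ∈ E') (e.apply_symm_apply x))⟩
  · intro G _
    refine Graph.ext (Setoid.ext fun x y => ?_) (Setoid.ext fun x y => ?_)
    · exact iff_of_eq (congrArg₂ G.vert (e.symm_apply_apply x) (e.symm_apply_apply y))
    · exact iff_of_eq (congrArg₂ G.edge (e.symm_apply_apply x) (e.symm_apply_apply y))
  · intro G _
    refine Graph.ext (Setoid.ext fun x y => ?_) (Setoid.ext fun x y => ?_)
    · exact iff_of_eq (congrArg₂ G.vert (e.apply_symm_apply x) (e.apply_symm_apply y))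
    · exact iff_of_eq (congrArg₂ G.edge (e.apply_symm_apply x) (e.apply_symm_apply y))
  · exact fun G _ => hΦ (G.isoTransport e)

theorem exists_equiv_of_ncard {β β' : Type} [Finite β] [Finite β'] {E : Set β} {E' : Set β'}
    (f : E ≃ E') (h : Eᶜ.ncard = E'ᶜ.ncard) : ∃ e : β ≃ β', ∀ x : E, e x = f x := by
  classical
  have f' : (Eᶜ : Set β) ≃ (E'ᶜ : Set β') :=
    Classical.choice ((Finite.card_eq (α := (Eᶜ : Set β)) (β := (E'ᶜ : Set β'))).1 h)
  refine ⟨(Equiv.Set.sumCompl E).symm.trans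
    ((Equiv.sumCongr f f').trans (Equiv.Set.sumCompl E')), fun x => ?_⟩
  simp [Equiv.Set.sumCompl_symm_apply]

theorem exists_equiv_of_ncard_eq {β β' : Type} [Finite β] [Finite β'] {E : Set β} {E' : Set β'}
    (h : E.ncard = E'.ncard) (h' : Eᶜ.ncard = E'ᶜ.ncard) :
    ∃ e : β ≃ β', ∀ x, e x ∈ E' ↔ x ∈ E := by
  have f : E ≃ E' := Classical.choice ((Finite.card_eq (α := E) (β := E')).1 h)
  obtain ⟨e, he⟩ := exists_equiv_of_ncard f h'
  refine ⟨e, fun x => ⟨fun hx => ?_, fun hx => ?_⟩⟩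
  · have h1 := he (f.symm ⟨e x, hx⟩)
    rw [f.apply_symm_apply] at h1
    exact e.injective h1 ▸ (f.symm ⟨e x, hx⟩).2
  · rw [he ⟨x, hx⟩]
    exact (f _).2

theorem gsum_eq {Φ : GraphFun R} (hΦ : Invariant Φ) {β β' : Type} [Finite β] [Finite β']
    {E : Set β} {E' : Set β'} (h : E.ncard = E'.ncard) (h' : Eᶜ.ncard = E'ᶜ.ncard) :
    gsum Φ E = gsum Φ E' := by
  obtain ⟨e, he⟩ := exists_equiv_of_ncard_eq h h'
  exact gsum_equiv hΦ e he

/-- The standard set of `n` external lines. -/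
abbrev stdLegs (n N : ℕ) : Set (Fin n ⊕ Fin N) := Set.range Sum.inl

theorem ncard_stdLegs (n N : ℕ) : (stdLegs n N).ncard = n := by
  rw [stdLegs, ← Set.image_univ, Set.ncard_image_of_injective _ Sum.inl_injective, Set.ncard_univ,
    Nat.card_fin]

theorem ncard_stdLegs_compl (n N : ℕ) : (stdLegs n N)ᶜ.ncard = N := by
  rw [stdLegs, Set.compl_range_inl, ← Set.image_univ,
    Set.ncard_image_of_injective _ Sum.inr_injective,
    Set.ncard_univ, Nat.card_fin]

/-- The sum over the graphs with `n` external and `N` internal half-lines. -/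
def gnum (Φ : GraphFun R) (n N : ℕ) : R := gsum Φ (stdLegs n N)

theorem gsum_eq_gnum {Φ : GraphFun R} (hΦ : Invariant Φ) {β : Type} [Finite β] (E : Set β) :
    gsum Φ E = gnum Φ E.ncard Eᶜ.ncard :=
  gsum_eq hΦ (ncard_stdLegs _ _).symm (ncard_stdLegs_compl _ _).symm

open Classical in
/-- The value on 1PI graphs of a function of isomorphism classes, and `0` on other graphs. -/
def onePIVal (ψ : GraphClass → R) : GraphFun R := fun _ _ G =>
  if h : G.IsOnePI then ψ (classOf G h) else 0

theorem onePIVal_of_isOnePI (ψ : GraphClass → R) {β : Type} [Finite β] {G : Graph β}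
    (h : G.IsOnePI) : onePIVal ψ β G = ψ (classOf G h) := dif_pos h

theorem onePIVal_of_not (ψ : GraphClass → R) {β : Type} [Finite β] {G : Graph β}
    (h : ¬ G.IsOnePI) : onePIVal ψ β G = 0 := dif_neg h

end Sums

/-! ### The coefficients of the Green's functions as sums over graphs -/

section Labelled

variable {n l N : ℕ}

/-- The isomorphisms from `G` to a labelled graph which respect the labels. -/
abbrev LabelIso (G : Graph (Fin n ⊕ Fin N)) (Γ : LabelledGraph n l) : Type :=
  {e : Graph.Iso G Γ.graph // ∀ i, e.toEquiv (Sum.inl i) = Γ.label i}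

/-- A graph with standard external lines is a labelled graph. -/
def toLabelled (G : Graph (Fin n ⊕ Fin N)) (h : G.IsOnePI) (hE : G.legs = stdLegs n N)
    (hl : G.loops = l) : LabelledGraph n l where
  size := n + N
  graph := G.transport finSumFinEquiv
  isOnePI := (G.isoTransport _).isOnePI h
  label := Equiv.ofBijective
    (fun i => ⟨finSumFinEquiv (Sum.inl i), by
      refine ((G.isoTransport finSumFinEquiv).mem_legs _).2 ?_
      rw [hE]
      exact ⟨i, rfl⟩⟩) (by
    refine ⟨fun i j h => Sum.inl_injective (finSumFinEquiv.injective (congrArg Subtype.val h)),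
      fun ⟨x, hx⟩ => ?_⟩
    obtain ⟨x, rfl⟩ := finSumFinEquiv.surjective x
    have := ((G.isoTransport finSumFinEquiv).mem_legs x).1 hx
    rw [hE] at this
    obtain ⟨i, rfl⟩ := this
    exact ⟨i, rfl⟩)
  loops_eq := by rw [(G.isoTransport finSumFinEquiv).loops_eq, hl]

theorem mk_toLabelled_eq_iff (G : Graph (Fin n ⊕ Fin N)) (h : G.IsOnePI)
    (hE : G.legs = stdLegs n N) (hl : G.loops = l) (c : LabelledClass n l) :
    (Quotient.mk _ (toLabelled G h hE hl) = c) ↔ Nonempty (LabelIso G c.out) := by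
  constructor
  · intro hc
    rw [← c.out_eq] at hc
    obtain ⟨e, he⟩ := Quotient.exact hc
    exact ⟨(G.isoTransport _).trans e, he⟩
  · rintro ⟨e, he⟩
    rw [← c.out_eq]
    exact Quotient.sound ⟨(G.isoTransport _).symm.trans e, fun i => by
      change e.toEquiv (finSumFinEquiv.symm (finSumFinEquiv (Sum.inl i))) = _
      rw [Equiv.symm_apply_apply, he]⟩

theorem LabelIso.legs_eq {G : Graph (Fin n ⊕ Fin N)} {Γ : LabelledGraph n l}
    (e : LabelIso G Γ) : G.legs = stdLegs n N := by
  ext x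
  rw [← e.1.mem_legs]
  constructor
  · intro h
    obtain ⟨i, hi⟩ := Γ.label.surjective ⟨_, h⟩
    refine ⟨i, e.1.toEquiv.injective ?_⟩
    rw [e.2, hi]
  · rintro ⟨i, rfl⟩
    rw [e.2]
    exact (Γ.label i).2

/-- The label-preserving isomorphisms form a torsor under the automorphisms fixing the external
lines. -/
def LabelIso.autEquiv {G : Graph (Fin n ⊕ Fin N)} {Γ : LabelledGraph n l} (e₀ : LabelIso G Γ) :
    LabelIso G Γ ≃ {e : Graph.Iso Γ.graph Γ.graph // ∀ x ∈ Γ.graph.legs, e.toEquiv x = x} where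
  toFun e := ⟨e₀.1.symm.trans e.1, fun x hx => by
    obtain ⟨i, hi⟩ := Γ.label.surjective ⟨x, hx⟩
    have hi' : (Γ.label i : Fin Γ.size) = x := congrArg Subtype.val hi
    change e.1.toEquiv (e₀.1.toEquiv.symm x) = x
    rw [← hi', ← e₀.2, Equiv.symm_apply_apply, e.2, e₀.2]⟩
  invFun e := ⟨e₀.1.trans e.1, fun i => by
    change e.1.toEquiv (e₀.1.toEquiv _) = _
    rw [e₀.2]
    exact e.2 _ (Γ.label i).2⟩
  left_inv e := by
    refine Subtype.ext ?_
    cases e with | mk e he => cases e; simp [Graph.Iso.trans, Graph.Iso.symm, ← Equiv.trans_assoc]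
  right_inv e := by
    refine Subtype.ext ?_
    cases e with | mk e he => cases e; simp [Graph.Iso.trans, Graph.Iso.symm, ← Equiv.trans_assoc]

/-- The numberings of the half-lines of a labelled graph which respect the labels. -/
abbrev Numbering (N : ℕ) (Γ : LabelledGraph n l) : Type :=
  {e : Fin n ⊕ Fin N ≃ Fin Γ.size // ∀ i, e (Sum.inl i) = Γ.label i}

/-- A numbering is the same as a graph on the standard half-lines with an isomorphism. -/
def numberingEquiv (N : ℕ) (Γ : LabelledGraph n l) :
    Numbering N Γ ≃ Σ G : Graph (Fin n ⊕ Fin N), LabelIso G Γ where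
  toFun e := ⟨Γ.graph.transport e.1.symm, ⟨e.1, fun _ _ => Iff.rfl, fun _ _ => Iff.rfl⟩, e.2⟩
  invFun p := ⟨p.2.1.toEquiv, p.2.2⟩
  left_inv _ := rfl
  right_inv p := by
    obtain ⟨G, ⟨e, hv, he⟩, hl⟩ := p
    obtain rfl : G = Γ.graph.transport e.symm :=
      Graph.ext (Setoid.ext fun x y => (hv x y).symm) (Setoid.ext fun x y => (he x y).symm)
    rfl

theorem ncard_legs_labelled (Γ : LabelledGraph n l) : Γ.graph.legs.ncard = n := by
  rw [← Nat.card_coe_set_eq, ← Nat.card_congr Γ.label, Nat.card_fin]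

/-- Relative to one numbering, all others are permutations of the `N` internal half-lines. -/
theorem card_numbering (Γ : LabelledGraph n l) (h : Γ.size = n + N) :
    Nat.card (Numbering N Γ) = N.factorial := by
  classical
  obtain ⟨e₁, he₁⟩ : ∃ e : Fin n ⊕ Fin N ≃ Fin Γ.size, ∀ i, e (Sum.inl i) = Γ.label i := by
    have hc : (stdLegs n N)ᶜ.ncard = Γ.graph.legsᶜ.ncard := by
      have := Set.ncard_add_ncard_compl Γ.graph.legs
      rw [ncard_legs_labelled, Nat.card_fin] at this
      rw [ncard_stdLegs_compl]
      omega
    obtain ⟨e, he⟩ := exists_equiv_of_ncard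
      ((Equiv.ofInjective _ Sum.inl_injective).symm.trans Γ.label) hc
    refine ⟨e, fun i => (he ⟨_, i, rfl⟩).trans ?_⟩
    rw [Equiv.trans_apply]
    congr 2
    exact Equiv.ofInjective_symm_apply Sum.inl_injective i
  let F : Numbering N Γ ≃ {σ : Equiv.Perm (Fin n ⊕ Fin N) //
      ∀ x, ¬ (x ∈ (stdLegs n N)ᶜ) → σ x = x} :=
    { toFun := fun e => ⟨e.1.trans e₁.symm, fun x hx => by
        obtain ⟨i, rfl⟩ := not_not.1 hx
        simp [e.2, ← he₁]⟩
      invFun := fun σ => ⟨σ.1.trans e₁, fun i => by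
        have := σ.2 (Sum.inl i) (not_not.2 ⟨i, rfl⟩)
        simp [this, he₁]⟩
      left_inv := fun e => Subtype.ext (by ext; simp)
      right_inv := fun σ => Subtype.ext (by ext x; simp) }
  rw [Nat.card_congr F, ← Nat.card_congr (Equiv.Perm.subtypeEquivSubtypePerm _), Nat.card_perm]
  congr 1
  exact ncard_stdLegs_compl n N

open Classical in
-- Orbit counting: the `N!` numberings are sorted by the graph which they induce on the standard
-- half-lines, and each such graph arises from as many numberings as there are automorphisms.
theorem card_labelIso_mul (Γ : LabelledGraph n l) (h : Γ.size = n + N) :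
    (Finset.univ.filter fun G : Graph (Fin n ⊕ Fin N) => Nonempty (LabelIso G Γ)).card *
      Γ.graph.symFactor = N.factorial := by
  rw [← card_numbering Γ h, Nat.card_congr (numberingEquiv N Γ), Nat.card_sigma,
    Finset.card_eq_sum_ones, Finset.sum_mul, Finset.sum_filter]
  refine Finset.sum_congr rfl fun G _ => ?_
  split_ifs with hG
  · obtain ⟨e₀⟩ := hG
    rw [one_mul, Nat.card_congr e₀.autEquiv]
    rfl
  · have : IsEmpty (LabelIso G Γ) := not_nonempty_iff.1 hG
    exact Nat.card_of_isEmpty.symm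

end Labelled

section LabelledSum

variable {R : Type} [CommRing R] {n l : ℕ}

theorem classOf_eq_mk {α : Type} [Finite α] {G : Graph α} (h : G.IsOnePI) (Γ : OnePIGraph)
    (e : Graph.Iso G Γ.graph) : classOf G h = Quotient.mk _ Γ :=
  Quotient.sound ⟨(G.isoTransport _).symm.trans e⟩

open Classical in
-- A 1PI graph on the standard half-lines with `l` loops belongs to exactly one labelled class. All
-- other graphs contribute zero to both sides.
theorem sum_labelIso (ψ : GraphClass → R) (N : ℕ) [Fintype (LabelledClass n l)] :
    gnum (onePIVal fun c => if c.rep.graph.loops = l then ψ c else 0) n N =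
      ∑ c : LabelledClass n l,
        (Finset.univ.filter fun G : Graph (Fin n ⊕ Fin N) => Nonempty (LabelIso G c.out)).card •
          ψ (Quotient.mk _ c.out.toOnePIGraph) := by
  have h1 : ∀ G : Graph (Fin n ⊕ Fin N), (if G.Marked (stdLegs n N) then
      onePIVal (fun c => if c.rep.graph.loops = l then ψ c else 0) _ G else 0) =
      ∑ c : LabelledClass n l, if Nonempty (LabelIso G c.out) then
        ψ (Quotient.mk _ c.out.toOnePIGraph) else 0 := by
    intro G
    by_cases h : G.IsOnePI ∧ G.legs = stdLegs n N ∧ G.loops = l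
    · obtain ⟨h, hE, hl⟩ := h
      rw [if_pos (hE ▸ h.marked), onePIVal_of_isOnePI _ h, if_pos ((loops_classOf h).trans hl),
        Finset.sum_eq_single (Quotient.mk _ (toLabelled G h hE hl))]
      · obtain ⟨e⟩ := (mk_toLabelled_eq_iff G h hE hl _).1 rfl
        rw [if_pos ⟨e⟩, classOf_eq_mk h _ e.1]
      · intro c _ hc
        rw [if_neg]
        rw [← mk_toLabelled_eq_iff G h hE hl]
        exact fun h' => hc h'.symm
      · exact fun h => (h (Finset.mem_univ _)).elim
    · rw [Finset.sum_eq_zero]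
      · split_ifs with hm
        · by_cases hG : G.IsOnePI
          · rw [onePIVal_of_isOnePI _ hG, if_neg]
            exact fun hl => h ⟨hG, hm.legs_eq, (loops_classOf hG).symm.trans hl⟩
          · rw [onePIVal_of_not _ hG]
        · rfl
      · intro c _
        rw [if_neg]
        rintro ⟨e⟩
        refine h ⟨e.1.symm.isOnePI c.out.isOnePI, e.legs_eq, ?_⟩
        rw [← e.1.loops_eq, c.out.loops_eq]
  rw [gnum, gsum, Finset.sum_filter, Finset.sum_congr rfl fun G _ => h1 G, Finset.sum_comm]
  refine Finset.sum_congr rfl fun c _ => ?_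
  rw [← Finset.sum_filter, Finset.sum_const]

/-- The sum over isomorphism classes, weighted with symmetry factors, as a sum over all graphs with
numbered half-lines. -/
theorem sum_labelledClass [Algebra ℂ R] (ψ : GraphClass → R) [Fintype (LabelledClass n l)] {B : ℕ}
    (hB : 6 * l + 3 * n < B) :
    ∑ c : LabelledClass n l,
        (1 / (c.out.graph.symFactor : ℂ)) • ψ (Quotient.mk _ c.out.toOnePIGraph) =
      ∑ N ∈ Finset.range B, ((N.factorial : ℂ)⁻¹) •
        gnum (onePIVal fun c => if c.rep.graph.loops = l then ψ c else 0) n N := by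
  classical
  simp only [sum_labelIso, Finset.smul_sum]
  rw [Finset.sum_comm]
  refine Finset.sum_congr rfl fun c _ => ?_
  have hn : n ≤ c.out.size := by
    refine (ncard_legs_labelled c.out).symm.le.trans ?_
    exact (Set.ncard_le_card _).trans_eq (Nat.card_fin _)
  have hsize := c.out.size_le
  -- A class occurs only for one `N`, the number of its internal half-lines, which is below `B` by
  -- `size_le`.
  rw [Finset.sum_eq_single (c.out.size - n)]
  · have h := card_labelIso_mul c.out (N := c.out.size - n) (by omega)
    have hne : ((c.out.size - n).factorial : ℂ) ≠ 0 := Nat.cast_ne_zero.2 (Nat.factorial_ne_zero _)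
    have hS : (c.out.graph.symFactor : ℂ) ≠ 0 := by
      rw [Nat.cast_ne_zero]
      rintro h0
      rw [h0, mul_zero] at h
      exact Nat.factorial_ne_zero _ h.symm
    rw [← Nat.cast_smul_eq_nsmul ℂ, smul_smul]
    congr 1
    rw [← h, Nat.cast_mul] at hne ⊢
    have h1 := left_ne_zero_of_mul hne
    field_simp
  · intro N _ hN
    rw [Finset.filter_eq_empty_iff.2, Finset.card_empty, zero_smul, smul_zero]
    rintro G - ⟨e⟩
    have := Nat.card_congr e.1.toEquiv
    rw [Nat.card_sum, Nat.card_fin, Nat.card_fin, Nat.card_fin] at this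
    omega
  · intro h
    rw [Finset.mem_range] at h
    omega

end LabelledSum

/-! ### Decomposition of graphs with respect to a subgraph -/

namespace Graph

variable {β : Type}

/-- Every vertex has valence at least three. -/
def MinThree (G : Graph β) : Prop := ∀ x, 3 ≤ {y | G.vert x y}.ncard

/-- The graph on `β` with the internal lines of `K` and, on the complement of `S`, the lines
of `G₀`. -/
def glue {S : Set β} (G₀ : Graph {x | x ∉ S}) (K : Graph β) : Graph β where
  vert := K.vert
  edge :=
    { r := fun x y => x = y ∨ (x ∈ S ∧ y ∈ S ∧ K.edge x y) ∨
        ∃ (hx : x ∉ S) (hy : y ∉ S), G₀.edge ⟨x, hx⟩ ⟨y, hy⟩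
      iseqv :=
        { refl := fun _ => Or.inl rfl
          symm := by
            rintro x y (h | ⟨hx, hy, h⟩ | ⟨hx, hy, h⟩)
            · exact Or.inl h.symm
            · exact Or.inr (Or.inl ⟨hy, hx, K.edge.symm h⟩)
            · exact Or.inr (Or.inr ⟨hy, hx, G₀.edge.symm h⟩)
          trans := by
            rintro x y z (rfl | ⟨hx, hy, h⟩ | ⟨hx, hy, h⟩) (rfl | ⟨hy', hz, h'⟩ | ⟨hy', hz, h'⟩)
            · exact Or.inl rfl
            · exact Or.inr (Or.inl ⟨hy', hz, h'⟩)
            · exact Or.inr (Or.inr ⟨hy', hz, h'⟩)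
            · exact Or.inr (Or.inl ⟨hx, hy, h⟩)
            · exact Or.inr (Or.inl ⟨hx, hz, K.edge.trans h h'⟩)
            · exact absurd hy hy'
            · exact Or.inr (Or.inr ⟨hx, hy, h⟩)
            · exact absurd hy' hy
            · exact Or.inr (Or.inr ⟨hx, hz, G₀.edge.trans h h'⟩) } }

theorem glue_edge_iff {S : Set β} {G₀ : Graph {x | x ∉ S}} {K : Graph β} {x y : β} :
    (glue G₀ K).edge x y ↔ x = y ∨ (x ∈ S ∧ y ∈ S ∧ K.edge x y) ∨
        ∃ (hx : x ∉ S) (hy : y ∉ S), G₀.edge ⟨x, hx⟩ ⟨y, hy⟩ := Iff.rfl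

theorem glue_closed {S : Set β} (G₀ : Graph {x | x ∉ S}) (K : Graph β) :
    ∀ x ∈ S, ∀ y, (glue G₀ K).edge x y → y ∈ S := by
  rintro x hx y (rfl | ⟨_, hy, _⟩ | ⟨hx', _⟩)
  · exact hx
  · exact hy
  · exact absurd hx hx'

theorem glue_keep {S : Set β} (G₀ : Graph {x | x ∉ S}) {K : Graph β} (hK : K.legs = Sᶜ) :
    (glue G₀ K).keep S = K := by
  have hmem : ∀ x y, K.edge x y → x ≠ y → x ∈ S := fun x y h hne => by
    by_contra hx
    have : x ∈ K.legs := by rw [hK]; exact hx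
    exact hne (this y h).symm
  refine Graph.ext rfl (Setoid.ext fun x y => ?_)
  change (x = y ∨ (x ∈ S ∧ y ∈ S ∧ (glue G₀ K).edge x y)) ↔ _
  constructor
  · rintro (rfl | ⟨hx, hy, rfl | ⟨_, _, h⟩ | ⟨hx', _⟩⟩)
    · exact K.edge.refl _
    · exact K.edge.refl _
    · exact h
    · exact absurd hx hx'
  · intro h
    by_cases hxy : x = y
    · exact Or.inl hxy
    · have hx := hmem x y h hxy
      have hy := hmem y x (K.edge.symm h) (Ne.symm hxy)
      exact Or.inr ⟨hx, hy, Or.inr (Or.inl ⟨hx, hy, h⟩)⟩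

theorem glue_quo {S : Set β} {G₀ : Graph {x | x ∉ S}} {K : Graph β} (hK : K.legs = Sᶜ)
    (h : Setoid.comap Subtype.val K.conn = G₀.vert) : (glue G₀ K).quo S = G₀ := by
  refine Graph.ext ?_ (Setoid.ext fun x y => ?_)
  · change Setoid.comap Subtype.val ((glue G₀ K).keep S).conn = _
    rw [glue_keep G₀ hK, h]
  · change (glue G₀ K).edge x y ↔ _
    rw [glue_edge_iff]
    constructor
    · rintro (hxy | ⟨hx, _⟩ | ⟨_, _, h⟩)
      · rw [Subtype.ext hxy]
      · exact absurd hx x.2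
      · exact h
    · exact fun h => Or.inr (Or.inr ⟨x.2, y.2, h⟩)

theorem glue_self {S : Set β} {G : Graph β} (hS : ∀ x ∈ S, ∀ y, G.edge x y → y ∈ S) :
    glue (G.quo S) (G.keep S) = G := by
  refine Graph.ext rfl (Setoid.ext fun x y => ?_)
  rw [glue_edge_iff]
  constructor
  · rintro (rfl | ⟨_, _, h⟩ | ⟨_, _, h⟩)
    · exact G.edge.refl _
    · exact onSet_le _ _ h
    · exact h
  · intro h
    by_cases hx : x ∈ S
    · have hy := hS x hx y h
      exact Or.inr (Or.inl ⟨hx, hy, Or.inr ⟨hx, hy, h⟩⟩)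
    · exact Or.inr (Or.inr ⟨hx, not_mem_of_closed hS h hx, h⟩)

/-- The graphs which are contracted to the vertices of `V`. -/
structure Refines (S : Set β) (V : Setoid {x | x ∉ S}) (K : Graph β) : Prop where
  nice : K.Nice
  minThree : K.MinThree
  legs_eq : K.legs = Sᶜ
  comap_conn : Setoid.comap Subtype.val K.conn = V

/-- Bridgelessness of the glued graph follows from that of the subgraph and of the quotient. For
connectedness, each half-line is joined inside `K` to one outside `S`, and these are connected in
the quotient. -/
theorem glue_marked {E S : Set β} (hSE : S ⊆ Eᶜ) {G₀ : Graph {x | x ∉ S}} {K : Graph β}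
    (hG : G₀.Marked (Subtype.val ⁻¹' E)) (hK : K.Refines S G₀.vert) :
    (glue G₀ K).Marked E ∧ (glue G₀ K).IsSub S := by
  have hq := glue_quo hK.legs_eq hK.comap_conn
  have hk := glue_keep G₀ hK.legs_eq
  have hcl := glue_closed G₀ K
  have hin : S ⊆ (glue G₀ K).inner := fun x hx => by
    have h1 : x ∈ K.inner := fun hl => by
      rw [hK.legs_eq] at hl
      exact hl hx
    obtain ⟨y, hy, hne⟩ := mem_inner.1 h1
    rw [← hk] at hy
    exact mem_inner.2 ⟨y, onSet_le _ _ hy, hne⟩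
  have hlegs : (glue G₀ K).legs = E := by
    ext x
    by_cases hx : x ∈ S
    · exact iff_of_false (fun h => hin hx h) fun h => hSE hx h
    · have := quo_legs (glue G₀ K) hcl ⟨x, hx⟩
      rw [hq, hG.legs_eq] at this
      exact this.symm
  have hu : (glue G₀ K).EdgeUnique := by
    rintro x y z hy hz hyx hzx
    rcases hy with rfl | ⟨hx, _, h⟩ | ⟨hx, hy, h⟩
    · exact absurd rfl hyx
    · rcases hz with rfl | ⟨_, _, h'⟩ | ⟨hx', _⟩
      · exact absurd rfl hzx
      · exact hK.nice.edge_unique x y z h h' hyx hzx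
      · exact absurd hx hx'
    · rcases hz with rfl | ⟨hx', _⟩ | ⟨_, _, h'⟩
      · exact absurd rfl hzx
      · exact absurd hx' hx
      · exact congrArg Subtype.val (hG.nice.edge_unique _ _ _ h h'
          (fun e => hyx (congrArg Subtype.val e)) fun e => hzx (congrArg Subtype.val e))
  have hout : ∀ x, ∃ y : {x | x ∉ S}, (glue G₀ K).conn x y := fun x => by
    obtain ⟨y, hy, hxy⟩ := hK.nice.leg x
    rw [hK.legs_eq] at hy
    refine ⟨⟨y, hy⟩, keep_conn_le _ S ?_⟩
    rw [hk]
    exact hxy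
  have hconn : ∀ x y : {x | x ∉ S}, (glue G₀ K).conn x y := fun x y => by
    have := hG.connected x y
    rw [← hq, quo_conn _ hcl] at this
    exact this
  have hc : ∀ x y, (glue G₀ K).conn x y := fun x y => by
    obtain ⟨x', hx⟩ := hout x
    obtain ⟨y', hy⟩ := hout y
    exact (glue G₀ K).conn.trans hx ((glue G₀ K).conn.trans (hconn x' y')
      ((glue G₀ K).conn.symm hy))
  refine ⟨⟨⟨hu, bridgeless_of_quo hu hcl (by rw [hk]; exact hK.nice.bridgeless)
    (by rw [hq]; exact hG.nice.bridgeless), fun x => ?_⟩, hc, hlegs⟩, hin, hcl,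
    by rw [hk]; exact hK.nice.bridgeless⟩
  obtain ⟨y, -⟩ := hout x
  obtain ⟨z, hz, -⟩ := hG.nice.leg y
  rw [hG.legs_eq] at hz
  exact ⟨z, by rw [hlegs]; exact hz, hc _ _⟩

open Classical in
/-- Graphs with a subgraph with the internal lines `S` correspond to pairs consisting of the
contracted graph and the subgraph. -/
theorem sum_isSub {R : Type} [CommRing R] [Finite β] {E S : Set β} (hSE : S ⊆ Eᶜ)
    (f : Graph β → R) (g : Graph {x | x ∉ S} → R) :
    ∑ G : Graph β with (G.Marked E ∧ G.MinThree) ∧ G.IsSub S, f (G.keep S) * g (G.quo S) =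
      ∑ G₀ : Graph {x | x ∉ S} with G₀.Marked (Subtype.val ⁻¹' E),
        g G₀ * ∑ K : Graph β with K.Refines S G₀.vert, f K := by
  simp only [Finset.mul_sum]
  rw [Finset.sum_sigma']
  refine Finset.sum_bij' (fun G _ => ⟨G.quo S, G.keep S⟩) (fun p _ => glue p.1 p.2) ?_ ?_ ?_ ?_ ?_
  · intro G hG
    simp only [Finset.mem_sigma, Finset.mem_filter, Finset.mem_univ, true_and] at hG ⊢
    obtain ⟨⟨hm, h3⟩, hS⟩ := hG
    refine ⟨⟨hm.nice.quo hS.subset_inner hS.closed, quo_connected hm.connected hS.closed, ?_⟩,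
      ⟨hm.nice.keep hS, h3, ?_, rfl⟩⟩
    · ext x
      rw [quo_legs G hS.closed, hm.legs_eq]
      rfl
    · ext x
      rw [keep_legs hS.subset_inner hS.closed]
      rfl
  · rintro ⟨G₀, K⟩ h
    simp only [Finset.mem_sigma, Finset.mem_filter, Finset.mem_univ, true_and] at h ⊢
    obtain ⟨h1, h2⟩ := glue_marked hSE h.1 h.2
    exact ⟨⟨h1, h.2.minThree⟩, h2⟩
  · intro G hG
    simp only [Finset.mem_filter, Finset.mem_univ, true_and] at hG
    exact glue_self hG.2.closed
  · rintro ⟨G₀, K⟩ h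
    simp only [Finset.mem_sigma, Finset.mem_filter, Finset.mem_univ, true_and] at h
    rw [glue_quo h.2.legs_eq h.2.comap_conn, glue_keep G₀ h.2.legs_eq]
  · exact fun G _ => mul_comm _ _

end Graph

/-! ### Graphs with prescribed components -/

section Fibers

variable {β ι : Type}

/-- The equivalence relation with prescribed restrictions to the fibers of a map. -/
def fiberSetoid (q : β → ι) (r : ∀ v, Setoid {x | q x = v}) : Setoid β where
  r x y := ∃ (v : ι) (hx : q x = v) (hy : q y = v), r v ⟨x, hx⟩ ⟨y, hy⟩
  iseqv :=
    { refl := fun x => ⟨q x, rfl, rfl, (r _).refl _⟩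
      symm := fun ⟨v, hx, hy, h⟩ => ⟨v, hy, hx, (r v).symm h⟩
      trans := by
        rintro x y z ⟨v, hx, hy, h⟩ ⟨v', hy', hz, h'⟩
        obtain rfl : v = v' := hy.symm.trans hy'
        exact ⟨v, hx, hz, (r v).trans h h'⟩ }

theorem comap_fiberSetoid (q : β → ι) (r : ∀ v, Setoid {x | q x = v}) (v : ι) :
    Setoid.comap Subtype.val (fiberSetoid q r) = r v := by
  ext ⟨x, hx⟩ ⟨y, hy⟩
  constructor
  · rintro ⟨v', hx', _, h⟩
    obtain rfl : v = v' := hx.symm.trans hx'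
    exact h
  · exact fun h => ⟨v, hx, hy, h⟩

theorem fiberSetoid_comap (q : β → ι) {r : Setoid β} (hr : ∀ x y, r x y → q x = q y) :
    fiberSetoid q (fun _ => Setoid.comap Subtype.val r) = r := by
  ext x y
  exact ⟨fun ⟨_, _, _, h⟩ => h, fun h => ⟨q y, hr x y h, rfl, h⟩⟩

namespace Graph

/-- The graph with prescribed restrictions to the fibers of a map. -/
def assemble (q : β → ι) (F : ∀ v, Graph {x | q x = v}) : Graph β :=
  ⟨fiberSetoid q fun v => (F v).vert, fiberSetoid q fun v => (F v).edge⟩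

theorem assemble_restrict (q : β → ι) (F : ∀ v, Graph {x | q x = v}) (v : ι) :
    (assemble q F).restrict {x | q x = v} = F v :=
  Graph.ext (comap_fiberSetoid q (fun v => (F v).vert) v)
    (comap_fiberSetoid q (fun v => (F v).edge) v)

theorem assemble_conn {q : β → ι} {F : ∀ v, Graph {x | q x = v}} {x y : β}
    (h : (assemble q F).conn x y) : q x = q y := by
  refine sup_closed (C := {z | q x = q z}) ?_ ?_ h rfl
  · rintro a b ⟨v, ha, hb, -⟩ (h : q x = q a)
    exact h.trans (ha.trans hb.symm)
  · rintro a b ⟨v, ha, hb, -⟩ (h : q x = q a)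
    exact h.trans (ha.trans hb.symm)

/-- The components of the graph are the fibers of `q`. -/
structure Fibered (E : Set β) (q : β → ι) (K : Graph β) : Prop where
  nice : K.Nice
  minThree : K.MinThree
  legs_eq : K.legs = E
  conn_iff : ∀ x y, K.conn x y ↔ q x = q y

theorem Fibered.closed {E : Set β} {q : β → ι} {K : Graph β} (h : K.Fibered E q) (v : ι) :
    ∀ x ∈ {x | q x = v}, ∀ y, K.conn x y → y ∈ {x | q x = v} :=
  fun x hx y hxy => ((h.conn_iff x y).1 hxy).symm.trans hx

theorem Fibered.restrict_marked {E : Set β} {q : β → ι} {K : Graph β} (h : K.Fibered E q) (v : ι) :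
    (K.restrict {x | q x = v}).Marked (Subtype.val ⁻¹' E) ∧
      (K.restrict {x | q x = v}).MinThree := by
  have hcl := h.closed v
  refine ⟨⟨h.nice.restrict _ hcl, fun x y => ?_, ?_⟩, fun x => ?_⟩
  · rw [K.restrict_conn _ hcl]
    exact (h.conn_iff x y).2 (x.2.trans y.2.symm)
  · ext x
    rw [K.restrict_legs _ fun x hx y hxy => hcl x hx y (conn_edge hxy), h.legs_eq]
    rfl
  · rw [K.ncard_vert_restrict _ fun x hx y hxy => hcl x hx y (conn_vert hxy)]
    exact h.minThree x

theorem fibered_assemble {E : Set β} {q : β → ι} {F : ∀ v, Graph {x | q x = v}}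
    (h : ∀ v, (F v).Marked (Subtype.val ⁻¹' E) ∧ (F v).MinThree) :
    (assemble q F).Fibered E q := by
  set K := assemble q F with hK
  have hcl : ∀ v, ∀ x ∈ {x | q x = v}, ∀ y, K.conn x y → y ∈ {x | q x = v} :=
    fun v x hx y hxy => (assemble_conn hxy).symm.trans hx
  have hr : ∀ v, K.restrict {x | q x = v} = F v := assemble_restrict q F
  have hconn : ∀ v (x y : {x | q x = v}), (F v).conn x y → K.conn x y := fun v x y h => by
    rw [← hr, K.restrict_conn _ (hcl v)] at h
    exact h
  have hlegs : ∀ v (x : {x | q x = v}), (x : β) ∈ K.legs ↔ x ∈ (F v).legs := fun v x => by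
    rw [← hr, K.restrict_legs _ fun x hx y hxy => hcl v x hx y (conn_edge hxy)]
  refine ⟨⟨?_, ?_, ?_⟩, ?_, ?_, ?_⟩
  · rintro x y z ⟨v, hx, hy, hxy⟩ ⟨v', hx', hz, hxz⟩ hyx hzx
    obtain rfl : v = v' := hx.symm.trans hx'
    exact congrArg Subtype.val ((h v).1.nice.edge_unique _ _ _ hxy hxz
      (fun e => hyx (congrArg Subtype.val e)) fun e => hzx (congrArg Subtype.val e))
  · rintro C hC x hx y hy ⟨v, hxv, hyv, hxy⟩
    obtain ⟨x', hx', y', hy', he, hne⟩ := (h v).1.nice.bridgeless (Subtype.val ⁻¹' C)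
      (fun a ha b hab => hC a ha b ⟨v, a.2, b.2, hab⟩) ⟨x, hxv⟩ hx ⟨y, hyv⟩ hy hxy
    exact ⟨x', hx', y', hy', ⟨v, x'.2, y'.2, he⟩, fun e => hne (Subtype.ext e)⟩
  · intro x
    obtain ⟨y, hy, hxy⟩ := (h (q x)).1.nice.leg ⟨x, rfl⟩
    exact ⟨y, (hlegs _ y).2 hy, hconn _ _ _ hxy⟩
  · intro x
    have := (h (q x)).2 ⟨x, rfl⟩
    rw [← hr, K.ncard_vert_restrict _ fun x hx y hxy => hcl _ x hx y (conn_vert hxy)] at this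
    exact this
  · ext x
    have := hlegs (q x) ⟨x, rfl⟩
    rw [(h (q x)).1.legs_eq] at this
    exact this
  · exact fun x y => ⟨assemble_conn, fun hxy =>
      hconn (q y) ⟨x, hxy⟩ ⟨y, rfl⟩ ((h _).1.connected _ _)⟩

end Graph

open Classical in
/-- The values of a multiplicative function on graphs with vertices of valence at least three. -/
def coreVal {R : Type} [CommRing R] (a : GraphClass → R) : GraphFun R := fun _ _ G =>
  if G.MinThree then evalGraph a G else 0

variable {R : Type} [CommRing R] [Finite β]

theorem Graph.Iso.minThree {α α' : Type} {G : Graph α} {G' : Graph α'} (e : Graph.Iso G G')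
    (h : G.MinThree) : G'.MinThree := fun x => by
  obtain ⟨x, rfl⟩ := e.toEquiv.surjective x
  exact (h x).trans_eq (Graph.Iso.ncard_eq e.toEquiv {y | G.vert x y}
    {y | G'.vert (e.toEquiv x) y} (e.vert_iff x)).symm

theorem coreVal_invariant (a : GraphClass → R) : Invariant (coreVal a) := by
  intro β β' _ _ G G' e
  by_cases h : G.MinThree
  · rw [coreVal, coreVal, if_pos h, if_pos (e.minThree h), evalGraph_iso a e]
  · rw [coreVal, coreVal, if_neg h, if_neg fun h' => h (e.symm.minThree h')]

open Classical in
theorem gsum_coreVal (a : GraphClass → R) (E : Set β) :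
    gsum (coreVal a) E = ∑ G : Graph β with G.Marked E ∧ G.MinThree, evalGraph a G := by
  rw [gsum, ← Finset.filter_filter, Finset.sum_filter _ _ (s := Finset.univ.filter _)]
  rfl

open Classical in
-- A graph whose components are the fibers of `q` is an independent choice of a connected graph on
-- each fiber.
theorem sum_fibered [Fintype ι] (a : GraphClass → R) (E : Set β) (q : β → ι) :
    ∑ K : Graph β with K.Fibered E q, prodVal a K =
      ∏ v, gsum (coreVal a) (Subtype.val ⁻¹' E : Set {x | q x = v}) := by
  simp only [gsum_coreVal]
  rw [Finset.prod_univ_sum]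
  refine Finset.sum_bij' (fun K _ v => K.restrict {x | q x = v})
    (fun F _ => Graph.assemble q F) ?_ ?_ ?_ ?_ ?_
  · intro K hK
    simp only [Finset.mem_filter, Finset.mem_univ, true_and, Fintype.mem_piFinset] at hK ⊢
    exact hK.restrict_marked
  · intro F hF
    simp only [Finset.mem_filter, Finset.mem_univ, true_and, Fintype.mem_piFinset] at hF ⊢
    exact Graph.fibered_assemble hF
  · intro K hK
    simp only [Finset.mem_filter, Finset.mem_univ, true_and] at hK
    exact Graph.ext
      (fiberSetoid_comap q fun x y h => (hK.conn_iff x y).1 (Graph.conn_vert h))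
      (fiberSetoid_comap q fun x y h => (hK.conn_iff x y).1 (Graph.conn_edge h))
  · exact fun F _ => funext fun v => Graph.assemble_restrict q F v
  · intro K hK
    simp only [Finset.mem_filter, Finset.mem_univ, true_and] at hK
    rw [prodVal_partition a q fun x y h => (hK.conn_iff x y).1 h, finprod_eq_prod_of_fintype]
    exact Finset.prod_congr rfl fun v _ =>
      prodVal_of_connected a (hK.restrict_marked v).1.connected

open Classical in
/-- The extension of the map to the classes of `V` by a map on `S`. -/
def extendMap {S : Set β} {V : Setoid {x | x ∉ S}} (f : S → Quotient V) (x : β) : Quotient V :=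
  if h : x ∈ S then f ⟨x, h⟩ else Quotient.mk _ ⟨x, h⟩

omit [Finite β] in
theorem extendMap_coe {S : Set β} {V : Setoid {x | x ∉ S}} (f : S → Quotient V) (x : S) :
    extendMap f x = f x := dif_pos x.2

omit [Finite β] in
theorem extendMap_compl {S : Set β} {V : Setoid {x | x ∉ S}} (f : S → Quotient V)
    (x : {x | x ∉ S}) : extendMap f x = Quotient.mk _ x := dif_neg x.2

omit [Finite β] in
-- Every component of `K` has an external line, that is, a half-line outside `S`. So each half-line
-- in `S` is attached to a well-defined vertex of the contracted graph, and this is the map `f`.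
theorem refines_iff {S : Set β} {V : Setoid {x | x ∉ S}} {K : Graph β} :
    K.Refines S V ↔ ∃ f : S → Quotient V, K.Fibered Sᶜ (extendMap f) := by
  constructor
  · intro h
    have hl : ∀ x, ∃ y : {x | x ∉ S}, K.conn x y := fun x => by
      obtain ⟨y, hy, hxy⟩ := h.nice.leg x
      rw [h.legs_eq] at hy
      exact ⟨⟨y, hy⟩, hxy⟩
    choose l hl using hl
    have hV : ∀ x y : {x | x ∉ S}, K.conn x y ↔ V x y := fun x y => by
      rw [← h.comap_conn]
      rfl
    have hf : ∀ x, extendMap (fun s : S => Quotient.mk V (l s)) x = Quotient.mk V (l x) := by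
      intro x
      by_cases hx : x ∈ S
      · exact extendMap_coe _ ⟨x, hx⟩
      · rw [extendMap_compl _ ⟨x, hx⟩]
        exact Quotient.sound ((hV ⟨x, hx⟩ _).1 (hl x))
    refine ⟨fun s => Quotient.mk _ (l s), h.nice, h.minThree, h.legs_eq, fun x y => ?_⟩
    rw [hf, hf]
    constructor
    · intro hxy
      exact Quotient.sound ((hV _ _).1
        (K.conn.trans (K.conn.symm (hl x)) (K.conn.trans hxy (hl y))))
    · intro hxy
      have h1 : V (l x) (l y) := Quotient.exact hxy
      exact K.conn.trans (hl x) (K.conn.trans ((hV _ _).2 h1) (K.conn.symm (hl y)))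
  · rintro ⟨f, h⟩
    refine ⟨h.nice, h.minThree, h.legs_eq, ?_⟩
    ext x y
    change K.conn x y ↔ _
    rw [h.conn_iff, extendMap_compl, extendMap_compl]
    exact ⟨fun h => Quotient.exact h, fun h => Quotient.sound h⟩

omit [Finite β] in
theorem fibered_unique {S : Set β} {V : Setoid {x | x ∉ S}} {K : Graph β} {f f' : S → Quotient V}
    (h : K.Fibered Sᶜ (extendMap f)) (h' : K.Fibered Sᶜ (extendMap f')) : f = f' := by
  funext s
  obtain ⟨y, hy, hsy⟩ := h.nice.leg s
  rw [h.legs_eq] at hy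
  rw [← extendMap_coe f, ← extendMap_coe f', (h.conn_iff _ _).1 hsy, (h'.conn_iff _ _).1 hsy,
    extendMap_compl f ⟨y, hy⟩, extendMap_compl f' ⟨y, hy⟩]

open Classical in
-- The graphs `K` are sorted by the unique map `f` that distributes `S` among the vertices. For
-- fixed `f` the components are chosen independently, and by invariance only the sizes of the fibers
-- matter.
theorem sum_refines (a : GraphClass → R) {S : Set β} (V : Setoid {x | x ∉ S}) [Fintype S]
    [Fintype (Quotient V)] :
    ∑ K : Graph β with K.Refines S V, prodVal a K = ∑ f : S → Quotient V,
      ∏ v, gnum (coreVal a) {x | Quotient.mk V x = v}.ncard {s | f s = v}.ncard := by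
  have h1 : ∀ f : S → Quotient V,
      ∏ v, gnum (coreVal a) {x | Quotient.mk V x = v}.ncard {s | f s = v}.ncard =
      ∑ K : Graph β, if K.Fibered Sᶜ (extendMap f) then prodVal a K else 0 := by
    intro f
    rw [← Finset.sum_filter, sum_fibered]
    refine Finset.prod_congr rfl fun v _ => ?_
    rw [gsum_eq_gnum (coreVal_invariant a)]
    congr 1
    · refine Set.ncard_congr (fun x _ => ⟨x.1, (extendMap_compl f x).trans (by assumption)⟩)
        (fun x _ => x.2) (fun x y _ _ h => Subtype.ext (congrArg (fun z => (z.1 : β)) h)) ?_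
      rintro ⟨x, hx⟩ hxS
      exact ⟨⟨x, hxS⟩, (extendMap_compl f ⟨x, hxS⟩).symm.trans hx, rfl⟩
    · refine Set.ncard_congr (fun x _ => ⟨x.1, (extendMap_coe f x).trans (by assumption)⟩)
        (fun x _ h => h x.2) (fun x y _ _ h => Subtype.ext (congrArg (fun z => (z.1 : β)) h)) ?_
      rintro ⟨x, hx⟩ hxS
      have hxS' : x ∈ S := not_not.1 hxS
      exact ⟨⟨x, hxS'⟩, (extendMap_coe f ⟨x, hxS'⟩).symm.trans hx, rfl⟩
  rw [Finset.sum_congr rfl fun f _ => h1 f, Finset.sum_comm, Finset.sum_filter]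
  refine Finset.sum_congr rfl fun K _ => ?_
  split_ifs with h
  · obtain ⟨f, hf⟩ := refines_iff.1 h
    rw [Finset.sum_eq_single f, if_pos hf]
    · exact fun f' _ hne => if_neg fun hf' => hne (fibered_unique hf' hf)
    · exact fun h => (h (Finset.mem_univ _)).elim
  · exact (Finset.sum_eq_zero fun f _ => if_neg fun hf => h (refines_iff.2 ⟨f, hf⟩)).symm

end Fibers

/-! ### Exponential sums -/

section Exponential

open Finset

variable {ι R : Type} [Fintype ι] [CommRing R]

theorem sum_functions (F : ι → ℕ → R) (m : ℕ) [DecidableEq ι] :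
    ∑ f : Fin m → ι, ∏ v, F v {s | f s = v}.ncard =
      ∑ k ∈ piAntidiag univ m, (Nat.multinomial univ k : R) * ∏ v, F v (k v) := by
  -- This linear functional replaces a monomial by a product of values of `F`. Applied to the
  -- expansions of the `m`-th power of the sum of the variables over words and over exponents, it
  -- gives the two sides.
  let Λ : MvPolynomial ι R →ₗ[R] R :=
    (MvPolynomial.basisMonomials ι R).constr R fun k => ∏ v, F v (k v)
  have hΛ : ∀ k : ι → ℕ, Λ (∏ v, MvPolynomial.X v ^ k v) = ∏ v, F v (k v) := by
    intro k
    have h1 : ∏ v, (MvPolynomial.X v : MvPolynomial ι R) ^ k v =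
        MvPolynomial.basisMonomials ι R (Finsupp.equivFunOnFinite.symm k) := by
      rw [MvPolynomial.coe_basisMonomials]
      beta_reduce
      rw [MvPolynomial.monomial_eq, Finsupp.prod_fintype]
      · simp
      · simp
    rw [h1, Module.Basis.constr_basis]
    rfl
  have h2 : ∀ f : Fin m → ι, ∏ i, (MvPolynomial.X (f i) : MvPolynomial ι R) =
      ∏ v, MvPolynomial.X v ^ {s | f s = v}.ncard := by
    intro f
    rw [← prod_fiberwise' univ f fun v => (MvPolynomial.X v : MvPolynomial ι R)]
    refine prod_congr rfl fun v _ => ?_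
    rw [prod_const, Set.ncard_eq_toFinset_card']
    congr 2
    ext
    simp
  have h := (Fintype.sum_pow (fun v => (MvPolynomial.X v : MvPolynomial ι R)) m).symm.trans
    (sum_pow_eq_sum_piAntidiag univ (fun v => (MvPolynomial.X v : MvPolynomial ι R)) m)
  have h' := congrArg Λ h
  rw [map_sum, map_sum] at h'
  refine Eq.trans (sum_congr rfl fun f _ => ?_) (h'.trans (sum_congr rfl fun k _ => ?_))
  · rw [h2, hΛ]
  · rw [← nsmul_eq_mul, map_nsmul, hΛ, nsmul_eq_mul]

theorem prod_factorial_smul [Algebra ℂ R] (F : ι → ℕ → R) {m : ℕ} {k : ι → ℕ}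
    (hk : ∑ v, k v = m) : ∏ v, (((k v).factorial : ℂ)⁻¹ • F v (k v)) =
      ((m.factorial : ℂ)⁻¹) • ((Nat.multinomial univ k : R) * ∏ v, F v (k v)) := by
  have h := Nat.multinomial_spec univ k
  rw [hk] at h
  have h1 : (m.factorial : ℂ) ≠ 0 := Nat.cast_ne_zero.2 (Nat.factorial_ne_zero _)
  have h2 : ((m.factorial : ℂ)⁻¹) * (Nat.multinomial univ k : ℂ) =
      ∏ v, ((k v).factorial : ℂ)⁻¹ := by
    rw [prod_inv_distrib, ← Nat.cast_prod]
    rw [← h, Nat.cast_mul] at h1 ⊢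
    have h3 := left_ne_zero_of_mul h1
    have h4 := right_ne_zero_of_mul h1
    field_simp
  rw [prod_smul, ← h2, mul_smul, ← nsmul_eq_mul, ← Nat.cast_smul_eq_nsmul ℂ]

/-- The exponential formula: a product of exponential generating functions counts distributions of
`m` marked objects among the indices. The hypothesis `hF` makes the generating functions
polynomials, which are evaluated at `1`. -/
theorem prod_sum_factorial [Algebra ℂ R] (F : ι → ℕ → R) (B : ι → ℕ)
    (hF : ∀ v i, B v ≤ i → F v i = 0) {D : ℕ} (hD : ∑ v, B v < D) :
    ∏ v, ∑ i ∈ range (B v), ((i.factorial : ℂ)⁻¹) • F v i =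
      ∑ m ∈ range D, ((m.factorial : ℂ)⁻¹) •
        ∑ f : Fin m → ι, ∏ v, F v {s | f s = v}.ncard := by
  classical
  let P : ι → Polynomial R := fun v =>
    ∑ i ∈ range (B v), Polynomial.monomial i (((i.factorial : ℂ)⁻¹) • F v i)
  have hP : ∀ v i, (P v).coeff i = ((i.factorial : ℂ)⁻¹) • F v i := by
    intro v i
    simp only [P, Polynomial.finsetSum_coeff, Polynomial.coeff_monomial, sum_ite_eq', mem_range]
    split_ifs with h
    · rfl
    · rw [hF v i (not_lt.1 h), smul_zero]
  have hdeg : ∀ v, (P v).natDegree ≤ B v := fun v =>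
    Polynomial.natDegree_le_iff_coeff_eq_zero.2 fun i hi => by rw [hP, hF v i hi.le, smul_zero]
  have hcoeff : ∀ m, (∏ v, P v).coeff m = ((m.factorial : ℂ)⁻¹) •
      ∑ f : Fin m → ι, ∏ v, F v {s | f s = v}.ncard := by
    intro m
    have h1 : ((∏ v, P v : Polynomial R) : PowerSeries R) = ∏ v, (P v : PowerSeries R) :=
      map_prod Polynomial.coeToPowerSeries.ringHom P univ
    rw [← Polynomial.coeff_coe, h1, PowerSeries.coeff_prod, sum_functions, smul_sum]
    refine sum_bij' (fun k _ => (k : ι → ℕ)) (fun k _ => Finsupp.equivFunOnFinite.symm k) ?_ ?_ ?_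
      ?_ ?_
    · intro k hk
      rw [mem_finsuppAntidiag] at hk
      exact mem_piAntidiag.2 ⟨hk.1, fun i _ => mem_univ i⟩
    · intro k hk
      rw [mem_piAntidiag] at hk
      exact mem_finsuppAntidiag.2 ⟨hk.1, subset_univ _⟩
    · intro k _
      ext
      rfl
    · intro k _
      rfl
    · intro k hk
      rw [mem_finsuppAntidiag] at hk
      rw [← prod_factorial_smul F hk.1]
      exact prod_congr rfl fun v _ => by rw [Polynomial.coeff_coe, hP]
  have heval : ∀ v, (P v).eval 1 = ∑ i ∈ range (B v), ((i.factorial : ℂ)⁻¹) • F v i := by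
    intro v
    simp only [P, Polynomial.eval_finsetSum, Polynomial.eval_monomial, one_pow, mul_one]
  simp only [← heval, ← Polynomial.eval_prod]
  -- `D` exceeds the degree of the product, so no coefficient is missed.
  rw [Polynomial.eval_eq_sum_range' (n := D)]
  · simp only [hcoeff, one_pow, mul_one]
  · exact ((Polynomial.natDegree_prod_le _ _).trans (sum_le_sum fun v _ => hdeg v)).trans_lt hD

end Exponential

/-! ### Bounds on the number of half-lines -/

namespace Graph

variable {α : Type} [Finite α] {G : Graph α}

theorem MinThree.card_le (h : G.MinThree) : 3 * G.numVerts ≤ Nat.card α := by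
  have := Fintype.ofFinite (Quotient G.vert)
  rw [card_eq_sum_fiber (Quotient.mk G.vert), numVerts, Nat.card_eq_fintype_card, mul_comm,
    ← smul_eq_mul, ← Finset.card_univ, ← Finset.sum_const]
  refine Finset.sum_le_sum fun q _ => ?_
  obtain ⟨x, rfl⟩ := Quotient.exists_rep q
  refine (h x).trans_eq ?_
  rw [Nat.card_coe_set_eq]
  congr 1
  ext y
  exact ⟨fun h => Quotient.sound (G.vert.symm h), fun h => G.vert.symm (Quotient.exact h)⟩

/-- With `N` internal half-lines, `E` external ones and `V` vertices, `N = 2 L + 2 V - 2` and `3 V ≤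
N + E`. Eliminating `V` bounds `N`, so that for bounded loop number only finitely many `N` matter.
-/
theorem Marked.ncard_inner_le {E : Set α} (hG : G.Marked E) (h : G.MinThree) :
    Eᶜ.ncard ≤ 6 * G.loops + 2 * E.ncard := by
  rcases isEmpty_or_nonempty α with hα | hα
  · simp [Set.eq_empty_of_isEmpty]
  · have h1 := two_mul_loops hG.nice.edge_unique hG.connected
    have h2 := h.card_le
    have h3 := Set.ncard_add_ncard_compl E
    rw [numLegs, hG.legs_eq] at h1
    omega

theorem Marked.isOnePI {E : Set α} (hG : G.Marked E) (h : G.MinThree) (hE : Eᶜ.Nonempty) :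
    G.IsOnePI := by
  refine isOnePI_iff.2 ⟨hG.nice, hG.connected, ?_, h⟩
  rw [inner, hG.legs_eq]
  exact hE

end Graph

theorem gnum_coreVal_eq_zero {R : Type} [CommRing R] {L : ℕ} {a : GraphClass → R}
    (ha : ∀ c, L < c.rep.graph.loops → a c = 0) {n N : ℕ} (hN : 6 * L + 2 * n < N) :
    gnum (coreVal a) n N = 0 := by
  classical
  rw [gnum, gsum_coreVal]
  refine Finset.sum_eq_zero fun G hG => ?_
  obtain ⟨-, hm, h3⟩ := Finset.mem_filter.1 hG
  have hle := hm.ncard_inner_le h3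
  rw [ncard_stdLegs, ncard_stdLegs_compl] at hle
  have hne : (stdLegs n N)ᶜ.Nonempty := by
    rw [← Set.ncard_pos, ncard_stdLegs_compl]
    omega
  have h1 := hm.isOnePI h3 hne
  rw [evalGraph_of_isOnePI _ h1]
  refine ha _ ?_
  rw [loops_classOf]
  omega

/-! ### Green's functions of convolution products -/

section Green

variable {R : Type} [CommRing R]

/-- The valence of a vertex. -/
def Graph.valence {β : Type} (G : Graph β) (v : Quotient G.vert) : ℕ :=
  {x | Quotient.mk G.vert x = v}.ncard

/-- An isomorphism induces a bijection between the vertices. -/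
def Graph.Iso.vertEquiv {α β : Type} {G : Graph α} {G' : Graph β} (e : Graph.Iso G G') :
    Quotient G.vert ≃ Quotient G'.vert :=
  Quotient.congr e.toEquiv fun x y => (e.vert_iff x y).symm

theorem Graph.Iso.valence_eq {α β : Type} {G : Graph α} {G' : Graph β} (e : Graph.Iso G G')
    (v : Quotient G.vert) : G'.valence (e.vertEquiv v) = G.valence v := by
  refine Graph.Iso.ncard_eq e.toEquiv _ _ fun x => ?_
  change e.vertEquiv (Quotient.mk _ x) = _ ↔ _
  rw [e.vertEquiv.apply_eq_iff_eq]
  rfl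

/-- The product over the vertices of a function of the valence. -/
def vertProd (y : ℕ → R) {β : Type} (G : Graph β) : R :=
  ∏ᶠ v : Quotient G.vert, y (G.valence v)

theorem vertProd_iso (y : ℕ → R) {α β : Type} {G : Graph α} {G' : Graph β} (e : Graph.Iso G G') :
    vertProd y G = vertProd y G' :=
  finprod_eq_of_bijective e.vertEquiv e.vertEquiv.bijective fun v => by rw [e.valence_eq]

/-- The value of `b` on the contracted graph times the product over its vertices of a function of
the valence. -/
def insertVal (b : GraphClass → R) (y : ℕ → R) : GraphFun R := fun _ _ G =>
  value b G * vertProd y G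

theorem insertVal_invariant (b : GraphClass → R) (y : ℕ → R) : Invariant (insertVal b y) :=
  fun e => congrArg₂ (· * ·) (value_iso b e) (vertProd_iso y e)

open Classical in
/-- The sum over the distributions of the half-lines of `σ` among the vertices. -/
def distribute (F : ℕ → ℕ → R) (σ : Type) [Fintype σ] {β : Type} [Finite β] (G : Graph β) : R :=
  letI := Fintype.ofFinite (Quotient G.vert)
  letI := Fintype.ofFinite (σ → Quotient G.vert)
  ∑ f : σ → Quotient G.vert, ∏ v, F (G.valence v) {s | f s = v}.ncard

theorem distribute_iso (F : ℕ → ℕ → R) {σ τ : Type} [Fintype σ] [Fintype τ] (k : σ ≃ τ)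
    {α β : Type} [Finite α] [Finite β] {G : Graph α} {G' : Graph β} (e : Graph.Iso G G') :
    distribute F σ G = distribute F τ G' := by
  let _ := Fintype.ofFinite (Quotient G.vert)
  let _ := Fintype.ofFinite (Quotient G'.vert)
  let _ := Fintype.ofFinite (σ → Quotient G.vert)
  let _ := Fintype.ofFinite (τ → Quotient G'.vert)
  refine Fintype.sum_equiv (k.arrowCongr e.vertEquiv) _ _ fun f => ?_
  refine Fintype.prod_equiv e.vertEquiv _ _ fun v => ?_
  rw [e.valence_eq]
  congr 1
  symm
  refine Graph.Iso.ncard_eq k _ _ fun x => ?_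
  simp [Equiv.arrowCongr]

/-- The value of a graph with `m` half-lines distributed among the vertices. -/
def distVal (b : GraphClass → R) (F : ℕ → ℕ → R) (m : ℕ) : GraphFun R := fun _ _ G =>
  value b G * distribute F (Fin m) G

theorem distVal_invariant (b : GraphClass → R) (F : ℕ → ℕ → R) (m : ℕ) :
    Invariant (distVal b F m) :=
  fun e => congrArg₂ (· * ·) (value_iso b e) (distribute_iso F (Equiv.refl _) e)

open Classical in
theorem gsum_conv (a b : GraphClass → R) {β : Type} [Fintype β] (E : Set β) :
    gsum (coreVal (conv a b)) E = ∑ S : Set β with S ⊆ Eᶜ,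
      ∑ G : Graph β with (G.Marked E ∧ G.MinThree) ∧ G.IsSub S,
        prodVal a (G.keep S) * value b (G.quo S) := by
  have h1 : ∀ G : Graph β, G.Marked E ∧ G.MinThree → evalGraph (conv a b) G =
      ∑ S : Set β with S ⊆ Eᶜ,
        if G.IsSub S then prodVal a (G.keep S) * value b (G.quo S) else 0 := by
    rintro G ⟨hm, h3⟩
    have hb : G.biv = ∅ := Set.eq_empty_of_forall_notMem fun x hx => by
      have h1 := h3 x
      have h2 : {y | G.vert x y}.ncard = 2 := hx
      omega
    have : Fintype {S // G.IsSub S} := Fintype.ofFinite _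
    rw [evalGraph_conv a b hm.nice hm.connected hb, convSum, finsum_eq_sum_of_fintype,
      ← Finset.sum_filter, Finset.filter_filter]
    rw [Finset.sum_subtype (p := fun S => G.IsSub S)
      (F := inferInstance) (Finset.univ.filter fun S => S ⊆ Eᶜ ∧ G.IsSub S)]
    · exact Finset.sum_congr rfl fun S _ => by
        rw [value_of_biv_eq_empty (G := G.keep S) a hb]
    · intro S
      simp only [Finset.mem_filter, Finset.mem_univ, true_and, and_iff_right_iff_imp]
      intro hS
      rw [← hm.legs_eq]
      exact hS.subset_inner
  rw [gsum_coreVal, Finset.sum_congr rfl fun G hG => h1 G (Finset.mem_filter.1 hG).2,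
    Finset.sum_comm]
  refine Finset.sum_congr rfl fun S _ => ?_
  rw [← Finset.sum_filter, Finset.filter_filter]

open Classical in
-- For fixed `S`, one sums over the contracted graph on the complement and over the distributions of
-- `S` among its vertices. The result depends only on the cardinalities.
theorem sum_isSub_eq_gnum (a b : GraphClass → R) {β : Type} [Fintype β] {E S : Set β}
    (hSE : S ⊆ Eᶜ) :
    ∑ G : Graph β with (G.Marked E ∧ G.MinThree) ∧ G.IsSub S,
        prodVal a (G.keep S) * value b (G.quo S) =
      gnum (distVal b (gnum (coreVal a)) S.ncard) E.ncard (Eᶜ.ncard - S.ncard) := by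
  rw [Graph.sum_isSub hSE]
  have h1 : (Subtype.val ⁻¹' E : Set {x | x ∉ S}).ncard = E.ncard := by
    rw [← Set.ncard_image_of_injective _ Subtype.val_injective, Subtype.image_preimage_coe,
      Set.inter_eq_right.2]
    exact fun x hx hS => hSE hS hx
  have h2 : ((Subtype.val ⁻¹' E)ᶜ : Set {x | x ∉ S}).ncard = Eᶜ.ncard - S.ncard := by
    rw [← Set.ncard_sdiff hSE, ← Set.preimage_compl,
      ← Set.ncard_image_of_injective _ Subtype.val_injective, Subtype.image_preimage_coe]
    congr 1
    ext x
    exact and_comm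
  rw [← h1, ← h2, ← gsum_eq_gnum (distVal_invariant b _ _), gsum]
  refine Finset.sum_congr rfl fun G₀ _ => ?_
  have : Fintype (Quotient G₀.vert) := Fintype.ofFinite _
  have k : S ≃ Fin S.ncard := Finite.equivFinOfCardEq (Nat.card_coe_set_eq S)
  rw [sum_refines, distVal, ← distribute_iso (gnum (coreVal a)) k (Graph.Iso.refl G₀)]
  congr 1
  unfold distribute
  congr!

/-- The binomial coefficient counts the sets `S` of `m` internal half-lines. -/
theorem gnum_conv (a b : GraphClass → R) (n N : ℕ) :
    gnum (coreVal (conv a b)) n N = ∑ m ∈ Finset.range (N + 1),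
      N.choose m • gnum (distVal b (gnum (coreVal a)) m) n (N - m) := by
  classical
  rw [gnum, gsum_conv, Finset.sum_congr rfl fun S hS => sum_isSub_eq_gnum a b
    (Finset.mem_filter.1 hS).2, ncard_stdLegs, ncard_stdLegs_compl]
  have h := Finset.sum_powerset_apply_card
    (fun m => gnum (distVal b (gnum (coreVal a)) m) n (N - m)) (x := (Finset.univ : Finset (Fin N)))
  rw [Finset.card_univ, Fintype.card_fin] at h
  rw [← h]
  symm
  refine Finset.sum_bij' (fun T _ => Sum.inr '' (T : Set (Fin N)))
    (fun S _ => Finset.univ.filter fun i => Sum.inr i ∈ S) ?_ ?_ ?_ ?_ ?_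
  · intro T _
    simp only [Finset.mem_filter, Finset.mem_univ, true_and, Set.compl_range_inl]
    exact Set.image_subset_range _ _
  · intro S _
    simp
  · intro T _
    ext i
    simp
  · intro S hS
    simp only [Finset.mem_filter, Finset.mem_univ, true_and, Set.compl_range_inl] at hS
    ext x
    constructor
    · rintro ⟨i, hi, rfl⟩
      simpa using hi
    · intro hx
      obtain ⟨i, rfl⟩ := hS hx
      exact ⟨i, by simpa using hx, rfl⟩
  · intro T _
    rw [Set.ncard_image_of_injective _ Sum.inr_injective, Set.ncard_coe_finset]

end Green

/-! ### Insertion of Green's functions at the vertices -/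

section Green

variable {R : Type} [CommRing R]

theorem Graph.sum_valence {β : Type} [Finite β] (G : Graph β) [Fintype (Quotient G.vert)] :
    ∑ v, G.valence v = Nat.card β := (card_eq_sum_fiber (Quotient.mk G.vert)).symm

theorem Graph.numVerts_le {β : Type} [Finite β] (G : Graph β) : G.numVerts ≤ Nat.card β :=
  Nat.card_le_card_of_surjective _ Quotient.mk_surjective

variable [Algebra ℂ R]

/-- The sum of the values of the graphs with `n` external lines and at most `L` loops, weighted
with symmetry factors. -/
def greenSum (a : GraphClass → R) (L n : ℕ) : R :=
  ∑ N ∈ Finset.range (6 * L + 2 * n + 1), ((N.factorial : ℂ)⁻¹) • gnum (coreVal a) n N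

theorem greenSum_eq {L : ℕ} {a : GraphClass → R} (ha : ∀ c, L < c.rep.graph.loops → a c = 0)
    {n B : ℕ} (hB : 6 * L + 2 * n < B) :
    greenSum a L n = ∑ N ∈ Finset.range B, ((N.factorial : ℂ)⁻¹) • gnum (coreVal a) n N := by
  refine Finset.sum_subset (Finset.range_subset_range.2 hB) fun N _ hN => ?_
  rw [gnum_coreVal_eq_zero ha, smul_zero]
  rw [Finset.mem_range] at hN
  omega

/-- The exponential formula, applied to the vertices of `G`. The bound `D` works because the
valences add up to the number of half-lines and there are at most as many vertices as half-lines. -/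
theorem sum_distribute {L : ℕ} {a : GraphClass → R} (ha : ∀ c, L < c.rep.graph.loops → a c = 0)
    {β : Type} [Finite β] (G : Graph β) {D : ℕ} (hD : (6 * L + 3) * Nat.card β < D) :
    ∑ m ∈ Finset.range D, ((m.factorial : ℂ)⁻¹) • distribute (gnum (coreVal a)) (Fin m) G =
      vertProd (greenSum a L) G := by
  have := Fintype.ofFinite (Quotient G.vert)
  rw [vertProd, finprod_eq_prod_of_fintype]
  simp only [greenSum]
  rw [prod_sum_factorial (fun v : Quotient G.vert => gnum (coreVal a) (G.valence v))
    (fun v => 6 * L + 2 * G.valence v + 1) (fun v i hi => gnum_coreVal_eq_zero ha hi) (D := D)]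
  · refine Finset.sum_congr rfl fun m _ => ?_
    unfold distribute
    congr!
  · have h1 := G.sum_valence
    have h2 := G.numVerts_le
    rw [Graph.numVerts, Nat.card_eq_fintype_card] at h2
    refine lt_of_le_of_lt ?_ hD
    rw [Finset.sum_add_distrib, Finset.sum_add_distrib, ← Finset.mul_sum, ← Finset.mul_sum, h1]
    simp only [Finset.sum_const, Finset.card_univ, smul_eq_mul]
    nlinarith [Nat.zero_le L]

omit [Algebra ℂ R] in
-- The left side is turned back into a sum over graphs with `m + r` internal half-lines and a fixed
-- subgraph with `m` of them. By the bound on half-lines all these graphs have more than `L` loops.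
theorem gnum_distVal_eq_zero {L : ℕ} {a b : GraphClass → R}
    (hab : ∀ {β : Type} [Finite β] [Nonempty β] {G : Graph β} {S : Set β}, G.Nice →
      (∀ x y, G.conn x y) → G.MinThree → G.IsSub S → L < G.loops →
      prodVal a (G.keep S) * value b (G.quo S) = 0)
    {n m r : ℕ} (h : 6 * L + 2 * n < m + r) :
    gnum (distVal b (gnum (coreVal a)) m) n r = 0 := by
  classical
  let S : Set (Fin n ⊕ Fin (m + r)) := Sum.inr '' Set.range (Fin.castAdd r)
  have hS : S ⊆ (stdLegs n (m + r))ᶜ := by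
    rw [Set.compl_range_inl]
    exact Set.image_subset_range _ _
  have hm : S.ncard = m := by
    rw [Set.ncard_image_of_injective _ Sum.inr_injective, ← Set.image_univ,
      Set.ncard_image_of_injective _ (Fin.castAdd_injective m r), Set.ncard_univ, Nat.card_fin]
  have := sum_isSub_eq_gnum a b hS
  rw [ncard_stdLegs, ncard_stdLegs_compl, hm, Nat.add_sub_cancel_left] at this
  rw [← this]
  refine Finset.sum_eq_zero fun G hG => ?_
  obtain ⟨-, ⟨hm, h3⟩, hS⟩ := Finset.mem_filter.1 hG
  have : Nonempty (Fin n ⊕ Fin (m + r)) := ⟨Sum.inr ⟨0, by omega⟩⟩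
  refine hab hm.nice hm.connected h3 hS ?_
  have hle := hm.ncard_inner_le h3
  rw [ncard_stdLegs, ncard_stdLegs_compl] at hle
  omega

/-- The Green's function of a convolution product: sum over the contracted graph, and insertion of
Green's functions at its vertices. -/
theorem greenSum_conv {L : ℕ} {a b : GraphClass → R}
    (ha : ∀ c, L < c.rep.graph.loops → a c = 0)
    (hab : ∀ {β : Type} [Finite β] [Nonempty β] {G : Graph β} {S : Set β}, G.Nice →
      (∀ x y, G.conn x y) → G.MinThree → G.IsSub S → L < G.loops →
      prodVal a (G.keep S) * value b (G.quo S) = 0)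
    {n B : ℕ} (hB : 6 * L + 2 * n < B) :
    ∑ N ∈ Finset.range B, ((N.factorial : ℂ)⁻¹) • gnum (coreVal (conv a b)) n N =
      ∑ r ∈ Finset.range B, ((r.factorial : ℂ)⁻¹) • gnum (insertVal b (greenSum a L)) n r := by
  classical
  set Ψ : ℕ → ℕ → R := fun m r => gnum (distVal b (gnum (coreVal a)) m) n r with hΨ
  -- The factor `1/N!` and the binomial coefficient combine to `1/(m! (N-m)!)`, so the half-lines of
  -- the subgraph and of the contracted graph separate.
  have h1 : ∀ N, ((N.factorial : ℂ)⁻¹) • gnum (coreVal (conv a b)) n N =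
      ∑ m ∈ Finset.range (N + 1),
        ((((N - m).factorial : ℂ)⁻¹) • ((m.factorial : ℂ)⁻¹) • Ψ m (N - m)) := by
    intro N
    rw [gnum_conv, Finset.smul_sum]
    refine Finset.sum_congr rfl fun m hm => ?_
    have hm' : m ≤ N := Nat.lt_succ_iff.1 (Finset.mem_range.1 hm)
    rw [← Nat.cast_smul_eq_nsmul ℂ, smul_smul, smul_smul, Nat.cast_choose ℂ hm']
    congr 1
    have h2 : (N.factorial : ℂ) ≠ 0 := Nat.cast_ne_zero.2 (Nat.factorial_ne_zero _)
    have h3 : (m.factorial : ℂ) ≠ 0 := Nat.cast_ne_zero.2 (Nat.factorial_ne_zero _)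
    have h4 : ((N - m).factorial : ℂ) ≠ 0 := Nat.cast_ne_zero.2 (Nat.factorial_ne_zero _)
    field_simp
  have h2 : ∀ r, ∑ m ∈ Finset.range (B - r), ((m.factorial : ℂ)⁻¹) • Ψ m r =
      gnum (insertVal b (greenSum a L)) n r := by
    intro r
    -- The sum over `m` is extended by vanishing terms until `sum_distribute` applies to all
    -- contracted graphs.
    have hD : B - r ≤ B + (6 * L + 3) * (n + r) + 1 := by omega
    have h3 : ∑ m ∈ Finset.range (B - r), ((m.factorial : ℂ)⁻¹) • Ψ m r =
        ∑ m ∈ Finset.range (B + (6 * L + 3) * (n + r) + 1), ((m.factorial : ℂ)⁻¹) • Ψ m r := by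
      refine Finset.sum_subset (Finset.range_subset_range.2 hD) fun m _ hm => ?_
      rw [Finset.mem_range] at hm
      rw [hΨ]
      beta_reduce
      rw [gnum_distVal_eq_zero hab (by omega), smul_zero]
    rw [h3, hΨ]
    simp only [gnum, gsum, Finset.smul_sum]
    rw [Finset.sum_comm]
    refine Finset.sum_congr rfl fun G _ => ?_
    simp only [distVal, insertVal]
    rw [← sum_distribute ha G (D := B + (6 * L + 3) * (n + r) + 1), Finset.mul_sum]
    · exact Finset.sum_congr rfl fun m _ => (mul_smul_comm _ _ _).symm
    · rw [Nat.card_sum, Nat.card_fin, Nat.card_fin]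
      omega
  rw [Finset.sum_congr rfl fun N _ => h1 N]
  refine (Finset.sum_range_diag_flip B fun m r =>
    (((r.factorial : ℂ)⁻¹) • ((m.factorial : ℂ)⁻¹) • Ψ m r)).trans ?_
  rw [Finset.sum_sigma', Finset.sum_congr rfl fun r _ => congrArg _ (h2 r).symm]
  simp only [Finset.smul_sum]
  rw [Finset.sum_sigma']
  refine Finset.sum_bij' (fun p _ => ⟨p.2, p.1⟩) (fun p _ => ⟨p.2, p.1⟩) ?_ ?_ ?_ ?_ ?_
  · intro p hp
    simp only [Finset.mem_sigma, Finset.mem_range] at hp ⊢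
    omega
  · intro p hp
    simp only [Finset.mem_sigma, Finset.mem_range] at hp ⊢
    omega
  · exact fun _ _ => rfl
  · exact fun _ _ => rfl
  · exact fun _ _ => rfl

end Green

/-! ### Insertion of vertices of valence two -/

namespace Graph

variable {β : Type}

open Classical in
/-- The half-line at the other end of the line of `y`. -/
def partner (K : Graph β) (y : β) : β :=
  if h : ∃ y', K.edge y y' ∧ y' ≠ y then h.choose else y

theorem partner_spec {K : Graph β} {y : β} (h : y ∈ K.inner) :
    K.edge y (K.partner y) ∧ K.partner y ≠ y := by
  have h' := mem_inner.1 h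
  rw [partner, dif_pos h']
  exact h'.choose_spec

section Insert

variable {x x' : β} (y : {z | z ∉ ({x, x'} : Set β)}) (K : Graph {z | z ∉ ({x, x'} : Set β)})

open Classical in
/-- The half-line `x` is identified with `y` and `x'` with the partner of `y`. -/
def insertMap (z : β) : {z | z ∉ ({x, x'} : Set β)} :=
  if h : z ∈ ({x, x'} : Set β) then (if z = x then y else K.partner y) else ⟨z, h⟩

/-- The graph in which a vertex `{x, x'}` is inserted into the line of `y`. -/
def insertVert : Graph β where
  vert :=
    { r := fun z z' => (z ∈ ({x, x'} : Set β) ∧ z' ∈ ({x, x'} : Set β)) ∨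
        ∃ (h : z ∉ ({x, x'} : Set β)) (h' : z' ∉ ({x, x'} : Set β)), K.vert ⟨z, h⟩ ⟨z', h'⟩
      iseqv :=
        { refl := fun z => by
            by_cases h : z ∈ ({x, x'} : Set β)
            · exact Or.inl ⟨h, h⟩
            · exact Or.inr ⟨h, h, K.vert.refl _⟩
          symm := by
            rintro z z' (⟨h, h'⟩ | ⟨h, h', e⟩)
            · exact Or.inl ⟨h', h⟩
            · exact Or.inr ⟨h', h, K.vert.symm e⟩
          trans := by
            rintro z z' z'' (⟨h, h'⟩ | ⟨h, h', e⟩) (⟨k, k'⟩ | ⟨k, k', e'⟩)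
            · exact Or.inl ⟨h, k'⟩
            · exact absurd h' k
            · exact absurd k h'
            · exact Or.inr ⟨h, k', K.vert.trans e e'⟩ } }
  -- The line of `y` is first cut. Pulling back along `insertMap` then creates the lines `{x, y}`
  -- and `{x', partner y}`.
  edge := Setoid.comap (insertMap y K) (onSet K.edge {y, K.partner y}ᶜ)

variable {y K}

theorem insertMap_left : insertMap y K x = y := by
  rw [insertMap, dif_pos (show x ∈ ({x, x'} : Set β) from Or.inl rfl), if_pos rfl]

theorem insertMap_right (h : x ≠ x') : insertMap y K x' = K.partner y := by
  rw [insertMap, dif_pos (show x' ∈ ({x, x'} : Set β) from Or.inr rfl), if_neg h.symm]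

theorem insertMap_coe (z : {z | z ∉ ({x, x'} : Set β)}) : insertMap y K z = z := dif_neg z.2

theorem insertMap_eq_left (h : x ≠ x') (hy : K.partner y ≠ y) {z : β}
    (hz : insertMap y K z = y) : z = x ∨ z = y := by
  by_cases hzx : z = x
  · exact Or.inl hzx
  · by_cases hzx' : z = x'
    · rw [hzx', insertMap_right h] at hz
      exact absurd hz hy
    · have h1 := insertMap_coe (y := y) (K := K) ⟨z, by rintro (h | h); exacts [hzx h, hzx' h]⟩
      exact Or.inr (congrArg Subtype.val (h1.symm.trans hz))

theorem insertMap_eq_right (hy : K.partner y ≠ y) {z : β}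
    (hz : insertMap y K z = K.partner y) : z = x' ∨ z = K.partner y := by
  by_cases hzx' : z = x'
  · exact Or.inl hzx'
  · by_cases hzx : z = x
    · rw [hzx, insertMap_left] at hz
      exact absurd hz.symm hy
    · have h1 := insertMap_coe (y := y) (K := K) ⟨z, by rintro (h | h); exacts [hzx h, hzx' h]⟩
      exact Or.inr (congrArg Subtype.val (h1.symm.trans hz))

theorem insertMap_of_mem_compl (h : x ≠ x') {z : β}
    (hz : insertMap y K z ∈ ({y, K.partner y} : Set _)ᶜ) :
    ∃ z' : {z | z ∉ ({x, x'} : Set β)}, z = z' ∧ insertMap y K z = z' := by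
  have hzB : z ∉ ({x, x'} : Set β) := by
    rintro (rfl | rfl)
    · exact hz (Or.inl insertMap_left)
    · exact hz (Or.inr (insertMap_right h))
  exact ⟨⟨z, hzB⟩, rfl, insertMap_coe ⟨z, hzB⟩⟩

theorem insertVert_edge_iff {z z' : β} : (insertVert y K).edge z z' ↔
    insertMap y K z = insertMap y K z' ∨ (insertMap y K z ∈ ({y, K.partner y} : Set _)ᶜ ∧
      insertMap y K z' ∈ ({y, K.partner y} : Set _)ᶜ ∧
      K.edge (insertMap y K z) (insertMap y K z')) := Iff.rfl

theorem insertVert_bivStep (h : x ≠ x') (hy : y ∈ K.inner) (hK : K.EdgeUnique) :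
    (insertVert y K).BivStep x x' y (K.partner y) := by
  obtain ⟨he, hne⟩ := partner_spec hy
  have hy2 := y.2
  have hp2 := (K.partner y).2
  simp only [Set.mem_ofPred_eq, Set.mem_insert_iff, Set.mem_singleton_iff, not_or] at hy2 hp2
  refine ⟨?_, h, fun z => ?_, ?_, ?_, hy2, hp2⟩
  · intro a b c hab hac hba hca
    rcases hab with hab | ⟨ha, hb, hab⟩
    · rcases hac with hac | ⟨ha, hc, hac⟩
      · by_cases ha : insertMap y K a = y
        · have ha' := insertMap_eq_left h hne ha
          have hb' := insertMap_eq_left h hne (hab.symm.trans ha)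
          have hc' := insertMap_eq_left h hne (hac.symm.trans ha)
          grind
        · by_cases ha2 : insertMap y K a = K.partner y
          · have ha' := insertMap_eq_right hne ha2
            have hb' := insertMap_eq_right hne (hab.symm.trans ha2)
            have hc' := insertMap_eq_right hne (hac.symm.trans ha2)
            grind
          · have ham : insertMap y K a ∈ ({y, K.partner y} : Set _)ᶜ := by
              rintro (h1 | h1)
              exacts [ha h1, ha2 h1]
            obtain ⟨a', rfl, ha'⟩ := insertMap_of_mem_compl h ham
            obtain ⟨b', rfl, hb'⟩ := insertMap_of_mem_compl h (hab ▸ ham)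
            exact absurd (congrArg Subtype.val (hb'.symm.trans (hab.symm.trans ha'))) hba
      · obtain ⟨a', rfl, ha'⟩ := insertMap_of_mem_compl h ha
        obtain ⟨b', rfl, hb'⟩ := insertMap_of_mem_compl h (hab ▸ ha)
        exact absurd (congrArg Subtype.val (hb'.symm.trans (hab.symm.trans ha'))) hba
    · obtain ⟨a', rfl, ha'⟩ := insertMap_of_mem_compl h ha
      obtain ⟨b', rfl, hb'⟩ := insertMap_of_mem_compl h hb
      rcases hac with hac | ⟨-, hc, hac⟩
      · obtain ⟨c', rfl, hc'⟩ := insertMap_of_mem_compl h (hac ▸ ha)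
        exact absurd (congrArg Subtype.val (hc'.symm.trans (hac.symm.trans ha'))) hca
      · obtain ⟨c', rfl, hc'⟩ := insertMap_of_mem_compl h hc
        rw [ha', hb'] at hab
        rw [ha', hc'] at hac
        exact congrArg Subtype.val (hK a' b' c' hab hac (fun e => hba (congrArg _ e))
          fun e => hca (congrArg _ e))
  · constructor
    · rintro (⟨-, hz⟩ | ⟨hx, -⟩)
      · exact hz
      · exact absurd (Or.inl rfl) hx
    · exact fun hz => Or.inl ⟨Or.inl rfl, hz⟩
  · exact Or.inl (by rw [insertMap_left, insertMap_coe])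
  · exact Or.inl (by rw [insertMap_right h, insertMap_coe])

theorem remove_insertVert (h : x ≠ x') (hy : y ∈ K.inner) (hK : K.EdgeUnique) :
    (insertVert y K).remove {x, x'} = K := by
  obtain ⟨he, hne⟩ := partner_spec hy
  refine Graph.ext (Setoid.ext fun z z' => ?_) (Setoid.ext fun z z' => ?_)
  · constructor
    · rintro (⟨hz, -⟩ | ⟨_, _, h⟩)
      · exact absurd hz z.2
      · exact h
    · exact fun h => Or.inr ⟨z.2, z'.2, h⟩
  · rw [(insertVert_bivStep h hy hK).remove_edge_iff, insertVert_edge_iff, insertMap_coe,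
      insertMap_coe, Subtype.coe_inj, Subtype.coe_inj, Subtype.coe_inj, Subtype.coe_inj]
    constructor
    · rintro ((rfl | ⟨-, -, h⟩) | ⟨rfl, rfl⟩ | ⟨rfl, rfl⟩)
      · exact K.edge.refl _
      · exact h
      · exact he
      · exact K.edge.symm he
    · intro hzz
      by_cases hz : z = y
      · rw [hz] at hzz ⊢
        rcases hK.eq_or he hne hzz with rfl | rfl
        · exact Or.inl (Or.inl rfl)
        · exact Or.inr (Or.inl ⟨rfl, rfl⟩)
      · by_cases hz2 : z = K.partner y
        · rw [hz2] at hzz ⊢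
          rcases hK.eq_or (K.edge.symm he) hne.symm hzz with h1 | h1
          · exact Or.inl (Or.inl h1.symm)
          · exact Or.inr (Or.inr ⟨rfl, h1⟩)
        · refine Or.inl (Or.inr ⟨?_, ?_, hzz⟩)
          · rintro (h1 | h1)
            exacts [hz h1, hz2 h1]
          · rintro (h1 | h1)
            · rw [h1] at hzz
              rcases hK.eq_or he hne (K.edge.symm hzz) with h2 | h2
              exacts [hz h2, hz2 h2]
            · rw [Set.mem_singleton_iff.1 h1] at hzz
              rcases hK.eq_or (K.edge.symm he) hne.symm (K.edge.symm hzz) with h2 | h2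
              exacts [hz2 h2, hz h2]

end Insert

theorem BivStep.y_mem_inner {G : Graph β} {x x' y y' : β} (h : G.BivStep x x' y y') :
    (⟨y, h.y_notMem⟩ : {z | z ∉ ({x, x'} : Set β)}) ∈ (G.remove {x, x'}).inner :=
  mem_inner.2 ⟨⟨y', h.y'_notMem⟩, (h.remove_edge_iff _ _).2 (Or.inr (Or.inl ⟨rfl, rfl⟩)),
    fun e => h.y_ne_y' (congrArg Subtype.val e).symm⟩

theorem BivStep.partner_eq {G : Graph β} {x x' y y' : β} (h : G.BivStep x x' y y') :
    (G.remove {x, x'}).partner ⟨y, h.y_notMem⟩ = ⟨y', h.y'_notMem⟩ := by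
  obtain ⟨he, hne⟩ := partner_spec h.y_mem_inner
  exact h.remove_edgeUnique _ _ _ he
    ((h.remove_edge_iff ⟨y, h.y_notMem⟩ ⟨y', h.y'_notMem⟩).2 (Or.inr (Or.inl ⟨rfl, rfl⟩))) hne
    fun e => h.y_ne_y' (congrArg Subtype.val e).symm

/-- Together with `remove_insertVert` this shows that, for fixed `x`, `x'` and `y`, inserting and
removing the vertex are inverse to each other. -/
theorem BivStep.insertVert_remove {G : Graph β} {x x' y y' : β} (h : G.BivStep x x' y y') :
    insertVert ⟨y, h.y_notMem⟩ (G.remove {x, x'}) = G := by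
  have hp := h.partner_eq
  have hne : (G.remove {x, x'}).partner ⟨y, h.y_notMem⟩ ≠ ⟨y, h.y_notMem⟩ :=
    (partner_spec h.y_mem_inner).2
  refine Graph.ext (Setoid.ext fun z z' => ?_) (Setoid.ext fun z z' => ?_)
  · constructor
    · rintro (⟨hz, hz'⟩ | ⟨_, _, e⟩)
      · exact G.vert.trans (G.vert.symm ((h.vert_iff z).2 hz)) ((h.vert_iff z').2 hz')
      · exact e
    · intro e
      by_cases hz : z ∈ ({x, x'} : Set β)
      · exact Or.inl ⟨hz, h.vertClosed z hz z' e⟩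
      · exact Or.inr ⟨hz, h.vertClosed.not_mem e hz, e⟩
  · rw [insertVert_edge_iff]
    have hmem : ∀ z, insertMap ⟨y, h.y_notMem⟩ (G.remove {x, x'}) z ∈
        ({⟨y, h.y_notMem⟩, (G.remove {x, x'}).partner ⟨y, h.y_notMem⟩} : Set _)ᶜ ↔
        z ≠ x ∧ z ≠ x' ∧ z ≠ y ∧ z ≠ y' := by
      intro z
      constructor
      · intro hz
        refine ⟨?_, ?_, ?_, ?_⟩ <;> rintro rfl
        · exact hz (Or.inl insertMap_left)
        · exact hz (Or.inr (insertMap_right h.ne))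
        · exact hz (Or.inl (insertMap_coe ⟨_, h.y_notMem⟩))
        · exact hz (Or.inr ((insertMap_coe ⟨_, h.y'_notMem⟩).trans hp.symm))
      · rintro ⟨h1, h2, h3, h4⟩ (h5 | h5)
        · rcases insertMap_eq_left h.ne hne h5 with h6 | h6
          exacts [h1 h6, h3 h6]
        · rcases insertMap_eq_right hne h5 with h6 | h6
          exacts [h2 h6, h4 (h6.trans (congrArg Subtype.val hp))]
    have hcoe : ∀ z, z ≠ x → (hz' : z ≠ x') → ∃ hz : z ∉ ({x, x'} : Set β),
        insertMap ⟨y, h.y_notMem⟩ (G.remove {x, x'}) z = ⟨z, hz⟩ := fun z hz hz' =>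
      ⟨by rintro (h1 | h1); exacts [hz h1, hz' h1], insertMap_coe ⟨z, by
        rintro (h1 | h1); exacts [hz h1, hz' h1]⟩⟩
    have hl : insertMap ⟨y, h.y_notMem⟩ (G.remove {x, x'}) x = ⟨y, h.y_notMem⟩ := insertMap_left
    have hr : insertMap ⟨y, h.y_notMem⟩ (G.remove {x, x'}) x' = ⟨y', h.y'_notMem⟩ :=
      (insertMap_right h.ne).trans hp
    have hyy : insertMap ⟨y, h.y_notMem⟩ (G.remove {x, x'}) y = ⟨y, h.y_notMem⟩ :=
      insertMap_coe ⟨_, h.y_notMem⟩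
    have hyy' : insertMap ⟨y, h.y_notMem⟩ (G.remove {x, x'}) y' = ⟨y', h.y'_notMem⟩ :=
      insertMap_coe ⟨_, h.y'_notMem⟩
    constructor
    · rintro (hzz | ⟨hz, hz', hzz⟩)
      · by_cases hz : insertMap ⟨y, h.y_notMem⟩ (G.remove {x, x'}) z ∈
          ({⟨y, h.y_notMem⟩, (G.remove {x, x'}).partner ⟨y, h.y_notMem⟩} : Set _)ᶜ
        · obtain ⟨a, rfl, ha⟩ := insertMap_of_mem_compl h.ne hz
          obtain ⟨b, rfl, hb⟩ := insertMap_of_mem_compl h.ne (hzz ▸ hz)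
          rw [← ha, ← hb, hzz]
        · rcases not_not.1 hz with h1 | h1
          · rcases insertMap_eq_left h.ne hne h1 with rfl | h2 <;>
              rcases insertMap_eq_left h.ne hne (hzz.symm.trans h1) with rfl | h3
            · exact G.edge.refl _
            · exact h3 ▸ h.edge
            · exact h2 ▸ G.edge.symm h.edge
            · exact h2 ▸ h3 ▸ G.edge.refl _
          · rw [hp] at hne
            rw [Set.mem_singleton_iff, hp] at h1
            have hq := fun z => insertMap_eq_right (x' := x') (y := ⟨y, h.y_notMem⟩)
              (K := G.remove {x, x'}) (z := z) (by rw [hp]; exact hne)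
            rw [hp] at hq
            rcases hq z h1 with rfl | h2 <;> rcases hq z' (hzz.symm.trans h1) with rfl | h3
            · exact G.edge.refl _
            · exact h3 ▸ h.edge'
            · exact h2 ▸ G.edge.symm h.edge'
            · exact h2 ▸ h3 ▸ G.edge.refl _
      · rw [hmem] at hz hz'
        obtain ⟨hzB, ez⟩ := hcoe z hz.1 hz.2.1
        obtain ⟨hzB', ez'⟩ := hcoe z' hz'.1 hz'.2.1
        rw [ez, ez'] at hzz
        rcases (h.remove_edge_iff _ _).1 hzz with h1 | ⟨h1, -⟩ | ⟨h1, -⟩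
        · exact h1
        · exact absurd h1 hz.2.2.1
        · exact absurd h1 hz.2.2.2
    · intro hzz
      have hcases : ∀ z z', G.edge z z' → (z ≠ x ∧ z ≠ x' ∧ z ≠ y ∧ z ≠ y') ∨
          insertMap ⟨y, h.y_notMem⟩ (G.remove {x, x'}) z =
            insertMap ⟨y, h.y_notMem⟩ (G.remove {x, x'}) z' := by
        intro z z' hzz
        by_cases h1 : z = x
        · subst h1
          rcases h.edge_x hzz with rfl | rfl
          exacts [Or.inr rfl, Or.inr (hl.trans hyy.symm)]
        by_cases h2 : z = x'
        · subst h2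
          rcases h.symm.edge_x hzz with rfl | rfl
          exacts [Or.inr rfl, Or.inr (hr.trans hyy'.symm)]
        by_cases h3 : z = y
        · subst h3
          rcases h.edge_y hzz with rfl | rfl
          exacts [Or.inr rfl, Or.inr (hyy.trans hl.symm)]
        by_cases h4 : z = y'
        · subst h4
          rcases h.symm.edge_y hzz with rfl | rfl
          exacts [Or.inr rfl, Or.inr (hyy'.trans hr.symm)]
        exact Or.inl ⟨h1, h2, h3, h4⟩
      rcases hcases z z' hzz with h1 | h1
      · rcases hcases z' z (G.edge.symm hzz) with h2 | h2
        · refine Or.inr ⟨(hmem z).2 h1, (hmem z').2 h2, ?_⟩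
          obtain ⟨hzB, ez⟩ := hcoe z h1.1 h1.2.1
          obtain ⟨hzB', ez'⟩ := hcoe z' h2.1 h2.2.1
          rw [ez, ez']
          exact (h.remove_edge_iff _ _).2 (Or.inl hzz)
        · exact Or.inl h2.symm
      · exact Or.inl h1

end Graph

/-! ### Summation over the vertices of valence two -/

namespace Graph

variable {β : Type} {G : Graph β} {x x' y y' : β}

theorem BivStep.marked_iff (h : G.BivStep x x' y y') {E : Set β} (hx : x ∉ E) (hx' : x' ∉ E) :
    (G.remove {x, x'}).Marked (Subtype.val ⁻¹' E) ↔ G.Marked E := by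
  have hxl : x ∉ G.legs := fun hl => h.y_ne.1 (hl y h.edge)
  have hxl' : x' ∉ G.legs := fun hl => h.y'_ne.2 (hl y' h.edge')
  have hlegs : (G.remove {x, x'}).legs = Subtype.val ⁻¹' E ↔ G.legs = E := by
    constructor
    · intro hE
      ext z
      by_cases hz : z ∈ ({x, x'} : Set β)
      · rcases hz with rfl | rfl
        exacts [iff_of_false hxl hx, iff_of_false hxl' hx']
      · rw [← h.remove_legs ⟨z, hz⟩, hE]
        rfl
    · intro hE
      ext z
      rw [h.remove_legs, hE]
      rfl
  constructor
  · intro hm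
    refine ⟨h.nice_of_remove hm.nice, fun a b => ?_, hlegs.1 hm.legs_eq⟩
    have hout : ∀ a, ∃ b : {z | z ∉ ({x, x'} : Set β)}, G.conn a b := by
      intro a
      by_cases ha : a ∈ ({x, x'} : Set β)
      · rcases ha with rfl | rfl
        exacts [⟨⟨y, h.y_notMem⟩, conn_edge h.edge⟩, ⟨⟨y', h.y'_notMem⟩, conn_edge h.edge'⟩]
      · exact ⟨⟨a, ha⟩, G.conn.refl a⟩
    obtain ⟨a', ha⟩ := hout a
    obtain ⟨b', hb⟩ := hout b
    have := hm.connected a' b'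
    rw [G.remove_conn h.vertClosed] at this
    exact G.conn.trans ha (G.conn.trans this (G.conn.symm hb))
  · exact fun hm => ⟨h.nice_remove hm.nice, remove_connected hm.connected h.vertClosed,
      hlegs.2 hm.legs_eq⟩

theorem BivStep.ncard_biv [Finite β] (h : G.BivStep x x' y y') :
    G.biv.ncard = (G.remove {x, x'}).biv.ncard + 2 := by
  rw [G.remove_biv h.vertClosed, ← Set.ncard_image_of_injective _ Subtype.val_injective,
    Subtype.image_preimage_coe, ← Set.ncard_sdiff_add_ncard_of_subset h.subset_biv,
    Set.ncard_pair h.ne]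
  congr 2
  ext z
  exact and_comm

theorem ncard_vert_eq_valence (G : Graph β) (x : β) :
    G.valence (Quotient.mk _ x) = {y | G.vert x y}.ncard := by
  rw [valence]
  congr 1
  ext y
  exact ⟨fun h => G.vert.symm (Quotient.exact h), fun h => Quotient.sound (G.vert.symm h)⟩

theorem vertProd_remove {R : Type} [CommRing R] [Finite β] (f : ℕ → R) {B : Set β}
    (hB : ∀ z, z ∈ B ↔ G.vert x z) :
    vertProd f G = f {z | G.vert x z}.ncard * vertProd f (G.remove B) := by
  have hcl : G.VertClosed B := fun a ha b hab => (hB b).2 (G.vert.trans ((hB a).1 ha) hab)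
  let F : Option (Quotient (G.remove B).vert) → Quotient G.vert := fun q =>
    q.elim (Quotient.mk _ x) (Quotient.map Subtype.val fun _ _ h => h)
  have hF : Function.Bijective F := by
    constructor
    · rintro (_ | a) (_ | b) h
      · rfl
      · induction b using Quotient.inductionOn with | _ b => ?_
        exact absurd ((hB b).2 (Quotient.exact h)) b.2
      · induction a using Quotient.inductionOn with | _ a => ?_
        exact absurd ((hB a).2 (G.vert.symm (Quotient.exact h))) a.2
      · induction a, b using Quotient.inductionOn₂ with | _ a b => ?_
        have h' : G.vert a b := Quotient.exact h
        exact congrArg some (Quotient.sound h')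
    · intro q
      induction q using Quotient.inductionOn with | _ z => ?_
      by_cases hz : z ∈ B
      · exact ⟨none, Quotient.sound ((hB z).1 hz)⟩
      · exact ⟨some (Quotient.mk _ ⟨z, hz⟩), rfl⟩
  have := Fintype.ofFinite (Quotient (G.remove B).vert)
  have := Fintype.ofFinite (Quotient G.vert)
  rw [vertProd, vertProd, finprod_eq_prod_of_fintype, finprod_eq_prod_of_fintype,
    ← Fintype.prod_bijective F hF (fun q => f (G.valence (F q))) _ fun _ => rfl,
    Fintype.prod_option]
  congr 1
  · rw [← ncard_vert_eq_valence]
    rfl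
  · refine Finset.prod_congr rfl fun q _ => ?_
    induction q using Quotient.inductionOn with | _ z => ?_
    have h1 := ncard_vert_eq_valence (G.remove B) z
    have h2 := ncard_vert_restrict G {x | x ∉ B} (fun a ha b hab => hcl.not_mem hab ha) z
    have h3 := ncard_vert_eq_valence G z
    exact congrArg f (h3.trans (h2.symm.trans h1.symm))

/-- A vertex `{x, x'}` of valence two whose half-line `x` belongs to the line of `y`. -/
def HasStep (G : Graph β) (x x' y : β) : Prop := ∃ y', G.BivStep x x' y y'

theorem HasStep.unique {x'' z : β} (h : G.HasStep x x' y) (h' : G.HasStep x x'' z) :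
    x'' = x' ∧ z = y := by
  obtain ⟨y', h⟩ := h
  obtain ⟨y'', h'⟩ := h'
  refine ⟨?_, ?_⟩
  · rcases (h.vert_iff x'').1 ((h'.vert_iff x'').2 (Or.inr rfl)) with e | e
    · exact absurd e.symm h'.ne
    · exact e
  · rcases h.edge_x h'.edge with e | e
    · exact absurd e h'.y_ne.1
    · exact e

theorem HasStep.notMem_legs (h : G.HasStep x x' y) :
    x ∉ G.legs ∧ x' ∉ G.legs ∧ y ∉ G.legs := by
  obtain ⟨y', h⟩ := h
  exact ⟨fun hl => h.y_ne.1 (hl y h.edge), fun hl => h.y'_ne.2 (hl y' h.edge'),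
    fun hl => h.y_ne.1 (hl x (G.edge.symm h.edge)).symm⟩

end Graph

section Recursion

variable {R : Type} [CommRing R]

open Classical in
/-- The restriction of a function to the graphs with `k` half-lines at vertices of valence two. -/
def withBiv (Φ : GraphFun R) (k : ℕ) : GraphFun R := fun β _ G =>
  if G.biv.ncard = k then Φ β G else 0

theorem Graph.Iso.ncard_biv {α β : Type} {G : Graph α} {G' : Graph β} (e : Graph.Iso G G') :
    G'.biv.ncard = G.biv.ncard := Graph.Iso.ncard_eq e.toEquiv _ _ e.mem_biv

theorem withBiv_invariant {Φ : GraphFun R} (hΦ : Invariant Φ) (k : ℕ) :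
    Invariant (withBiv Φ k) := by
  intro β β' _ _ G G' e
  simp only [withBiv, e.ncard_biv, hΦ e]

variable (b : GraphClass → R) (y : ℕ → R)

theorem insertVal_remove {β : Type} [Finite β] {G : Graph β} {x x' z z' : β}
    (h : G.BivStep x x' z z') :
    insertVal b y β G = y 2 * insertVal b y _ (G.remove {x, x'}) := by
  have hx : {z | G.vert x z}.ncard = 2 := h.subset_biv (Or.inl rfl)
  rw [insertVal, insertVal, value_remove b h.vertClosed h.subset_biv,
    Graph.vertProd_remove (x := x) (B := {x, x'}) y fun z => (h.vert_iff z).symm, hx]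
  ring

open Classical in
-- For fixed names of the three half-lines, removal of the vertex is a bijection onto the graphs on
-- the remaining half-lines. The removed vertex contributes the factor `y 2`.
theorem sum_hasStep {β : Type} [Finite β] {E : Set β} {x x' z : β} (hne : x ≠ x')
    (hx : x ∉ E) (hx' : x' ∉ E) (hz : z ∉ E) (hzB : z ∉ ({x, x'} : Set β)) (k : ℕ) :
    ∑ G : Graph β with G.Marked E, (if G.HasStep x x' z then
        withBiv (insertVal b y) (k + 2) β G else 0) =
      y 2 * gsum (withBiv (insertVal b y) k)
        (Subtype.val ⁻¹' E : Set {z | z ∉ ({x, x'} : Set β)}) := by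
  have hin : ∀ K : Graph {z | z ∉ ({x, x'} : Set β)}, K.Marked (Subtype.val ⁻¹' E) →
      (⟨z, hzB⟩ : {z | z ∉ ({x, x'} : Set β)}) ∈ K.inner := fun K hK hl => by
    rw [hK.legs_eq] at hl
    exact hz hl
  rw [← Finset.sum_filter, Finset.filter_filter, gsum, Finset.mul_sum]
  refine Finset.sum_bij' (fun G _ => G.remove {x, x'}) (fun K _ => K.insertVert ⟨z, hzB⟩) ?_ ?_ ?_
    ?_ ?_
  · intro G hG
    simp only [Finset.mem_filter, Finset.mem_univ, true_and] at hG ⊢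
    obtain ⟨hm, z', h⟩ := hG
    exact (h.marked_iff hx hx').2 hm
  · intro K hK
    simp only [Finset.mem_filter, Finset.mem_univ, true_and] at hK ⊢
    have h := Graph.insertVert_bivStep hne (hin K hK) hK.nice.edge_unique
    refine ⟨(h.marked_iff hx hx').1 ?_, _, h⟩
    rw [Graph.remove_insertVert hne (hin K hK) hK.nice.edge_unique]
    exact hK
  · intro G hG
    simp only [Finset.mem_filter, Finset.mem_univ, true_and] at hG
    obtain ⟨hm, z', h⟩ := hG
    exact h.insertVert_remove
  · intro K hK
    simp only [Finset.mem_filter, Finset.mem_univ, true_and] at hK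
    exact Graph.remove_insertVert hne (hin K hK) hK.nice.edge_unique
  · intro G hG
    simp only [Finset.mem_filter, Finset.mem_univ, true_and] at hG
    obtain ⟨hm, z', h⟩ := hG
    simp only [withBiv, h.ncard_biv, Nat.add_right_cancel_iff, insertVal_remove b y h, mul_ite,
      mul_zero]

open Classical in
-- First half of a double count: a half-line `x` at a bivalent vertex determines the other half-line
-- `x'` of the vertex and the other end `z` of its line. So a graph with `k` such half-lines has `k`
-- triples.
theorem nsmul_withBiv {β : Type} [Fintype β] {E : Set β} {G : Graph β} (hG : G.Marked E)
    (hE : Eᶜ.Nonempty) (Φ : GraphFun R) (k : ℕ) :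
    k • withBiv Φ k β G = ∑ x ∈ Eᶜ.toFinset, ∑ x' ∈ Eᶜ.toFinset.erase x,
      ∑ z ∈ (Eᶜ.toFinset.erase x).erase x',
        if G.HasStep x x' z then withBiv Φ k β G else 0 := by
  have hi : G.inner.Nonempty := by rwa [Graph.inner, hG.legs_eq]
  have h1 : ∀ x ∈ Eᶜ.toFinset, ∑ x' ∈ Eᶜ.toFinset.erase x, ∑ z ∈ (Eᶜ.toFinset.erase x).erase x',
        (if G.HasStep x x' z then withBiv Φ k β G else 0) =
      if x ∈ G.biv then withBiv Φ k β G else 0 := by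
    intro x hx
    split_ifs with hb
    · obtain ⟨x', z, z', h⟩ := hG.nice.exists_bivStep_of_connected hG.connected hi hb
      have hs : G.HasStep x x' z := ⟨z', h⟩
      have hl := hs.notMem_legs
      rw [hG.legs_eq] at hl
      rw [Finset.sum_eq_single x', Finset.sum_eq_single z, if_pos hs]
      · exact fun w _ hw => if_neg fun hs' => hw (hs.unique hs').2
      · intro hz
        refine absurd ?_ hz
        simp [hl.2.2, h.y_ne.1, h.y_ne.2]
      · exact fun w _ hw => Finset.sum_eq_zero fun u _ => if_neg fun hs' => hw (hs.unique hs').1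
      · intro hz
        refine absurd ?_ hz
        simp [hl.2.1, h.ne.symm]
    · refine Finset.sum_eq_zero fun x' _ => Finset.sum_eq_zero fun z _ => if_neg ?_
      rintro ⟨z', h⟩
      exact hb (h.subset_biv (Or.inl rfl))
  rw [Finset.sum_congr rfl h1, ← Finset.sum_filter, Finset.sum_const]
  have h2 : (Eᶜ.toFinset.filter fun x => x ∈ G.biv).card = G.biv.ncard := by
    rw [Set.ncard_eq_toFinset_card']
    congr 1
    ext x
    simp only [Finset.mem_filter, Set.mem_toFinset, and_iff_right_iff_imp]
    intro hb hx
    obtain ⟨x', z, z', h⟩ := hG.nice.exists_bivStep_of_connected hG.connected hi hb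
    rw [← hG.legs_eq] at hx
    exact Graph.HasStep.notMem_legs ⟨z', h⟩ |>.1 hx
  rw [h2, withBiv]
  split_ifs with h
  · rw [h]
  · rw [smul_zero, smul_zero]

open Classical in
-- Second half of the double count: there are `(r+2)(r+1)r` triples of distinct internal half-lines,
-- and each contributes the same amount.
theorem gsum_withBiv_succ {β : Type} [Fintype β] {E : Set β} {r : ℕ} (hE : Eᶜ.ncard = r + 2)
    (k : ℕ) :
    (k + 2) • gsum (withBiv (insertVal b y) (k + 2)) E =
      ((r + 2) * (r + 1) * r) • (y 2 * gnum (withBiv (insertVal b y) k) E.ncard r) := by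
  have hI : Eᶜ.toFinset.card = r + 2 := by
    rw [← Set.ncard_eq_toFinset_card', hE]
  have hne : Eᶜ.Nonempty := by
    rw [← Set.ncard_pos, hE]
    omega
  have hinv : Invariant (withBiv (insertVal b y) k) :=
    withBiv_invariant (insertVal_invariant b y) k
  have h1 : ∀ x ∈ Eᶜ.toFinset, ∀ x' ∈ Eᶜ.toFinset.erase x,
      ∀ z ∈ (Eᶜ.toFinset.erase x).erase x', ∑ G : Graph β with G.Marked E,
        (if G.HasStep x x' z then withBiv (insertVal b y) (k + 2) _ G else 0) =
      y 2 * gnum (withBiv (insertVal b y) k) E.ncard r := by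
    intro x hx x' hx' z hz
    simp only [Finset.mem_erase, Set.mem_toFinset] at hx hx' hz
    rw [sum_hasStep b y hx'.1.symm hx hx'.2 hz.2.2 (by
      rintro (h | h)
      exacts [hz.2.1 h, hz.1 h]) k, gsum_eq_gnum hinv]
    have hB : ({x, x'} : Set β) ⊆ Eᶜ := by
      rintro w (rfl | rfl)
      exacts [hx, hx'.2]
    congr 2
    · rw [← Set.ncard_image_of_injective _ Subtype.val_injective, Subtype.image_preimage_coe,
        Set.inter_eq_right.2 (show E ⊆ {z | z ∉ ({x, x'} : Set β)} from
          fun w hw hwB => hB hwB hw)]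
    · rw [← Set.preimage_compl, ← Set.ncard_image_of_injective _ Subtype.val_injective,
        Subtype.image_preimage_coe]
      have h2 := Set.ncard_sdiff hB
      rw [Set.ncard_pair hx'.1.symm, hE, Nat.add_sub_cancel] at h2
      refine Eq.trans (congrArg Set.ncard ?_) h2
      ext w
      exact and_comm
  have h2 : (k + 2) • gsum (withBiv (insertVal b y) (k + 2)) E =
      ∑ x ∈ Eᶜ.toFinset, ∑ x' ∈ Eᶜ.toFinset.erase x, ∑ z ∈ (Eᶜ.toFinset.erase x).erase x',
        ∑ G : Graph β with G.Marked E,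
          (if G.HasStep x x' z then withBiv (insertVal b y) (k + 2) _ G else 0) := by
    rw [gsum, Finset.smul_sum, Finset.sum_congr rfl fun G hG =>
      nsmul_withBiv (Finset.mem_filter.1 hG).2 hne (insertVal b y) (k + 2), Finset.sum_comm]
    refine Finset.sum_congr rfl fun x _ => ?_
    rw [Finset.sum_comm]
    refine Finset.sum_congr rfl fun x' _ => ?_
    rw [Finset.sum_comm]
  rw [h2]
  calc _ = ∑ x ∈ Eᶜ.toFinset, ∑ x' ∈ Eᶜ.toFinset.erase x, ∑ z ∈ (Eᶜ.toFinset.erase x).erase x',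
        y 2 * gnum (withBiv (insertVal b y) k) E.ncard r :=
      Finset.sum_congr rfl fun x hx => Finset.sum_congr rfl fun x' hx' =>
        Finset.sum_congr rfl fun z hz => h1 x hx x' hx' z hz
    _ = ∑ x ∈ Eᶜ.toFinset, ∑ x' ∈ Eᶜ.toFinset.erase x,
        r • (y 2 * gnum (withBiv (insertVal b y) k) E.ncard r) := by
      refine Finset.sum_congr rfl fun x hx => Finset.sum_congr rfl fun x' hx' => ?_
      rw [Finset.sum_const, Finset.card_erase_of_mem hx', Finset.card_erase_of_mem hx, hI]
      rfl
    _ = ∑ x ∈ Eᶜ.toFinset, (r + 1) • r • (y 2 * gnum (withBiv (insertVal b y) k) E.ncard r) := by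
      refine Finset.sum_congr rfl fun x hx => ?_
      rw [Finset.sum_const, Finset.card_erase_of_mem hx, hI]
      rfl
    _ = _ := by
      rw [Finset.sum_const, hI, smul_smul, smul_smul]

theorem gnum_withBiv_succ (n r k : ℕ) :
    (k + 2) • gnum (withBiv (insertVal b y) (k + 2)) n (r + 2) =
      ((r + 2) * (r + 1) * r) • (y 2 * gnum (withBiv (insertVal b y) k) n r) := by
  have h := gsum_withBiv_succ b y (ncard_stdLegs_compl n (r + 2)) k
  rw [ncard_stdLegs] at h
  exact h

end Recursion

/-! ### Green's functions after summation over the vertices of valence two -/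

section Trivial

variable {R : Type} [CommRing R]

/-- The graph with one vertex and no internal line. -/
def star (β : Type) : Graph β := ⟨⊤, ⊥⟩

theorem star_legs (β : Type) : (star β).legs = Set.univ :=
  Set.eq_univ_of_forall fun _ _ h => Eq.symm h

theorem marked_zero_iff {n : ℕ} {G : Graph (Fin n ⊕ Fin 0)} :
    G.Marked (stdLegs n 0) ↔ G = star _ := by
  have huniv : stdLegs n 0 = Set.univ := by
    rw [← compl_compl (stdLegs n 0), Set.compl_range_inl, Set.range_eq_empty, Set.compl_empty]
  rw [huniv]
  constructor
  · intro h
    have hedge : G.edge = ⊥ := by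
      refine eq_bot_iff.2 fun x y hxy => ?_
      have hx : x ∈ G.legs := by
        rw [h.legs_eq]
        trivial
      exact (hx y hxy).symm
    have hvert : G.vert = ⊤ := by
      have : G.conn = G.vert := by rw [Graph.conn, hedge, sup_bot_eq]
      refine eq_top_iff.2 fun x y _ => ?_
      rw [← this]
      exact h.connected x y
    exact Graph.ext hvert hedge
  · rintro rfl
    have hc : ∀ x y, (star (Fin n ⊕ Fin 0)).conn x y := fun x y => Graph.conn_vert trivial
    refine ⟨⟨fun x y z hy hz hyx _ => absurd (Eq.symm hy) hyx,
      fun C _ x hx y hy h => absurd (Eq.subst h hx) hy, fun x => ⟨x, ?_, hc x x⟩⟩, hc,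
      star_legs _⟩
    rw [star_legs]
    trivial

theorem gnum_zero (Φ : GraphFun R) (n : ℕ) :
    gnum Φ n 0 = Φ (Fin n ⊕ Fin 0) (star (Fin n ⊕ Fin 0)) := by
  classical
  rw [gnum, gsum, Finset.sum_filter, Finset.sum_eq_single (star _)]
  · exact if_pos (marked_zero_iff.2 rfl)
  · exact fun G _ hG => if_neg fun h => hG (marked_zero_iff.1 h)
  · exact fun h => (h (Finset.mem_univ _)).elim

theorem star_not_isOnePI (β : Type) [Finite β] : ¬ (star β).IsOnePI := fun h => by
  obtain ⟨x, hx⟩ := h.inner_nonempty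
  rw [Graph.inner, star_legs] at hx
  exact hx trivial

theorem gnum_onePIVal_zero (ψ : GraphClass → R) (n : ℕ) :
    gnum (onePIVal ψ) n 0 = 0 := by
  rw [gnum_zero, onePIVal_of_not _ (star_not_isOnePI _)]

/-- The single vertex without lines is allowed only if its valence is at least three. This is the
constant term of `Xⁿ` for `n ≥ 3`, and the reason why two-point functions enter without one. -/
theorem gnum_coreVal_zero (a : GraphClass → R) {n : ℕ} (hn : 0 < n) :
    gnum (coreVal a) n 0 = if 3 ≤ n then 1 else 0 := by
  have h : (star (Fin n ⊕ Fin 0)).MinThree ↔ 3 ≤ n := by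
    have hcard : ∀ x, {y | (star (Fin n ⊕ Fin 0)).vert x y}.ncard = n := fun x => by
      have : {y | (star (Fin n ⊕ Fin 0)).vert x y} = Set.univ :=
        Set.eq_univ_of_forall fun _ => trivial
      rw [this, Set.ncard_univ, Nat.card_sum, Nat.card_fin, Nat.card_fin, add_zero]
    constructor
    · intro h
      exact (h (Sum.inl ⟨0, hn⟩)).trans_eq (hcard _)
    · exact fun h x => h.trans_eq (hcard x).symm
  rw [gnum_zero, coreVal, evalGraph_of_not _ (star_not_isOnePI _)]
  simp only [h]

theorem gnum_insertVal_zero (b : GraphClass → R) (y : ℕ → R) {n : ℕ} (hn : 0 < n) :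
    gnum (insertVal b y) n 0 = y n := by
  have x₀ : Fin n ⊕ Fin 0 := Sum.inl ⟨0, hn⟩
  let _ : Unique (Quotient (star (Fin n ⊕ Fin 0)).vert) :=
    { default := Quotient.mk _ x₀
      uniq := fun q => by
        induction q using Quotient.inductionOn with | _ x => ?_
        exact Quotient.sound trivial }
  rw [gnum_zero, insertVal, value_eq_one, one_mul, vertProd, finprod_unique]
  · congr 1
    have : {x | Quotient.mk (star (Fin n ⊕ Fin 0)).vert x = default} = Set.univ :=
      Set.eq_univ_of_forall fun _ => Subsingleton.elim _ _
    rw [Graph.valence, this, Set.ncard_univ, Nat.card_sum, Nat.card_fin, Nat.card_fin, add_zero]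
  · intro x
    rw [star_legs]
    trivial

theorem gnum_congr {Φ Φ' : GraphFun R} {n r : ℕ}
    (h : ∀ G : Graph (Fin n ⊕ Fin r), G.Marked (stdLegs n r) → Φ _ G = Φ' _ G) :
    gnum Φ n r = gnum Φ' n r := by
  classical
  exact Finset.sum_congr rfl fun G hG => h G (Finset.mem_filter.1 hG).2

theorem gnum_eq_zero {Φ : GraphFun R} {n r : ℕ}
    (h : ∀ G : Graph (Fin n ⊕ Fin r), G.Marked (stdLegs n r) → Φ _ G = 0) : gnum Φ n r = 0 := by
  classical
  exact Finset.sum_eq_zero fun G hG => h G (Finset.mem_filter.1 hG).2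

theorem gnum_mul (c : R) (Φ : GraphFun R) (n r : ℕ) :
    gnum (fun β _ G => c * Φ β G) n r = c * gnum Φ n r := by
  classical
  exact (Finset.mul_sum _ _ _).symm

theorem Graph.Marked.inner_nonempty {n r : ℕ} {G : Graph (Fin n ⊕ Fin r)}
    (hG : G.Marked (stdLegs n r)) (hr : 0 < r) : G.inner.Nonempty := by
  rw [Graph.inner, hG.legs_eq, ← Set.ncard_pos, ncard_stdLegs_compl]
  exact hr

theorem gnum_coreVal_eq_onePIVal (a : GraphClass → R) {n r : ℕ} (hr : 0 < r) :
    gnum (coreVal a) n r = gnum (onePIVal a) n r := by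
  refine gnum_congr fun G hG => ?_
  by_cases h : G.IsOnePI
  · rw [coreVal, if_pos (show G.MinThree from h.three_le_valence), onePIVal_of_isOnePI _ h,
      evalGraph_of_isOnePI _ h]
  · rw [onePIVal_of_not _ h, coreVal, if_neg]
    exact fun h3 => h (Graph.isOnePI_iff.2 ⟨hG.nice, hG.connected, hG.inner_nonempty hr, h3⟩)

end Trivial

/-! ### The geometric series of bivalent vertices on the lines -/

section Smoothing

variable {R : Type} [CommRing R] (b : GraphClass → R) (y : ℕ → R)

theorem gnum_odd (Φ : GraphFun R) (n s : ℕ) : gnum Φ n (2 * s + 1) = 0 := by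
  refine gnum_eq_zero fun G hG => ?_
  obtain ⟨k, hk, -⟩ := Graph.exists_numEdges hG.nice.edge_unique
  rw [Graph.inner, hG.legs_eq, ncard_stdLegs_compl] at hk
  omega

theorem Graph.Marked.ncard_biv_ne_one {n r : ℕ} {G : Graph (Fin n ⊕ Fin r)}
    (hG : G.Marked (stdLegs n r)) (hr : 0 < r) : G.biv.ncard ≠ 1 := by
  intro h
  obtain ⟨x, hx⟩ := Set.ncard_eq_one.1 h
  obtain ⟨x', z, z', hs⟩ := hG.nice.exists_bivStep_of_connected hG.connected
    (hG.inner_nonempty hr) (x := x) (by rw [hx]; rfl)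
  have := hs.ncard_biv
  omega

theorem Graph.Marked.ncard_biv_le {n r : ℕ} {G : Graph (Fin n ⊕ Fin r)}
    (hG : G.Marked (stdLegs n r)) (hr : 0 < r) : G.biv.ncard ≤ r := by
  refine (Set.ncard_le_ncard (t := (stdLegs n r)ᶜ) fun x hx => ?_).trans
    (ncard_stdLegs_compl n r).le
  rw [← hG.legs_eq]
  obtain ⟨x', z, z', hs⟩ := hG.nice.exists_bivStep_of_connected hG.connected
    (hG.inner_nonempty hr) hx
  exact Graph.HasStep.notMem_legs ⟨z', hs⟩ |>.1

variable [Algebra ℂ R]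

/-- The sum over the graphs with `k` half-lines at vertices of valence two. -/
def bivSum (n r k : ℕ) : R :=
  ((r.factorial : ℂ)⁻¹) • gnum (withBiv (insertVal b y) k) n r

/-- The double count divided by factorials: of the number `(r+2)(r+1)r` of triples only the factor
`r` remains. -/
theorem bivSum_succ (n r k : ℕ) : ((k + 2 : ℕ) : ℂ) • bivSum b y n (r + 2) (k + 2) =
    (r : ℂ) • (y 2 * bivSum b y n r k) := by
  have h := gnum_withBiv_succ b y n r k
  rw [← Nat.cast_smul_eq_nsmul ℂ, ← Nat.cast_smul_eq_nsmul ℂ] at h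
  rw [bivSum, bivSum, smul_comm, h, mul_smul_comm, smul_smul, smul_smul]
  congr 1
  have h1 : (r.factorial : ℂ) ≠ 0 := Nat.cast_ne_zero.2 (Nat.factorial_ne_zero _)
  have h2 : ((r + 1 : ℕ) : ℂ) ≠ 0 := Nat.cast_ne_zero.2 (Nat.succ_ne_zero _)
  have h3 : ((r + 2 : ℕ) : ℂ) ≠ 0 := Nat.cast_ne_zero.2 (Nat.succ_ne_zero _)
  rw [Nat.factorial_succ, Nat.factorial_succ]
  have h4 : (r : ℂ) + 1 + 1 ≠ 0 := by exact_mod_cast h3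
  push_cast at h2 h3 ⊢
  field_simp
  ring

theorem bivSum_eq_of_smul {x z : R} {c d : ℕ} (hc : c ≠ 0) {e : ℕ} (hd : d = c * e)
    (h : (c : ℂ) • x = (d : ℂ) • z) : x = (e : ℂ) • z := by
  have hc' : (c : ℂ) ≠ 0 := Nat.cast_ne_zero.2 hc
  rw [hd, Nat.cast_mul, mul_smul] at h
  exact smul_right_injective R hc' h

theorem eq_zero_of_natCast_smul {x : R} {c : ℕ} (hc : c ≠ 0) (h : (c : ℂ) • x = 0) : x = 0 :=
  (smul_eq_zero_iff_right (Nat.cast_ne_zero.2 hc)).1 h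

/-- Bivalent vertices take half-lines in pairs. The case of a single half-line is excluded directly,
and the recursion does the rest. -/
theorem bivSum_odd (n j : ℕ) : ∀ s, 0 < s → bivSum b y n (2 * s) (2 * j + 1) = 0 := by
  induction j with
  | zero =>
    intro s hs
    rw [bivSum, gnum_eq_zero, smul_zero]
    intro G hG
    exact if_neg (hG.ncard_biv_ne_one (by omega))
  | succ j ih =>
    intro s hs
    obtain ⟨s, rfl⟩ : ∃ t, s = t + 1 := ⟨s - 1, by omega⟩
    have h := bivSum_succ b y n (2 * s) (2 * j + 1)
    refine eq_zero_of_natCast_smul (c := 2 * j + 1 + 2) (by omega) (h.trans ?_)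
    rcases Nat.eq_zero_or_pos s with rfl | hs'
    · simp
    · rw [ih s hs', mul_zero, smul_zero]

/-- Not all internal half-lines can be at bivalent vertices: a bivalent vertex has to be inserted
into an existing line. In the recursion this is the factor `r = 0` at the start. -/
theorem bivSum_diag (n j : ℕ) : bivSum b y n (2 * (j + 1)) (2 * (j + 1)) = 0 := by
  induction j with
  | zero =>
    refine eq_zero_of_natCast_smul (c := 0 + 2) (by omega) ((bivSum_succ b y n 0 0).trans ?_)
    simp
  | succ j ih =>
    refine eq_zero_of_natCast_smul (c := 2 * (j + 1) + 2) (by omega)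
      ((bivSum_succ b y n (2 * (j + 1)) (2 * (j + 1))).trans ?_)
    rw [ih, mul_zero, smul_zero]

/-- The binomial coefficient counts the ways to distribute `j` bivalent vertices among the `s + 1`
internal lines of the graph without them. -/
theorem bivSum_even (n s j : ℕ) : bivSum b y n (2 * (s + 1) + 2 * j) (2 * j) =
    ((s + j).choose j : ℂ) • (y 2 ^ j * bivSum b y n (2 * (s + 1)) 0) := by
  induction j with
  | zero => simp
  | succ j ih =>
    have h := bivSum_succ b y n (2 * (s + 1) + 2 * j) (2 * j)
    rw [ih, mul_smul_comm, smul_smul, ← Nat.cast_mul] at h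
    have hc : (2 * (s + 1) + 2 * j) * (s + j).choose j =
        (2 * j + 2) * (s + (j + 1)).choose (j + 1) := by
      have := Nat.add_one_mul_choose_eq (s + j) j
      rw [← add_assoc]
      linarith
    have h' := bivSum_eq_of_smul (by omega) hc h
    rw [pow_succ', mul_assoc]
    exact h'

theorem sum_bivSum (n s : ℕ) (hs : 0 < s) :
    (((2 * s).factorial : ℂ)⁻¹) • gnum (insertVal b y) n (2 * s) =
      ∑ j ∈ Finset.range s, bivSum b y n (2 * s) (2 * j) := by
  classical
  have h1 : (((2 * s).factorial : ℂ)⁻¹) • gnum (insertVal b y) n (2 * s) =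
      ∑ k ∈ Finset.range (2 * (s + 1)), bivSum b y n (2 * s) k := by
    simp only [bivSum, ← Finset.smul_sum]
    congr 1
    simp only [gnum, gsum]
    rw [Finset.sum_comm]
    refine Finset.sum_congr rfl fun G hG => ?_
    have hG' := (Finset.mem_filter.1 hG).2
    have hle := hG'.ncard_biv_le (by omega)
    simp only [withBiv]
    rw [Finset.sum_ite_eq, if_pos (Finset.mem_range.2 (by omega))]
  have h2 : ∀ m, ∑ k ∈ Finset.range (2 * m), bivSum b y n (2 * s) k =
      ∑ j ∈ Finset.range m, bivSum b y n (2 * s) (2 * j) := by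
    intro m
    induction m with
    | zero => simp
    | succ m ih =>
      rw [mul_add, Finset.sum_range_succ, Finset.sum_range_succ, ih, bivSum_odd b y n m s hs,
        add_zero, Finset.sum_range_succ]
  rw [h1, h2, Finset.sum_range_succ]
  obtain ⟨s, rfl⟩ : ∃ t, s = t + 1 := ⟨s - 1, by omega⟩
  rw [bivSum_diag, add_zero]

omit [Algebra ℂ R] in
-- The binomial series of `(1 - w)^(-(s+1))`, which is finite because `w` is nilpotent.
theorem sum_choose_mul_pow {w : R} {J : ℕ} (hw : w ^ J = 0) (s : ℕ) :
    (1 - w) ^ (s + 1) * ∑ j ∈ Finset.range J, ((s + j).choose j : R) * w ^ j = 1 := by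
  -- Multiplication by `1 - w` takes differences of the coefficients, up to a boundary term with `w
  -- ^ J`. By Pascal's rule the differences lower `s` by one.
  have step : ∀ f g : ℕ → R, f 0 = g 0 → (∀ j, f (j + 1) - f j = g (j + 1)) → ∀ J,
      (1 - w) * ∑ j ∈ Finset.range J, f j * w ^ j =
        ∑ j ∈ Finset.range J, g j * w ^ j - if J = 0 then 0 else f (J - 1) * w ^ J := by
    intro f g h0 hs J
    induction J with
    | zero => simp
    | succ J ih =>
      rw [Finset.sum_range_succ, mul_add, ih, Finset.sum_range_succ, if_neg (Nat.succ_ne_zero J)]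
      rcases J with _ | J
      · simp [h0]
        ring
      · rw [if_neg (Nat.succ_ne_zero J), Nat.add_sub_cancel, Nat.add_sub_cancel, ← hs]
        ring
  have hJ : ∀ c : R, (if J = 0 then 0 else c * w ^ J) = 0 := fun c => by
    split_ifs
    · rfl
    · rw [hw, mul_zero]
  have h0 : (1 - w) * ∑ j ∈ Finset.range J, ((0 + j).choose j : R) * w ^ j = 1 := by
    simp only [zero_add, Nat.choose_self, Nat.cast_one, one_mul]
    rw [mul_neg_geom_sum, hw, sub_zero]
  induction s with
  | zero => rw [zero_add, pow_one, h0]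
  | succ s ih =>
    rw [pow_succ, mul_assoc, step _ (fun j => ((s + j).choose j : R)) (by simp) ?_ J, hJ, sub_zero,
      ih]
    intro j
    have : s + 1 + (j + 1) = (s + j + 1) + 1 := by ring
    rw [this, Nat.choose_succ_succ (s + j + 1) j]
    have h1 : s + 1 + j = s + j + 1 := by ring
    rw [h1]
    rw [Nat.succ_eq_add_one]
    push_cast
    ring_nf

end Smoothing

/-! ### Vertex weights governed by a single coupling -/

section Composition

variable {R : Type} [CommRing R]

theorem Graph.valence_mk {β : Type} (G : Graph β) (x : β) :
    G.valence (Quotient.mk G.vert x) = {y | G.vert x y}.ncard := by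
  rw [Graph.valence]
  congr 1
  ext z
  exact ⟨fun h => G.vert.symm (Quotient.exact h), fun h => Quotient.sound (G.vert.symm h)⟩

/-- The product over the vertices of a graph of weights which are monomial in the valence. -/
theorem vertProd_monomial {β : Type} [Finite β] [Nonempty β] {G : Graph β} (hG : G.IsOnePI)
    {y : ℕ → R} {P Y : R} (hy : ∀ m, 3 ≤ m → y m = P ^ (m - 2) * Y ^ m) :
    vertProd y G = P ^ (2 * G.loops + G.numLegs - 2) * Y ^ Nat.card β := by
  have := Fintype.ofFinite (Quotient G.vert)
  have hval : ∀ v, 3 ≤ G.valence v := fun v => by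
    obtain ⟨x, rfl⟩ := Quotient.exists_rep v
    exact (hG.three_le_valence x).trans_eq (G.valence_mk x).symm
  rw [vertProd, finprod_eq_prod_of_fintype, Finset.prod_congr rfl fun v _ => hy _ (hval v),
    Finset.prod_mul_distrib, Finset.prod_pow_eq_pow_sum, Finset.prod_pow_eq_pow_sum,
    G.sum_valence]
  congr 2
  have h1 := G.sum_valence
  have h2 : ∑ v, (G.valence v - 2) + 2 * G.numVerts = ∑ v, G.valence v := by
    have : 2 * G.numVerts = ∑ _v : Quotient G.vert, 2 := by
      rw [Finset.sum_const, Finset.card_univ, smul_eq_mul, Graph.numVerts,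
        Nat.card_eq_fintype_card, mul_comm]
    rw [this, ← Finset.sum_add_distrib]
    exact Finset.sum_congr rfl fun v _ => by have := hval v; omega
  -- The exponent of `P` is the sum of the valences minus `2 V`, which the Euler relation turns into
  -- `2 L + E - 2`.
  have h3 := Graph.two_mul_loops (Graph.isOnePI_iff.1 hG).1.edge_unique hG.connected
  omega

variable [Algebra ℂ R] {b : GraphClass → R} {y : ℕ → R} {P Y : R}

/-- If there are internal lines, the graphs without bivalent vertices are the 1PI graphs. Their
vertex weights depend only on the loop number and the numbers of half-lines, so the power of `Y` can
be taken out. -/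
theorem bivSum_zero (hy : ∀ m, 3 ≤ m → y m = P ^ (m - 2) * Y ^ m) {n r : ℕ} (hr : 0 < r) :
    bivSum b y n r 0 = Y ^ (n + r) * ((r.factorial : ℂ)⁻¹) •
      gnum (onePIVal fun c => b c * P ^ (2 * c.rep.graph.loops + n - 2)) n r := by
  rw [bivSum, mul_smul_comm, ← gnum_mul]
  congr 1
  refine gnum_congr fun G hG => ?_
  by_cases h : G.IsOnePI
  · have : Nonempty (Fin n ⊕ Fin r) := ⟨Sum.inr ⟨0, hr⟩⟩
    have hb := h.biv_eq_empty
    rw [withBiv, if_pos (by rw [hb, Set.ncard_empty]), insertVal, value_of_biv_eq_empty _ hb,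
      prodVal_of_connected _ h.connected, evalGraph_of_isOnePI _ h, vertProd_monomial h hy,
      onePIVal_of_isOnePI _ h, loops_classOf, Graph.numLegs, hG.legs_eq, ncard_stdLegs,
      Nat.card_sum, Nat.card_fin, Nat.card_fin]
    ring
  · rw [onePIVal_of_not _ h, mul_zero, withBiv, if_neg]
    intro hb
    have hb' : G.biv = ∅ := (Set.ncard_eq_zero).1 hb
    refine h (Graph.isOnePI_iff.2 ⟨hG.nice, hG.connected, hG.inner_nonempty hr, fun x => ?_⟩)
    exact hG.nice.three_le_valence hG.connected (hG.inner_nonempty hr) (by rw [hb']; exact id)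

/-- The sum of the values of the 1PI graphs with `n` external lines and less than `B` other
half-lines, weighted with symmetry factors. -/
def onePISum (a : GraphClass → R) (n B : ℕ) : R :=
  ∑ N ∈ Finset.range B, ((N.factorial : ℂ)⁻¹) • gnum (onePIVal a) n N

theorem sum_coreVal (a : GraphClass → R) {n B : ℕ} (hn : 0 < n) (hB : 0 < B) :
    ∑ N ∈ Finset.range B, ((N.factorial : ℂ)⁻¹) • gnum (coreVal a) n N =
      (if 3 ≤ n then 1 else 0) + onePISum a n B := by
  obtain ⟨B, rfl⟩ : ∃ k, B = k + 1 := ⟨B - 1, by omega⟩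
  rw [onePISum, Finset.sum_range_succ', Finset.sum_range_succ', gnum_coreVal_zero a hn,
    gnum_onePIVal_zero, Finset.sum_congr rfl fun N _ => by
      rw [gnum_coreVal_eq_onePIVal a (Nat.succ_pos N)]]
  simp [add_comm]

theorem greenSum_eq_onePISum {L : ℕ} {a : GraphClass → R}
    (ha : ∀ c, L < c.rep.graph.loops → a c = 0) {n B : ℕ} (hn : 0 < n) (hB : 6 * L + 2 * n < B) :
    greenSum a L n = (if 3 ≤ n then 1 else 0) + onePISum a n B := by
  rw [greenSum_eq ha hB, sum_coreVal a hn (by omega)]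

omit [Algebra ℂ R] in
theorem sum_range_two_mul {f : ℕ → R} (hf : ∀ s, f (2 * s + 1) = 0) (M : ℕ) :
    ∑ r ∈ Finset.range (2 * M), f r = ∑ s ∈ Finset.range M, f (2 * s) := by
  induction M with
  | zero => simp
  | succ M ih =>
    rw [mul_add, Finset.sum_range_succ, Finset.sum_range_succ, ih, hf, add_zero,
      Finset.sum_range_succ]

/-- A graph with `σ + 1` internal lines has the factor `Y ^ (n + 2 (σ + 1))` from its vertices.
Bivalent vertices on the lines give `(1 - y 2)^(-(σ+1)) = Y ^ (-2 (σ+1))`, so only `Y ^ n` survives.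
The single vertex gives the term `y n`. -/
theorem sum_insertVal {L J M n : ℕ} (hb : ∀ c, L < c.rep.graph.loops → b c = 0)
    (hy2 : y 2 = 1 - Y ^ 2) (hJ : y 2 ^ J = 0) (hy : ∀ m, 3 ≤ m → y m = P ^ (m - 2) * Y ^ m)
    (hn : 0 < n) (hM : 3 * L + n + J < M) :
    ∑ r ∈ Finset.range (2 * M), ((r.factorial : ℂ)⁻¹) • gnum (insertVal b y) n r =
      y n + Y ^ n * onePISum (fun c => b c * P ^ (2 * c.rep.graph.loops + n - 2)) n (2 * M) := by
  set b' : GraphClass → R := fun c => b c * P ^ (2 * c.rep.graph.loops + n - 2) with hb'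
  have hb'L : ∀ c, L < c.rep.graph.loops → b' c = 0 := fun c hc => by
    rw [hb']
    beta_reduce
    rw [hb c hc, zero_mul]
  obtain ⟨M, rfl⟩ : ∃ k, M = k + 1 := ⟨M - 1, by omega⟩
  rw [onePISum, sum_range_two_mul fun s => by rw [gnum_odd, smul_zero],
    sum_range_two_mul fun s => by rw [gnum_odd, smul_zero],
    Finset.sum_range_succ', Finset.sum_range_succ', mul_zero, gnum_insertVal_zero b y hn,
    gnum_onePIVal_zero, smul_zero, add_zero, Nat.factorial_zero, Nat.cast_one, inv_one, one_smul,
    add_comm]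
  congr 1
  have h1 : ∀ ρ, (((2 * (ρ + 1)).factorial : ℂ)⁻¹) • gnum (insertVal b y) n (2 * (ρ + 1)) =
      ∑ j ∈ Finset.range (ρ + 1), ((ρ - j + j).choose j : ℂ) •
        (y 2 ^ j * bivSum b y n (2 * (ρ - j + 1)) 0) := by
    intro ρ
    rw [sum_bivSum b y n (ρ + 1) (Nat.succ_pos ρ)]
    refine Finset.sum_congr rfl fun j hj => ?_
    have hj' : j ≤ ρ := Nat.lt_succ_iff.1 (Finset.mem_range.1 hj)
    rw [← bivSum_even]
    congr 1
    omega
  rw [Finset.sum_congr rfl fun ρ _ => h1 ρ]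
  refine (Finset.sum_range_diag_flip M fun j σ => ((σ + j).choose j : ℂ) •
    (y 2 ^ j * bivSum b y n (2 * (σ + 1)) 0)).trans ?_
  have hswap : ∑ j ∈ Finset.range M, ∑ σ ∈ Finset.range (M - j), ((σ + j).choose j : ℂ) •
      (y 2 ^ j * bivSum b y n (2 * (σ + 1)) 0) =
      ∑ σ ∈ Finset.range M, ∑ j ∈ Finset.range (M - σ), ((σ + j).choose j : ℂ) •
      (y 2 ^ j * bivSum b y n (2 * (σ + 1)) 0) :=
    Finset.sum_comm' fun j σ => by
      simp only [Finset.mem_range]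
      omega
  rw [hswap, Finset.mul_sum]
  refine Finset.sum_congr rfl fun σ hσ => ?_
  rw [bivSum_zero hy (by omega)]
  -- With too many lines the coefficient vanishes. Otherwise the bound on `M` leaves at least `J`
  -- terms of the binomial series, which is then complete.
  by_cases hlarge : 6 * L + 2 * n < 2 * (σ + 1)
  · rw [← gnum_coreVal_eq_onePIVal _ (by omega), gnum_coreVal_eq_zero hb'L hlarge]
    simp
  · have hw : y 2 ^ (M - σ) = 0 := pow_eq_zero_of_le (by omega) hJ
    have h2 := sum_choose_mul_pow hw σ
    rw [hy2, sub_sub_cancel] at h2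
    set t := (((2 * (σ + 1)).factorial : ℂ)⁻¹) • gnum (onePIVal b') n (2 * (σ + 1))
    calc _ = Y ^ n * t * ((Y ^ 2) ^ (σ + 1) *
          ∑ j ∈ Finset.range (M - σ), ((σ + j).choose j : R) * (1 - Y ^ 2) ^ j) := by
          rw [Finset.mul_sum, Finset.mul_sum]
          refine Finset.sum_congr rfl fun j _ => ?_
          rw [Nat.cast_smul_eq_nsmul, nsmul_eq_mul, hy2]
          ring
      _ = Y ^ n * t := by rw [h2, mul_one]

/-- The Green's functions of a convolution product, if the Green's functions of the first factor
are governed by a single coupling `P`. -/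
theorem onePISum_conv {a : GraphClass → R} {L J M n : ℕ}
    (ha : ∀ c, L < c.rep.graph.loops → a c = 0) (hb : ∀ c, L < c.rep.graph.loops → b c = 0)
    (hab : ∀ {β : Type} [Finite β] [Nonempty β] {G : Graph β} {S : Set β}, G.Nice →
      (∀ x y, G.conn x y) → G.MinThree → G.IsSub S → L < G.loops →
      prodVal a (G.keep S) * value b (G.quo S) = 0)
    (hy2 : greenSum a L 2 = 1 - Y ^ 2) (hJ : greenSum a L 2 ^ J = 0)
    (hy : ∀ m, 3 ≤ m → greenSum a L m = P ^ (m - 2) * Y ^ m)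
    (hn : 0 < n) (hM : 3 * L + n + J < M) :
    onePISum (conv a b) n (2 * M) = onePISum a n (2 * M) +
      Y ^ n * onePISum (fun c => b c * P ^ (2 * c.rep.graph.loops + n - 2)) n (2 * M) := by
  have h1 := greenSum_conv ha hab (n := n) (B := 2 * M) (by omega)
  rw [sum_coreVal _ hn (by omega), sum_insertVal hb hy2 hJ hy hn hM,
    greenSum_eq_onePISum ha hn (B := 2 * M) (by omega), add_assoc] at h1
  exact add_left_cancel h1

end Composition

/-! ### Grading by the loop number -/

section Grading

variable {A R : Type} [CommRing A] [CommRing R] (φ : A →+* R) (t : R)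

/-- A function of 1PI graphs, weighted with a power of the coupling constant. -/
def weighted (a : GraphClass → A) (c : GraphClass) : R := φ (a c) * t ^ c.rep.graph.loops

theorem evalGraph_weighted (a : GraphClass → A) {α : Type} [Finite α] {G : Graph α}
    (hG : G.IsOnePI ∨ G.loops = 0) :
    evalGraph (weighted φ t a) G = φ (evalGraph a G) * t ^ G.loops := by
  by_cases h : G.IsOnePI
  · rw [evalGraph_of_isOnePI _ h, evalGraph_of_isOnePI _ h, weighted, loops_classOf]
  · rw [evalGraph_of_not _ h, evalGraph_of_not _ h, hG.resolve_left h, pow_zero, map_one, mul_one]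

theorem value_weighted (a : GraphClass → A) {α : Type} [Finite α] [Nonempty α] {G : Graph α}
    (hG : G.Nice) (hc : ∀ x y, G.conn x y) :
    value (weighted φ t a) G = φ (value a G) * t ^ G.loops := by
  rcases G.inner.eq_empty_or_nonempty with h | h
  · have hl : ∀ x, x ∈ G.legs := fun x => by
      by_contra hx
      exact (Set.eq_empty_iff_forall_notMem.1 h x) hx
    rw [value_eq_one _ hl, value_eq_one _ hl, Graph.loops_of_inner_eq_empty h, pow_zero, map_one,
      mul_one]
  · rw [value_of_connected _ hc, value_of_connected _ hc,
      evalGraph_weighted φ t a (Or.inl (Graph.smooth_isOnePI hG hc h)),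
      (Graph.smooth_data hG hc h).2.2]

theorem prodVal_weighted (a : GraphClass → A) {α : Type} [Finite α] {G : Graph α}
    [Fintype (Quotient G.conn)] (hG : G.Nice) (h3 : G.MinThree) :
    prodVal (weighted φ t a) G = φ (prodVal a G) * t ^ ∑ q, (G.component q).loops := by
  rw [prodVal, prodVal, finprod_eq_prod_of_fintype, finprod_eq_prod_of_fintype, map_prod,
    ← Finset.prod_pow_eq_pow_sum, ← Finset.prod_mul_distrib]
  refine Finset.prod_congr rfl fun q _ => evalGraph_weighted φ t a ?_
  rcases (G.component q).inner.eq_empty_or_nonempty with h | h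
  · have : Nonempty {x | Quotient.mk G.conn x = q} := by
      induction q using Quotient.inductionOn with | _ x => exact ⟨⟨x, rfl⟩⟩
    exact Or.inr (Graph.loops_of_inner_eq_empty h)
  · refine Or.inl (Graph.isOnePI_iff.2 ⟨hG.component q, Graph.component_connected _ q, h,
      fun y => ?_⟩)
    exact (h3 y).trans_eq (Graph.ncard_vert_restrict G _ (fun x hx z hz =>
      G.component_closed q x hx z (Graph.conn_vert hz)) y).symm

theorem prodVal_mul_value_weighted (a b : GraphClass → A) {α : Type} [Finite α] [Nonempty α]
    {G : Graph α} {S : Set α} (hG : G.Nice) (hc : ∀ x y, G.conn x y) (h3 : G.MinThree)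
    (hS : G.IsSub S) :
    prodVal (weighted φ t a) (G.keep S) * value (weighted φ t b) (G.quo S) =
      φ (prodVal a (G.keep S) * value b (G.quo S)) * t ^ G.loops := by
  have := Fintype.ofFinite (Quotient (G.keep S).conn)
  obtain ⟨y, hy, -⟩ := hG.exists_not_mem hS.subset_inner hS.closed (Classical.arbitrary α)
  have : Nonempty {x | x ∉ S} := ⟨⟨y, hy⟩⟩
  rw [prodVal_weighted φ t a (hG.keep hS) h3,
    value_weighted φ t b (hG.quo hS.subset_inner hS.closed)
      (Graph.quo_connected hc hS.closed), Graph.loops_eq_sum hG hc hS, pow_add, map_mul]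
  ring

/-- Weights `t ^ L` are compatible with convolution because the loop numbers of subgraph and
contracted graph add up. -/
theorem conv_weighted (a b : GraphClass → A) :
    conv (weighted φ t a) (weighted φ t b) = weighted φ t (conv a b) := by
  funext c
  have hG := c.rep.isOnePI
  have hb := hG.biv_eq_empty
  have := Fintype.ofFinite {S // c.rep.graph.IsSub S}
  rw [conv, convSum, weighted, conv, convSum, finsum_eq_sum_of_fintype, finsum_eq_sum_of_fintype,
    map_sum, Finset.sum_mul]
  refine Finset.sum_congr rfl fun S _ => ?_
  rw [value_of_biv_eq_empty (G := c.rep.graph.keep S) _ hb,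
    value_of_biv_eq_empty (G := c.rep.graph.keep S) _ hb]
  obtain ⟨h1, h2, ⟨x, -⟩, h4⟩ := Graph.isOnePI_iff.1 hG
  have : Nonempty (Fin c.rep.size) := ⟨x⟩
  exact prodVal_mul_value_weighted φ t a b h1 h2 h4 S.2

theorem sum_onePISum [Algebra ℂ R] {L : ℕ} {ψ : GraphClass → R}
    (hψ : ∀ c, L < c.rep.graph.loops → ψ c = 0) (n B : ℕ) :
    ∑ l ∈ Finset.range (L + 1), onePISum (fun c => if c.rep.graph.loops = l then ψ c else 0) n B =
      onePISum ψ n B := by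
  classical
  simp only [onePISum]
  rw [Finset.sum_comm]
  refine Finset.sum_congr rfl fun N _ => ?_
  rw [← Finset.smul_sum]
  congr 1
  simp only [gnum, gsum]
  rw [Finset.sum_comm]
  refine Finset.sum_congr rfl fun G _ => ?_
  by_cases h : G.IsOnePI
  · simp only [onePIVal_of_isOnePI _ h]
    rw [Finset.sum_ite_eq]
    split_ifs with h1
    · rfl
    · rw [Finset.mem_range] at h1
      exact (hψ _ (by omega)).symm
  · simp only [onePIVal_of_not _ h, Finset.sum_const_zero]

/-- Summation of the Green's function over the number of loops. -/
theorem onePISum_eq_sum_greenCoeff [Algebra ℂ R] (f : H →ₐ[ℂ] R) {w : ℕ → R} {L n B : ℕ}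
    (hw : ∀ l, L < l → w l = 0) (hB : 6 * L + 3 * n < B) :
    onePISum (fun c => f (MvPolynomial.X c) * w c.rep.graph.loops) n B =
      ∑ l ∈ Finset.range (L + 1), f (greenCoeff n l) * w l := by
  rw [← sum_onePISum (L := L) fun c hc => by rw [hw _ hc, mul_zero]]
  refine Finset.sum_congr rfl fun l hl => ?_
  rw [Finset.mem_range] at hl
  let _ := Fintype.ofFinite (LabelledClass n l)
  have h := sum_labelledClass (n := n) (l := l) (B := B)
    (fun c => f (MvPolynomial.X c) * w c.rep.graph.loops) (by omega)
  rw [onePISum, ← h, greenCoeff, map_sum, Finset.sum_mul]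
  refine Finset.sum_congr rfl fun c _ => ?_
  rw [map_smul, smul_mul_assoc]
  congr 3
  obtain ⟨e⟩ := Quotient.exact (Quotient.out_eq (Quotient.mk OnePIGraph.isoSetoid
    c.out.toOnePIGraph))
  exact e.loops_eq.symm.trans c.out.loops_eq

end Grading

/-! ### Green's functions as power series -/

section Series

open PowerSeries

variable {A : Type} [CommRing A]

theorem hasSubst_of_X_dvd {s : PowerSeries A} (hs : X ∣ s) : HasSubst s :=
  HasSubst.of_constantCoeff_zero' (X_dvd_iff.1 hs)

theorem exists_eq_sum_add (F : PowerSeries A) (L : ℕ) :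
    ∃ F', F = ∑ l ∈ Finset.range (L + 1), C (coeff l F) * X ^ l + X ^ (L + 1) * F' := by
  have h : X ^ (L + 1) ∣ F - ∑ l ∈ Finset.range (L + 1), C (coeff l F) * X ^ l := by
    rw [X_pow_dvd_iff]
    intro m hm
    rw [map_sub, map_sum]
    simp only [coeff_C_mul, coeff_X_pow, mul_ite, mul_one, mul_zero]
    rw [Finset.sum_ite_eq, if_pos (Finset.mem_range.2 hm), sub_self]
  obtain ⟨F', hF'⟩ := h
  exact ⟨F', by rw [← hF', add_sub_cancel]⟩

/-- Since `X` divides `s`, the terms of order above `L` are divisible by `X ^ (L + 1)`. So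
substitution becomes a finite sum after truncation. -/
theorem subst_sub_sum_dvd {s : PowerSeries A} (hs : X ∣ s) (F : PowerSeries A) (L : ℕ) :
    X ^ (L + 1) ∣ F.subst s - ∑ l ∈ Finset.range (L + 1), C (coeff l F) * s ^ l := by
  have hs' := hasSubst_of_X_dvd hs
  obtain ⟨F', hF'⟩ := exists_eq_sum_add F L
  have h : F.subst s = ∑ l ∈ Finset.range (L + 1), C (coeff l F) * s ^ l +
      s ^ (L + 1) * F'.subst s := by
    conv_lhs => rw [hF']
    rw [← coe_substAlgHom hs', map_add, map_sum, map_mul, map_pow, substAlgHom_X]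
    congr 1
    refine Finset.sum_congr rfl fun l _ => ?_
    rw [map_mul, map_pow, substAlgHom_X, coe_substAlgHom, subst_C]
    rfl
  rw [h, add_sub_cancel_left]
  exact (pow_dvd_pow_of_dvd hs _).mul_right _

variable [Algebra ℂ A]

/-- The power series modulo `X ^ (L + 1)`. -/
abbrev Truncated (A : Type) [CommRing A] (L : ℕ) : Type :=
  PowerSeries A ⧸ Ideal.span {(X : PowerSeries A) ^ (L + 1)}

/-- The quotient map to the power series modulo `X ^ (L + 1)`. -/
def truncated (A : Type) [CommRing A] [Algebra ℂ A] (L : ℕ) : PowerSeries A →ₐ[ℂ] Truncated A L :=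
  Ideal.Quotient.mkₐ ℂ _

theorem truncated_eq_iff {L : ℕ} {F G : PowerSeries A} :
    truncated A L F = truncated A L G ↔ X ^ (L + 1) ∣ F - G :=
  Ideal.Quotient.eq.trans Ideal.mem_span_singleton

theorem truncated_X_pow {L l : ℕ} (h : L < l) : truncated A L X ^ l = 0 := by
  rw [← map_pow, ← map_zero (truncated A L), truncated_eq_iff, sub_zero]
  exact pow_dvd_pow _ h

theorem ext_truncated {F G : PowerSeries A} (h : ∀ L, truncated A L F = truncated A L G) :
    F = G := by
  ext l
  have := X_pow_dvd_iff.1 (truncated_eq_iff.1 (h l)) l (Nat.lt_succ_self l)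
  rwa [map_sub, sub_eq_zero] at this

/-- The constants in the truncated power series. -/
def constTruncated (A : Type) [CommRing A] [Algebra ℂ A] (L : ℕ) : A →ₐ[ℂ] Truncated A L :=
  (truncated A L).comp (IsScalarTower.toAlgHom ℂ A (PowerSeries A))

theorem truncated_subst {s : PowerSeries A} (hs : X ∣ s) (F : PowerSeries A) (L : ℕ) :
    truncated A L (F.subst s) =
      ∑ l ∈ Finset.range (L + 1), constTruncated A L (coeff l F) * truncated A L s ^ l := by
  rw [truncated_eq_iff.2 (subst_sub_sum_dvd hs F L), map_sum]
  exact Finset.sum_congr rfl fun l _ => by rw [map_mul, map_pow]; rfl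

/-- The image under `f` of the sum of the 1PI graphs with `n` external lines. -/
def graphSeries (f : H →ₐ[ℂ] A) (n : ℕ) : PowerSeries A :=
  PowerSeries.mk fun l => f (greenCoeff n l)

theorem onePISum_weighted (f : H →ₐ[ℂ] A) {L n B : ℕ} (hB : 6 * L + 3 * n < B) :
    onePISum (weighted (constTruncated A L) (truncated A L X) fun c => f (MvPolynomial.X c)) n B =
      truncated A L (graphSeries f n) := by
  have h := onePISum_eq_sum_greenCoeff ((constTruncated A L).comp f)
    (w := fun l => truncated A L X ^ l) (fun l hl => truncated_X_pow hl) hB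
  refine h.trans ?_
  have h2 := truncated_subst (dvd_refl (X : PowerSeries A)) (graphSeries f n) L
  rw [X_subst] at h2
  rw [h2]
  exact Finset.sum_congr rfl fun l _ => by rw [graphSeries, coeff_mk]; rfl

/-- The factor `Q ^ (2 l + n - 2)` of a graph with `l` loops splits into `Q ^ (n - 2)` and `(Q ^ 2)
^ l`. The latter rescales the coupling constant, and this is where the substitution comes from. -/
theorem onePISum_weighted_mul (f : H →ₐ[ℂ] A) (Q : PowerSeries A) {L n B : ℕ} (hn : 2 ≤ n)
    (hB : 6 * L + 3 * n < B) :
    onePISum (fun c => weighted (constTruncated A L) (truncated A L X)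
        (fun c => f (MvPolynomial.X c)) c *
          truncated A L Q ^ (2 * c.rep.graph.loops + n - 2)) n B =
      truncated A L (Q ^ (n - 2) * (graphSeries f n).subst (X * Q ^ 2)) := by
  have h := onePISum_eq_sum_greenCoeff ((constTruncated A L).comp f) (L := L) (n := n) (B := B)
    (w := fun l => truncated A L X ^ l * truncated A L Q ^ (2 * l + n - 2))
    (fun l hl => by rw [truncated_X_pow hl, zero_mul]) hB
  simp only [weighted, mul_assoc]
  refine h.trans ?_
  rw [map_mul, truncated_subst (dvd_mul_right _ _), Finset.mul_sum]
  refine Finset.sum_congr rfl fun l _ => ?_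
  have : 2 * l + n - 2 = (n - 2) + 2 * l := by omega
  rw [this, graphSeries, coeff_mk, map_mul, map_pow, map_pow]
  change constTruncated A L (f _) * _ = _
  ring

theorem X_dvd_graphSeries (f : H →ₐ[ℂ] A) (n : ℕ) : X ∣ graphSeries f n := by
  have h : greenCoeff n 0 = 0 := by
    unfold greenCoeff
    refine Finset.sum_eq_zero fun c _ => ?_
    have h1 := c.out.isOnePI.not_tree
    have h2 := c.out.loops_eq
    omega
  rw [X_dvd_iff, ← coeff_zero_eq_constantCoeff_apply, graphSeries, coeff_mk, h, map_zero]

/-- The Green's functions of a convolution product of characters. -/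
theorem graphSeries_conv {f h k : H →ₐ[ℂ] A} (hk : ∀ c, k (MvPolynomial.X c) =
      conv (fun c => f (MvPolynomial.X c)) (fun c => h (MvPolynomial.X c)) c)
    {Q Y : PowerSeries A} (hY : 1 - graphSeries f 2 = Y ^ 2)
    (hQ : ∀ m, 3 ≤ m → 1 + graphSeries f m = Q ^ (m - 2) * Y ^ m) {n : ℕ} (hn : 2 ≤ n) :
    graphSeries k n = graphSeries f n +
      Y ^ n * (Q ^ (n - 2) * (graphSeries h n).subst (X * Q ^ 2)) := by
  refine ext_truncated fun L => ?_
  set φ := constTruncated A L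
  set t := truncated A L X
  set a : GraphClass → Truncated A L := weighted φ t fun c => f (MvPolynomial.X c)
  set b : GraphClass → Truncated A L := weighted φ t fun c => h (MvPolynomial.X c)
  have hw : ∀ (u : GraphClass → A) c, L < c.rep.graph.loops → weighted (φ : A →+* _) t u c = 0 :=
    fun u c hc => by rw [weighted, truncated_X_pow hc, mul_zero]
  have hg : ∀ m, 0 < m → greenSum a L m =
      (if 3 ≤ m then 1 else 0) + truncated A L (graphSeries f m) := fun m hm => by
    rw [greenSum_eq_onePISum (B := 6 * L + 3 * m + 1) (hw _) hm (by omega),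
      onePISum_weighted f (by omega)]
  have hg2 : greenSum a L 2 = truncated A L (graphSeries f 2) := by
    rw [hg 2 (by omega), if_neg (by omega), zero_add]
  -- `J = L + 1` is admissible because `X` divides the two-point series. The value of `M` makes `2 *
  -- M` large enough for both the bound on `M` and the bound `6 L + 3 n` on half-lines.
  have key := onePISum_conv (a := a) (b := b) (L := L) (J := L + 1)
    (M := 4 * L + 3 * n + 2) (n := n)
    (P := truncated A L Q) (Y := truncated A L Y) (hw _) (hw _)
    (fun {β} _ _ {G S} hG hc h3 hS hL => by
      rw [prodVal_mul_value_weighted (φ : A →+* _) t _ _ hG hc h3 hS, truncated_X_pow hL,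
        mul_zero])
    (by rw [hg2, ← map_pow, ← hY, map_sub, map_one, sub_sub_cancel])
    (by
      rw [hg2, ← map_pow, ← map_zero (truncated A L), truncated_eq_iff, sub_zero]
      exact pow_dvd_pow_of_dvd (X_dvd_graphSeries f 2) _)
    (fun m hm => by
      rw [hg m (by omega), if_pos hm, ← map_pow, ← map_pow, ← map_mul, ← hQ m hm, map_add,
        map_one])
    (by omega) (by omega)
  rw [conv_weighted, ← funext hk, onePISum_weighted k (by omega), onePISum_weighted f (by omega),
    onePISum_weighted_mul h Q hn (by omega)] at key
  rw [key, map_add, map_mul _ (Y ^ n), map_pow]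

end Series

/-! ### Couplings -/

section Couplings

open PowerSeries

theorem hasSubst_sub_one {f : PowerSeries H} (hf : constantCoeff f = 1) : HasSubst (f - 1) :=
  HasSubst.of_constantCoeff_zero' (by rw [map_sub, hf, map_one, sub_self])

theorem fracPow_add {f : PowerSeries H} (hf : constantCoeff f = 1) (p q : ℚ) :
    fracPow f (p + q) = fracPow f p * fracPow f q := by
  rw [fracPow, binomialSeries_add, subst_mul (hasSubst_sub_one hf)]
  rfl

theorem fracPow_natCast {f : PowerSeries H} (hf : constantCoeff f = 1) (n : ℕ) :
    fracPow f (n : ℚ) = f ^ n := by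
  have hs := hasSubst_sub_one hf
  rw [fracPow, binomialSeries_nat, subst_pow hs, ← coe_substAlgHom hs, map_add, map_one,
    substAlgHom_X, add_sub_cancel]

theorem fracPow_pow {f : PowerSeries H} (hf : constantCoeff f = 1) (p : ℚ) (n : ℕ) :
    fracPow f p ^ n = fracPow f (n * p) := by
  induction n with
  | zero =>
    have := fracPow_natCast hf 0
    rw [pow_zero] at this
    rw [pow_zero, Nat.cast_zero, zero_mul, ← this, Nat.cast_zero]
  | succ n ih =>
    rw [pow_succ, ih, ← fracPow_add hf]
    congr 1
    push_cast
    ring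

theorem constantCoeff_fracPow {f : PowerSeries H} (hf : constantCoeff f = 1) (p : ℚ) :
    constantCoeff (fracPow f p) = 1 := by
  have hs := hasSubst_sub_one hf
  have h := constantCoeff_subst_eq_zero (a := f - 1) (by
    change constantCoeff (f - 1) = 0
    rw [map_sub, hf, map_one, sub_self]) (binomialSeries H p - 1) (by
    rw [map_sub, binomialSeries_constantCoeff, map_one, sub_self])
  rw [← coe_substAlgHom hs, map_sub, map_one, coe_substAlgHom, map_sub, sub_eq_zero, map_one] at h
  exact h

/-- The square root of the propagator. -/
def rootTwo : PowerSeries H := fracPow (green 2) (1 / 2)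

theorem rootTwo_sq : rootTwo ^ 2 = green 2 := by
  have h := constantCoeff_green 2
  rw [rootTwo, fracPow_pow h]
  refine Eq.trans ?_ ((fracPow_natCast h 1).trans (pow_one _))
  congr 1
  norm_num

theorem constantCoeff_rootTwo : constantCoeff rootTwo = 1 :=
  constantCoeff_fracPow (constantCoeff_green 2) _

theorem constantCoeff_coupling_base (m : ℕ) :
    constantCoeff (green m * fracPow (green 2) (-((m : ℚ) / 2))) = 1 := by
  rw [map_mul, constantCoeff_green, constantCoeff_fracPow (constantCoeff_green 2), mul_one]

theorem constantCoeff_coupling (m : ℕ) : constantCoeff (coupling m) = 1 :=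
  constantCoeff_fracPow (constantCoeff_coupling_base m) _

/-- The definition of the coupling with the fractional powers undone. Later arguments use only this
equation and the constant term `1`. -/
theorem coupling_pow_mul {m : ℕ} (hm : 3 ≤ m) :
    coupling m ^ (m - 2) * rootTwo ^ m = green m := by
  have h2 := constantCoeff_green 2
  have hb := constantCoeff_coupling_base m
  have h1 : coupling m ^ (m - 2) = green m * fracPow (green 2) (-((m : ℚ) / 2)) := by
    rw [coupling, fracPow_pow hb]
    refine Eq.trans ?_ ((fracPow_natCast hb 1).trans (pow_one _))
    congr 1
    have h3 : ((m - 2 : ℕ) : ℚ) = (m : ℚ) - 2 := by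
      rw [Nat.cast_sub (by omega)]
      norm_num
    have h4 : (m : ℚ) - 2 ≠ 0 := by
      rw [← h3, Nat.cast_ne_zero]
      omega
    rw [h3, mul_one_div_cancel h4, Nat.cast_one]
  have h5 : -((m : ℚ) / 2) + m * (1 / 2) = (0 : ℕ) := by
    push_cast
    ring
  rw [h1, rootTwo, fracPow_pow h2, mul_assoc, ← fracPow_add h2, h5, fracPow_natCast h2, pow_zero,
    mul_one]

variable {A : Type} [CommRing A] [Algebra ℂ A]

/-- The cofactor of `F - G` in `F ^ m - G ^ m` has the constant term `m`, which is invertible in a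
`ℂ`-algebra. -/
theorem eq_of_pow_eq {F G : PowerSeries A} (hF : constantCoeff F = 1) (hG : constantCoeff G = 1)
    {m : ℕ} (hm : 0 < m) (h : F ^ m = G ^ m) : F = G := by
  have h1 := geom_sum₂_mul F G m
  rw [h, sub_self] at h1
  have h2 : IsUnit (∑ i ∈ Finset.range m, F ^ i * G ^ (m - 1 - i)) := by
    rw [isUnit_iff_constantCoeff, map_sum]
    simp only [map_mul, map_pow, hF, hG, one_pow, mul_one, Finset.sum_const, Finset.card_range,
      nsmul_one]
    have := (IsUnit.mk0 (m : ℂ) (Nat.cast_ne_zero.2 hm.ne')).map (algebraMap ℂ A)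
    rwa [map_natCast] at this
  exact sub_eq_zero.1 ((h2.mul_right_eq_zero).1 h1)

omit [Algebra ℂ A] in
theorem constantCoeff_subst_eq_one {F s : PowerSeries A} (hF : constantCoeff F = 1) (hs : X ∣ s) :
    constantCoeff (F.subst s : PowerSeries A) = 1 := by
  have h := subst_sub_sum_dvd hs F 0
  rw [zero_add, pow_one, X_dvd_iff, Finset.sum_range_one, pow_zero, mul_one, map_sub,
    constantCoeff_C, coeff_zero_eq_constantCoeff_apply, hF, sub_eq_zero] at h
  exact h

omit [Algebra ℂ A] in
theorem constantCoeff_map {B : Type} [CommRing B] (f : B →+* A) {F : PowerSeries B}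
    (hF : constantCoeff F = 1) : constantCoeff (map f F) = 1 := by
  rw [← coeff_zero_eq_constantCoeff_apply, coeff_map, coeff_zero_eq_constantCoeff_apply, hF,
    map_one]

theorem map_green (f : H →ₐ[ℂ] A) (n : ℕ) : map (f : H →+* A) (green n) =
    if n = 2 then 1 - graphSeries f n else 1 + graphSeries f n := by
  have : map (f : H →+* A) (PowerSeries.mk (greenCoeff n)) = graphSeries f n := by
    ext l
    rw [coeff_map, coeff_mk, graphSeries, coeff_mk]
    rfl
  rw [green]
  split_ifs
  · rw [map_sub, map_one, this]
  · rw [map_add, map_one, this]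

variable {f h k : H →ₐ[ℂ] A} (hk : ∀ c, k (MvPolynomial.X c) =
  conv (fun c => f (MvPolynomial.X c)) (fun c => h (MvPolynomial.X c)) c)
  {Q : PowerSeries A} (hQ : ∀ m, 3 ≤ m → map (f : H →+* A) (coupling m) = Q)

include hk hQ

/-- In `graphSeries_conv` the factor `Y ^ n * Q ^ (n - 2)` of the second term equals the image of
`Xⁿ` under `f`, so this factor can be taken out. The sign for `n = 2` is the one for which this
works. -/
theorem map_green_conv {n : ℕ} (hn : 2 ≤ n) : map (k : H →+* A) (green n) =
    map (f : H →+* A) (green n) * (map (h : H →+* A) (green n)).subst (X * Q ^ 2) := by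
  set Y := map (f : H →+* A) rootTwo
  have hs : HasSubst (X * Q ^ 2) := hasSubst_of_X_dvd (dvd_mul_right _ _)
  have h2 : 1 - graphSeries f 2 = Y ^ 2 := by
    rw [← map_pow, rootTwo_sq, map_green, if_pos rfl]
  have h3 : ∀ m, 3 ≤ m → 1 + graphSeries f m = Q ^ (m - 2) * Y ^ m := fun m hm => by
    rw [← hQ m hm, ← map_pow, ← map_pow, ← map_mul, coupling_pow_mul hm, map_green,
      if_neg (by omega)]
  have key := graphSeries_conv hk h2 h3 hn
  rw [map_green, map_green, map_green]
  split_ifs with h4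
  · subst h4
    rw [← coe_substAlgHom hs, map_sub, map_one, coe_substAlgHom, key, ← sub_sub, h2]
    rw [Nat.sub_self, pow_zero, one_mul]
    ring
  · rw [← coe_substAlgHom hs, map_add, map_one, coe_substAlgHom, key, ← add_assoc,
      h3 n (by omega)]
    ring

/-- `map_green_conv` holds for `X²` and `Xᵐ`, hence for roots and quotients, as roots with constant
term `1` are unique. The factor of the Green's functions under `f` becomes the coupling `Q`. -/
theorem map_coupling_conv {m : ℕ} (hm : 3 ≤ m) : map (k : H →+* A) (coupling m) =
    Q * (map (h : H →+* A) (coupling m)).subst (X * Q ^ 2) := by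
  have hd : X ∣ X * Q ^ 2 := dvd_mul_right _ _
  have hs : HasSubst (X * Q ^ 2) := hasSubst_of_X_dvd hd
  have hQ1 : constantCoeff Q = 1 := by
    rw [← hQ m hm]
    exact constantCoeff_map _ (constantCoeff_coupling m)
  set σ : PowerSeries A →ₐ[A] PowerSeries A := substAlgHom hs
  have hσ : ∀ F : PowerSeries A, F.subst (X * Q ^ 2) = σ F := fun F => by rw [coe_substAlgHom]
  have hσ1 : ∀ F : PowerSeries A, constantCoeff F = 1 → constantCoeff (σ F) = 1 := fun F hF => by
    rw [← hσ]
    exact constantCoeff_subst_eq_one hF hd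
  have hr : ∀ u : H →ₐ[ℂ] A, constantCoeff (map (u : H →+* A) rootTwo) = 1 := fun u =>
    constantCoeff_map _ constantCoeff_rootTwo
  have hroot : map (k : H →+* A) rootTwo =
      map (f : H →+* A) rootTwo * σ (map (h : H →+* A) rootTwo) := by
    refine eq_of_pow_eq (hr k) ?_ two_pos ?_
    · rw [map_mul, hr, hσ1 _ (hr h), mul_one]
    · rw [mul_pow, ← map_pow, ← map_pow, ← map_pow, ← map_pow, rootTwo_sq,
        map_green_conv hk hQ le_rfl, hσ]
  have hc : ∀ u : H →ₐ[ℂ] A, constantCoeff (map (u : H →+* A) (coupling m)) = 1 := fun u =>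
    constantCoeff_map _ (constantCoeff_coupling m)
  rw [hσ]
  refine eq_of_pow_eq (hc k) ?_ (Nat.sub_pos_of_lt hm) ?_
  · rw [map_mul, hQ1, hσ1 _ (hc h), mul_one]
  · have hu : IsUnit (map (k : H →+* A) rootTwo ^ m) := by
      refine IsUnit.pow _ (isUnit_iff_constantCoeff.2 ?_)
      rw [hr]
      exact isUnit_one
    refine hu.mul_right_cancel ?_
    rw [← map_pow, ← map_pow, ← map_mul, coupling_pow_mul hm, map_green_conv hk hQ (by omega), hσ,
      map_pow, hroot, mul_pow, mul_pow, ← hQ m hm, ← coupling_pow_mul hm]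
    simp only [map_mul, map_pow]
    ring

end Couplings

/-! ### Quotients by Hopf ideals -/

section Quotients

variable {A : Type} [CommRing A] [Algebra ℂ A]

theorem HopfLaws.quotient {Δ : A →ₐ[ℂ] A ⊗[ℂ] A} {ε : A →ₐ[ℂ] ℂ} {S : A →ₐ[ℂ] A}
    (h : HopfLaws Δ ε S.toLinearMap) {I : Ideal A} {Δ' : A ⧸ I →ₐ[ℂ] (A ⧸ I) ⊗[ℂ] (A ⧸ I)}
    {ε' : A ⧸ I →ₐ[ℂ] ℂ} {S' : A ⧸ I →ₐ[ℂ] A ⧸ I}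
    (hΔ : Δ'.comp (Ideal.Quotient.mkₐ ℂ I) = (Algebra.TensorProduct.map (Ideal.Quotient.mkₐ ℂ I)
      (Ideal.Quotient.mkₐ ℂ I)).comp Δ)
    (hε : ε'.comp (Ideal.Quotient.mkₐ ℂ I) = ε)
    (hS : S'.comp (Ideal.Quotient.mkₐ ℂ I) = (Ideal.Quotient.mkₐ ℂ I).comp S) :
    HopfLaws Δ' ε' S'.toLinearMap := by
  set π := Ideal.Quotient.mkₐ ℂ I
  have hΔ' : ∀ x, Δ' (π x) = Algebra.TensorProduct.map π π (Δ x) := DFunLike.congr_fun hΔ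
  have hε' : ∀ x, ε' (π x) = ε x := DFunLike.congr_fun hε
  have hS' : ∀ x, S' (π x) = π (S x) := DFunLike.congr_fun hS
  have hsurj : Function.Surjective π := Ideal.Quotient.mkₐ_surjective ℂ I
  constructor
  · refine Ideal.Quotient.algHom_ext ℂ (AlgHom.ext fun x => ?_)
    change Algebra.TensorProduct.assoc ℂ ℂ ℂ _ _ _
      (Algebra.TensorProduct.map Δ' (.id ℂ _) (Δ' (π x))) =
      Algebra.TensorProduct.map (.id ℂ _) Δ' (Δ' (π x))
    have h1 : ∀ y, Algebra.TensorProduct.map Δ' (.id ℂ _) (Algebra.TensorProduct.map π π y) =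
        Algebra.TensorProduct.map (Algebra.TensorProduct.map π π) π
          (Algebra.TensorProduct.map Δ (.id ℂ _) y) := fun y => by
      induction y with
      | zero => simp only [map_zero]
      | add y z hy hz => simp only [map_add, hy, hz]
      | tmul a b => simp only [Algebra.TensorProduct.map_tmul, hΔ', AlgHom.id_apply]
    have h2 : ∀ y, Algebra.TensorProduct.map (.id ℂ _) Δ' (Algebra.TensorProduct.map π π y) =
        Algebra.TensorProduct.map π (Algebra.TensorProduct.map π π)
          (Algebra.TensorProduct.map (.id ℂ _) Δ y) := fun y => by
      induction y with
      | zero => simp only [map_zero]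
      | add y z hy hz => simp only [map_add, hy, hz]
      | tmul a b => simp only [Algebra.TensorProduct.map_tmul, hΔ', AlgHom.id_apply]
    have h3 : ∀ y, Algebra.TensorProduct.assoc ℂ ℂ ℂ _ _ _
        (Algebra.TensorProduct.map (Algebra.TensorProduct.map π π) π y) =
        Algebra.TensorProduct.map π (Algebra.TensorProduct.map π π)
          (Algebra.TensorProduct.assoc ℂ ℂ ℂ A A A y) := fun y =>
      (TensorProduct.map_map_assoc π.toLinearMap π.toLinearMap π.toLinearMap y).symm
    rw [hΔ', h1, h2, h3]
    exact congrArg _ (DFunLike.congr_fun h.coassoc x)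
  · refine Ideal.Quotient.algHom_ext ℂ (AlgHom.ext fun x => ?_)
    change Algebra.TensorProduct.map ε' (.id ℂ _) (Δ' (π x)) = 1 ⊗ₜ π x
    have h1 : ∀ y, Algebra.TensorProduct.map ε' (.id ℂ _) (Algebra.TensorProduct.map π π y) =
        Algebra.TensorProduct.map (.id ℂ _) π (Algebra.TensorProduct.map ε (.id ℂ _) y) :=
      fun y => by
      induction y with
      | zero => simp only [map_zero]
      | add y z hy hz => simp only [map_add, hy, hz]
      | tmul a b => simp only [Algebra.TensorProduct.map_tmul, hε', AlgHom.id_apply]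
    rw [hΔ', h1]
    exact congrArg (Algebra.TensorProduct.map (.id ℂ _) π) (DFunLike.congr_fun h.counit_left x)
  · refine Ideal.Quotient.algHom_ext ℂ (AlgHom.ext fun x => ?_)
    change Algebra.TensorProduct.map (.id ℂ _) ε' (Δ' (π x)) = π x ⊗ₜ 1
    have h1 : ∀ y, Algebra.TensorProduct.map (.id ℂ _) ε' (Algebra.TensorProduct.map π π y) =
        Algebra.TensorProduct.map π (.id ℂ _) (Algebra.TensorProduct.map (.id ℂ _) ε y) :=
      fun y => by
      induction y with
      | zero => simp only [map_zero]
      | add y z hy hz => simp only [map_add, hy, hz]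
      | tmul a b => simp only [Algebra.TensorProduct.map_tmul, hε', AlgHom.id_apply]
    rw [hΔ', h1]
    exact congrArg (Algebra.TensorProduct.map π (.id ℂ _)) (DFunLike.congr_fun h.counit_right x)
  · refine LinearMap.ext fun z => ?_
    obtain ⟨x, rfl⟩ := hsurj z
    change LinearMap.mul' ℂ _ (S'.toLinearMap.rTensor _ (Δ' (π x))) = algebraMap ℂ _ (ε' (π x))
    have h1 : ∀ y, LinearMap.mul' ℂ _
        (S'.toLinearMap.rTensor _ (Algebra.TensorProduct.map π π y)) =
        π (LinearMap.mul' ℂ _ (S.toLinearMap.rTensor _ y)) := fun y => by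
      induction y with
      | zero => simp only [map_zero]
      | add y z hy hz => simp only [map_add, hy, hz]
      | tmul a b => simp [hS']
    rw [hΔ', h1, hε', ← π.commutes]
    exact congrArg π (LinearMap.congr_fun h.antipode_left x)
  · refine LinearMap.ext fun z => ?_
    obtain ⟨x, rfl⟩ := hsurj z
    change LinearMap.mul' ℂ _ (S'.toLinearMap.lTensor _ (Δ' (π x))) = algebraMap ℂ _ (ε' (π x))
    have h1 : ∀ y, LinearMap.mul' ℂ _
        (S'.toLinearMap.lTensor _ (Algebra.TensorProduct.map π π y)) =
        π (LinearMap.mul' ℂ _ (S.toLinearMap.lTensor _ y)) := fun y => by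
      induction y with
      | zero => simp only [map_zero]
      | add y z hy hz => simp only [map_add, hy, hz]
      | tmul a b => simp [hS']
    rw [hΔ', h1, hε', ← π.commutes]
    exact congrArg π (LinearMap.congr_fun h.antipode_right x)

end Quotients

/-! ### The ideal generated by the differences of the couplings -/

section CouplingIdeal

open PowerSeries

variable {A : Type} [CommRing A] [Algebra ℂ A]

theorem eq_zero_of_mem_couplingIdeal {f : H →ₐ[ℂ] A}
    (hf : ∀ m, 3 ≤ m → map (f : H →+* A) (coupling m) = map (f : H →+* A) (coupling 3)) {x : H}
    (hx : x ∈ couplingIdeal) :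
    f x = 0 := by
  have h : couplingIdeal ≤ RingHom.ker (f : H →+* A) := by
    refine Ideal.span_le.2 ?_
    rintro _ ⟨m, n, l, hm, hn, rfl⟩
    have h1 := congrArg (coeff l) ((hf m hm).trans (hf n hn).symm)
    rw [coeff_map, coeff_map] at h1
    exact (map_sub _ _ _).trans (sub_eq_zero.2 h1)
  exact h hx

theorem map_coupling_eq {f : H →ₐ[ℂ] A} (hf : ∀ x ∈ couplingIdeal, f x = 0) {m n : ℕ}
    (hm : 3 ≤ m) (hn : 3 ≤ n) :
    map (f : H →+* A) (coupling m) = map (f : H →+* A) (coupling n) := by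
  ext l
  rw [coeff_map, coeff_map, ← sub_eq_zero]
  exact (map_sub _ _ _).symm.trans (hf _ (Ideal.subset_span ⟨m, n, l, hm, hn, rfl⟩))

theorem proj_eq_zero {x : H} (hx : x ∈ couplingIdeal) : proj x = 0 :=
  Ideal.Quotient.eq_zero_iff_mem.2 hx

theorem map_proj_coupling {m n : ℕ} (hm : 3 ≤ m) (hn : 3 ≤ n) :
    map (proj : H →+* H ⧸ couplingIdeal) (coupling m) =
      map (proj : H →+* H ⧸ couplingIdeal) (coupling n) :=
  map_coupling_eq (fun _ => proj_eq_zero) hm hn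

/-- If both restrictions of `φ` kill the ideal, the right side of `map_coupling_conv` does not
depend on `m`. So the composition with the coproduct kills the generators of the ideal. -/
theorem map_coproduct_eq_zero (φ : H ⊗[ℂ] H →ₐ[ℂ] A) (hl : ∀ x ∈ couplingIdeal, φ (x ⊗ₜ 1) = 0)
    (hr : ∀ x ∈ couplingIdeal, φ (1 ⊗ₜ x) = 0) {x : H} (hx : x ∈ couplingIdeal) :
    φ (coproduct x) = 0 := by
  have hf : ∀ m, 3 ≤ m → _ := fun m hm =>
    map_coupling_eq (f := φ.comp Algebra.TensorProduct.includeLeft) hl hm le_rfl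
  refine eq_zero_of_mem_couplingIdeal (f := φ.comp coproduct) (fun m hm => ?_) hx
  have hk := map_coproduct_X φ
  have h := fun n (hn : 3 ≤ n) => map_coupling_conv (k := φ.comp coproduct)
    (f := φ.comp Algebra.TensorProduct.includeLeft)
    (h := φ.comp Algebra.TensorProduct.includeRight) hk hf hn
  rw [h m hm, h 3 le_rfl,
    map_coupling_eq (f := φ.comp Algebra.TensorProduct.includeRight) hr hm le_rfl]

theorem map_proj_coproduct {x : H} (hx : x ∈ couplingIdeal) :
    Algebra.TensorProduct.map proj proj (coproduct x) = 0 := by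
  refine map_coproduct_eq_zero (A := (H ⧸ couplingIdeal) ⊗[ℂ] (H ⧸ couplingIdeal)) _
    (fun x hx => ?_) (fun x hx => ?_) hx
  · refine (Algebra.TensorProduct.map_tmul _ _ _ _).trans ?_
    rw [proj_eq_zero hx, TensorProduct.zero_tmul]
  · refine (Algebra.TensorProduct.map_tmul _ _ _ _).trans ?_
    rw [proj_eq_zero hx, TensorProduct.tmul_zero]

theorem map_counit_coupling {f : H →ₐ[ℂ] A} (hf : ∀ c, f (MvPolynomial.X c) = 0) {m : ℕ}
    (hm : 3 ≤ m) : map (f : H →+* A) (coupling m) = 1 := by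
  have h1 : ∀ n, map (f : H →+* A) (green n) = 1 := fun n => by
    have : graphSeries f n = 0 := by
      ext l
      rw [graphSeries, coeff_mk, greenCoeff, map_sum, map_zero]
      exact Finset.sum_eq_zero fun c _ => by rw [map_smul, hf, smul_zero]
    rw [map_green, this, sub_zero, add_zero, ite_self]
  have h2 : map (f : H →+* A) rootTwo = 1 :=
    eq_of_pow_eq (constantCoeff_map _ constantCoeff_rootTwo) (map_one _) two_pos (by
      rw [← map_pow, rootTwo_sq, h1, one_pow])
  refine eq_of_pow_eq (constantCoeff_map _ (constantCoeff_coupling m)) (map_one _)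
    (Nat.sub_pos_of_lt hm) ?_
  have h3 := congrArg (map (f : H →+* A)) (coupling_pow_mul hm)
  rw [map_mul, map_pow, map_pow, h2, h1, one_pow, mul_one] at h3
  rw [h3, one_pow]

theorem counit_eq_zero {x : H} (hx : x ∈ couplingIdeal) : counit x = 0 :=
  eq_zero_of_mem_couplingIdeal (fun _ hm => by
    rw [map_counit_coupling counit_X hm, map_counit_coupling counit_X le_rfl]) hx

omit [Algebra ℂ A] in
-- A series without constant term and with invertible linear coefficient has a compositional
-- inverse.
theorem subst_injective {s : PowerSeries A} (hs : X ∣ s) (h1 : IsUnit (coeff 1 s))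
    {F G : PowerSeries A} (h : (F.subst s : PowerSeries A) = G.subst s) : F = G := by
  have h0 : constantCoeff s = 0 := X_dvd_iff.1 hs
  have hs' := hasSubst_of_X_dvd hs
  have ht := HasSubst.substInvOfIsUnit s h1
  have key : ∀ F : PowerSeries A,
      PowerSeries.subst (s.substInvOfIsUnit h1) (PowerSeries.subst s F) = F := fun F => by
    rw [subst_comp_subst_apply hs' ht, subst_substInvOfIsUnit_right s h0, X_subst]
  rw [← key F, h, key]

/-- The counit `k` is the convolution product of the projection and `h`, the antipode followed by
the projection. Hence `1 = Q * h(Q⁽ᵐ⁾)(g Q²)` for every `m`. Cancelling `Q` and inverting the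
substitution shows that `h` has the same value on all couplings. -/
theorem antipode_mem {x : H} (hx : x ∈ couplingIdeal) : antipode x ∈ couplingIdeal := by
  let B := H ⧸ couplingIdeal
  let h : H →ₐ[ℂ] B := proj.comp antipode
  let k : H →ₐ[ℂ] B := (Algebra.ofId ℂ B).comp counit
  have hk0 : ∀ c, k (MvPolynomial.X c) = 0 := fun c => by
    change algebraMap ℂ B (counit _) = 0
    rw [counit_X, map_zero]
  have hk : ∀ c, k (MvPolynomial.X c) =
      conv (fun c => proj (MvPolynomial.X c)) (fun c => h (MvPolynomial.X c)) c := fun c => by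
    have h1 := map_coproduct_X (A := B) (Algebra.TensorProduct.productMap proj h) c
    simp only [Algebra.TensorProduct.productMap_apply_tmul, map_one, mul_one, one_mul] at h1
    rw [← h1]
    have h2 := LinearMap.congr_fun hopfLaws.antipode_right (MvPolynomial.X c)
    have h3 : ∀ y, Algebra.TensorProduct.productMap proj h y =
        proj (LinearMap.mul' ℂ H (antipode.toLinearMap.lTensor H y)) := fun y => by
      induction y with
      | zero => simp only [map_zero]
      | add y z hy hz => simp only [map_add, hy, hz]
      | tmul a b => simp [h]
    rw [h3]
    exact (proj.commutes _).symm.trans (congrArg proj h2.symm)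
  set Q := map (proj : H →+* B) (coupling 3) with hQdef
  have hQ : ∀ m, 3 ≤ m → map (proj : H →+* B) (coupling m) = Q := fun m hm =>
    map_proj_coupling hm le_rfl
  have hQ1 : constantCoeff Q = 1 := constantCoeff_map _ (constantCoeff_coupling 3)
  have hu : IsUnit Q := isUnit_iff_constantCoeff.2 (by rw [hQ1]; exact isUnit_one)
  have hs1 : IsUnit (coeff 1 (X * Q ^ 2)) := by
    rw [coeff_succ_X_mul, coeff_zero_eq_constantCoeff_apply, map_pow, hQ1, one_pow]
    exact isUnit_one
  have hh : ∀ m, 3 ≤ m → map (h : H →+* B) (coupling m) = map (h : H →+* B) (coupling 3) :=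
    fun m hm => by
    refine subst_injective (dvd_mul_right _ _) hs1 (hu.mul_left_cancel ?_)
    rw [← map_coupling_conv hk hQ hm, ← map_coupling_conv hk hQ le_rfl, map_counit_coupling hk0 hm,
      map_counit_coupling hk0 le_rfl]
  have := eq_zero_of_mem_couplingIdeal hh hx
  exact Ideal.Quotient.eq_zero_iff_mem.1 this

/-- The kernel of `proj ⊗ proj` is `I ⊗ H + H ⊗ I`, by right exactness of the tensor product. -/
theorem coproduct_mem {x : H} (hx : x ∈ couplingIdeal) : coproduct x ∈
    LinearMap.range (LinearMap.rTensor H (couplingIdeal.restrictScalars ℂ).subtype) ⊔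
      LinearMap.range (LinearMap.lTensor H (couplingIdeal.restrictScalars ℂ).subtype) := by
  set J := couplingIdeal.restrictScalars ℂ
  have h := TensorProduct.map_ker (LinearMap.exact_subtype_mkQ J) J.mkQ_surjective
    (LinearMap.exact_subtype_mkQ J) J.mkQ_surjective
  rw [sup_comm, ← h]
  exact map_proj_coproduct hx

/-- In the quotient `Xᵐ = Q ^ (m - 2) * Y ^ m` for all `m ≥ 2`, where `m = 2` is the definition of
`Y`. So the Green's functions form a geometric progression with ratio `Q * Y`. -/
theorem greenQuot_mul_inv {n : ℕ} (hn : 4 ≤ n) : greenQuot n * inv (greenQuot (n - 1)) =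
    greenQuot (n - 1) * inv (greenQuot (n - 2)) := by
  have hinv : ∀ m, greenQuot m * inv (greenQuot m) = 1 := fun m =>
    mul_invOfUnit _ _ (constantCoeff_map _ (constantCoeff_green m))
  set Q := map (proj : H →+* H ⧸ couplingIdeal) (coupling 3)
  set Y := map (proj : H →+* H ⧸ couplingIdeal) rootTwo
  have h : ∀ m, 2 ≤ m → greenQuot m = Q ^ (m - 2) * Y ^ m := fun m hm => by
    rcases hm.eq_or_lt with rfl | hm
    · rw [Nat.sub_self, pow_zero, one_mul, ← map_pow, rootTwo_sq]
      rfl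
    · have hQ : Q = map (proj : H →+* H ⧸ couplingIdeal) (coupling m) := map_proj_coupling le_rfl hm
      rw [hQ, ← map_pow, ← map_pow, ← map_mul, coupling_pow_mul hm]
      rfl
  have h1 : greenQuot n * greenQuot (n - 2) = greenQuot (n - 1) * greenQuot (n - 1) := by
    obtain ⟨k, rfl⟩ : ∃ k, n = k + 4 := ⟨n - 4, by omega⟩
    rw [h (k + 4) (by omega), h (k + 4 - 2) (by omega), h (k + 4 - 1) (by omega)]
    have e1 : k + 4 - 2 = k + 2 := rfl
    have e2 : k + 4 - 1 = k + 3 := rfl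
    have e3 : k + 2 - 2 = k := rfl
    have e4 : k + 3 - 2 = k + 1 := rfl
    rw [e1, e2, e3, e4]
    ring
  calc greenQuot n * inv (greenQuot (n - 1))
      = greenQuot n * greenQuot (n - 2) * inv (greenQuot (n - 2)) * inv (greenQuot (n - 1)) := by
        rw [mul_assoc (greenQuot n), hinv, mul_one]
    _ = greenQuot (n - 1) * inv (greenQuot (n - 2)) *
          (greenQuot (n - 1) * inv (greenQuot (n - 1))) := by
        rw [h1]
        ring
    _ = _ := by rw [hinv, mul_one]

end CouplingIdeal

end CoreHopf

end

theorem mainTheorem1 :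
    -- `H` is a Hopf algebra, and `I` is a Hopf ideal of it
    ∃ laws : CoreHopf.HopfLaws CoreHopf.coproduct CoreHopf.counit CoreHopf.antipode.toLinearMap,
      (letI : HopfAlgebra ℂ CoreHopf.H := laws.hopfAlgebra
       CoreHopf.couplingIdeal.IsHopfIdeal ℂ) ∧
      -- in detail: `Δ(I) ⊆ I ⊗ H + H ⊗ I`, `ε(I) = 0`, `S(I) ⊆ I`
      (∀ x ∈ CoreHopf.couplingIdeal,
        CoreHopf.coproduct x ∈
          LinearMap.range (LinearMap.rTensor CoreHopf.H
            (CoreHopf.couplingIdeal.restrictScalars ℂ).subtype) ⊔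
          LinearMap.range (LinearMap.lTensor CoreHopf.H
            (CoreHopf.couplingIdeal.restrictScalars ℂ).subtype)) ∧
      (∀ x ∈ CoreHopf.couplingIdeal, CoreHopf.counit x = 0) ∧
      (∀ x ∈ CoreHopf.couplingIdeal, CoreHopf.antipode x ∈ CoreHopf.couplingIdeal) ∧
      -- `H/I` is a Hopf algebra, with the structure maps induced from `H`
      (∃ (Δ : CoreHopf.H ⧸ CoreHopf.couplingIdeal →ₐ[ℂ]
            (CoreHopf.H ⧸ CoreHopf.couplingIdeal) ⊗[ℂ] (CoreHopf.H ⧸ CoreHopf.couplingIdeal))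
          (ε : CoreHopf.H ⧸ CoreHopf.couplingIdeal →ₐ[ℂ] ℂ)
          (S : CoreHopf.H ⧸ CoreHopf.couplingIdeal →ₐ[ℂ] CoreHopf.H ⧸ CoreHopf.couplingIdeal),
        CoreHopf.HopfLaws Δ ε S.toLinearMap ∧
        Δ.comp CoreHopf.proj =
          (Algebra.TensorProduct.map CoreHopf.proj CoreHopf.proj).comp CoreHopf.coproduct ∧
        ε.comp CoreHopf.proj = CoreHopf.counit ∧
        S.comp CoreHopf.proj = CoreHopf.proj.comp CoreHopf.antipode) ∧
      -- all couplings coincide in `H/I`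
      (∃! Q : PowerSeries (CoreHopf.H ⧸ CoreHopf.couplingIdeal),
        ∀ m : ℕ, 3 ≤ m →
          PowerSeries.map CoreHopf.proj.toRingHom (CoreHopf.coupling m) = Q) ∧
      -- `Xⁿ / Xⁿ⁻¹ = Xⁿ⁻¹ / Xⁿ⁻²` in `H/I`
      (∀ n : ℕ, 4 ≤ n →
        CoreHopf.greenQuot n * CoreHopf.inv (CoreHopf.greenQuot (n - 1)) =
          CoreHopf.greenQuot (n - 1) * CoreHopf.inv (CoreHopf.greenQuot (n - 2))) := by
  have hΔ := fun x (hx : x ∈ CoreHopf.couplingIdeal) => CoreHopf.map_proj_coproduct hx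
  have hε := fun x (hx : x ∈ CoreHopf.couplingIdeal) => CoreHopf.counit_eq_zero hx
  have hS := fun x (hx : x ∈ CoreHopf.couplingIdeal) => CoreHopf.antipode_mem hx
  refine ⟨CoreHopf.hopfLaws, ?_, fun x hx => CoreHopf.coproduct_mem hx, hε, hS, ?_, ?_,
    fun n hn => CoreHopf.greenQuot_mul_inv hn⟩
  · let _ : HopfAlgebra ℂ CoreHopf.H := CoreHopf.hopfLaws.hopfAlgebra
    exact
      { counit_eq_zero := hε
        map_mkQ_comul_eq_zero := hΔ
        antipode_mem := hS }
  · refine ⟨Ideal.Quotient.liftₐ _ ((Algebra.TensorProduct.map CoreHopf.proj CoreHopf.proj).comp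
      CoreHopf.coproduct) hΔ, Ideal.Quotient.liftₐ _ CoreHopf.counit hε,
      Ideal.Quotient.liftₐ _ (CoreHopf.proj.comp CoreHopf.antipode) fun x hx =>
        Ideal.Quotient.eq_zero_iff_mem.2 (hS x hx), ?_, rfl, rfl, rfl⟩
    exact CoreHopf.hopfLaws.quotient rfl rfl rfl
  · refine ⟨_, fun m hm => CoreHopf.map_proj_coupling hm le_rfl, fun Q hQ => ?_⟩
    exact (hQ 3 le_rfl).symm
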